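/- Let $k$ be a field and let $R$ be an associative unital differential graded $k$-algebra ($\mathbb Z$-graded, $R=\bigoplus_n R_n$, differential of degree $-1$) with an augmentation $\varepsilon\colon R\to k$. Assume that $R$ is connected: $H_0(R)=k\cdot 1$, and $H_n(R)=0$ either for all $n<0$ or for all $n>0$. Let $B(R)=(T(s\overline R),b)$, $\overline R=\ker\varepsilon$, be the (normalized) bar construction, a differential graded coalgebra, and let $R^!=B(R)^\vee=\mathrm{Hom}_k(B(R),k)$ be the Koszul dual differential graded algebra (graded dual, convolution product). Assume that $H_*(R^!)$ is a finite-dimensional $k$-vector space. For a differential graded algebra $A$ let $CH^*(A,A)=\mathrm{Hom}_k(T(sA),A)$ be the Hochschild cochain algebra, with the Hochschild differential and the cup product, and let $HH^*(A,A)$ be its cohomology ring. Let $\Omega(B(R))$ be the cobar construction; here it is the tensor algebra $T(s^{-1}B(R))$ with the derivation differential given by the differential and the full comultiplication of $B(R)$, with universal twisting cochain $x\mapsto s^{-1}x$. Consider the differential graded algebras (convolution products, twisted differentials) $$CH^*(R,R)\xrightarrow{\ \rho\ }\mathrm{Hom}_k(B(R),R)\xleftarrow{\ \alpha\ }\mathrm{Hom}_k(B(R),\Omega(B(R)))\xrightarrow{\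 \delta\ }CH^*(R^!,R^!).$$ The second one is the algebra of normalized Hochschild cochains, with differential twisted by the canonical twisting cochain $B(R)\to R$. The third one is twisted by the universal twisting cochain, and its underlying complex is the complex $\mathrm{Hom}_{B(R)\otimes B(R)^{op}\text{-comod}}(B(R),\Omega(B(R),B(R),B(R)))$ of comodule maps into the cofree resolution of $B(R)$. The map $\rho$ is restriction to $B(R)\subset T(sR)$; $\alpha$ is induced by the homomorphism $\Omega(B(R))\to R$ that extends the canonical twisting cochain; and $\delta$ is linear duality, i.e. it is induced by the homomorphism $\Omega(B(R))\to \mathrm{Hom}_k(T(sR^!),k)$ that evaluates words in $R^!$ on words in $B(R)$, followed by the interchange $\mathrm{Hom}_k(B(R),\mathrm{Hom}_k(T(sR^!),k))\cong\mathrm{Hom}_k(T(sR^!),R^!)$. Then $\rho$, $\alpha$ and $\delta$, which are homomorphisms of differential graded algebras, are quasi-isomorphisms. They are Hu's chain equivalence $CH^*(R,R)\simeq CH^*(R^!,R^!)$, and this equivalence induces an isomorphism of graded $k$-algebras $$\Phi\colon HH^*(R,R)\xrightarrow{\ \cong\ }HH^*(R^!,R^!)$$ for the cup products: $\Phi$ is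 the degree-preserving algebra isomorphism with $\Phi(a)=\delta_*(z)$ whenever $\rho_*(a)=\alpha_*(z)$. -/

import Mathlib

open scoped TensorProduct

noncomputable section

namespace DG

section Graded

variable (k : Type*) [Field k]

/-- The Koszul sign `(-1) ^ n` as an element of `k`. -/
def koszul (n : ℤ) : k := if Even n then 1 else -1

/-- A `ℤ`-graded vector space. -/
class GrMod (V : Type*) [AddCommGroup V] [Module k V] where
  part : ℤ → Submodule k V
  internal : DirectSum.IsInternal part

/-- The part of degree `n`. -/
abbrev gr (V : Type*) [AddCommGroup V] [Module k V] [GrMod k V] (n : ℤ) : Submodule k V :=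
  GrMod.part n

variable {k}

@[simp] theorem koszul_mul_self (n : ℤ) : koszul k n * koszul k n = 1 := by
  unfold koszul; split_ifs <;> simp

theorem koszul_add (m n : ℤ) : koszul k (m + n) = koszul k m * koszul k n := by
  unfold koszul
  by_cases hm : Even m <;> by_cases hn : Even n <;> simp [Int.even_add, hm, hn]

@[simp] theorem koszul_zero : koszul k 0 = 1 := by simp [koszul]

@[simp] theorem koszul_one : koszul k 1 = -1 := by simp [koszul]

@[simp] theorem koszul_neg (n : ℤ) : koszul k (-n) = koszul k n := by simp [koszul]

theorem koszul_sub (m n : ℤ) : koszul k (m - n) = koszul k m * koszul k n := by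
  rw [sub_eq_add_neg, koszul_add, koszul_neg]

theorem koszul_cases (n : ℤ) :
    (Even n ∧ koszul k n = 1) ∨ (¬ Even n ∧ koszul k n = -1) := by
  by_cases h : Even n <;> simp [koszul, h]

variable (k) {V W : Type*} [AddCommGroup V] [Module k V] [AddCommGroup W] [Module k W]

/-- A graded vector space is the direct sum of its parts. -/
def grEquiv (V : Type*) [AddCommGroup V] [Module k V] [GrMod k V] :
    (DirectSum ℤ fun n => gr k V n) ≃ₗ[k] V :=
  LinearEquiv.ofBijective (DirectSum.coeLinearMap (gr k V))
    (show Function.Bijective (DirectSum.coeLinearMap (gr k V)) from GrMod.internal)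

/-- The linear map given by its restrictions to the homogeneous parts. -/
def grLift (V : Type*) [AddCommGroup V] [Module k V] [GrMod k V] {X : Type*} [AddCommGroup X]
    [Module k X] (f : ∀ n, gr k V n →ₗ[k] X) : V →ₗ[k] X :=
  DirectSum.toModule k ℤ X f ∘ₗ (grEquiv k V).symm.toLinearMap

/-- The operator that multiplies the degree `n` part by `c n`. -/
def wt (V : Type*) [AddCommGroup V] [Module k V] [GrMod k V] (c : ℤ → k) : V →ₗ[k] V :=
  grLift k V fun n => c n • (gr k V n).subtype

/-- The operator `v ↦ (-1) ^ |v| v`. -/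
def sgn (V : Type*) [AddCommGroup V] [Module k V] [GrMod k V] : V →ₗ[k] V := wt k V (koszul k)

/-- Projection onto the part of even degree. -/
def ev (V : Type*) [AddCommGroup V] [Module k V] [GrMod k V] : V →ₗ[k] V :=
  wt k V fun n => if Even n then 1 else 0

/-- Projection onto the part of odd degree. -/
def od (V : Type*) [AddCommGroup V] [Module k V] [GrMod k V] : V →ₗ[k] V :=
  wt k V fun n => if Even n then 0 else 1

variable {k}

theorem grLift_of_mem [GrMod k V] {X : Type*} [AddCommGroup X] [Module k X]
    (f : ∀ n, gr k V n →ₗ[k] X) {n : ℤ} {v : V} (hv : v ∈ gr k V n) :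
    grLift k V f v = f n ⟨v, hv⟩ := by
  have : (grEquiv k V).symm v = DirectSum.lof k ℤ (fun i => gr k V i) n ⟨v, hv⟩ := by
    rw [LinearEquiv.symm_apply_eq]
    simp [grEquiv]
  simp only [grLift, LinearMap.comp_apply, LinearEquiv.coe_coe, this, DirectSum.toModule_lof]

theorem wt_of_mem [GrMod k V] (c : ℤ → k) {n : ℤ} {v : V}
    (hv : v ∈ gr k V n) : wt k V c v = c n • v := by
  rw [wt, grLift_of_mem _ hv]
  simp

theorem sgn_of_mem [GrMod k V] {n : ℤ} {v : V}
    (hv : v ∈ gr k V n) : sgn k V v = koszul k n • v := wt_of_mem _ hv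

theorem ev_of_mem [GrMod k V] {n : ℤ} {v : V}
    (hv : v ∈ gr k V n) : ev k V v = if Even n then v else 0 := by
  rw [ev, wt_of_mem _ hv]; split_ifs <;> simp

theorem od_of_mem [GrMod k V] {n : ℤ} {v : V}
    (hv : v ∈ gr k V n) : od k V v = if Even n then 0 else v := by
  rw [od, wt_of_mem _ hv]; split_ifs <;> simp

theorem gr_induction (k : Type*) [Field k] {V : Type*} [AddCommGroup V] [Module k V] [GrMod k V] {p : V → Prop}
    (hom : ∀ n, ∀ v ∈ gr k V n, p v) (zero : p 0)
    (add : ∀ v w, p v → p w → p (v + w)) (v : V) : p v := by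
  have hv : v ∈ ⨆ n, gr k V n := by
    rw [(GrMod.internal (k := k) (V := V)).submodule_iSup_eq_top]; trivial
  exact Submodule.iSup_induction (motive := p) _ hv hom zero add

theorem gr_ext [GrMod k V] {f g : V →ₗ[k] W}
    (h : ∀ n, ∀ v ∈ gr k V n, f v = g v) : f = g := by
  ext v
  refine gr_induction k (p := fun v => f v = g v) h (by simp) ?_ v
  intro v w hv hw
  simp [hv, hw]

theorem gr_ext₂ [GrMod k V] [GrMod k W] {X : Type*} [AddCommGroup X] [Module k X]
    {f g : V ⊗[k] W →ₗ[k] X}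
    (h : ∀ m n, ∀ v ∈ gr k V m, ∀ w ∈ gr k W n,
      f (v ⊗ₜ w) = g (v ⊗ₜ w)) : f = g := by
  apply TensorProduct.ext
  refine gr_ext fun m v hv => gr_ext fun n w hw => ?_
  exact h m n v hv w hw

@[simp] theorem sgn_sgn [GrMod k V] (v : V) : sgn k V (sgn k V v) = v := by
  have : sgn k V ∘ₗ sgn k V = LinearMap.id := gr_ext fun n v hv => by
    simp [sgn_of_mem hv, smul_smul]
  exact LinearMap.congr_fun this v

/-- A family of submodules that spans and is separated by suitable maps is a grading. -/
theorem isInternal_of_separating {T : Type*} (g : ℤ → Submodule k V) (π : ℤ → T → V →ₗ[k] W)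
    (h0 : ∀ m n, m ≠ n → ∀ v ∈ g m, ∀ t, π n t v = 0)
    (h1 : ∀ n, ∀ v ∈ g n, (∀ t, π n t v = 0) → v = 0) (hs : ⨆ n, g n = ⊤) :
    DirectSum.IsInternal g := by
  classical
  rw [DirectSum.isInternal_submodule_iff_iSupIndep_and_iSup_eq_top]
  refine ⟨?_, hs⟩
  rw [iSupIndep_def]
  intro i
  rw [Submodule.disjoint_def]
  intro v hv hv'
  refine h1 i v hv fun t => ?_
  have : (⨆ j, ⨆ (_ : j ≠ i), g j) ≤ LinearMap.ker (π i t) :=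
    iSup_le fun j => iSup_le fun hj w hw => h0 j i hj w hw t
  exact this hv'

theorem gr_disjoint [GrMod k V] {m n : ℤ} (h : m ≠ n) {v : V} (hm : v ∈ gr k V m)
    (hn : v ∈ gr k V n) : v = 0 := by
  have h1 := wt_of_mem (Pi.single m (1 : k)) hm
  rw [wt_of_mem _ hn] at h1
  simpa [h.symm] using h1.symm

end Graded

section KoszulMaps

variable {k : Type*} [Field k]
variable {V W X Y : Type*} [AddCommGroup V] [Module k V] [AddCommGroup W] [Module k W]
  [AddCommGroup X] [Module k X] [AddCommGroup Y] [Module k Y]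
  [GrMod k V] [GrMod k W] [GrMod k Y]

variable (k V W) in
/-- Linear maps that raise the degree by `n`. -/
def homGr (n : ℤ) : Submodule k (V →ₗ[k] W) where
  carrier := {f | ∀ i, ∀ v ∈ gr k V i, f v ∈ gr k W (i + n)}
  add_mem' hf hg i v hv := add_mem (hf i v hv) (hg i v hv)
  zero_mem' _ _ _ := zero_mem _
  smul_mem' _ _ hf i v hv := Submodule.smul_mem _ _ (hf i v hv)

/-- `f ↦ (-1) ^ |f| f`. -/
def hat (f : V →ₗ[k] W) : V →ₗ[k] W := sgn k W ∘ₗ f ∘ₗ sgn k V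

/-- The Koszul tensor product of maps,
`(f ⊗ g)(v ⊗ w) = (-1) ^ (|g| |v|) f(v) ⊗ g(w)`. -/
def km (f : V →ₗ[k] X) (g : W →ₗ[k] Y) : V ⊗[k] W →ₗ[k] X ⊗[k] Y :=
  TensorProduct.map (f ∘ₗ ev k V) g + TensorProduct.map (f ∘ₗ od k V) (hat g)

theorem hat_of_mem {n : ℤ} {f : V →ₗ[k] W} (hf : f ∈ homGr k V W n) : hat f = koszul k n • f := by
  refine gr_ext fun i v hv => ?_
  have h := sgn_of_mem (hf i v hv)
  simp only [hat, LinearMap.comp_apply, sgn_of_mem hv, map_smul, h, smul_smul, LinearMap.smul_apply]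
  congr 1
  rw [koszul_add, ← mul_assoc, koszul_mul_self, one_mul]

@[simp] theorem hat_hat (f : V →ₗ[k] W) : hat (hat f) = f := by ext; simp [hat]

@[simp] theorem hat_id : hat (LinearMap.id : V →ₗ[k] V) = LinearMap.id := by ext; simp [hat]

theorem hat_comp [GrMod k X] (g : W →ₗ[k] X) (f : V →ₗ[k] W) : hat (g ∘ₗ f) = hat g ∘ₗ hat f := by
  ext; simp [hat]

@[simp] theorem hat_add (f g : V →ₗ[k] W) : hat (f + g) = hat f + hat g := by ext; simp [hat]

@[simp] theorem hat_sub (f g : V →ₗ[k] W) : hat (f - g) = hat f - hat g := by ext; simp [hat]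

@[simp] theorem hat_neg (f : V →ₗ[k] W) : hat (-f) = - hat f := by ext; simp [hat]

@[simp] theorem hat_zero : hat (0 : V →ₗ[k] W) = 0 := by ext; simp [hat]

@[simp] theorem hat_smul (c : k) (f : V →ₗ[k] W) : hat (c • f) = c • hat f := by ext; simp [hat]

/-- `hat` applied `i` times. -/
def tw (i : ℤ) (g : V →ₗ[k] W) : V →ₗ[k] W := if Even i then g else hat g

theorem km_tmul {i : ℤ} {v : V} (hv : v ∈ gr k V i) (f : V →ₗ[k] X)
    (g : W →ₗ[k] Y) (w : W) : km f g (v ⊗ₜ w) = f v ⊗ₜ tw i g w := by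
  simp only [km, tw, LinearMap.add_apply, TensorProduct.map_tmul, LinearMap.comp_apply,
    ev_of_mem hv, od_of_mem hv]
  split_ifs <;> simp

theorem km_even (f : V →ₗ[k] X) (g : W →ₗ[k] Y) (hg : hat g = g) :
    km f g = TensorProduct.map f g := by
  refine TensorProduct.ext (gr_ext fun i v hv => LinearMap.ext fun w => ?_)
  simp [km_tmul hv, tw, hg]

end KoszulMaps

section Complexes

variable (k : Type*) [Field k]

/-- A chain complex of vector spaces: a graded vector space with a differential of degree `-1`. -/
class Cx (V : Type*) [AddCommGroup V] [Module k V] extends GrMod k V where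
  dif : V →ₗ[k] V
  dif_mem : ∀ n, ∀ v ∈ part n, dif v ∈ part (n - 1)
  dif_dif : ∀ v, dif (dif v) = 0

/-- The differential of a complex. -/
abbrev del (V : Type*) [AddCommGroup V] [Module k V] [Cx k V] : V →ₗ[k] V := Cx.dif

/-- A differential graded algebra (associative and unital), homologically graded. -/
class DGA (A : Type*) [Ring A] [Algebra k A] extends Cx k A where
  one_mem : (1 : A) ∈ part 0
  mul_mem : ∀ m n, ∀ x ∈ part m, ∀ y ∈ part n, x * y ∈ part (m + n)
  leibniz : ∀ m, ∀ x ∈ part m, ∀ y, dif (x * y) = dif x * y + koszul k m • (x * dif y)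

/-- A differential graded algebra without unit. -/
class NDGA (V : Type*) [AddCommGroup V] [Module k V] extends Cx k V where
  mul : V →ₗ[k] V →ₗ[k] V
  mul_mem : ∀ m n, ∀ x ∈ part m, ∀ y ∈ part n, mul x y ∈ part (m + n)
  mul_assoc : ∀ x y z, mul (mul x y) z = mul x (mul y z)
  leibniz : ∀ m, ∀ x ∈ part m, ∀ y, dif (mul x y) = mul (dif x) y + koszul k m • mul x (dif y)

/-- The part of degree `n` of the tensor product of two graded vector spaces. -/
def tensorPart (V W : Type*) [AddCommGroup V] [Module k V] [AddCommGroup W] [Module k W]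
    [GrMod k V] [GrMod k W] (n : ℤ) : Submodule k (V ⊗[k] W) :=
  Submodule.span k {t | ∃ i j, i + j = n ∧ ∃ v ∈ gr k V i, ∃ w ∈ gr k W j, t = v ⊗ₜ w}

/-- A differential graded coalgebra. -/
class DGCoalg (C : Type*) [AddCommGroup C] [Module k C] [Coalgebra k C] extends Cx k C where
  comul_mem : ∀ n, ∀ x ∈ part n, Coalgebra.comul (R := k) x ∈ tensorPart k C C n
  counit_eq_zero : ∀ n, n ≠ 0 → ∀ x ∈ part n, Coalgebra.counit (R := k) x = 0
  comul_dif : Coalgebra.comul ∘ₗ dif = (km dif LinearMap.id + km LinearMap.id dif) ∘ₗ Coalgebra.comul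
  counit_dif : ∀ x, Coalgebra.counit (R := k) (dif x) = 0

/-- A degree preserving chain map. -/
structure IsChainMap {V W : Type*} [AddCommGroup V] [Module k V] [Cx k V]
    [AddCommGroup W] [Module k W] [Cx k W] (f : V →ₗ[k] W) : Prop where
  map_mem : ∀ n, ∀ v ∈ gr k V n, f v ∈ gr k W n
  map_del : ∀ v, f (del k V v) = del k W (f v)

/-- A chain map that induces a bijection on homology. -/
structure IsQuasiIso {V W : Type*} [AddCommGroup V] [Module k V] [Cx k V]
    [AddCommGroup W] [Module k W] [Cx k W] (f : V →ₗ[k] W) : Prop extends IsChainMap k f where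
  inj : ∀ v, del k V v = 0 → (∃ w, f v = del k W w) → ∃ u, v = del k V u
  surj : ∀ w, del k W w = 0 → ∃ v, del k V v = 0 ∧ ∃ u, w = f v + del k W u

variable {k}

theorem dif_hat {V : Type*} [AddCommGroup V] [Module k V] [Cx k V] :
    hat (del k V) = - del k V := by
  rw [hat_of_mem (n := -1)]
  · simp
  · intro i v hv
    exact Cx.dif_mem i v hv

theorem sgn_del {V : Type*} [AddCommGroup V] [Module k V] [Cx k V] (v : V) :
    sgn k V (del k V v) = - del k V (sgn k V v) := by
  have := LinearMap.congr_fun (dif_hat (k := k) (V := V)) (sgn k V v)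
  simpa [hat] using this

theorem DGA.leibniz' {A : Type*} [Ring A] [Algebra k A] [DGA k A] (x y : A) :
    del k A (x * y) = del k A x * y + sgn k A x * del k A y := by
  refine gr_induction k
    (p := fun x => del k A (x * y) = del k A x * y + sgn k A x * del k A y) ?_ (by simp) ?_ x
  · intro n v hv
    rw [sgn_of_mem hv, smul_mul_assoc]
    exact DGA.leibniz n v hv y
  · intro v w hv hw
    simp only [map_add, add_mul, hv, hw]
    abel

theorem DGA.sgn_mul {A : Type*} [Ring A] [Algebra k A] [DGA k A] (x y : A) :
    sgn k A (x * y) = sgn k A x * sgn k A y := by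
  refine gr_induction k (p := fun x => sgn k A (x * y) = sgn k A x * sgn k A y) ?_ (by simp) ?_ x
  · intro m v hv
    refine gr_induction k (p := fun y => sgn k A (v * y) = sgn k A v * sgn k A y) ?_ (by simp) ?_ y
    · intro n w hw
      rw [sgn_of_mem hv, sgn_of_mem hw, sgn_of_mem (DGA.mul_mem m n v hv w hw), koszul_add]
      simp [smul_smul, mul_comm]
    · intro v w hv hw
      simp only [map_add, mul_add, hv, hw]
  · intro v w hv hw
    simp only [map_add, add_mul, hv, hw]

@[simp] theorem DGA.sgn_one {A : Type*} [Ring A] [Algebra k A] [DGA k A] :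
    sgn k A (1 : A) = 1 := by
  rw [sgn_of_mem (DGA.one_mem (k := k)), koszul_zero, one_smul]

@[simp] theorem DGA.del_one {A : Type*} [Ring A] [Algebra k A] [DGA k A] :
    del k A (1 : A) = 0 := by
  have := DGA.leibniz' (k := k) (1 : A) 1
  simpa using this

end Complexes

section Homology

variable (k : Type*) [Field k] (A : Type*) [Ring A] [Algebra k A] [DGA k A]

/-- The algebra of cycles. -/
def cycles : Subalgebra k A where
  carrier := {x | del k A x = 0}
  mul_mem' {x y} hx hy := by
    simp only [Set.mem_ofPred_eq] at hx hy ⊢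
    rw [DGA.leibniz', hx, hy]; simp
  add_mem' {x y} hx hy := by
    simp only [Set.mem_ofPred_eq] at hx hy ⊢
    rw [map_add, hx, hy, add_zero]
  algebraMap_mem' c := by
    simp [Algebra.algebraMap_eq_smul_one]

/-- The ideal of boundaries. -/
def boundaries : Ideal (cycles k A) where
  carrier := {x | ∃ y, del k A y = x}
  add_mem' := by
    rintro a b ⟨x, hx⟩ ⟨y, hy⟩
    exact ⟨x + y, by simp [hx, hy]⟩
  zero_mem' := ⟨0, by simp⟩
  smul_mem' := by
    rintro ⟨c, hc⟩ a ⟨x, hx⟩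
    refine ⟨sgn k A c * x, ?_⟩
    have hc' : del k A (sgn k A c) = 0 := by
      have h : del k A c = 0 := hc
      have := sgn_del (k := k) c
      rw [h, map_zero, eq_comm, neg_eq_zero] at this
      exact this
    rw [DGA.leibniz', hc', hx]
    simp

instance : (boundaries k A).IsTwoSided where
  mul_mem_of_left := by
    rintro a ⟨b, hb⟩ ⟨x, hx⟩
    refine ⟨x * b, ?_⟩
    have h : del k A b = 0 := hb
    rw [DGA.leibniz', h, hx]
    simp

/-- The homology algebra `H_*(A)` of a differential graded algebra. -/
def Homology : Type _ := cycles k A ⧸ boundaries k A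

instance : Ring (Homology k A) := inferInstanceAs (Ring (cycles k A ⧸ boundaries k A))

instance : Algebra k (Homology k A) := inferInstanceAs (Algebra k (cycles k A ⧸ boundaries k A))

/-- The homology class of a cycle. -/
def Homology.mk : cycles k A →ₐ[k] Homology k A := Ideal.Quotient.mkₐ k (boundaries k A)

/-- The part `H_n(A)` of the homology. -/
def Homology.part (n : ℤ) : Submodule k (Homology k A) :=
  ((gr k A n).comap (cycles k A).val.toLinearMap).map (Homology.mk k A).toLinearMap

end Homology

section Hom

variable (k : Type*) [Field k]

/-- Homomorphisms of differential graded algebras. -/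
structure DGHom (A B : Type*) [Ring A] [Algebra k A] [DGA k A] [Ring B] [Algebra k B] [DGA k B]
    extends A →ₐ[k] B where
  map_mem : ∀ n, ∀ x ∈ gr k A n, toFun x ∈ gr k B n
  map_del : ∀ x, toFun (del k A x) = del k B (toFun x)

variable {k} {A B : Type*} [Ring A] [Algebra k A] [DGA k A] [Ring B] [Algebra k B] [DGA k B]

/-- The map on cycles induced by a homomorphism. -/
def DGHom.mapCycles (f : DGHom k A B) : cycles k A →ₐ[k] cycles k B :=
  (f.toAlgHom.comp (cycles k A).val).codRestrict (cycles k B) fun x => by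
    have hx : del k A x.1 = 0 := x.2
    have := f.map_del x.1
    rw [hx] at this
    show del k B (f.toFun x.1) = 0
    rw [← this]
    exact map_zero f.toAlgHom

/-- The map on homology induced by a homomorphism. -/
def DGHom.mapHomology (f : DGHom k A B) : Homology k A →ₐ[k] Homology k B :=
  Ideal.Quotient.liftₐ (boundaries k A) ((Homology.mk k B).comp f.mapCycles) (by
    rintro a ⟨x, hx⟩
    refine Ideal.Quotient.eq_zero_iff_mem.2 ⟨f.toFun x, ?_⟩
    rw [← f.map_del, hx]
    rfl)

theorem DGHom.map_sgn (f : DGHom k A B) (x : A) : f.toAlgHom (sgn k A x) = sgn k B (f.toAlgHom x) := by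
  refine gr_induction k
    (p := fun x => f.toAlgHom (sgn k A x) = sgn k B (f.toAlgHom x)) ?_ (by simp) ?_ x
  · intro n v hv
    have h : sgn k B (f.toAlgHom v) = koszul k n • f.toAlgHom v := sgn_of_mem (f.map_mem n v hv)
    rw [sgn_of_mem hv, h, map_smul]
  · intro v w hv hw
    simp only [map_add, hv, hw]

end Hom

section Twist

variable (k : Type*) [Field k]

/-- A Maurer–Cartan element: `t` of degree `-1` with `d t + t t = 0`. -/
structure MC (A : Type*) [Ring A] [Algebra k A] [DGA k A] where
  val : A
  mem : val ∈ gr k A (-1)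
  eq : del k A val + val * val = 0

variable {k} {A : Type*} [Ring A] [Algebra k A] [DGA k A]

/-- The algebra `A` with the differential `x ↦ d x + t x - (-1) ^ |x| x t`. -/
def Twist (_t : MC k A) : Type _ := A

variable (t : MC k A)

instance : Ring (Twist t) := inferInstanceAs (Ring A)

instance : Algebra k (Twist t) := inferInstanceAs (Algebra k A)

/-- The twisted differential. -/
def twistDel : A →ₗ[k] A :=
  del k A + LinearMap.mulLeft k t.val - LinearMap.mulRight k t.val ∘ₗ sgn k A

theorem twistDel_apply (x : A) : twistDel t x = del k A x + t.val * x - sgn k A x * t.val := rfl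

theorem MC.sgn_val : sgn k A t.val = - t.val := by
  rw [sgn_of_mem t.mem]; simp

instance : GrMod k (Twist t) := inferInstanceAs (GrMod k A)

theorem twistDel_twistDel (v : A) : twistDel t (twistDel t v) = 0 := by
  have h' : del k A t.val = - (t.val * t.val) := eq_neg_of_add_eq_zero_left t.eq
  have h0 : del k A (del k A v) = 0 := Cx.dif_dif v
  simp only [twistDel_apply, map_add, map_sub, DGA.leibniz', DGA.sgn_mul, sgn_del, MC.sgn_val,
    sgn_sgn, h', h0]
  noncomm_ring

theorem twistDel_mul (x y : A) :
    twistDel t (x * y) = twistDel t x * y + sgn k A x * twistDel t y := by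
  simp only [twistDel_apply, DGA.leibniz', DGA.sgn_mul]
  noncomm_ring

theorem twistDel_mem (n : ℤ) (v : A) (hv : v ∈ gr k A n) : twistDel t v ∈ gr k A (n - 1) := by
  rw [twistDel_apply]
  refine sub_mem (add_mem (Cx.dif_mem n v hv) ?_) ?_
  · have := DGA.mul_mem (-1) n _ t.mem v hv
    rwa [neg_add_eq_sub] at this
  · have := DGA.mul_mem n (-1) v hv _ t.mem
    rw [sgn_of_mem hv, smul_mul_assoc]
    exact Submodule.smul_mem _ _ this

theorem twistDel_leibniz (m : ℤ) (x : A) (hx : x ∈ gr k A m) (y : A) :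
    twistDel t (x * y) = twistDel t x * y + koszul k m • (x * twistDel t y) := by
  rw [← smul_mul_assoc, ← sgn_of_mem hx]
  exact twistDel_mul t x y

/-- The twisted differential as an operator on the twisted algebra. -/
def Twist.dif : Twist t →ₗ[k] Twist t :=
  (fun D => D : (A →ₗ[k] A) → (Twist t →ₗ[k] Twist t)) (twistDel t)

instance : Cx k (Twist t) where
  dif := Twist.dif t
  dif_mem := twistDel_mem t
  dif_dif := twistDel_twistDel t

instance : DGA k (Twist t) where
  one_mem := DGA.one_mem (k := k) (A := A)
  mul_mem := DGA.mul_mem (k := k) (A := A)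
  leibniz := twistDel_leibniz t

theorem DGHom.map_twistDel {B : Type*} [Ring B] [Algebra k B] [DGA k B] (f : DGHom k A B)
    (s : MC k B) (h : f.toAlgHom t.val = s.val) (x : A) :
    f.toAlgHom (twistDel t x) = twistDel s (f.toAlgHom x) := by
  have h1 : f.toAlgHom (del k A x) = del k B (f.toAlgHom x) := f.map_del x
  simp only [twistDel_apply, map_add, map_sub, map_mul, h, f.map_sgn, h1]

/-- A homomorphism that matches Maurer–Cartan elements is a homomorphism of twisted algebras. -/
def DGHom.twist {B : Type*} [Ring B] [Algebra k B] [DGA k B] (f : DGHom k A B)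
    (s : MC k B) (h : f.toAlgHom t.val = s.val) : DGHom k (Twist t) (Twist s) where
  toAlgHom := (f.toAlgHom : A →ₐ[k] B)
  map_mem := f.map_mem
  map_del := f.map_twistDel t s h

end Twist

section KoszulMaps

variable {k : Type*} [Field k]
variable {V W X Y V' W' : Type*} [AddCommGroup V] [Module k V] [AddCommGroup W] [Module k W]
  [AddCommGroup X] [Module k X] [AddCommGroup Y] [Module k Y]
  [AddCommGroup V'] [Module k V'] [AddCommGroup W'] [Module k W']
  [GrMod k V] [GrMod k W]

@[simp] theorem tw_id (i : ℤ) : tw i (LinearMap.id : V →ₗ[k] V) = LinearMap.id := by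
  unfold tw; split_ifs <;> simp

theorem tw_comp [GrMod k X] (i : ℤ) (g : W →ₗ[k] X) (f : V →ₗ[k] W) :
    tw i (g ∘ₗ f) = tw i g ∘ₗ tw i f := by
  unfold tw; split_ifs <;> simp [hat_comp]

theorem tw_del [Cx k X] (i : ℤ) : tw i (del k X) = koszul k i • del k X := by
  unfold tw koszul; split_ifs <;> simp [dif_hat]

theorem tw_sub_one (i : ℤ) (g : V →ₗ[k] W) : tw (i - 1) g = tw i (hat g) := by
  unfold tw
  by_cases h : Even i <;> simp [h]

theorem tw_hat (i : ℤ) (g : V →ₗ[k] W) : tw i (hat g) = hat (tw i g) := by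
  unfold tw; split_ifs <;> simp

theorem tw_add (i j : ℤ) (g : V →ₗ[k] W) : tw (i + j) g = tw i (tw j g) := by
  unfold tw
  by_cases h : Even i <;> by_cases h' : Even j <;> simp [Int.even_add, h, h']

theorem tw_of_mem {n : ℤ} {f : V →ₗ[k] W} (hf : f ∈ homGr k V W n) (i : ℤ) :
    tw i f = koszul k (i * n) • f := by
  unfold tw
  rw [hat_of_mem hf]
  unfold koszul
  by_cases h : Even i <;> simp [Int.even_mul, h]

@[simp] theorem hat_del [Cx k X] : hat (del k X) = - del k X := dif_hat

end KoszulMaps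

section Convolution

variable (k : Type*) [Field k]
variable (C : Type*) [AddCommGroup C] [Module k C] [Coalgebra k C] [DGCoalg k C]
variable (A : Type*) [Ring A] [Algebra k A] [DGA k A]

/-- All linear maps from a differential graded coalgebra to a differential graded algebra,
with the convolution product `(f * g)(x) = ∑ (-1) ^ (|g| |x₁|) f(x₁) g(x₂)`. -/
def ConvAlg : Type _ := C →ₗ[k] A

instance : AddCommGroup (ConvAlg k C A) := inferInstanceAs (AddCommGroup (C →ₗ[k] A))

instance : Module k (ConvAlg k C A) := inferInstanceAs (Module k (C →ₗ[k] A))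

variable {k C A}

/-- The convolution product. -/
def conv (f g : C →ₗ[k] A) : C →ₗ[k] A :=
  LinearMap.mul' k A ∘ₗ km f g ∘ₗ Coalgebra.comul

/-- The unit of the convolution product. -/
def convOne : C →ₗ[k] A := Algebra.linearMap k A ∘ₗ Coalgebra.counit

theorem tensorPart_induction {V W : Type*} [AddCommGroup V] [Module k V] [AddCommGroup W]
    [Module k W] [GrMod k V] [GrMod k W] {n : ℤ} {p : V ⊗[k] W → Prop}
    (hom : ∀ i j, i + j = n → ∀ v ∈ gr k V i, ∀ w ∈ gr k W j, p (v ⊗ₜ w))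
    (zero : p 0) (add : ∀ s t, p s → p t → p (s + t)) (smul : ∀ (c : k) t, p t → p (c • t))
    {t : V ⊗[k] W} (ht : t ∈ tensorPart k V W n) : p t := by
  refine Submodule.span_induction ?_ zero (fun _ _ _ _ => add _ _) (fun c _ _ => smul c _) ht
  rintro _ ⟨i, j, h, v, hv, w, hw, rfl⟩
  exact hom i j h v hv w hw

theorem comul_sgn (x : C) : Coalgebra.comul (R := k) (sgn k C x) =
    TensorProduct.map (sgn k C) (sgn k C) (Coalgebra.comul (R := k) x) := by
  refine gr_induction k (p := fun x => Coalgebra.comul (R := k) (sgn k C x) =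
    TensorProduct.map (sgn k C) (sgn k C) (Coalgebra.comul (R := k) x)) ?_ (by simp) ?_ x
  · intro n v hv
    rw [sgn_of_mem hv, map_smul]
    refine tensorPart_induction (p := fun t => koszul k n • t =
      TensorProduct.map (sgn k C) (sgn k C) t) ?_ (by simp) ?_ ?_ (DGCoalg.comul_mem n v hv)
    · intro i j h v hv w hw
      rw [← h, koszul_add, TensorProduct.map_tmul, sgn_of_mem hv, sgn_of_mem hw,
        TensorProduct.smul_tmul_smul]
    · intro s t hs ht
      rw [smul_add, hs, ht, map_add]
    · intro c t ht
      rw [smul_comm, ht, map_smul]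
  · intro v w hv hw
    simp only [map_add, hv, hw]

theorem comul_ev (x : C) : Coalgebra.comul (R := k) (ev k C x) =
    (TensorProduct.map (ev k C) (ev k C) + TensorProduct.map (od k C) (od k C))
      (Coalgebra.comul (R := k) x) := by
  refine gr_induction k (p := fun x => Coalgebra.comul (R := k) (ev k C x) =
    (TensorProduct.map (ev k C) (ev k C) + TensorProduct.map (od k C) (od k C))
      (Coalgebra.comul (R := k) x)) ?_ (by simp) ?_ x
  · intro n v hv
    have h1 : Coalgebra.comul (R := k) (ev k C v) =
        (if Even n then (1 : k) else 0) • Coalgebra.comul (R := k) v := by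
      rw [ev_of_mem hv]; split_ifs <;> simp
    rw [h1]
    refine tensorPart_induction (p := fun t => (if Even n then (1 : k) else 0) • t =
      (TensorProduct.map (ev k C) (ev k C) + TensorProduct.map (od k C) (od k C)) t)
      ?_ (by simp) ?_ ?_ (DGCoalg.comul_mem n v hv)
    · intro i j h v hv w hw
      simp only [LinearMap.add_apply, TensorProduct.map_tmul, ev_of_mem hv, ev_of_mem hw,
        od_of_mem hv, od_of_mem hw, ← h, Int.even_add]
      by_cases hi : Even i <;> by_cases hj : Even j <;> simp [hi, hj]
    · intro s t hs ht
      rw [smul_add, hs, ht, map_add]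
    · intro c t ht
      rw [smul_comm, ht, map_smul]
  · intro v w hv hw
    simp only [map_add, hv, hw]

theorem comul_od (x : C) : Coalgebra.comul (R := k) (od k C x) =
    (TensorProduct.map (ev k C) (od k C) + TensorProduct.map (od k C) (ev k C))
      (Coalgebra.comul (R := k) x) := by
  have ho : ∀ x, od k C x = x - ev k C x := by
    intro x
    have : od k C = LinearMap.id - ev k C := gr_ext fun n v hv => by
      rw [LinearMap.sub_apply, od_of_mem hv, ev_of_mem hv]; split_ifs <;> simp
    rw [this]; rfl
  rw [ho, map_sub, comul_ev]
  generalize Coalgebra.comul (R := k) x = t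
  have : TensorProduct.map (ev k C) (ev k C) + TensorProduct.map (od k C) (od k C) +
      (TensorProduct.map (ev k C) (od k C) + TensorProduct.map (od k C) (ev k C)) =
      LinearMap.id := by
    refine TensorProduct.ext' fun x y => ?_
    simp only [LinearMap.add_apply, TensorProduct.map_tmul, ho, TensorProduct.tmul_sub,
      TensorProduct.sub_tmul, LinearMap.id_apply]
    abel
  have h := LinearMap.congr_fun this t
  rw [LinearMap.add_apply, LinearMap.id_apply] at h
  exact (eq_sub_of_add_eq' h).symm

theorem counit_sgn (x : C) :
    Coalgebra.counit (R := k) (sgn k C x) = Coalgebra.counit (R := k) x := by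
  have : Coalgebra.counit (R := k) ∘ₗ sgn k C = Coalgebra.counit (R := k) := gr_ext fun n v hv => by
    by_cases h : n = 0
    · subst h; simp [sgn_of_mem hv]
    · simp [sgn_of_mem hv, DGCoalg.counit_eq_zero n h v hv]
  exact LinearMap.congr_fun this x

theorem mul'_map_sgn (t : A ⊗[k] A) : LinearMap.mul' k A (TensorProduct.map (sgn k A) (sgn k A) t) =
    sgn k A (LinearMap.mul' k A t) := by
  have : LinearMap.mul' k A ∘ₗ TensorProduct.map (sgn k A) (sgn k A) =
    sgn k A ∘ₗ LinearMap.mul' k A := TensorProduct.ext' fun x y => by simp [DGA.sgn_mul]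
  exact LinearMap.congr_fun this t

theorem hat_conv (f g : C →ₗ[k] A) : hat (conv f g) = conv (hat f) (hat g) := by
  have key : TensorProduct.map (sgn k A) (sgn k A) ∘ₗ km f g ∘ₗ
      TensorProduct.map (sgn k C) (sgn k C) = km (hat f) (hat g) := by
    refine gr_ext₂ fun i j x hx y hy => ?_
    have hx' : sgn k C x ∈ gr k C i := by
      rw [sgn_of_mem hx]; exact Submodule.smul_mem _ _ hx
    simp only [LinearMap.comp_apply, TensorProduct.map_tmul, km_tmul hx, km_tmul hx', tw_hat]
    rfl
  ext x
  have := LinearMap.congr_fun key (Coalgebra.comul (R := k) x)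
  simp only [LinearMap.comp_apply] at this
  simp only [hat, conv, LinearMap.comp_apply, comul_sgn, ← mul'_map_sgn, this]

theorem hat_convOne : hat (convOne : C →ₗ[k] A) = convOne := by
  ext x
  simp [hat, convOne, counit_sgn, Algebra.algebraMap_eq_smul_one]

theorem tw_conv (i : ℤ) (f g : C →ₗ[k] A) : tw i (conv f g) = conv (tw i f) (tw i g) := by
  unfold tw; split_ifs <;> simp [hat_conv]

theorem tw_convOne (i : ℤ) : tw i (convOne : C →ₗ[k] A) = convOne := by
  unfold tw; split_ifs <;> simp [hat_convOne]

theorem conv_assoc (f g h : C →ₗ[k] A) : conv (conv f g) h = conv f (conv g h) := by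
  let m := LinearMap.mul' k A
  let E := TensorProduct.map (ev k C) (ev k C) + TensorProduct.map (od k C) (od k C)
  let O := TensorProduct.map (ev k C) (od k C) + TensorProduct.map (od k C) (ev k C)
  let L : (C ⊗[k] C) ⊗[k] C →ₗ[k] A :=
    m ∘ₗ (TensorProduct.map (m ∘ₗ km f g ∘ₗ E) h + TensorProduct.map (m ∘ₗ km f g ∘ₗ O) (hat h))
  let R : C ⊗[k] (C ⊗[k] C) →ₗ[k] A :=
    m ∘ₗ (TensorProduct.map (f ∘ₗ ev k C) (m ∘ₗ km g h) +
      TensorProduct.map (f ∘ₗ od k C) (m ∘ₗ km (hat g) (hat h)))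
  have hLR : L = R ∘ₗ (TensorProduct.assoc k C C C).toLinearMap := by
    apply TensorProduct.ext_threefold
    intro x y z
    revert y
    refine gr_induction k (p := fun x => ∀ y, L ((x ⊗ₜ y) ⊗ₜ z) =
      (R ∘ₗ (TensorProduct.assoc k C C C).toLinearMap) ((x ⊗ₜ y) ⊗ₜ z)) ?_ (by simp) ?_ x
    · intro i x hx y
      refine gr_induction k (p := fun y => L ((x ⊗ₜ y) ⊗ₜ z) =
        (R ∘ₗ (TensorProduct.assoc k C C C).toLinearMap) ((x ⊗ₜ y) ⊗ₜ z)) ?_ (by simp) ?_ y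
      · intro j y hy
        simp only [L, R, E, O, LinearMap.comp_apply, LinearMap.add_apply, TensorProduct.map_tmul,
          LinearEquiv.coe_coe, TensorProduct.assoc_tmul, ev_of_mem hx, ev_of_mem hy,
          od_of_mem hx, od_of_mem hy]
        by_cases hi : Even i <;> by_cases hj : Even j <;>
          simp [hi, hj, km_tmul hx, km_tmul hy, tw, m, mul_assoc]
      · intro y y' h h'
        simp only [TensorProduct.tmul_add, TensorProduct.add_tmul, map_add, h, h']
    · intro x x' h h' y
      simp only [TensorProduct.add_tmul, map_add, h, h']
  ext x
  have hl : conv (conv f g) h x =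
      L ((Coalgebra.comul (R := k)).rTensor C (Coalgebra.comul (R := k) x)) := by
    show m (km (conv f g) h (Coalgebra.comul (R := k) x)) = _
    generalize Coalgebra.comul (R := k) x = t
    induction t with
    | zero => simp
    | add s t hs ht => simp only [map_add, hs, ht]
    | tmul y z =>
      simp only [km, L, E, O, LinearMap.comp_apply, LinearMap.add_apply, TensorProduct.map_tmul,
        LinearMap.rTensor_tmul, conv, comul_ev, comul_od]
      rfl
  have hr : conv f (conv g h) x =
      R ((Coalgebra.comul (R := k)).lTensor C (Coalgebra.comul (R := k) x)) := by
    show m (km f (conv g h) (Coalgebra.comul (R := k) x)) = _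
    generalize Coalgebra.comul (R := k) x = t
    induction t with
    | zero => simp
    | add s t hs ht => simp only [map_add, hs, ht]
    | tmul y z =>
      rw [km, hat_conv]
      simp only [R, LinearMap.comp_apply, LinearMap.add_apply, TensorProduct.map_tmul,
        LinearMap.lTensor_tmul, conv]
      rfl
  rw [hl, hr, hLR, LinearMap.comp_apply, LinearEquiv.coe_coe, Coalgebra.coassoc_apply]

theorem convOne_conv (f : C →ₗ[k] A) : conv convOne f = f := by
  ext x
  have h : ∀ t : C ⊗[k] C, LinearMap.mul' k A (km (convOne : C →ₗ[k] A) f t) =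
      TensorProduct.lid k A (f.lTensor k ((Coalgebra.counit (R := k) (A := C)).rTensor C t)) := by
    have : LinearMap.mul' k A ∘ₗ km (convOne : C →ₗ[k] A) f = (TensorProduct.lid k A).toLinearMap ∘ₗ
        f.lTensor k ∘ₗ (Coalgebra.counit (R := k) (A := C)).rTensor C := by
      refine gr_ext₂ fun i j x hx y hy => ?_
      simp only [LinearMap.comp_apply, km_tmul hx, LinearEquiv.coe_coe, LinearMap.rTensor_tmul,
        LinearMap.lTensor_tmul, TensorProduct.lid_tmul, LinearMap.mul'_apply, convOne,
        Algebra.linearMap_apply, ← Algebra.smul_def]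
      by_cases h : i = 0
      · subst h; simp [tw]
      · simp [DGCoalg.counit_eq_zero i h x hx]
    exact LinearMap.congr_fun this
  simp [conv, h]

theorem conv_convOne (f : C →ₗ[k] A) : conv f convOne = f := by
  ext x
  have h : ∀ t : C ⊗[k] C, LinearMap.mul' k A (km f (convOne : C →ₗ[k] A) t) =
      TensorProduct.rid k A (f.rTensor k ((Coalgebra.counit (R := k) (A := C)).lTensor C t)) := by
    have : LinearMap.mul' k A ∘ₗ km f (convOne : C →ₗ[k] A) = (TensorProduct.rid k A).toLinearMap ∘ₗ
        f.rTensor k ∘ₗ (Coalgebra.counit (R := k) (A := C)).lTensor C := by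
      refine gr_ext₂ fun i j x hx y hy => ?_
      simp only [LinearMap.comp_apply, km_tmul hx, LinearEquiv.coe_coe, LinearMap.rTensor_tmul,
        LinearMap.lTensor_tmul, TensorProduct.rid_tmul, LinearMap.mul'_apply, tw_convOne]
      simp [convOne, ← Algebra.commutes, ← Algebra.smul_def]
    exact LinearMap.congr_fun this
  simp [conv, h]

theorem conv_add (f g h : C →ₗ[k] A) : conv f (g + h) = conv f g + conv f h := by
  ext x
  simp [conv, km, TensorProduct.map_add_right]
  abel

theorem add_conv (f g h : C →ₗ[k] A) : conv (f + g) h = conv f h + conv g h := by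
  ext x
  simp [conv, km, LinearMap.add_comp, TensorProduct.map_add_left]
  abel

theorem smul_conv (c : k) (f g : C →ₗ[k] A) : conv (c • f) g = c • conv f g := by
  ext x
  simp [conv, km, LinearMap.smul_comp, TensorProduct.map_smul_left]

theorem conv_smul (c : k) (f g : C →ₗ[k] A) : conv f (c • g) = c • conv f g := by
  ext x
  simp [conv, km, TensorProduct.map_smul_right]

instance : Ring (ConvAlg k C A) :=
  { (inferInstance : AddCommGroup (ConvAlg k C A)) with
    mul := conv
    one := convOne
    mul_assoc := conv_assoc
    one_mul := convOne_conv
    mul_one := conv_convOne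
    left_distrib := conv_add
    right_distrib := add_conv
    zero_mul := fun f => by
      have := smul_conv (k := k) (A := A) (0 : k) (0 : C →ₗ[k] A) f
      rwa [zero_smul, zero_smul] at this
    mul_zero := fun f => by
      have := conv_smul (k := k) (A := A) (0 : k) f (0 : C →ₗ[k] A)
      rwa [zero_smul, zero_smul] at this }

instance : Algebra k (ConvAlg k C A) := Algebra.ofModule smul_conv conv_smul


theorem conv_mem {m n : ℤ} {f g : C →ₗ[k] A} (hf : f ∈ homGr k C A m) (hg : g ∈ homGr k C A n) :
    conv f g ∈ homGr k C A (m + n) := by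
  intro i x hx
  refine tensorPart_induction
    (p := fun t => LinearMap.mul' k A (km f g t) ∈ gr k A (i + (m + n)))
    ?_ (by simp) ?_ ?_ (DGCoalg.comul_mem i x hx)
  · intro a b hab v hv w hw
    rw [km_tmul hv, tw_of_mem hg, LinearMap.mul'_apply, LinearMap.smul_apply, mul_smul_comm]
    refine Submodule.smul_mem _ _ ?_
    have := DGA.mul_mem _ _ _ (hf a v hv) _ (hg b w hw)
    rwa [show a + m + (b + n) = i + (m + n) by omega] at this
  · intro s t hs ht
    rw [map_add, map_add]; exact add_mem hs ht
  · intro c t ht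
    rw [map_smul, map_smul]; exact Submodule.smul_mem _ _ ht

theorem convOne_mem : (convOne : C →ₗ[k] A) ∈ homGr k C A 0 := by
  intro i x hx
  by_cases h : i = 0
  · subst h
    simp only [convOne, LinearMap.comp_apply, Algebra.linearMap_apply,
      Algebra.algebraMap_eq_smul_one]
    exact Submodule.smul_mem _ _ DGA.one_mem
  · simp [convOne, DGCoalg.counit_eq_zero i h x hx]

/-- The differential `f ↦ d f - (-1) ^ |f| f d` on linear maps. -/
def homDel {V W : Type*} [AddCommGroup V] [Module k V] [Cx k V] [AddCommGroup W] [Module k W]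
    [Cx k W] : (V →ₗ[k] W) →ₗ[k] (V →ₗ[k] W) where
  toFun f := del k W ∘ₗ f - hat f ∘ₗ del k V
  map_add' f g := by ext; simp; abel
  map_smul' c f := by ext; simp [smul_sub]

theorem homDel_apply {V W : Type*} [AddCommGroup V] [Module k V] [Cx k V] [AddCommGroup W]
    [Module k W] [Cx k W] (f : V →ₗ[k] W) :
    homDel f = del k W ∘ₗ f - hat f ∘ₗ del k V := rfl

theorem homDel_homDel {V W : Type*} [AddCommGroup V] [Module k V] [Cx k V] [AddCommGroup W]
    [Module k W] [Cx k W] (f : V →ₗ[k] W) : homDel (homDel f) = 0 := by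
  have h1 : del k W ∘ₗ del k W = 0 := LinearMap.ext Cx.dif_dif
  have h2 : del k V ∘ₗ del k V = 0 := LinearMap.ext Cx.dif_dif
  simp only [homDel_apply, hat_sub, hat_comp, hat_del, hat_hat, LinearMap.comp_sub,
    LinearMap.sub_comp, LinearMap.neg_comp, LinearMap.comp_neg]
  rw [← LinearMap.comp_assoc, h1, LinearMap.comp_assoc _ _ f, h2]
  ext x
  simp

theorem homDel_mem {V W : Type*} [AddCommGroup V] [Module k V] [Cx k V] [AddCommGroup W]
    [Module k W] [Cx k W] {n : ℤ} {f : V →ₗ[k] W} (hf : f ∈ homGr k V W n) :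
    homDel f ∈ homGr k V W (n - 1) := by
  intro i v hv
  rw [homDel_apply, hat_of_mem hf]
  refine sub_mem ?_ (Submodule.smul_mem _ _ ?_)
  · have := Cx.dif_mem _ _ (hf i v hv)
    rwa [show i + n - 1 = i + (n - 1) by ring] at this
  · have := hf _ _ (Cx.dif_mem i v hv)
    rwa [show i - 1 + n = i + (n - 1) by ring] at this

theorem del_comp_mul' : del k A ∘ₗ LinearMap.mul' k A =
    LinearMap.mul' k A ∘ₗ (km (del k A) LinearMap.id + km LinearMap.id (del k A)) := by
  refine gr_ext₂ fun i j x hx y hy => ?_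
  simp [km_tmul hx, tw_del, DGA.leibniz', sgn_of_mem hx]

section km
variable {V V' W W' X X' : Type*} [AddCommGroup V] [Module k V] [AddCommGroup W] [Module k W]
  [AddCommGroup X] [Module k X] [AddCommGroup V'] [Module k V'] [AddCommGroup W'] [Module k W']
  [AddCommGroup X'] [Module k X'] [Cx k V] [Cx k V'] [Cx k W] [Cx k W']

theorem km_sub_left {W : Type*} [AddCommGroup W] [Module k W] (f f' : V →ₗ[k] W)
    (g : V' →ₗ[k] W') : km (f - f') g = km f g - km f' g := by
  refine TensorProduct.ext (gr_ext fun i v hv => LinearMap.ext fun w => ?_)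
  simp [km_tmul hv, TensorProduct.sub_tmul]

theorem km_sub_right {W : Type*} [AddCommGroup W] [Module k W] (f : V →ₗ[k] W)
    (g g' : V' →ₗ[k] W') : km f (g - g') = km f g - km f g' := by
  refine TensorProduct.ext (gr_ext fun i v hv => LinearMap.ext fun w => ?_)
  have : tw i (g - g') = tw i g - tw i g' := by unfold tw; split_ifs <;> simp
  simp [km_tmul hv, this, TensorProduct.tmul_sub]

theorem km_del_id_comp (f : V →ₗ[k] W) (g : V' →ₗ[k] W') :
    km (del k W) LinearMap.id ∘ₗ km f g = km (del k W ∘ₗ f) g := by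
  refine TensorProduct.ext (gr_ext fun i v hv => LinearMap.ext fun w => ?_)
  have : ∀ (u : W) (u' : W'), km (del k W) LinearMap.id (u ⊗ₜ[k] u') = del k W u ⊗ₜ[k] u' := by
    intro u u'
    rw [km_even _ _ (by simp)]; simp
  simp [km_tmul hv, this]

theorem km_id_del_tmul (u : W) (u' : W') :
    km LinearMap.id (del k W') (u ⊗ₜ[k] u') = sgn k W u ⊗ₜ[k] del k W' u' := by
  refine gr_induction k (p := fun u => km LinearMap.id (del k W') (u ⊗ₜ[k] u') =
    sgn k W u ⊗ₜ[k] del k W' u') ?_ (by simp) ?_ u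
  · intro n v hv
    rw [km_tmul hv, tw_del, sgn_of_mem hv]
    simp [TensorProduct.smul_tmul]
  · intro u v hu hv
    simp [TensorProduct.add_tmul, hu, hv]

theorem km_id_del_comp (f : V →ₗ[k] W) (g : V' →ₗ[k] W') :
    km LinearMap.id (del k W') ∘ₗ km f g = km (hat f) (del k W' ∘ₗ g) := by
  refine TensorProduct.ext (gr_ext fun i v hv => LinearMap.ext fun w => ?_)
  simp [km_tmul hv, km_id_del_tmul, tw_comp, tw_del, hat, sgn_of_mem hv, TensorProduct.smul_tmul,
    smul_smul]

theorem km_comp_id_del {W : Type*} [AddCommGroup W] [Module k W] (f : V →ₗ[k] W) (g : V' →ₗ[k] W') :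
    km f g ∘ₗ km LinearMap.id (del k V') = km f (g ∘ₗ del k V') := by
  refine TensorProduct.ext (gr_ext fun i v hv => LinearMap.ext fun w => ?_)
  simp [km_tmul hv, tw_comp, tw_del]

theorem km_comp_del_id {W : Type*} [AddCommGroup W] [Module k W] (f : V →ₗ[k] W) (g : V' →ₗ[k] W') :
    km f g ∘ₗ km (del k V) LinearMap.id = km (f ∘ₗ del k V) (hat g) := by
  refine TensorProduct.ext (gr_ext fun i v hv => LinearMap.ext fun w => ?_)
  simp [km_tmul hv, km_tmul (Cx.dif_mem i v hv), tw_sub_one]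

end km

theorem homDel_conv (f g : C →ₗ[k] A) :
    homDel (conv f g) = conv (homDel f) g + conv (hat f) (homDel g) := by
  have h1 : conv (homDel f) g = LinearMap.mul' k A ∘ₗ
      (km (del k A ∘ₗ f) g - km (hat f ∘ₗ del k C) g) ∘ₗ Coalgebra.comul := by
    rw [conv, homDel_apply, km_sub_left]
  have h2 : conv (hat f) (homDel g) = LinearMap.mul' k A ∘ₗ
      (km (hat f) (del k A ∘ₗ g) - km (hat f) (hat g ∘ₗ del k C)) ∘ₗ Coalgebra.comul := by
    rw [conv, homDel_apply, km_sub_right]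
  have h3 : Coalgebra.comul ∘ₗ del k C = (km (del k C) LinearMap.id +
    km LinearMap.id (del k C)) ∘ₗ Coalgebra.comul := DGCoalg.comul_dif
  have h4 : km (hat f) (hat g) ∘ₗ km (del k C) LinearMap.id = km (hat f ∘ₗ del k C) g := by
    rw [km_comp_del_id, hat_hat]
  rw [homDel_apply, hat_conv, h1, h2]
  simp only [conv]
  have h5 : ∀ t, del k A (LinearMap.mul' k A t) = LinearMap.mul' k A
      ((km (del k A) LinearMap.id + km LinearMap.id (del k A) : A ⊗[k] A →ₗ[k] A ⊗[k] A) t) :=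
    LinearMap.congr_fun del_comp_mul'
  ext x
  have h6 := LinearMap.congr_fun h3 x
  simp only [LinearMap.comp_apply] at h6
  simp only [LinearMap.sub_apply, LinearMap.add_apply, LinearMap.comp_apply, h5, h6, map_add,
    map_sub, ← LinearMap.comp_apply (km (hat f) (hat g)), h4, km_comp_id_del,
    ← LinearMap.comp_apply (km (del k A) _), ← LinearMap.comp_apply (km LinearMap.id (del k A)),
    km_del_id_comp, km_id_del_comp]
  abel

theorem conv_mem_iSup {f g : C →ₗ[k] A} (hf : f ∈ ⨆ n, homGr k C A n)
    (hg : g ∈ ⨆ n, homGr k C A n) : conv f g ∈ ⨆ n, homGr k C A n := by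
  refine Submodule.iSup_induction (motive := fun f : C →ₗ[k] A => conv f g ∈
    ⨆ n, homGr k C A n) _ hf ?_ ?_ ?_
  · intro m f hf
    refine Submodule.iSup_induction (motive := fun g : C →ₗ[k] A => conv f g ∈
      ⨆ n, homGr k C A n) _ hg ?_ ?_ ?_
    · intro n g hg
      exact Submodule.mem_iSup_of_mem (m + n) (conv_mem hf hg)
    · have := conv_smul (k := k) (A := A) (0 : k) f (0 : C →ₗ[k] A)
      rw [zero_smul, zero_smul] at this
      rw [this]; exact zero_mem _
    · intro g h hg hh
      rw [conv_add]; exact add_mem hg hh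
  · have := smul_conv (k := k) (A := A) (0 : k) (0 : C →ₗ[k] A) g
    rw [zero_smul, zero_smul] at this
    rw [this]; exact zero_mem _
  · intro f h hf hh
    rw [add_conv]; exact add_mem hf hh

variable (k C A) in
/-- The sums of homogeneous maps from `C` to `A`. -/
def convTot : Subalgebra k (ConvAlg k C A) where
  carrier := ((⨆ n, homGr k C A n : Submodule k (C →ₗ[k] A)) : Set (C →ₗ[k] A))
  add_mem' hf hg := add_mem (S := Submodule k (C →ₗ[k] A)) hf hg
  algebraMap_mem' c := by
    have h : (convOne : C →ₗ[k] A) ∈ (⨆ n, homGr k C A n : Submodule k (C →ₗ[k] A)) :=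
      Submodule.mem_iSup_of_mem 0 convOne_mem
    exact Submodule.smul_mem _ c h
  mul_mem' hf hg := conv_mem_iSup hf hg

variable (k C A) in
/-- The differential graded algebra of sums of homogeneous maps from `C` to `A`. -/
def ConvDG : Type _ := convTot k C A

instance : Ring (ConvDG k C A) := inferInstanceAs (Ring (convTot k C A))

instance : Algebra k (ConvDG k C A) := inferInstanceAs (Algebra k (convTot k C A))

/-- The element given by a sum of homogeneous maps. -/
def ConvDG.mk (f : C →ₗ[k] A) (hf : f ∈ (⨆ n, homGr k C A n : Submodule k (C →ₗ[k] A))) :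
    ConvDG k C A := (⟨f, hf⟩ : convTot k C A)

/-- The underlying linear map. -/
def ConvDG.val : ConvDG k C A →ₗ[k] (C →ₗ[k] A) := (convTot k C A).val.toLinearMap

@[simp] theorem ConvDG.val_mk (f : C →ₗ[k] A)
    (hf : f ∈ (⨆ n, homGr k C A n : Submodule k (C →ₗ[k] A))) : (ConvDG.mk f hf).val = f := rfl

theorem ConvDG.val_injective : Function.Injective (ConvDG.val : ConvDG k C A → _) :=
  Subtype.val_injective

theorem ConvDG.val_mul (f g : ConvDG k C A) : (f * g).val = conv f.val g.val := rfl

theorem ConvDG.val_one : (1 : ConvDG k C A).val = convOne := rfl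

theorem ConvDG.val_mem (f : ConvDG k C A) :
    f.val ∈ (⨆ n, homGr k C A n : Submodule k (C →ₗ[k] A)) := f.2

theorem ConvDG.range_val :
    LinearMap.range (ConvDG.val : ConvDG k C A →ₗ[k] _) = ⨆ n, homGr k C A n := by
  ext f
  exact ⟨by rintro ⟨g, rfl⟩; exact g.val_mem, fun h => ⟨ConvDG.mk f h, rfl⟩⟩

instance : GrMod k (ConvDG k C A) where
  part n := (homGr k C A n).comap ConvDG.val
  internal := by
    refine isInternal_of_separating (T := Σ j : ℤ, gr k C j) (W := A) _
      (fun n t => wt k A (Pi.single (t.1 + n) 1) ∘ₗ LinearMap.applyₗ (t.2 : C) ∘ₗ ConvDG.val)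
      ?_ ?_ ?_
    · rintro m n hmn f hf ⟨j, x, hx⟩
      have := hf j x hx
      simp only [LinearMap.comp_apply, LinearMap.applyₗ_apply_apply, wt_of_mem _ this]
      rw [Pi.single_eq_of_ne (by omega), zero_smul]
    · intro n f hf h
      apply ConvDG.val_injective
      refine gr_ext fun j x hx => ?_
      have h1 := h ⟨j, x, hx⟩
      simp only [LinearMap.comp_apply, LinearMap.applyₗ_apply_apply, wt_of_mem _ (hf j x hx)] at h1
      simpa using h1
    · apply Submodule.map_injective_of_injective (f := ConvDG.val) ConvDG.val_injective
      rw [Submodule.map_iSup, Submodule.map_top, ConvDG.range_val]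
      refine iSup_congr fun n => ?_
      rw [Submodule.map_comap_eq, ConvDG.range_val]
      exact inf_eq_right.2 (le_iSup (fun n => homGr k C A n) n)

theorem ConvDG.mem_gr {n : ℤ} {f : ConvDG k C A} :
    f ∈ gr k (ConvDG k C A) n ↔ f.val ∈ homGr k C A n := Iff.rfl

theorem homDel_mem_iSup {f : C →ₗ[k] A} (hf : f ∈ ⨆ n, homGr k C A n) :
    homDel f ∈ ⨆ n, homGr k C A n := by
  refine Submodule.iSup_induction (motive := fun f : C →ₗ[k] A => homDel f ∈
    ⨆ n, homGr k C A n) _ hf ?_ ?_ ?_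
  · intro n f hf
    exact Submodule.mem_iSup_of_mem (n - 1) (homDel_mem hf)
  · rw [map_zero]; exact zero_mem _
  · intro f g hf hg
    rw [map_add]; exact add_mem hf hg

instance : Cx k (ConvDG k C A) where
  dif :=
    { toFun := fun f => ConvDG.mk (homDel f.val) (homDel_mem_iSup f.val_mem)
      map_add' := fun f g => ConvDG.val_injective (map_add homDel f.val g.val)
      map_smul' := fun c f => ConvDG.val_injective (map_smul homDel c f.val) }
  dif_mem _ _ hf := homDel_mem hf
  dif_dif f := ConvDG.val_injective (homDel_homDel f.val)

theorem ConvDG.val_del (f : ConvDG k C A) : (del k (ConvDG k C A) f).val = homDel f.val := rfl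

instance : DGA k (ConvDG k C A) where
  one_mem := convOne_mem
  mul_mem _ _ _ hf _ hg := conv_mem hf hg
  leibniz m f hf g := by
    apply ConvDG.val_injective
    have := homDel_conv f.val g.val
    rw [hat_of_mem hf, smul_conv] at this
    exact this

theorem ConvDG.val_sgn (f : ConvDG k C A) : (sgn k (ConvDG k C A) f).val = hat f.val := by
  refine gr_induction k (p := fun f => (sgn k (ConvDG k C A) f).val = hat f.val) ?_ (by simp) ?_ f
  · intro n v hv
    rw [sgn_of_mem hv, map_smul, hat_of_mem hv]
  · intro f g hf hg
    simp only [map_add, hf, hg, hat_add]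

end Convolution

section Words

variable (k : Type*) [Field k] (V : Type*) [AddCommGroup V] [Module k V]

/-- Words in `V`. -/
abbrev Words : Type _ := TensorAlgebra k V

variable {k V}

/-- Prepend a letter. -/
def wcons : V →ₗ[k] Words k V →ₗ[k] Words k V := LinearMap.mul k (Words k V) ∘ₗ TensorAlgebra.ι k

theorem wcons_apply (v : V) (w : Words k V) : wcons v w = TensorAlgebra.ι k v * w := rfl

theorem words_top {S : Submodule k (Words k V)} (h1 : (1 : Words k V) ∈ S)
    (hc : ∀ v, ∀ w ∈ S, wcons v w ∈ S) : S = ⊤ := by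
  have key : ∀ w : Words k V, ∀ u ∈ S, w * u ∈ S := by
    intro w
    induction w using TensorAlgebra.induction with
    | algebraMap r => intro u hu; rw [← Algebra.smul_def]; exact S.smul_mem r hu
    | ι v => intro u hu; exact hc v u hu
    | mul a b ha hb => intro u hu; rw [mul_assoc]; exact ha _ (hb _ hu)
    | add a b ha hb => intro u hu; rw [add_mul]; exact S.add_mem (ha _ hu) (hb _ hu)
  rw [eq_top_iff]
  intro w _
  simpa using key w 1 h1

theorem words_ext {X : Type*} [AddCommGroup X] [Module k X] {f g : Words k V →ₗ[k] X}
    (h1 : f 1 = g 1) (hc : ∀ v w, f w = g w → f (wcons v w) = g (wcons v w)) : f = g := by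
  have : LinearMap.eqLocus f g = ⊤ := words_top h1 fun v w hw => hc v w hw
  ext w : 1
  have hw : w ∈ LinearMap.eqLocus f g := this ▸ Submodule.mem_top
  exact hw

section Rec

variable {X : Type*} [AddCommGroup X] [Module k X]

/-- The linear map on words with value `x` on the empty word and
`f (v w) = a v w + b v (f w)`. -/
def wordsRec (x : X) (a : V →ₗ[k] Words k V →ₗ[k] X) (b : V →ₗ[k] X →ₗ[k] X) :
    Words k V →ₗ[k] X :=
  LinearMap.snd k (Words k V) X ∘ₗ
    LinearMap.applyₗ ((1 : Words k V), x) ∘ₗ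
      (TensorAlgebra.lift k (A := Module.End k (Words k V × X)) (LinearMap.mk₂ k
        (fun v p => (wcons v p.1, a v p.1 + b v p.2))
        (fun v v' p => by ext <;> simp; abel)
        (fun c v p => by ext <;> simp)
        (fun v p q => by ext <;> simp; abel)
        (fun c v p => by ext <;> simp))).toLinearMap

variable (x : X) (a : V →ₗ[k] Words k V →ₗ[k] X) (b : V →ₗ[k] X →ₗ[k] X)

@[simp] theorem wordsRec_one : wordsRec x a b 1 = x := by
  simp [wordsRec]

@[simp] theorem wordsRec_cons (v : V) (w : Words k V) :
    wordsRec x a b (wcons v w) = a v w + b v (wordsRec x a b w) := by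
  set L := (TensorAlgebra.lift k (A := Module.End k (Words k V × X)) (LinearMap.mk₂ k
        (fun v p => (wcons v p.1, a v p.1 + b v p.2))
        (fun v v' p => by ext <;> simp; abel)
        (fun c v p => by ext <;> simp)
        (fun v p q => by ext <;> simp; abel)
        (fun c v p => by ext <;> simp))) with hL
  have hL' : ∀ v p, L (TensorAlgebra.ι k v) p = (wcons v p.1, a v p.1 + b v p.2) := by
    intro v p; rw [hL]; simp
  have hfst : ∀ w, (L w (1, x)).1 = w := by
    have : LinearMap.fst k (Words k V) X ∘ₗ LinearMap.applyₗ ((1 : Words k V), x) ∘ₗ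
        L.toLinearMap = LinearMap.id := by
      refine words_ext (by simp) ?_
      intro v w hw
      simp only [LinearMap.comp_apply, LinearMap.applyₗ_apply_apply, AlgHom.toLinearMap_apply,
        LinearMap.fst_apply, LinearMap.id_apply] at hw ⊢
      rw [wcons_apply, map_mul, Module.End.mul_apply, hL', hw]
      rfl
    exact LinearMap.congr_fun this
  have hsnd : ∀ w, wordsRec x a b w = (L w (1, x)).2 := fun w => rfl
  rw [hsnd, hsnd, wcons_apply, map_mul, Module.End.mul_apply, hL', hfst]

end Rec

variable [GrMod k V]

/-- Words of total degree `n`, where a letter `v` counts with degree `|v| + s`. -/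
def wordsPart (s n : ℤ) : Submodule k (Words k V) :=
  Submodule.span k {w | ∃ l : List (Σ i, gr k V i), (l.map fun x => x.1 + s).sum = n ∧
    w = (l.map fun x => TensorAlgebra.ι k (x.2 : V)).prod}

theorem wordsPart_induction {s : ℤ} {p : ℤ → Words k V → Prop} (one : p 0 1)
    (cons : ∀ i, ∀ v ∈ gr k V i, ∀ n, ∀ w ∈ wordsPart s n, p n w → p (i + s + n) (wcons v w))
    (zero : ∀ n, p n 0) (add : ∀ n v w, p n v → p n w → p n (v + w))
    (smul : ∀ n (c : k) w, p n w → p n (c • w)) {n : ℤ} {w : Words k V}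
    (hw : w ∈ wordsPart s n) : p n w := by
  refine Submodule.span_induction ?_ (zero n) (fun _ _ _ _ => add n _ _) (fun c _ _ => smul n c _) hw
  rintro _ ⟨l, rfl, rfl⟩
  clear hw
  induction l with
  | nil => simpa using one
  | cons x l ih =>
    simp only [List.map_cons, List.sum_cons, List.prod_cons]
    exact cons _ _ x.2.2 _ _ (Submodule.subset_span ⟨l, rfl, rfl⟩) ih

theorem one_mem_wordsPart (s : ℤ) : (1 : Words k V) ∈ wordsPart s 0 :=
  Submodule.subset_span ⟨[], by simp, by simp⟩

theorem wcons_mem {s i n : ℤ} {v : V} (hv : v ∈ gr k V i) {w : Words k V}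
    (hw : w ∈ wordsPart s n) : wcons v w ∈ wordsPart s (i + s + n) := by
  refine Submodule.span_induction (p := fun w _ => wcons v w ∈ wordsPart s (i + s + n))
    ?_ (by simp) ?_ ?_ hw
  · rintro _ ⟨l, rfl, rfl⟩
    exact Submodule.subset_span ⟨⟨i, v, hv⟩ :: l, by simp, by simp [wcons_apply]⟩
  · intro x y _ _ hx hy
    rw [map_add]; exact add_mem hx hy
  · intro c x _ hx
    rw [map_smul]; exact Submodule.smul_mem _ _ hx

theorem words_mul_mem {s m n : ℤ} {v w : Words k V} (hv : v ∈ wordsPart s m)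
    (hw : w ∈ wordsPart s n) : v * w ∈ wordsPart s (m + n) := by
  refine wordsPart_induction (p := fun m v => v * w ∈ wordsPart s (m + n)) ?_ ?_ ?_ ?_ ?_ hv
  · simpa using hw
  · intro i v hv j u _ hu
    rw [wcons_apply, mul_assoc, add_assoc]
    exact wcons_mem hv hu
  · simp
  · intro n v w hv hw
    rw [add_mul]; exact add_mem hv hw
  · intro n c w hw
    rw [smul_mul_assoc]; exact Submodule.smul_mem _ _ hw

theorem iSup_wordsPart (s : ℤ) : ⨆ n, wordsPart (k := k) (V := V) s n = ⊤ := by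
  refine words_top (Submodule.mem_iSup_of_mem 0 (one_mem_wordsPart s)) ?_
  intro v w hw
  refine gr_induction k (p := fun v => wcons v w ∈ ⨆ n, wordsPart (k := k) (V := V) s n)
    ?_ (by simp) ?_ v
  · intro i v hv
    refine Submodule.iSup_induction
      (motive := fun w => wcons v w ∈ ⨆ n, wordsPart (k := k) (V := V) s n) _ hw ?_ (by simp) ?_
    · intro n w hw
      exact Submodule.mem_iSup_of_mem _ (wcons_mem hv hw)
    · intro u w hu hw
      rw [map_add]; exact add_mem hu hw
  · intro u w hu hw
    rw [map_add]; exact add_mem hu hw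

/-- Auxiliary coaction that records the degree of words. -/
def wordsCoact (s : ℤ) : Words k V →ₐ[k] AddMonoidAlgebra (Words k V) ℤ :=
  TensorAlgebra.lift k (grLift k V fun i =>
    AddMonoidAlgebra.lsingle (i + s) ∘ₗ TensorAlgebra.ι k ∘ₗ (gr k V i).subtype)

theorem wordsCoact_of_mem {s n : ℤ} {w : Words k V} (hw : w ∈ wordsPart s n) :
    wordsCoact s w = AddMonoidAlgebra.single n w := by
  refine wordsPart_induction (p := fun n w => wordsCoact s w = AddMonoidAlgebra.single n w)
    ?_ ?_ ?_ ?_ ?_ hw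
  · rw [map_one]; rfl
  · intro i v hv n w _ h
    rw [wcons_apply, map_mul, h, wordsCoact, TensorAlgebra.lift_ι_apply, grLift_of_mem _ hv]
    simp [-LaurentPolynomial.single_eq_C_mul_T, AddMonoidAlgebra.single_mul_single]
  · simp
  · intro n v w hv hw; simp [hv, hw]
  · intro n c w hw; simp [-LaurentPolynomial.single_eq_C_mul_T, hw]

/-- The grading on words, where a letter `v` counts with degree `|v| + s`. -/
abbrev wordsGrMod (s : ℤ) : GrMod k (Words k V) where
  part := wordsPart s
  internal := by
    refine isInternal_of_separating (T := Unit) (W := Words k V) _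
      (fun n _ => (Finsupp.lapply n ∘ₗ (AddMonoidAlgebra.coeffLinearEquiv k).toLinearMap) ∘ₗ
        (wordsCoact s).toLinearMap) ?_ ?_ (iSup_wordsPart s)
    · intro m n hmn w hw _
      simp [-LaurentPolynomial.single_eq_C_mul_T, wordsCoact_of_mem hw, hmn]
    · intro n w hw h
      have := h ()
      simpa [-LaurentPolynomial.single_eq_C_mul_T, wordsCoact_of_mem hw] using this

end Words

section Bar

variable (k : Type*) [Field k] (V : Type*) [AddCommGroup V] [Module k V]

/-- The underlying vector space of the bar construction: the tensor coalgebra on the suspension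
of `V`. The word `[v₁ | ⋯ | vₙ]` has degree `|v₁| + ⋯ + |vₙ| + n`. -/
def Bar : Type _ := Words k V

instance : AddCommGroup (Bar k V) := inferInstanceAs (AddCommGroup (Words k V))

instance : Module k (Bar k V) := inferInstanceAs (Module k (Words k V))

variable {k V}

/-- The empty word. -/
def Bar.nil : Bar k V := (1 : Words k V)

/-- The word `[v | w]`. -/
def Bar.cons : V →ₗ[k] Bar k V →ₗ[k] Bar k V := wcons (k := k) (V := V)

theorem Bar.ext' {X : Type*} [AddCommGroup X] [Module k X] {f g : Bar k V →ₗ[k] X}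
    (h1 : f Bar.nil = g Bar.nil)
    (hc : ∀ v w, f w = g w → f (Bar.cons v w) = g (Bar.cons v w)) : f = g :=
  words_ext (f := f) (g := g) h1 hc

theorem Bar.ext_hom [GrMod k V] {X : Type*} [AddCommGroup X] [Module k X] {f g : Bar k V →ₗ[k] X}
    (h1 : f Bar.nil = g Bar.nil)
    (hc : ∀ i, ∀ v ∈ gr k V i, ∀ w, f w = g w → f (Bar.cons v w) = g (Bar.cons v w)) : f = g :=
  Bar.ext' h1 fun v w hw => gr_induction k (p := fun v => f (Bar.cons v w) = g (Bar.cons v w))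
    (fun i v hv => hc i v hv w hw) (by simp)
    (fun v v' h h' => by simp only [map_add, LinearMap.add_apply, h, h']) v

/-- The linear map on words with value `x` on the empty word and
`f [v | w] = a v w + b v (f w)`. -/
def Bar.rec' {X : Type*} [AddCommGroup X] [Module k X] (x : X) (a : V →ₗ[k] Bar k V →ₗ[k] X)
    (b : V →ₗ[k] X →ₗ[k] X) : Bar k V →ₗ[k] X := wordsRec (k := k) (V := V) x a b

@[simp] theorem Bar.rec'_nil {X : Type*} [AddCommGroup X] [Module k X] (x : X)
    (a : V →ₗ[k] Bar k V →ₗ[k] X) (b : V →ₗ[k] X →ₗ[k] X) :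
    Bar.rec' x a b Bar.nil = x := wordsRec_one x a b

@[simp] theorem Bar.rec'_cons {X : Type*} [AddCommGroup X] [Module k X] (x : X)
    (a : V →ₗ[k] Bar k V →ₗ[k] X) (b : V →ₗ[k] X →ₗ[k] X) (v : V) (w : Bar k V) :
    Bar.rec' x a b (Bar.cons v w) = a v w + b v (Bar.rec' x a b w) := wordsRec_cons x a b v w

/-- Deconcatenation. -/
def Bar.comul : Bar k V →ₗ[k] Bar k V ⊗[k] Bar k V :=
  Bar.rec' (Bar.nil ⊗ₜ[k] Bar.nil)
    (Bar.cons.compr₂ (TensorProduct.mk k (Bar k V) (Bar k V) Bar.nil))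
    (LinearMap.rTensorHom (Bar k V) ∘ₗ Bar.cons)

theorem Bar.comul_nil : Bar.comul (Bar.nil : Bar k V) = Bar.nil ⊗ₜ[k] Bar.nil := by
  simp [Bar.comul]

theorem Bar.comul_cons (v : V) (w : Bar k V) : Bar.comul (Bar.cons v w) =
    Bar.nil ⊗ₜ[k] Bar.cons v w + (Bar.cons v).rTensor (Bar k V) (Bar.comul w) := by
  simp [Bar.comul]

/-- The counit: the coefficient of the empty word. -/
def Bar.counit : Bar k V →ₗ[k] k := Bar.rec' 1 0 0

theorem Bar.counit_nil : Bar.counit (Bar.nil : Bar k V) = 1 := by simp [Bar.counit]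

theorem Bar.counit_cons (v : V) (w : Bar k V) : Bar.counit (Bar.cons v w) = 0 := by
  simp [Bar.counit]

instance : Coalgebra k (Bar k V) where
  comul := Bar.comul
  counit := Bar.counit
  coassoc := by
    refine Bar.ext' (by simp [Bar.comul_nil]) fun v w hw => ?_
    simp only [LinearMap.comp_apply, LinearEquiv.coe_coe] at hw ⊢
    have key : ∀ t : Bar k V ⊗[k] Bar k V, TensorProduct.assoc k _ _ _
        (Bar.comul.rTensor _ ((Bar.cons v).rTensor _ t)) =
        Bar.nil ⊗ₜ ((Bar.cons v).rTensor (Bar k V) t) +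
          (Bar.cons v).rTensor (Bar k V ⊗[k] Bar k V)
            (TensorProduct.assoc k _ _ _ (Bar.comul.rTensor _ t)) := by
      intro t
      induction t with
      | zero => simp
      | add s t hs ht =>
        simp only [map_add, hs, ht, TensorProduct.tmul_add]; abel
      | tmul x y =>
        simp only [LinearMap.rTensor_tmul, Bar.comul_cons, TensorProduct.add_tmul, map_add,
          TensorProduct.assoc_tmul]
        congr 1
        generalize Bar.comul x = u
        induction u with
        | zero => simp
        | add s t hs ht => simp only [map_add, TensorProduct.add_tmul, hs, ht]
        | tmul a b => simp
    have key2 : ∀ t : Bar k V ⊗[k] Bar k V,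
        Bar.comul.lTensor _ ((Bar.cons v).rTensor _ t) =
          (Bar.cons v).rTensor (Bar k V ⊗[k] Bar k V) (Bar.comul.lTensor _ t) := by
      intro t
      induction t with
      | zero => simp
      | add s t hs ht => simp only [map_add, hs, ht]
      | tmul x y => simp
    rw [Bar.comul_cons, map_add, map_add, map_add, key, key2, hw]
    simp [Bar.comul_nil, Bar.comul_cons, TensorProduct.tmul_add, add_assoc]
  rTensor_counit_comp_comul := by
    refine Bar.ext' (by simp [Bar.comul_nil, Bar.counit_nil]) fun v w _ => ?_
    have key : ∀ t : Bar k V ⊗[k] Bar k V,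
        Bar.counit.rTensor _ ((Bar.cons v).rTensor _ t) = 0 := by
      intro t
      induction t with
      | zero => simp
      | add s t hs ht => simp only [map_add, hs, ht, add_zero]
      | tmul x y => simp [Bar.counit_cons]
    simp [Bar.comul_cons, key, Bar.counit_nil]
  lTensor_counit_comp_comul := by
    refine Bar.ext' (by simp [Bar.comul_nil, Bar.counit_nil]) fun v w hw => ?_
    have key : ∀ t : Bar k V ⊗[k] Bar k V,
        Bar.counit.lTensor _ ((Bar.cons v).rTensor _ t) =
          (Bar.cons v).rTensor _ (Bar.counit.lTensor _ t) := by
      intro t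
      induction t with
      | zero => simp
      | add s t hs ht => simp only [map_add, hs, ht]
      | tmul x y => simp
    simp only [LinearMap.comp_apply] at hw ⊢
    rw [Bar.comul_cons, map_add, key, hw]
    simp [Bar.counit_cons]

theorem Bar.comul_def : (Coalgebra.comul : Bar k V →ₗ[k] _) = Bar.comul := rfl

theorem Bar.counit_def : (Coalgebra.counit : Bar k V →ₗ[k] k) = Bar.counit := rfl

section Graded

variable [GrMod k V]

instance : GrMod k (Bar k V) where
  part := wordsPart (k := k) (V := V) 1
  internal := (wordsGrMod (k := k) (V := V) 1).internal

theorem Bar.nil_mem : (Bar.nil : Bar k V) ∈ gr k (Bar k V) 0 := one_mem_wordsPart 1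

theorem Bar.cons_mem {i n : ℤ} {v : V} (hv : v ∈ gr k V i) {w : Bar k V}
    (hw : w ∈ gr k (Bar k V) n) : Bar.cons v w ∈ gr k (Bar k V) (i + 1 + n) :=
  wcons_mem hv hw

theorem Bar.induction_gr {p : ℤ → Bar k V → Prop} (one : p 0 Bar.nil)
    (cons : ∀ i, ∀ v ∈ gr k V i, ∀ n, ∀ w ∈ gr k (Bar k V) n, p n w → p (i + 1 + n) (Bar.cons v w))
    (zero : ∀ n, p n 0) (add : ∀ n v w, p n v → p n w → p n (v + w))
    (smul : ∀ n (c : k) w, p n w → p n (c • w)) {n : ℤ} {w : Bar k V}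
    (hw : w ∈ gr k (Bar k V) n) : p n w :=
  wordsPart_induction (p := p) one cons zero add smul hw

theorem Bar.sgn_nil : sgn k (Bar k V) Bar.nil = Bar.nil := by
  rw [sgn_of_mem Bar.nil_mem]; simp

theorem Bar.sgn_cons (v : V) (w : Bar k V) :
    sgn k (Bar k V) (Bar.cons v w) = - Bar.cons (sgn k V v) (sgn k (Bar k V) w) := by
  refine gr_induction k (p := fun v => sgn k (Bar k V) (Bar.cons v w) =
    - Bar.cons (sgn k V v) (sgn k (Bar k V) w)) ?_ (by simp) ?_ v
  · intro i v hv
    refine gr_induction k (p := fun w => sgn k (Bar k V) (Bar.cons v w) =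
      - Bar.cons (sgn k V v) (sgn k (Bar k V) w)) ?_ (by simp) ?_ w
    · intro n w hw
      rw [sgn_of_mem (Bar.cons_mem hv hw), sgn_of_mem hv, sgn_of_mem hw, koszul_add, koszul_add]
      simp [smul_smul, mul_comm]
    · intro x y hx hy
      simp only [map_add, hx, hy]; abel
  · intro x y hx hy
    simp only [map_add, LinearMap.add_apply, hx, hy]; abel

end Graded

section Differential

variable [NDGA k V]

/-- Split off the first letter. -/
def Bar.uncons : Bar k V →ₗ[k] V ⊗[k] Bar k V := Bar.rec' 0 (TensorProduct.mk k V (Bar k V)) 0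

/-- Multiply `(-1) ^ |v| v` with the first letter of a word. -/
def Bar.merge : V →ₗ[k] Bar k V →ₗ[k] Bar k V :=
  LinearMap.mk₂ k (fun v w => TensorProduct.lift Bar.cons
      ((NDGA.mul (k := k) (sgn k V v)).rTensor (Bar k V) (Bar.uncons w)))
    (fun v v' w => by simp [LinearMap.rTensor_add])
    (fun c v w => by simp [LinearMap.rTensor_smul])
    (fun v w w' => by simp)
    (fun c v w => by simp)

@[simp] theorem Bar.merge_nil (v : V) : Bar.merge v (Bar.nil : Bar k V) = 0 := by
  simp [Bar.merge, Bar.uncons]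

@[simp] theorem Bar.merge_cons (v v' : V) (w : Bar k V) : Bar.merge v (Bar.cons v' w) =
    Bar.cons (NDGA.mul (k := k) (sgn k V v) v') w := by
  simp [Bar.merge, Bar.uncons]

/-- The differential of the bar construction: the coderivation with `[v] ↦ -[d v]` and
`[v | v'] ↦ (-1) ^ |v| [v v'] - [d v | v'] - (-1) ^ |v| [v | d [v']]`. -/
def Bar.dif : Bar k V →ₗ[k] Bar k V :=
  Bar.rec' 0 (Bar.merge - Bar.cons ∘ₗ del k V) (-(Bar.cons ∘ₗ sgn k V))

theorem Bar.dif_nil : Bar.dif (Bar.nil : Bar k V) = 0 := by simp [Bar.dif]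

theorem Bar.dif_cons (v : V) (w : Bar k V) : Bar.dif (Bar.cons v w) =
    Bar.merge v w - Bar.cons (del k V v) w - Bar.cons (sgn k V v) (Bar.dif w) := by
  simp [Bar.dif]; abel

theorem NDGA.sgn_mul (x y : V) : sgn k V (NDGA.mul (k := k) x y) =
    NDGA.mul (k := k) (sgn k V x) (sgn k V y) := by
  refine gr_induction k (p := fun x => sgn k V (NDGA.mul (k := k) x y) =
    NDGA.mul (k := k) (sgn k V x) (sgn k V y)) ?_ (by simp) ?_ x
  · intro m v hv
    refine gr_induction k (p := fun y => sgn k V (NDGA.mul (k := k) v y) =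
      NDGA.mul (k := k) (sgn k V v) (sgn k V y)) ?_ (by simp) ?_ y
    · intro n w hw
      rw [sgn_of_mem hv, sgn_of_mem hw, sgn_of_mem (NDGA.mul_mem m n v hv w hw), koszul_add]
      simp [smul_smul, mul_comm]
    · intro v w hv hw
      simp only [map_add, hv, hw]
  · intro v w hv hw
    simp only [map_add, LinearMap.add_apply, hv, hw]

theorem NDGA.leibniz' (x y : V) : del k V (NDGA.mul (k := k) x y) =
    NDGA.mul (k := k) (del k V x) y + NDGA.mul (k := k) (sgn k V x) (del k V y) := by
  refine gr_induction k (p := fun x => del k V (NDGA.mul (k := k) x y) =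
    NDGA.mul (k := k) (del k V x) y + NDGA.mul (k := k) (sgn k V x) (del k V y)) ?_ (by simp) ?_ x
  · intro n v hv
    rw [sgn_of_mem hv, map_smul, LinearMap.smul_apply]
    exact NDGA.leibniz n v hv y
  · intro v w hv hw
    simp only [map_add, LinearMap.add_apply, hv, hw]
    abel

theorem Bar.merge_merge (v v' : V) (w : Bar k V) :
    Bar.merge (NDGA.mul (k := k) (sgn k V v) v') w = Bar.merge (sgn k V v) (Bar.merge v' w) := by
  have : Bar.merge (NDGA.mul (k := k) (sgn k V v) v') =
      Bar.merge (sgn k V v) ∘ₗ (Bar.merge v' : Bar k V →ₗ[k] _) := by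
    refine Bar.ext' (by simp) fun x w _ => ?_
    simp [NDGA.sgn_mul, NDGA.mul_assoc]
  exact LinearMap.congr_fun this w

theorem Bar.dif_merge (v : V) (w : Bar k V) : Bar.dif (Bar.merge v w) =
    Bar.merge (del k V v) w + Bar.merge (sgn k V v) (Bar.dif w) := by
  have : Bar.dif ∘ₗ (Bar.merge v : Bar k V →ₗ[k] _) =
      Bar.merge (del k V v) + Bar.merge (sgn k V v) ∘ₗ Bar.dif := by
    refine Bar.ext' (by simp [Bar.dif_nil]) fun x w _ => ?_
    simp only [LinearMap.comp_apply, LinearMap.add_apply, Bar.merge_cons, Bar.dif_cons, map_sub,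
      Bar.merge_merge, NDGA.leibniz', NDGA.sgn_mul, sgn_del, sgn_sgn, map_add, map_neg,
      LinearMap.neg_apply]
    abel
  exact LinearMap.congr_fun this w

theorem Bar.dif_dif (w : Bar k V) : Bar.dif (Bar.dif w) = 0 := by
  have : Bar.dif ∘ₗ Bar.dif = (0 : Bar k V →ₗ[k] _) := by
    refine Bar.ext' (by simp [Bar.dif_nil]) fun v w hw => ?_
    have hd : del k V (del k V v) = 0 := Cx.dif_dif v
    simp only [LinearMap.comp_apply, LinearMap.zero_apply] at hw ⊢
    simp only [Bar.dif_cons, map_sub, Bar.dif_merge, sgn_del, sgn_sgn, hw, hd, map_neg,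
      LinearMap.neg_apply, map_zero, LinearMap.zero_apply]
    abel
  exact LinearMap.congr_fun this w

theorem Bar.merge_mem {i n : ℤ} {v : V} (hv : v ∈ gr k V i) {w : Bar k V}
    (hw : w ∈ gr k (Bar k V) n) : Bar.merge v w ∈ gr k (Bar k V) (i + n) := by
  refine Bar.induction_gr (p := fun n w => Bar.merge v w ∈ gr k (Bar k V) (i + n))
    (by simp) ?_ (by simp) ?_ ?_ hw
  · intro j x hx n w hw _
    rw [Bar.merge_cons, sgn_of_mem hv]
    have := Bar.cons_mem (NDGA.mul_mem i j v hv x hx) hw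
    rw [show i + j + 1 + n = i + (j + 1 + n) by ring] at this
    simpa using Submodule.smul_mem _ _ this
  · intro n x y hx hy
    rw [map_add]; exact add_mem hx hy
  · intro n c x hx
    rw [map_smul]; exact Submodule.smul_mem _ _ hx

theorem Bar.dif_mem {n : ℤ} {w : Bar k V} (hw : w ∈ gr k (Bar k V) n) :
    Bar.dif w ∈ gr k (Bar k V) (n - 1) := by
  refine Bar.induction_gr (p := fun n w => Bar.dif w ∈ gr k (Bar k V) (n - 1))
    (by simp [Bar.dif_nil]) ?_ (by simp) ?_ ?_ hw
  · intro i v hv n w hw h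
    rw [Bar.dif_cons, sgn_of_mem hv]
    refine sub_mem (sub_mem ?_ ?_) ?_
    · have := Bar.merge_mem hv hw
      rwa [show i + n = i + 1 + n - 1 by ring] at this
    · have := Bar.cons_mem (Cx.dif_mem i v hv) hw
      rwa [show i - 1 + 1 + n = i + 1 + n - 1 by ring] at this
    · have := Bar.cons_mem hv h
      rw [show i + 1 + (n - 1) = i + 1 + n - 1 by ring] at this
      simpa using Submodule.smul_mem _ _ this
  · intro n x y hx hy
    rw [map_add]; exact add_mem hx hy
  · intro n c x hx
    rw [map_smul]; exact Submodule.smul_mem _ _ hx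

instance : Cx k (Bar k V) where
  dif := Bar.dif
  dif_mem _ _ hw := Bar.dif_mem hw
  dif_dif := Bar.dif_dif

theorem Bar.del_def : del k (Bar k V) = Bar.dif := rfl

theorem Bar.comul_merge (v : V) (w : Bar k V) : Bar.comul (Bar.merge v w) =
    Bar.nil ⊗ₜ Bar.merge v w + (Bar.merge v).rTensor (Bar k V) (Bar.comul w) := by
  have : Bar.comul ∘ₗ (Bar.merge v : Bar k V →ₗ[k] _) = TensorProduct.mk k (Bar k V) (Bar k V) Bar.nil ∘ₗ
      (Bar.merge v : Bar k V →ₗ[k] _) +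
      (Bar.merge v : Bar k V →ₗ[k] Bar k V).rTensor (Bar k V) ∘ₗ Bar.comul := by
    refine Bar.ext' (by simp [Bar.comul_nil]) fun x w _ => ?_
    have h : (Bar.merge v : Bar k V →ₗ[k] Bar k V).rTensor (Bar k V) ∘ₗ (Bar.cons x).rTensor (Bar k V) =
        (Bar.cons (NDGA.mul (k := k) (sgn k V v) x)).rTensor (Bar k V) := by
      ext; simp
    have h' := fun t => LinearMap.congr_fun h t
    simp only [LinearMap.comp_apply] at h'
    simp [Bar.comul_cons, h']
  exact LinearMap.congr_fun this w

theorem km_del_id_tmul {V W : Type*} [AddCommGroup V] [Module k V] [Cx k V] [AddCommGroup W]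
    [Module k W] [Cx k W] (u : V) (u' : W) :
    km (del k V) LinearMap.id (u ⊗ₜ[k] u') = del k V u ⊗ₜ[k] u' := by
  rw [km_even _ _ (by simp)]; simp

theorem tmul_mem_tensorPart {V W : Type*} [AddCommGroup V] [Module k V] [GrMod k V]
    [AddCommGroup W] [Module k W] [GrMod k W] {i j n : ℤ} {v : V} {w : W} (hv : v ∈ gr k V i)
    (hw : w ∈ gr k W j) (h : i + j = n) : v ⊗ₜ w ∈ tensorPart k V W n :=
  Submodule.subset_span ⟨i, j, h, v, hv, w, hw, rfl⟩

instance : DGCoalg k (Bar k V) where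
  comul_mem n w hw := by
    rw [Bar.comul_def]
    refine Bar.induction_gr (p := fun n w => Bar.comul w ∈ tensorPart k (Bar k V) (Bar k V) n)
      ?_ ?_ (by simp) ?_ ?_ hw
    · rw [Bar.comul_nil]
      exact tmul_mem_tensorPart Bar.nil_mem Bar.nil_mem (by simp)
    · intro i v hv n w hw h
      rw [Bar.comul_cons]
      refine add_mem (tmul_mem_tensorPart Bar.nil_mem (Bar.cons_mem hv hw) (by simp)) ?_
      refine tensorPart_induction (p := fun t => (Bar.cons v).rTensor (Bar k V) t ∈
        tensorPart k (Bar k V) (Bar k V) (i + 1 + n)) ?_ (by simp) ?_ ?_ h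
      · intro a b hab x hx y hy
        rw [LinearMap.rTensor_tmul]
        exact tmul_mem_tensorPart (Bar.cons_mem hv hx) hy (by omega)
      · intro s t hs ht
        rw [map_add]; exact add_mem hs ht
      · intro c t ht
        rw [map_smul]; exact Submodule.smul_mem _ _ ht
    · intro n x y hx hy
      rw [map_add]; exact add_mem hx hy
    · intro n c x hx
      rw [map_smul]; exact Submodule.smul_mem _ _ hx
  counit_eq_zero n hn w hw := by
    rw [Bar.counit_def]
    refine Bar.induction_gr (p := fun n w => n ≠ 0 → Bar.counit w = 0)
      (by simp) ?_ (by simp) ?_ ?_ hw hn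
    · intro i v _ n w _ _ _
      exact Bar.counit_cons v w
    · intro n x y hx hy h
      rw [map_add, hx h, hy h, add_zero]
    · intro n c x hx h
      rw [map_smul, hx h, smul_zero]
  comul_dif := by
    show Bar.comul ∘ₗ Bar.dif = (km (del k (Bar k V)) LinearMap.id +
      km LinearMap.id (del k (Bar k V))) ∘ₗ Bar.comul
    refine Bar.ext' ?_ fun v w hw => ?_
    · simp only [LinearMap.comp_apply, Bar.comul_nil, Bar.dif_nil, LinearMap.add_apply,
        km_del_id_tmul, km_id_del_tmul, map_zero]
      simp [Bar.del_def, Bar.dif_nil]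
    · simp only [LinearMap.comp_apply] at hw ⊢
      have key : ∀ t : Bar k V ⊗[k] Bar k V,
          (km (del k (Bar k V)) LinearMap.id + km LinearMap.id (del k (Bar k V)) :
            Bar k V ⊗[k] Bar k V →ₗ[k] _) ((Bar.cons v).rTensor _ t) =
          (Bar.merge v).rTensor _ t - (Bar.cons (del k V v)).rTensor _ t -
            (Bar.cons (sgn k V v)).rTensor _ ((km (del k (Bar k V)) LinearMap.id +
              km LinearMap.id (del k (Bar k V)) : Bar k V ⊗[k] Bar k V →ₗ[k] _) t) := by
        intro t
        induction t with
        | zero => simp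
        | add s t hs ht =>
          simp only [map_add, hs, ht]; abel
        | tmul x y =>
          simp only [LinearMap.add_apply, LinearMap.rTensor_tmul, km_del_id_tmul, km_id_del_tmul, map_add]
          simp only [Bar.del_def, Bar.dif_cons, Bar.sgn_cons, TensorProduct.sub_tmul,
            TensorProduct.neg_tmul]
          abel
      have h1 : (km (del k (Bar k V)) LinearMap.id + km LinearMap.id (del k (Bar k V)) :
            Bar k V ⊗[k] Bar k V →ₗ[k] _) (Bar.nil ⊗ₜ Bar.cons v w) =
          Bar.nil ⊗ₜ Bar.dif (Bar.cons v w) := by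
        simp only [LinearMap.add_apply, km_del_id_tmul, km_id_del_tmul, Bar.sgn_nil]
        simp [Bar.del_def, Bar.dif_nil]
      rw [Bar.comul_cons v w, map_add, key, h1, ← hw, Bar.dif_cons]
      simp only [map_sub, Bar.comul_cons, Bar.comul_merge, TensorProduct.tmul_sub]
      abel
  counit_dif w := by
    rw [Bar.counit_def]
    have hm : ∀ v, Bar.counit ∘ₗ Bar.merge v = (0 : Bar k V →ₗ[k] k) := by
      intro v
      exact Bar.ext' (by simp) fun x w _ => by simp [Bar.counit_cons]
    have : Bar.counit ∘ₗ Bar.dif = (0 : Bar k V →ₗ[k] k) := by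
      refine Bar.ext' (by simp [Bar.dif_nil]) fun v w _ => ?_
      have := LinearMap.congr_fun (hm v) w
      simp only [LinearMap.comp_apply] at this
      simp [Bar.dif_cons, Bar.counit_cons, this]
    exact LinearMap.congr_fun this w

end Differential

end Bar

section Cobar

variable (k : Type*) [Field k] (C : Type*) [AddCommGroup C] [Module k C]

/-- The underlying algebra of the cobar construction: the tensor algebra on the desuspension
of `C`. The product `c₁ ⋯ cₙ` has degree `|c₁| + ⋯ + |cₙ| - n`. -/
def Cobar : Type _ := Words k C

instance : Ring (Cobar k C) := inferInstanceAs (Ring (Words k C))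

instance : Algebra k (Cobar k C) := inferInstanceAs (Algebra k (Words k C))

variable {k C}

/-- The inclusion of the generators. -/
def Cobar.ι : C →ₗ[k] Cobar k C := TensorAlgebra.ι k

theorem Cobar.ext' {X : Type*} [AddCommGroup X] [Module k X] {f g : Cobar k C →ₗ[k] X}
    (h1 : f 1 = g 1) (hc : ∀ c w, f w = g w → f (Cobar.ι c * w) = g (Cobar.ι c * w)) : f = g :=
  words_ext (f := f) (g := g) h1 hc

/-- The universal property of the underlying algebra. -/
def Cobar.lift {A : Type*} [Ring A] [Algebra k A] (f : C →ₗ[k] A) : Cobar k C →ₐ[k] A :=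
  TensorAlgebra.lift k f

@[simp] theorem Cobar.lift_ι {A : Type*} [Ring A] [Algebra k A] (f : C →ₗ[k] A) (c : C) :
    Cobar.lift f (Cobar.ι c) = f c := TensorAlgebra.lift_ι_apply f c

/-- The linear map with value `x` at `1` and `f (c w) = a c w + b c (f w)`. -/
def Cobar.rec' {X : Type*} [AddCommGroup X] [Module k X] (x : X) (a : C →ₗ[k] Cobar k C →ₗ[k] X)
    (b : C →ₗ[k] X →ₗ[k] X) : Cobar k C →ₗ[k] X := wordsRec (k := k) (V := C) x a b

@[simp] theorem Cobar.rec'_one {X : Type*} [AddCommGroup X] [Module k X] (x : X)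
    (a : C →ₗ[k] Cobar k C →ₗ[k] X) (b : C →ₗ[k] X →ₗ[k] X) :
    Cobar.rec' x a b 1 = x := wordsRec_one x a b

@[simp] theorem Cobar.rec'_cons {X : Type*} [AddCommGroup X] [Module k X] (x : X)
    (a : C →ₗ[k] Cobar k C →ₗ[k] X) (b : C →ₗ[k] X →ₗ[k] X) (c : C) (w : Cobar k C) :
    Cobar.rec' x a b (Cobar.ι c * w) = a c w + b c (Cobar.rec' x a b w) := wordsRec_cons x a b c w

section Graded

variable [GrMod k C]

instance : GrMod k (Cobar k C) where
  part := wordsPart (k := k) (V := C) (-1)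
  internal := (wordsGrMod (k := k) (V := C) (-1)).internal

theorem Cobar.one_mem : (1 : Cobar k C) ∈ gr k (Cobar k C) 0 := one_mem_wordsPart (-1)

theorem Cobar.mul_mem {m n : ℤ} {v w : Cobar k C} (hv : v ∈ gr k (Cobar k C) m)
    (hw : w ∈ gr k (Cobar k C) n) : v * w ∈ gr k (Cobar k C) (m + n) := words_mul_mem hv hw

theorem Cobar.ι_mem {i : ℤ} {c : C} (hc : c ∈ gr k C i) :
    Cobar.ι c ∈ gr k (Cobar k C) (i - 1) := by
  have := wcons_mem (s := -1) hc (one_mem_wordsPart (k := k) (V := C) (-1))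
  rw [wcons_apply, mul_one, add_zero] at this
  exact this

theorem Cobar.induction_gr {p : ℤ → Cobar k C → Prop} (one : p 0 1)
    (cons : ∀ i, ∀ c ∈ gr k C i, ∀ n, ∀ w ∈ gr k (Cobar k C) n, p n w →
      p (i - 1 + n) (Cobar.ι c * w))
    (zero : ∀ n, p n 0) (add : ∀ n v w, p n v → p n w → p n (v + w))
    (smul : ∀ n (c : k) w, p n w → p n (c • w)) {n : ℤ} {w : Cobar k C}
    (hw : w ∈ gr k (Cobar k C) n) : p n w :=
  wordsPart_induction (p := p) one cons zero add smul hw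

theorem Cobar.sgn_one : sgn k (Cobar k C) 1 = 1 := by
  rw [sgn_of_mem Cobar.one_mem]; simp

theorem Cobar.sgn_mul (x y : Cobar k C) :
    sgn k (Cobar k C) (x * y) = sgn k (Cobar k C) x * sgn k (Cobar k C) y := by
  refine gr_induction k (p := fun x => sgn k (Cobar k C) (x * y) =
    sgn k (Cobar k C) x * sgn k (Cobar k C) y) ?_ (by simp) ?_ x
  · intro m v hv
    refine gr_induction k (p := fun y => sgn k (Cobar k C) (v * y) =
      sgn k (Cobar k C) v * sgn k (Cobar k C) y) ?_ (by simp) ?_ y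
    · intro n w hw
      rw [sgn_of_mem hv, sgn_of_mem hw, sgn_of_mem (Cobar.mul_mem hv hw), koszul_add]
      simp [smul_smul, mul_comm]
    · intro v w hv hw
      simp only [map_add, mul_add, hv, hw]
  · intro v w hv hw
    simp only [map_add, add_mul, hv, hw]

theorem Cobar.sgn_ι (c : C) : sgn k (Cobar k C) (Cobar.ι c) = - Cobar.ι (sgn k C c) := by
  refine gr_induction k (p := fun c => sgn k (Cobar k C) (Cobar.ι c) =
    - Cobar.ι (sgn k C c)) ?_ (by simp) ?_ c
  · intro i c hc
    rw [sgn_of_mem (Cobar.ι_mem hc), sgn_of_mem hc, koszul_sub]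
    simp
  · intro x y hx hy
    simp only [map_add, hx, hy]; abel

end Graded

section Differential

variable [Coalgebra k C] [DGCoalg k C]

/-- The product of two generators. -/
def Cobar.ιι : C ⊗[k] C →ₗ[k] Cobar k C :=
  LinearMap.mul' k (Cobar k C) ∘ₗ TensorProduct.map Cobar.ι Cobar.ι

/-- The differential on generators, `c ↦ -(d c) - ∑ (-1) ^ |c₁| c₁ c₂`. -/
def Cobar.difι : C →ₗ[k] Cobar k C :=
  -(Cobar.ι ∘ₗ del k C) - Cobar.ιι ∘ₗ (sgn k C).rTensor C ∘ₗ Coalgebra.comul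

/-- The differential of the cobar construction: the derivation that extends `Cobar.difι`. -/
def Cobar.dif : Cobar k C →ₗ[k] Cobar k C :=
  Cobar.rec' 0 (LinearMap.mul k (Cobar k C) ∘ₗ Cobar.difι)
    (-(LinearMap.mul k (Cobar k C) ∘ₗ Cobar.ι ∘ₗ sgn k C))

theorem Cobar.dif_one : Cobar.dif (1 : Cobar k C) = 0 := by simp [Cobar.dif]

theorem Cobar.dif_cons (c : C) (w : Cobar k C) : Cobar.dif (Cobar.ι c * w) =
    Cobar.difι c * w - Cobar.ι (sgn k C c) * Cobar.dif w := by
  simp [Cobar.dif]; abel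

theorem Cobar.dif_ι (c : C) : Cobar.dif (Cobar.ι c : Cobar k C) = Cobar.difι c := by
  have := Cobar.dif_cons c (1 : Cobar k C)
  simpa [Cobar.dif_one] using this

theorem Cobar.dif_mul (x y : Cobar k C) : Cobar.dif (x * y) =
    Cobar.dif x * y + sgn k (Cobar k C) x * Cobar.dif y := by
  have : (Cobar.dif : Cobar k C →ₗ[k] Cobar k C) ∘ₗ LinearMap.mulRight k y =
      LinearMap.mulRight k y ∘ₗ (Cobar.dif : Cobar k C →ₗ[k] Cobar k C) +
        LinearMap.mulRight k (Cobar.dif y) ∘ₗ sgn k (Cobar k C) := by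
    refine Cobar.ext' ?_ fun c w hw => ?_
    · simp [Cobar.dif_one, Cobar.sgn_one]
    · simp only [LinearMap.comp_apply, LinearMap.add_apply, LinearMap.mulRight_apply] at hw ⊢
      rw [mul_assoc, Cobar.dif_cons, hw, Cobar.dif_cons, Cobar.sgn_mul, Cobar.sgn_ι]
      noncomm_ring
  exact LinearMap.congr_fun this x

theorem Cobar.difι_sgn (c : C) :
    sgn k (Cobar k C) (Cobar.difι c) = Cobar.difι (sgn k C c) := by
  have h : ∀ t : C ⊗[k] C, sgn k (Cobar k C) (Cobar.ιι ((sgn k C).rTensor C t)) =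
      Cobar.ιι ((sgn k C).rTensor C (TensorProduct.map (sgn k C) (sgn k C) t)) := by
    intro t
    induction t with
    | zero => simp
    | add s t hs ht => simp only [map_add, hs, ht]
    | tmul x y => simp [Cobar.ιι, Cobar.sgn_mul, Cobar.sgn_ι]
  simp only [Cobar.difι, LinearMap.sub_apply, LinearMap.neg_apply, LinearMap.comp_apply, map_sub,
    map_neg, h, ← comul_sgn, Cobar.sgn_ι, sgn_del, neg_neg]

theorem Cobar.dif_difι (c : C) : Cobar.dif (Cobar.difι c : Cobar k C) = 0 := by
  let m3 : C ⊗[k] (C ⊗[k] C) →ₗ[k] Cobar k C :=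
    LinearMap.mul' k (Cobar k C) ∘ₗ TensorProduct.map Cobar.ι Cobar.ιι ∘ₗ
      ((sgn k C).rTensor C).lTensor C
  have hσ : ∀ x : C, Cobar.difι (sgn k C x) =
      Cobar.ι (sgn k C (del k C x)) - Cobar.ιι ((sgn k C).lTensor C (Coalgebra.comul (R := k) x)) := by
    intro x
    simp only [Cobar.difι, LinearMap.sub_apply, LinearMap.neg_apply, LinearMap.comp_apply,
      comul_sgn, sgn_del, map_neg]
    congr 2
    generalize Coalgebra.comul (R := k) x = t
    induction t with
    | zero => simp
    | add s t hs ht => simp only [map_add, hs, ht]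
    | tmul x y => simp
  have h1 : ∀ t : C ⊗[k] C, Cobar.dif (Cobar.ιι ((sgn k C).rTensor C t)) =
      Cobar.ιι ((sgn k C).rTensor C ((km (del k C) LinearMap.id +
        km LinearMap.id (del k C) : C ⊗[k] C →ₗ[k] C ⊗[k] C) t))
      - m3 (TensorProduct.assoc k C C C ((Coalgebra.comul (R := k)).rTensor C t))
      + m3 ((Coalgebra.comul (R := k)).lTensor C t) := by
    intro t
    induction t with
    | zero => simp
    | add s t hs ht => simp only [map_add, hs, ht]; abel
    | tmul x y =>
      have e1 : m3 (TensorProduct.assoc k C C C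
          ((Coalgebra.comul (R := k)).rTensor C (x ⊗ₜ y))) =
          Cobar.ιι ((sgn k C).lTensor C (Coalgebra.comul (R := k) x)) * Cobar.ι y := by
        rw [LinearMap.rTensor_tmul]
        generalize Coalgebra.comul (R := k) x = u
        induction u with
        | zero => simp
        | add s t hs ht => simp only [map_add, TensorProduct.add_tmul, hs, ht, add_mul]
        | tmul a b => simp [m3, Cobar.ιι, mul_assoc]
      have e2 : m3 ((Coalgebra.comul (R := k)).lTensor C (x ⊗ₜ y)) =
          Cobar.ι x * Cobar.ιι ((sgn k C).rTensor C (Coalgebra.comul (R := k) y)) := by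
        rw [LinearMap.lTensor_tmul]
        simp [m3]
      rw [e1, e2]
      simp only [LinearMap.add_apply, km_del_id_tmul, km_id_del_tmul, map_add,
        LinearMap.rTensor_tmul, sgn_sgn]
      have e3 : ∀ a b : C, Cobar.ιι (a ⊗ₜ[k] b) = Cobar.ι a * Cobar.ι b := fun a b => by
        simp [Cobar.ιι]
      rw [e3, e3, e3, Cobar.dif_cons, Cobar.dif_ι, hσ, sgn_sgn]
      simp only [Cobar.difι, LinearMap.sub_apply, LinearMap.neg_apply, LinearMap.comp_apply]
      noncomm_ring
  have h2 := LinearMap.congr_fun (DGCoalg.comul_dif (k := k) (C := C)) c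
  simp only [LinearMap.comp_apply] at h2
  have h3 : del k C (del k C c) = 0 := Cx.dif_dif c
  have h4 : Cobar.dif (Cobar.difι c) = -Cobar.difι (del k C c) -
      Cobar.dif (Cobar.ιι ((sgn k C).rTensor C (Coalgebra.comul (R := k) c))) := by
    rw [← Cobar.dif_ι (del k C c), ← map_neg, ← map_sub]
    rfl
  rw [h4, h1, Coalgebra.coassoc_apply, ← h2]
  simp only [Cobar.difι, LinearMap.sub_apply, LinearMap.neg_apply, LinearMap.comp_apply, h3,
    map_zero]
  abel

theorem Cobar.dif_dif (w : Cobar k C) : Cobar.dif (Cobar.dif w) = 0 := by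
  have : Cobar.dif ∘ₗ Cobar.dif = (0 : Cobar k C →ₗ[k] _) := by
    refine Cobar.ext' (by simp [Cobar.dif_one]) fun c w hw => ?_
    simp only [LinearMap.comp_apply, LinearMap.zero_apply] at hw ⊢
    rw [Cobar.dif_cons, map_sub, Cobar.dif_mul, Cobar.dif_mul, Cobar.dif_difι, Cobar.difι_sgn, hw,
      Cobar.dif_ι, Cobar.sgn_ι, sgn_sgn]
    simp
  exact LinearMap.congr_fun this w

theorem Cobar.difι_mem {i : ℤ} {c : C} (hc : c ∈ gr k C i) :
    Cobar.difι c ∈ gr k (Cobar k C) (i - 2) := by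
  refine sub_mem (neg_mem ?_) ?_
  · have := Cobar.ι_mem (Cx.dif_mem i c hc)
    rwa [show i - 1 - 1 = i - 2 by ring] at this
  · refine tensorPart_induction (p := fun t => Cobar.ιι ((sgn k C).rTensor C t) ∈
      gr k (Cobar k C) (i - 2)) ?_ (by simp) ?_ ?_ (DGCoalg.comul_mem i c hc)
    · intro a b hab x hx y hy
      rw [LinearMap.rTensor_tmul, sgn_of_mem hx, ← TensorProduct.smul_tmul', map_smul]
      refine Submodule.smul_mem _ _ ?_
      have := Cobar.mul_mem (Cobar.ι_mem hx) (Cobar.ι_mem hy)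
      rw [show a - 1 + (b - 1) = i - 2 by omega] at this
      simpa [Cobar.ιι] using this
    · intro s t hs ht
      rw [map_add, map_add]; exact add_mem hs ht
    · intro r t ht
      rw [map_smul, map_smul]; exact Submodule.smul_mem _ _ ht

theorem Cobar.dif_mem {n : ℤ} {w : Cobar k C} (hw : w ∈ gr k (Cobar k C) n) :
    Cobar.dif w ∈ gr k (Cobar k C) (n - 1) := by
  refine Cobar.induction_gr (p := fun n w => Cobar.dif w ∈ gr k (Cobar k C) (n - 1))
    (by simp [Cobar.dif_one]) ?_ (by simp) ?_ ?_ hw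
  · intro i c hc n w hw h
    rw [Cobar.dif_cons, sgn_of_mem hc]
    refine sub_mem ?_ ?_
    · have := Cobar.mul_mem (Cobar.difι_mem hc) hw
      rwa [show i - 2 + n = i - 1 + n - 1 by ring] at this
    · rw [map_smul, smul_mul_assoc]
      refine Submodule.smul_mem _ _ ?_
      have := Cobar.mul_mem (Cobar.ι_mem hc) h
      rwa [show i - 1 + (n - 1) = i - 1 + n - 1 by ring] at this
  · intro n x y hx hy
    rw [map_add]; exact add_mem hx hy
  · intro n c x hx
    rw [map_smul]; exact Submodule.smul_mem _ _ hx

instance : Cx k (Cobar k C) where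
  dif := Cobar.dif
  dif_mem _ _ hw := Cobar.dif_mem hw
  dif_dif := Cobar.dif_dif

instance : DGA k (Cobar k C) where
  one_mem := Cobar.one_mem
  mul_mem _ _ _ hx _ hy := Cobar.mul_mem hx hy
  leibniz m x hx y := by
    rw [← smul_mul_assoc, ← sgn_of_mem hx]
    exact Cobar.dif_mul x y

end Differential

end Cobar

section TwistingCochains

variable {k : Type*} [Field k] {C : Type*} [AddCommGroup C] [Module k C] [Coalgebra k C]
  [DGCoalg k C] {A : Type*} [Ring A] [Algebra k A] [DGA k A]

theorem mem_convTot {n : ℤ} {f : C →ₗ[k] A} (hf : f ∈ homGr k C A n) :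
    f ∈ (⨆ n, homGr k C A n : Submodule k (C →ₗ[k] A)) := Submodule.mem_iSup_of_mem n hf

/-- A twisting cochain: a linear map of degree `-1` with `d t + t d + t * t = 0`. -/
def MC.ofLinear (f : C →ₗ[k] A) (hf : f ∈ homGr k C A (-1))
    (h : ∀ x, del k A (f x) + f (del k C x) + conv f f x = 0) : MC k (ConvDG k C A) where
  val := ConvDG.mk f (mem_convTot hf)
  mem := hf
  eq := by
    apply ConvDG.val_injective
    refine LinearMap.ext fun x => ?_
    have := h x
    show homDel f x + conv f f x = 0
    rw [homDel_apply, hat_of_mem hf]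
    simpa using this

theorem MC.val_apply (t : MC k (ConvDG k C A)) (x : C) :
    del k A (t.val.val x) + t.val.val (del k C x) + conv t.val.val t.val.val x = 0 := by
  have h := LinearMap.congr_fun (congrArg ConvDG.val t.eq) x
  have h' : homDel t.val.val x + conv t.val.val t.val.val x = 0 := h
  rw [homDel_apply, hat_of_mem t.mem] at h'
  simpa using h'

theorem conv_apply_of_mem {n : ℤ} {f g : C →ₗ[k] A} (hg : g ∈ homGr k C A n) (hn : ¬ Even n)
    (x : C) : conv f g x = LinearMap.mul' k A (TensorProduct.map f g
      ((sgn k C).rTensor C (Coalgebra.comul (R := k) x))) := by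
  have : km f g = TensorProduct.map f g ∘ₗ (sgn k C).rTensor C := by
    refine gr_ext₂ fun i j v hv w hw => ?_
    rw [km_tmul hv, tw_of_mem hg]
    have : koszul k (i * n) = koszul k i := by simp [koszul, Int.even_mul, hn]
    simp [this, sgn_of_mem hv, TensorProduct.smul_tmul]
  rw [conv, this]
  rfl

theorem Cobar.ι_mem_homGr : (Cobar.ι : C →ₗ[k] Cobar k C) ∈ homGr k C (Cobar k C) (-1) := by
  intro i c hc
  rw [← sub_eq_add_neg]
  exact Cobar.ι_mem hc

theorem Cobar.univ_eq (x : C) : del k (Cobar k C) (Cobar.ι x) + Cobar.ι (del k C x) +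
    conv (Cobar.ι : C →ₗ[k] Cobar k C) Cobar.ι x = 0 := by
  have h1 : del k (Cobar k C) (Cobar.ι x) = Cobar.difι x := Cobar.dif_ι x
  have h2 : conv (Cobar.ι : C →ₗ[k] Cobar k C) Cobar.ι x =
      Cobar.ιι ((sgn k C).rTensor C (Coalgebra.comul (R := k) x)) := by
    have h3 := @conv_apply_of_mem k _ C _ _ _ _ (Cobar k C) _ _ _ (-1) Cobar.ι Cobar.ι
      Cobar.ι_mem_homGr (by decide) x
    rw [Cobar.ιι, LinearMap.comp_apply, h3]
  rw [h1, h2]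
  simp only [Cobar.difι, LinearMap.sub_apply, LinearMap.neg_apply, LinearMap.comp_apply]
  abel

variable (k C) in
/-- The universal twisting cochain `c ↦ c`. -/
def Cobar.univ : MC k (ConvDG k C (Cobar k C)) :=
  MC.ofLinear Cobar.ι Cobar.ι_mem_homGr Cobar.univ_eq

/-- The homomorphism from the cobar construction that corresponds to a twisting cochain. -/
def Cobar.liftDG (t : MC k (ConvDG k C A)) : DGHom k (Cobar k C) A where
  toAlgHom := Cobar.lift t.val.val
  map_mem n w hw := by
    show Cobar.lift t.val.val w ∈ gr k A n
    refine Cobar.induction_gr (p := fun n w => Cobar.lift t.val.val w ∈ gr k A n)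
      ?_ ?_ (by simp) ?_ ?_ hw
    · rw [map_one]; exact DGA.one_mem
    · intro i c hc n w _ h
      rw [map_mul, Cobar.lift_ι]
      exact DGA.mul_mem _ _ _ (t.mem i c hc) _ h
    · intro n x y hx hy
      rw [map_add]; exact add_mem hx hy
    · intro n c x hx
      rw [map_smul]; exact Submodule.smul_mem _ _ hx
  map_del w := by
    show Cobar.lift t.val.val (Cobar.dif w) = del k A (Cobar.lift t.val.val w)
    have hs : ∀ c, sgn k A (t.val.val c) = - t.val.val (sgn k C c) := by
      intro c
      have h := LinearMap.congr_fun (hat_of_mem t.mem) (sgn k C c)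
      simpa [hat] using h
    have hι : ∀ c, Cobar.lift t.val.val (Cobar.difι c) = del k A (t.val.val c) := by
      intro c
      have h := t.val_apply c
      rw [conv_apply_of_mem t.mem (by decide)] at h
      have h1 : ∀ s : C ⊗[k] C, Cobar.lift t.val.val (Cobar.ιι s) =
          LinearMap.mul' k A (TensorProduct.map t.val.val t.val.val s) := by
        intro s
        induction s with
        | zero => simp
        | add s t hs ht => simp only [map_add, hs, ht]
        | tmul x y => simp [Cobar.ιι]
      simp only [Cobar.difι, LinearMap.sub_apply, LinearMap.neg_apply, LinearMap.comp_apply,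
        map_sub, map_neg, Cobar.lift_ι, h1]
      rw [add_assoc] at h
      rw [eq_neg_of_add_eq_zero_left h]
      abel
    have : (Cobar.lift t.val.val).toLinearMap ∘ₗ Cobar.dif =
        del k A ∘ₗ (Cobar.lift t.val.val).toLinearMap := by
      refine Cobar.ext' (by simp [Cobar.dif_one]) fun c w hw => ?_
      simp only [LinearMap.comp_apply, AlgHom.toLinearMap_apply] at hw ⊢
      rw [Cobar.dif_cons, map_sub, map_mul, map_mul, map_mul, hw, hι, Cobar.lift_ι, Cobar.lift_ι,
        DGA.leibniz', hs]
      noncomm_ring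
    exact LinearMap.congr_fun this w

end TwistingCochains

section Ground

variable (k : Type*) [Field k]

/-- The ground field is a differential graded algebra concentrated in degree `0`. -/
instance groundDGA : DGA k k where
  part n := if n = 0 then ⊤ else ⊥
  internal := by
    refine isInternal_of_separating (T := Unit) (W := k) _
      (fun n _ => if n = 0 then LinearMap.id else 0) ?_ ?_ ?_
    · intro m n hmn v hv _
      by_cases h : n = 0
      · have h' : m ≠ 0 := by omega
        simp only [h', if_false, Submodule.mem_bot] at hv
        simp [hv]
      · simp [h]
    · intro n v hv h
      by_cases hn : n = 0
      · simpa [hn] using h ()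
      · simpa [hn] using hv
    · exact eq_top_iff.2 (le_iSup_of_le (0 : ℤ) (by simp))
  dif := 0
  dif_mem _ _ _ := Submodule.zero_mem _
  dif_dif _ := rfl
  one_mem := by simp
  mul_mem m n x hx y hy := by
    by_cases hm : m = 0 <;> by_cases hn : n = 0 <;> simp_all
  leibniz _ _ _ _ := by simp

theorem ground_mem {n : ℤ} (hn : n ≠ 0) {x : k} : x ∈ gr k k n ↔ x = 0 := by
  show x ∈ (if n = 0 then ⊤ else ⊥ : Submodule k k) ↔ _
  simp [hn]

end Ground

section Augmented

variable {k : Type*} [Field k] {R : Type*} [Ring R] [Algebra k R] [DGA k R]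

/-- A differential graded algebra, without its unit. -/
instance DGA.toNDGA : NDGA k R where
  toCx := inferInstance
  mul := LinearMap.mul k R
  mul_mem m n x hx y hy := DGA.mul_mem m n x hx y hy
  mul_assoc x y z := by simp [mul_assoc]
  leibniz m x hx y := DGA.leibniz m x hx y

/-- The augmentation ideal. An augmentation is a homomorphism of differential graded algebras
to the ground field. -/
def augIdeal (ε : DGHom k R k) : Submodule k R := LinearMap.ker ε.toAlgHom.toLinearMap

variable (ε : DGHom k R k)

/-- The augmentation ideal as a vector space. -/
abbrev AugIdeal : Type _ := augIdeal ε

theorem mem_augIdeal {x : R} : x ∈ augIdeal ε ↔ ε.toAlgHom x = 0 := Iff.rfl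

instance : GrMod k (AugIdeal ε) where
  part n := (gr k R n).comap (augIdeal ε).subtype
  internal := by
    refine isInternal_of_separating (T := Unit) (W := R) _
      (fun n _ => wt k R (Pi.single n 1) ∘ₗ (augIdeal ε).subtype) ?_ ?_ ?_
    · intro m n hmn v hv _
      rw [LinearMap.comp_apply, wt_of_mem _ hv, Pi.single_eq_of_ne hmn, zero_smul]
    · intro n v hv h
      have h1 := h ()
      rw [LinearMap.comp_apply, wt_of_mem _ hv, Pi.single_eq_same, one_smul] at h1
      exact Subtype.ext h1
    · have key : ∀ v : R, v - algebraMap k R (ε.toAlgHom v) ∈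
          (⨆ n, (gr k R n).comap (augIdeal ε).subtype).map (augIdeal ε).subtype := by
        refine gr_induction k ?_ (by simp) ?_
        · intro n v hv
          have hm : v - algebraMap k R (ε.toAlgHom v) ∈ augIdeal ε := by
            rw [mem_augIdeal, map_sub, AlgHom.commutes]
            exact sub_self _
          refine ⟨⟨_, hm⟩, Submodule.mem_iSup_of_mem n ?_, rfl⟩
          show v - algebraMap k R (ε.toAlgHom v) ∈ gr k R n
          refine sub_mem hv ?_
          by_cases hn : n = 0
          · subst hn
            rw [Algebra.algebraMap_eq_smul_one]
            exact Submodule.smul_mem _ _ DGA.one_mem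
          · have h0 : ε.toAlgHom v = 0 := (ground_mem k hn).1 (ε.map_mem n v hv)
            rw [h0, map_zero]
            exact zero_mem _
        · intro v w hv hw
          rw [map_add, map_add, add_sub_add_comm]
          exact add_mem hv hw
      rw [eq_top_iff]
      intro v _
      have h0 : ε.toAlgHom v.1 = 0 := v.2
      obtain ⟨u, hu, huv⟩ := key v.1
      rw [h0, map_zero, sub_zero] at huv
      rwa [← Subtype.ext huv]

instance : NDGA k (AugIdeal ε) where
  dif := (del k R).restrict (p := augIdeal ε) (q := augIdeal ε) fun x _ => by
    have h : ε.toAlgHom (del k R x) = del k k (ε.toAlgHom x) := ε.map_del x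
    rw [mem_augIdeal, h]
    rfl
  dif_mem n v hv := Cx.dif_mem n v.1 hv
  dif_dif v := Subtype.ext (Cx.dif_dif v.1)
  mul := LinearMap.mk₂ k (fun x y => ⟨x.1 * y.1, by
      have h : ε.toAlgHom x.1 = 0 := x.2
      rw [mem_augIdeal, map_mul, h, zero_mul]⟩)
    (fun x y z => Subtype.ext (add_mul x.1 y.1 z.1))
    (fun c x y => Subtype.ext (smul_mul_assoc c x.1 y.1))
    (fun x y z => Subtype.ext (mul_add x.1 y.1 z.1))
    (fun c x y => Subtype.ext (mul_smul_comm c x.1 y.1))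
  mul_mem m n x hx y hy := DGA.mul_mem m n x.1 hx y.1 hy
  mul_assoc x y z := Subtype.ext (_root_.mul_assoc x.1 y.1 z.1)
  leibniz m x hx y := Subtype.ext (DGA.leibniz m x.1 hx y.1)

end Augmented

section NDGHoms

variable (k : Type*) [Field k]

/-- Homomorphisms of differential graded algebras without unit. -/
structure NDGHom (V W : Type*) [AddCommGroup V] [Module k V] [NDGA k V] [AddCommGroup W]
    [Module k W] [NDGA k W] extends V →ₗ[k] W where
  map_mem : ∀ n, ∀ v ∈ gr k V n, toFun v ∈ gr k W n
  map_del : ∀ v, toFun (del k V v) = del k W (toFun v)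
  map_mul : ∀ v w, toFun (NDGA.mul (k := k) v w) = NDGA.mul (k := k) (toFun v) (toFun w)

variable {k}

/-- The identity of a differential graded algebra. -/
def NDGHom.id (R : Type*) [Ring R] [Algebra k R] [DGA k R] : NDGHom k R R where
  toLinearMap := LinearMap.id
  map_mem _ _ h := h
  map_del _ := rfl
  map_mul _ _ := rfl

/-- The inclusion of the augmentation ideal. -/
def augIncl {R : Type*} [Ring R] [Algebra k R] [DGA k R] (ε : DGHom k R k) :
    NDGHom k (AugIdeal ε) R where
  toLinearMap := (augIdeal ε).subtype
  map_mem _ _ h := h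
  map_del _ := rfl
  map_mul _ _ := rfl

/-- Homomorphisms of differential graded coalgebras. -/
structure DGCoalgHom (k : Type*) [Field k] (C D : Type*) [AddCommGroup C] [Module k C]
    [Coalgebra k C] [DGCoalg k C] [AddCommGroup D] [Module k D] [Coalgebra k D] [DGCoalg k D]
    extends C →ₗc[k] D where
  map_mem : ∀ n, ∀ x ∈ gr k C n, toFun x ∈ gr k D n
  map_del : ∀ x, toFun (del k C x) = del k D (toFun x)

variable {V W : Type*} [AddCommGroup V] [Module k V] [NDGA k V] [AddCommGroup W]
    [Module k W] [NDGA k W] (j : NDGHom k V W)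

theorem NDGHom.map_sgn (v : V) : j.toLinearMap (sgn k V v) = sgn k W (j.toLinearMap v) := by
  refine gr_induction k
    (p := fun v => j.toLinearMap (sgn k V v) = sgn k W (j.toLinearMap v)) ?_ (by simp) ?_ v
  · intro n v hv
    have h : sgn k W (j.toLinearMap v) = koszul k n • j.toLinearMap v :=
      sgn_of_mem (j.map_mem n v hv)
    rw [sgn_of_mem hv, h, map_smul]
  · intro v w hv hw
    simp only [map_add, hv, hw]

/-- The map `[v₁ | ⋯ | vₙ] ↦ [j v₁ | ⋯ | j vₙ]`. -/
def Bar.mapL : Bar k V →ₗ[k] Bar k W := Bar.rec' Bar.nil 0 (Bar.cons ∘ₗ j.toLinearMap)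

theorem Bar.mapL_nil : Bar.mapL j Bar.nil = Bar.nil := by simp [Bar.mapL]

theorem Bar.mapL_cons (v : V) (w : Bar k V) :
    Bar.mapL j (Bar.cons v w) = Bar.cons (j.toLinearMap v) (Bar.mapL j w) := by
  simp [Bar.mapL]

theorem Bar.mapL_merge (v : V) (w : Bar k V) :
    Bar.mapL j (Bar.merge v w) = Bar.merge (j.toLinearMap v) (Bar.mapL j w) := by
  have : Bar.mapL j ∘ₗ Bar.merge v = Bar.merge (j.toLinearMap v) ∘ₗ Bar.mapL j := by
    refine Bar.ext' (by simp [Bar.mapL_nil]) fun x w _ => ?_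
    have h : ∀ x y, j.toLinearMap (NDGA.mul (k := k) x y) =
      NDGA.mul (k := k) (j.toLinearMap x) (j.toLinearMap y) := j.map_mul
    simp only [LinearMap.comp_apply, Bar.merge_cons, Bar.mapL_cons, h, j.map_sgn]
  exact LinearMap.congr_fun this w

/-- The functoriality of the bar construction. -/
def Bar.map : DGCoalgHom k (Bar k V) (Bar k W) where
  toLinearMap := Bar.mapL j
  counit_comp := by
    refine Bar.ext' ?_ fun v w _ => ?_
    · rw [LinearMap.comp_apply, Bar.mapL_nil, Bar.counit_def, Bar.counit_def, Bar.counit_nil, Bar.counit_nil]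
    · simp [Bar.counit_def, Bar.mapL_cons, Bar.counit_cons]
  map_comp_comul := by
    refine Bar.ext' ?_ fun v w hw => ?_
    · simp [Bar.comul_def, Bar.mapL_nil, Bar.comul_nil]
    · simp only [LinearMap.comp_apply, Bar.comul_def] at hw ⊢
      rw [Bar.mapL_cons, Bar.comul_cons, Bar.comul_cons, map_add, ← hw]
      congr 1
      · simp [Bar.mapL_nil, Bar.mapL_cons]
      · generalize Bar.comul w = t
        induction t with
        | zero => simp
        | add s t hs ht => simp only [map_add, hs, ht]
        | tmul x y => simp [Bar.mapL_cons]
  map_mem n w hw := by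
    show Bar.mapL j w ∈ gr k (Bar k W) n
    refine Bar.induction_gr (p := fun n w => Bar.mapL j w ∈ gr k (Bar k W) n) ?_ ?_ ?_ ?_ ?_ hw
    · rw [Bar.mapL_nil]; exact Bar.nil_mem
    · intro i v hv n w _ h
      rw [Bar.mapL_cons]
      exact Bar.cons_mem (j.map_mem i v hv) h
    · intro n; rw [map_zero]; exact zero_mem _
    · intro n x y hx hy
      rw [map_add]; exact add_mem hx hy
    · intro n c x hx
      rw [map_smul]; exact Submodule.smul_mem _ _ hx
  map_del w := by
    show Bar.mapL j (Bar.dif w) = Bar.dif (Bar.mapL j w)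
    have : Bar.mapL j ∘ₗ Bar.dif = Bar.dif ∘ₗ Bar.mapL j := by
      refine Bar.ext' (by simp [Bar.mapL_nil, Bar.dif_nil]) fun v w hw => ?_
      have h : ∀ x, j.toLinearMap (del k V x) = del k W (j.toLinearMap x) := j.map_del
      simp only [LinearMap.comp_apply] at hw ⊢
      simp only [Bar.dif_cons, map_sub, Bar.mapL_merge, Bar.mapL_cons, hw, h, j.map_sgn]
    exact LinearMap.congr_fun this w

variable {A : Type*} [Ring A] [Algebra k A] [DGA k A] (i : NDGHom k V A)

/-- The linear map with `[v] ↦ i v` that vanishes on words of length different from one. -/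
def Bar.proj : Bar k V →ₗ[k] A :=
  Bar.rec' 0 ((LinearMap.lsmul k A).flip.compl₂ Bar.counit ∘ₗ i.toLinearMap) 0

theorem Bar.proj_nil : Bar.proj i Bar.nil = 0 := by simp [Bar.proj]

theorem Bar.proj_cons (v : V) (w : Bar k V) :
    Bar.proj i (Bar.cons v w) = Bar.counit w • i.toLinearMap v := by simp [Bar.proj]

theorem Bar.proj_merge (v : V) (w : Bar k V) :
    Bar.proj i (Bar.merge v w) = i.toLinearMap (sgn k V v) * Bar.proj i w := by
  have : Bar.proj i ∘ₗ Bar.merge v =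
      LinearMap.mulLeft k (i.toLinearMap (sgn k V v)) ∘ₗ Bar.proj i := by
    refine Bar.ext' (by simp [Bar.proj_nil]) fun x w _ => ?_
    have h : ∀ x y, i.toLinearMap (NDGA.mul (k := k) x y) =
      i.toLinearMap x * i.toLinearMap y := i.map_mul
    simp [Bar.proj_cons, h]
  exact LinearMap.congr_fun this w

theorem Bar.proj_mem : Bar.proj i ∈ homGr k (Bar k V) A (-1) := by
  intro n w hw
  have h : ∀ n, ∀ w ∈ gr k (Bar k V) n, n ≠ 0 → Bar.counit w = 0 := fun n w hw hn =>
    DGCoalg.counit_eq_zero n hn w hw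
  refine Bar.induction_gr (p := fun n w => Bar.proj i w ∈ gr k A (n + -1)) ?_ ?_ ?_ ?_ ?_ hw
  · rw [Bar.proj_nil]; exact zero_mem _
  · intro m v hv n w hw _
    rw [Bar.proj_cons]
    by_cases hn : n = 0
    · subst hn
      rw [show m + 1 + 0 + -1 = m by ring]
      exact Submodule.smul_mem _ _ (i.map_mem m v hv)
    · rw [h n w hw hn, zero_smul]; exact zero_mem _
  · intro n; rw [map_zero]; exact zero_mem _
  · intro n x y hx hy
    rw [map_add]; exact add_mem hx hy
  · intro n c x hx
    rw [map_smul]; exact Submodule.smul_mem _ _ hx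

theorem Bar.proj_eq (x : Bar k V) : del k A (Bar.proj i x) + Bar.proj i (del k (Bar k V) x) +
    conv (Bar.proj i) (Bar.proj i) x = 0 := by
  have hm : ∀ x, conv (Bar.proj i) (Bar.proj i) x = LinearMap.mul' k A
      (TensorProduct.map (Bar.proj i) (Bar.proj i)
        ((sgn k (Bar k V)).rTensor (Bar k V) (Bar.comul x))) := fun x =>
    conv_apply_of_mem (Bar.proj_mem i) (by decide) x
  rw [hm]
  have : del k A ∘ₗ Bar.proj i + Bar.proj i ∘ₗ Bar.dif + LinearMap.mul' k A ∘ₗ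
      TensorProduct.map (Bar.proj i) (Bar.proj i) ∘ₗ (sgn k (Bar k V)).rTensor (Bar k V) ∘ₗ
        Bar.comul = 0 := by
    refine Bar.ext' ?_ fun v w _ => ?_
    · simp [Bar.proj_nil, Bar.dif_nil, Bar.comul_nil, Bar.sgn_nil]
    · have h1 : ∀ x, i.toLinearMap (del k V x) = del k A (i.toLinearMap x) := i.map_del
      have h2 : Bar.counit (Bar.dif w) = 0 := DGCoalg.counit_dif (k := k) (C := Bar k V) w
      have h3 : ∀ t : Bar k V ⊗[k] Bar k V, LinearMap.mul' k A (TensorProduct.map (Bar.proj i)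
          (Bar.proj i) ((sgn k (Bar k V)).rTensor (Bar k V) ((Bar.cons v).rTensor _ t))) =
          - (i.toLinearMap (sgn k V v) * Bar.proj i
            (TensorProduct.lid k _ ((Bar.counit).rTensor _ t))) := by
        intro t
        have hs : ∀ x : Bar k V, Bar.counit (sgn k _ x) = Bar.counit x := counit_sgn (k := k)
        induction t with
        | zero => simp
        | add s t hs ht => simp only [map_add, hs, ht, mul_add]; abel
        | tmul x y => simp [Bar.sgn_cons, Bar.proj_cons, hs]
      have h4 : TensorProduct.lid k _ ((Bar.counit).rTensor (Bar k V) (Bar.comul w)) = w := by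
        have := Coalgebra.rTensor_counit_comul (R := k) (A := Bar k V) w
        rw [Bar.comul_def, Bar.counit_def] at this
        rw [this]; simp
      simp only [LinearMap.add_apply, LinearMap.comp_apply, Bar.comul_cons, map_add, h3, h4,
        LinearMap.zero_apply, Bar.dif_cons, map_sub, Bar.proj_merge, Bar.proj_cons, h1, h2,
        map_smul]
      simp [Bar.sgn_nil, Bar.proj_nil]
  exact LinearMap.congr_fun this x

/-- The twisting cochain `[v] ↦ i v` on the bar construction. -/
def barMC : MC k (ConvDG k (Bar k V) A) :=
  MC.ofLinear (Bar.proj i) (Bar.proj_mem i) (Bar.proj_eq i)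

theorem barMC_val : (barMC i).val.val = Bar.proj i := rfl

end NDGHoms

section Functoriality

variable {k : Type*} [Field k]

/-- Composition of homomorphisms. -/
def DGHom.comp {A B C : Type*} [Ring A] [Algebra k A] [DGA k A] [Ring B] [Algebra k B] [DGA k B]
    [Ring C] [Algebra k C] [DGA k C] (g : DGHom k B C) (f : DGHom k A B) : DGHom k A C where
  toAlgHom := g.toAlgHom.comp f.toAlgHom
  map_mem n x hx := g.map_mem n _ (f.map_mem n x hx)
  map_del x := by
    have h1 : f.toAlgHom (del k A x) = del k B (f.toAlgHom x) := f.map_del x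
    have h2 : ∀ y, g.toAlgHom (del k B y) = del k C (g.toAlgHom y) := g.map_del
    show g.toAlgHom (f.toAlgHom (del k A x)) = del k C (g.toAlgHom (f.toAlgHom x))
    rw [h1, h2]

variable {C D : Type*} [AddCommGroup C] [Module k C] [Coalgebra k C] [DGCoalg k C]
  [AddCommGroup D] [Module k D] [Coalgebra k D] [DGCoalg k D]
  {A B : Type*} [Ring A] [Algebra k A] [DGA k A] [Ring B] [Algebra k B] [DGA k B]

theorem DGCoalgHom.map_sgn (φ : DGCoalgHom k C D) (x : C) :
    φ.toLinearMap (sgn k C x) = sgn k D (φ.toLinearMap x) := by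
  refine gr_induction k
    (p := fun x => φ.toLinearMap (sgn k C x) = sgn k D (φ.toLinearMap x)) ?_ (by simp) ?_ x
  · intro n v hv
    have h : sgn k D (φ.toLinearMap v) = koszul k n • φ.toLinearMap v :=
      sgn_of_mem (φ.map_mem n v hv)
    rw [sgn_of_mem hv, h, map_smul]
  · intro v w hv hw
    simp only [map_add, hv, hw]

theorem hat_precomp (φ : DGCoalgHom k C D) (f : D →ₗ[k] A) :
    hat (f ∘ₗ φ.toLinearMap) = hat f ∘ₗ φ.toLinearMap := by
  ext x
  show sgn k A (f (φ.toLinearMap (sgn k C x))) = sgn k A (f (sgn k D (φ.toLinearMap x)))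
  rw [φ.map_sgn]

theorem precomp_mem (φ : DGCoalgHom k C D) {n : ℤ} {f : D →ₗ[k] A} (hf : f ∈ homGr k D A n) :
    f ∘ₗ φ.toLinearMap ∈ homGr k C A n := fun i x hx => hf i _ (φ.map_mem i x hx)

theorem precomp_conv (φ : DGCoalgHom k C D) (f g : D →ₗ[k] A) :
    conv f g ∘ₗ φ.toLinearMap = conv (f ∘ₗ φ.toLinearMap) (g ∘ₗ φ.toLinearMap) := by
  have h1 : km f g ∘ₗ TensorProduct.map φ.toLinearMap φ.toLinearMap =
      km (f ∘ₗ φ.toLinearMap) (g ∘ₗ φ.toLinearMap) := by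
    refine gr_ext₂ fun i j x hx y hy => ?_
    have hx' : φ.toLinearMap x ∈ gr k D i := φ.map_mem i x hx
    have h2 : tw i (g ∘ₗ φ.toLinearMap) = tw i g ∘ₗ φ.toLinearMap := by
      unfold tw; split_ifs
      · rfl
      · exact hat_precomp φ g
    simp only [LinearMap.comp_apply, TensorProduct.map_tmul, km_tmul hx, km_tmul hx', h2]
  rw [conv, conv, ← h1]
  have h3 : Coalgebra.comul ∘ₗ φ.toLinearMap =
      TensorProduct.map φ.toLinearMap φ.toLinearMap ∘ₗ Coalgebra.comul := φ.map_comp_comul.symm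
  simp only [LinearMap.comp_assoc, h3]

theorem precomp_mem_iSup (φ : DGCoalgHom k C D) {f : D →ₗ[k] A} (hf : f ∈ ⨆ n, homGr k D A n) :
    f ∘ₗ φ.toLinearMap ∈ ⨆ n, homGr k C A n := by
  refine Submodule.iSup_induction (motive := fun f : D →ₗ[k] A => f ∘ₗ φ.toLinearMap ∈
    ⨆ n, homGr k C A n) _ hf ?_ ?_ ?_
  · intro n f hf
    exact Submodule.mem_iSup_of_mem n (precomp_mem φ hf)
  · rw [LinearMap.zero_comp]; exact zero_mem _
  · intro f g hf hg
    rw [LinearMap.add_comp]; exact add_mem hf hg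

variable (A) in
/-- Precomposition with a homomorphism of coalgebras. -/
def precomp (φ : DGCoalgHom k C D) : DGHom k (ConvDG k D A) (ConvDG k C A) where
  toAlgHom := AlgHom.ofLinearMap
    { toFun := fun f => ConvDG.mk (f.val ∘ₗ φ.toLinearMap) (precomp_mem_iSup φ f.val_mem)
      map_add' := fun _ _ => ConvDG.val_injective rfl
      map_smul' := fun _ _ => ConvDG.val_injective rfl }
    (ConvDG.val_injective (by
      show convOne ∘ₗ φ.toLinearMap = convOne
      have h : Coalgebra.counit ∘ₗ φ.toLinearMap = (Coalgebra.counit : C →ₗ[k] k) :=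
        φ.counit_comp
      rw [convOne, LinearMap.comp_assoc, h, convOne]))
    (fun f g => ConvDG.val_injective (precomp_conv φ f.val g.val))
  map_mem _ _ hf := precomp_mem φ hf
  map_del f := ConvDG.val_injective (by
    show homDel f.val ∘ₗ φ.toLinearMap = homDel (f.val ∘ₗ φ.toLinearMap)
    have h : ∀ x, φ.toLinearMap (del k C x) = del k D (φ.toLinearMap x) := φ.map_del
    ext x
    simp only [homDel_apply, hat_precomp, LinearMap.sub_apply, LinearMap.comp_apply, h])

theorem precomp_val (φ : DGCoalgHom k C D) (f : ConvDG k D A) :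
    ((precomp A φ).toAlgHom f).val = f.val ∘ₗ φ.toLinearMap := rfl

theorem hat_postcomp (g : DGHom k A B) (f : C →ₗ[k] A) :
    hat (g.toAlgHom.toLinearMap ∘ₗ f) = g.toAlgHom.toLinearMap ∘ₗ hat f := by
  ext x
  simp only [hat, LinearMap.comp_apply, AlgHom.toLinearMap_apply, g.map_sgn]

theorem postcomp_mem (g : DGHom k A B) {n : ℤ} {f : C →ₗ[k] A} (hf : f ∈ homGr k C A n) :
    g.toAlgHom.toLinearMap ∘ₗ f ∈ homGr k C B n := fun i x hx => g.map_mem _ _ (hf i x hx)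

theorem postcomp_conv (g : DGHom k A B) (f f' : C →ₗ[k] A) :
    g.toAlgHom.toLinearMap ∘ₗ conv f f' =
      conv (g.toAlgHom.toLinearMap ∘ₗ f) (g.toAlgHom.toLinearMap ∘ₗ f') := by
  have h1 : g.toAlgHom.toLinearMap ∘ₗ LinearMap.mul' k A ∘ₗ km f f' =
      LinearMap.mul' k B ∘ₗ km (g.toAlgHom.toLinearMap ∘ₗ f) (g.toAlgHom.toLinearMap ∘ₗ f') := by
    refine gr_ext₂ fun i j x hx y hy => ?_
    have h2 : tw i (g.toAlgHom.toLinearMap ∘ₗ f') = g.toAlgHom.toLinearMap ∘ₗ tw i f' := by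
      unfold tw; split_ifs <;> simp [hat_postcomp]
    simp only [LinearMap.comp_apply, km_tmul hx, h2, LinearMap.mul'_apply,
      AlgHom.toLinearMap_apply, map_mul]
  rw [conv, conv, ← LinearMap.comp_assoc _ _ (LinearMap.mul' k B), ← h1]
  simp only [LinearMap.comp_assoc]

theorem postcomp_mem_iSup (g : DGHom k A B) {f : C →ₗ[k] A} (hf : f ∈ ⨆ n, homGr k C A n) :
    g.toAlgHom.toLinearMap ∘ₗ f ∈ ⨆ n, homGr k C B n := by
  refine Submodule.iSup_induction (motive := fun f : C →ₗ[k] A => g.toAlgHom.toLinearMap ∘ₗ f ∈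
    ⨆ n, homGr k C B n) _ hf ?_ ?_ ?_
  · intro n f hf
    exact Submodule.mem_iSup_of_mem n (postcomp_mem g hf)
  · rw [LinearMap.comp_zero]; exact zero_mem _
  · intro f f' hf hf'
    rw [LinearMap.comp_add]; exact add_mem hf hf'

variable (C) in
/-- Postcomposition with a homomorphism of algebras. -/
def postcomp (g : DGHom k A B) : DGHom k (ConvDG k C A) (ConvDG k C B) where
  toAlgHom := AlgHom.ofLinearMap
    { toFun := fun f => ConvDG.mk (g.toAlgHom.toLinearMap ∘ₗ f.val) (postcomp_mem_iSup g f.val_mem)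
      map_add' := fun f f' => ConvDG.val_injective (LinearMap.comp_add f.val f'.val _)
      map_smul' := fun c f => ConvDG.val_injective (LinearMap.comp_smul _ c f.val) }
    (ConvDG.val_injective (by
      show g.toAlgHom.toLinearMap ∘ₗ convOne = convOne
      ext x
      simp [convOne]))
    (fun f f' => ConvDG.val_injective (postcomp_conv g f.val f'.val))
  map_mem _ _ hf := postcomp_mem g hf
  map_del f := ConvDG.val_injective (by
    show g.toAlgHom.toLinearMap ∘ₗ homDel f.val = homDel (g.toAlgHom.toLinearMap ∘ₗ f.val)
    have h : ∀ x, g.toAlgHom.toLinearMap (del k A x) = del k B (g.toAlgHom.toLinearMap x) :=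
      g.map_del
    ext x
    simp only [homDel_apply, hat_postcomp, LinearMap.sub_apply, LinearMap.comp_apply, h, map_sub])

theorem postcomp_val (g : DGHom k A B) (f : ConvDG k C A) :
    ((postcomp C g).toAlgHom f).val = g.toAlgHom.toLinearMap ∘ₗ f.val := rfl

end Functoriality

section Swap

variable {k : Type*} [Field k]
  {C : Type*} [AddCommGroup C] [Module k C] [Coalgebra k C] [DGCoalg k C]
  {B : Type*} [AddCommGroup B] [Module k B] [Coalgebra k B] [DGCoalg k B]
  {A : Type*} [Ring A] [Algebra k A] [DGA k A]

/-- The interchange `F ↦ (b ↦ c ↦ (-1) ^ (|b| |c|) F(c)(b))`, on all linear maps. -/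
def swapRaw (F : C →ₗ[k] ConvDG k B A) : B →ₗ[k] C →ₗ[k] A :=
  (ConvDG.val ∘ₗ F ∘ₗ ev k C).flip + (ConvDG.val ∘ₗ F ∘ₗ od k C).flip ∘ₗ sgn k B

theorem swapRaw_of_mem (F : C →ₗ[k] ConvDG k B A) {i j : ℤ} {c : C} (hc : c ∈ gr k C i) {b : B}
    (hb : b ∈ gr k B j) : swapRaw F b c = koszul k (i * j) • (F c).val b := by
  simp only [swapRaw, LinearMap.add_apply, LinearMap.comp_apply, LinearMap.flip_apply,
    ev_of_mem hc, od_of_mem hc, sgn_of_mem hb]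
  unfold koszul
  by_cases hi : Even i <;> by_cases hj : Even j <;> simp [Int.even_mul, hi, hj]

theorem swapRaw_mem {n : ℤ} {F : C →ₗ[k] ConvDG k B A} (hF : F ∈ homGr k C (ConvDG k B A) n)
    {j : ℤ} {b : B} (hb : b ∈ gr k B j) : swapRaw F b ∈ homGr k C A (j + n) := by
  intro i c hc
  rw [swapRaw_of_mem F hc hb]
  refine Submodule.smul_mem _ _ ?_
  have := hF i c hc j b hb
  rwa [show j + (i + n) = i + (j + n) by ring] at this

theorem swapRaw_add (F G : C →ₗ[k] ConvDG k B A) : swapRaw (F + G) = swapRaw F + swapRaw G := by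
  ext b c
  simp [swapRaw]; abel

theorem swapRaw_smul (r : k) (F : C →ₗ[k] ConvDG k B A) : swapRaw (r • F) = r • swapRaw F := by
  ext b c
  simp [swapRaw]

theorem swapRaw_apply_mem {F : C →ₗ[k] ConvDG k B A} (hF : F ∈ ⨆ n, homGr k C (ConvDG k B A) n)
    (b : B) : swapRaw F b ∈ (⨆ n, homGr k C A n : Submodule k (C →ₗ[k] A)) := by
  refine Submodule.iSup_induction (motive := fun F : C →ₗ[k] ConvDG k B A => swapRaw F b ∈
    (⨆ n, homGr k C A n : Submodule k (C →ₗ[k] A))) _ hF ?_ ?_ ?_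
  · intro n F hF
    refine gr_induction k (p := fun b => swapRaw F b ∈
      (⨆ n, homGr k C A n : Submodule k (C →ₗ[k] A))) ?_ ?_ ?_ b
    · intro j b hb
      exact Submodule.mem_iSup_of_mem _ (swapRaw_mem hF hb)
    · rw [map_zero]; exact zero_mem _
    · intro x y hx hy
      rw [map_add]; exact add_mem hx hy
  · have := swapRaw_smul (0 : k) (0 : C →ₗ[k] ConvDG k B A)
    rw [zero_smul, zero_smul] at this
    rw [this]; exact zero_mem _
  · intro F G hF hG
    rw [swapRaw_add]; exact add_mem hF hG

/-- The interchange for a sum of homogeneous maps. -/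
def swapFun (F : ConvDG k C (ConvDG k B A)) : B →ₗ[k] ConvDG k C A :=
  { toFun := fun b => ConvDG.mk (swapRaw F.val b) (swapRaw_apply_mem F.val_mem b)
    map_add' := fun b b' => ConvDG.val_injective (map_add (swapRaw F.val) b b')
    map_smul' := fun c b => ConvDG.val_injective (map_smul (swapRaw F.val) c b) }

theorem swapFun_val (F : ConvDG k C (ConvDG k B A)) (b : B) :
    (swapFun F b).val = swapRaw F.val b := rfl

theorem swapFun_of_mem (F : ConvDG k C (ConvDG k B A)) {i j : ℤ} {c : C} (hc : c ∈ gr k C i)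
    {b : B} (hb : b ∈ gr k B j) :
    (swapFun F b).val c = koszul k (i * j) • (F.val c).val b := swapRaw_of_mem F.val hc hb

theorem swapFun_add (F G : ConvDG k C (ConvDG k B A)) :
    swapFun (F + G) = swapFun F + swapFun G :=
  LinearMap.ext fun b => ConvDG.val_injective (LinearMap.congr_fun (swapRaw_add F.val G.val) b)

theorem swapFun_smul (r : k) (F : ConvDG k C (ConvDG k B A)) :
    swapFun (r • F) = r • swapFun F :=
  LinearMap.ext fun b => ConvDG.val_injective (LinearMap.congr_fun (swapRaw_smul r F.val) b)

theorem swapFun_zero : swapFun (0 : ConvDG k C (ConvDG k B A)) = 0 := by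
  have := swapFun_smul (0 : k) (0 : ConvDG k C (ConvDG k B A))
  rwa [zero_smul, zero_smul] at this

theorem swapFun_mem {n : ℤ} {F : ConvDG k C (ConvDG k B A)}
    (hF : F ∈ gr k (ConvDG k C (ConvDG k B A)) n) : swapFun F ∈ homGr k B (ConvDG k C A) n :=
  fun _ _ hb => swapRaw_mem hF hb

theorem swapFun_mem_iSup (F : ConvDG k C (ConvDG k B A)) :
    swapFun F ∈ (⨆ n, homGr k B (ConvDG k C A) n : Submodule k (B →ₗ[k] ConvDG k C A)) := by
  refine gr_induction k (p := fun F => swapFun F ∈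
    (⨆ n, homGr k B (ConvDG k C A) n : Submodule k (B →ₗ[k] ConvDG k C A))) ?_ ?_ ?_ F
  · intro n F hF
    exact Submodule.mem_iSup_of_mem n (swapFun_mem hF)
  · rw [swapFun_zero]; exact zero_mem _
  · intro F G hF hG
    rw [swapFun_add]; exact add_mem hF hG

theorem swap_ext {f g : B →ₗ[k] ConvDG k C A}
    (h : ∀ i, ∀ c ∈ gr k C i, ∀ j, ∀ b ∈ gr k B j, (f b).val c = (g b).val c) : f = g :=
  gr_ext fun j b hb => ConvDG.val_injective (gr_ext fun i c hc => h i c hc j b hb)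

theorem swapFun_one : swapFun (1 : ConvDG k C (ConvDG k B A)) = convOne := by
  refine swap_ext fun i c hc j b hb => ?_
  rw [swapFun_of_mem _ hc hb, ConvDG.val_one]
  have h1 : ((convOne : C →ₗ[k] ConvDG k B A) c).val b =
      Coalgebra.counit (R := k) c • Coalgebra.counit (R := k) b • (1 : A) := by
    simp only [convOne, LinearMap.comp_apply, Algebra.linearMap_apply,
      Algebra.algebraMap_eq_smul_one, map_smul, ConvDG.val_one, LinearMap.smul_apply]
  have h2 : ((convOne : B →ₗ[k] ConvDG k C A) b).val c =
      Coalgebra.counit (R := k) b • Coalgebra.counit (R := k) c • (1 : A) := by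
    simp only [convOne, LinearMap.comp_apply, Algebra.linearMap_apply,
      Algebra.algebraMap_eq_smul_one, map_smul, ConvDG.val_one, LinearMap.smul_apply]
  rw [h1, h2, smul_comm (Coalgebra.counit (R := k) c)]
  by_cases hi : i = 0
  · subst hi; simp
  · simp [DGCoalg.counit_eq_zero i hi c hc]

/-- `km` followed by multiplication, as a bilinear operation. -/
def mulKm {D : Type*} [AddCommGroup D] [Module k D] [Coalgebra k D] [DGCoalg k D] :
    (D →ₗ[k] A) →ₗ[k] (D →ₗ[k] A) →ₗ[k] (D ⊗[k] D →ₗ[k] A) :=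
  LinearMap.mk₂ k (fun f g => LinearMap.mul' k A ∘ₗ km f g)
    (fun f f' g => by
      ext; simp [km, LinearMap.add_comp, TensorProduct.add_tmul]; abel)
    (fun c f g => by
      ext; simp [km, LinearMap.smul_comp])
    (fun f g g' => by
      ext; simp [km, mul_add]; abel)
    (fun c f g => by
      ext; simp [km])

theorem mulKm_apply {D : Type*} [AddCommGroup D] [Module k D] [Coalgebra k D] [DGCoalg k D]
    (f g : D →ₗ[k] A) (t : D ⊗[k] D) :
    mulKm f g t = LinearMap.mul' k A (km f g t) := rfl

/-- The value of a convolution product of `A`-valued families, with both coproducts as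
arguments. -/
def famKm (n : ℤ) (F G : C →ₗ[k] ConvDG k B A) : C ⊗[k] C →ₗ[k] B ⊗[k] B →ₗ[k] A :=
  TensorProduct.lift ((mulKm.compl₁₂ (ConvDG.val ∘ₗ F ∘ₗ wt k C fun a => koszul k (a * n))
    (ConvDG.val ∘ₗ G)))

theorem famKm_tmul {n : ℤ} {F G : C →ₗ[k] ConvDG k B A}
    (hG : G ∈ homGr k C (ConvDG k B A) n) {c₁ c₂ : C} {b₁ b₂ : B} {i₁ i₂ j₁ : ℤ}
    (hc₁ : c₁ ∈ gr k C i₁) (hc₂ : c₂ ∈ gr k C i₂) (hb₁ : b₁ ∈ gr k B j₁) :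
    famKm n F G (c₁ ⊗ₜ c₂) (b₁ ⊗ₜ b₂) =
      (koszul k (i₁ * n) * koszul k (j₁ * (i₂ + n))) • ((F c₁).val b₁ * (G c₂).val b₂) := by
  simp only [famKm, TensorProduct.lift.tmul, LinearMap.compl₁₂_apply, LinearMap.comp_apply,
    wt_of_mem _ hc₁, map_smul, LinearMap.smul_apply, mulKm_apply, km_tmul hb₁,
    tw_of_mem (hG i₂ c₂ hc₂), LinearMap.mul'_apply, mul_smul_comm, smul_smul]

theorem conv_val_eq_famKm {n : ℤ} {F G : C →ₗ[k] ConvDG k B A}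
    (hG : G ∈ homGr k C (ConvDG k B A) n) (c : C) (b : B) :
    (conv F G c).val b =
      famKm n F G (Coalgebra.comul (R := k) c) (Coalgebra.comul (R := k) b) := by
  have : LinearMap.applyₗ b ∘ₗ ConvDG.val ∘ₗ LinearMap.mul' k (ConvDG k B A) ∘ₗ km F G =
      LinearMap.applyₗ (Coalgebra.comul (R := k) b) ∘ₗ famKm n F G := by
    refine gr_ext₂ fun i j c₁ hc₁ c₂ hc₂ => ?_
    simp only [famKm, TensorProduct.lift.tmul, LinearMap.compl₁₂_apply, LinearMap.comp_apply,
      wt_of_mem _ hc₁, map_smul, LinearMap.smul_apply, km_tmul hc₁, tw_of_mem hG,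
      LinearMap.mul'_apply, mul_smul_comm, LinearMap.applyₗ_apply_apply, ConvDG.val_mul]
    rfl
  exact LinearMap.congr_fun this (Coalgebra.comul (R := k) c)

theorem swapFun_mul_of_mem {n : ℤ} (F : ConvDG k C (ConvDG k B A))
    {G : ConvDG k C (ConvDG k B A)} (hG : G ∈ gr k (ConvDG k C (ConvDG k B A)) n) :
    swapFun (F * G) = conv (swapFun F) (swapFun G) := by
  refine swap_ext fun i c hc j b hb => ?_
  rw [swapFun_of_mem _ hc hb, ConvDG.val_mul, conv_val_eq_famKm hG,
    conv_val_eq_famKm (swapFun_mem hG)]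
  refine tensorPart_induction (p := fun s => koszul k (i * j) •
    famKm n F.val G.val s (Coalgebra.comul (R := k) b) =
      famKm n (swapFun F) (swapFun G) (Coalgebra.comul (R := k) b) s) ?_ (by simp) ?_ ?_
      (DGCoalg.comul_mem i c hc)
  · intro i₁ i₂ hi c₁ hc₁ c₂ hc₂
    refine tensorPart_induction (p := fun t => koszul k (i * j) •
      famKm n F.val G.val (c₁ ⊗ₜ c₂) t =
        famKm n (swapFun F) (swapFun G) t (c₁ ⊗ₜ c₂)) ?_ (by simp) ?_ ?_
        (DGCoalg.comul_mem j b hb)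
    · intro j₁ j₂ hj b₁ hb₁ b₂ hb₂
      rw [famKm_tmul hG hc₁ hc₂ hb₁, famKm_tmul (swapFun_mem hG) hb₁ hb₂ hc₁,
        swapFun_of_mem _ hc₁ hb₁, swapFun_of_mem _ hc₂ hb₂]
      simp only [smul_mul_assoc, mul_smul_comm, smul_smul]
      congr 1
      rw [← hi, ← hj]
      unfold koszul
      by_cases h1 : Even i₁ <;> by_cases h2 : Even i₂ <;> by_cases h3 : Even j₁ <;>
        by_cases h4 : Even j₂ <;> by_cases h5 : Even n <;>
        simp [Int.even_add, Int.even_mul, h1, h2, h3, h4, h5]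
    · intro s t hs ht
      simp only [map_add, LinearMap.add_apply, smul_add, hs, ht]
    · intro r t ht
      simp only [map_smul, LinearMap.smul_apply, ← ht, smul_comm r]
  · intro s t hs ht
    simp only [map_add, LinearMap.add_apply, smul_add, hs, ht]
  · intro r t ht
    simp only [map_smul, LinearMap.smul_apply, ← ht, smul_comm r]

theorem swapFun_mul (F G : ConvDG k C (ConvDG k B A)) :
    swapFun (F * G) = conv (swapFun F) (swapFun G) := by
  have h0' : ∀ f : B →ₗ[k] ConvDG k C A, conv f 0 = 0 := fun f => by
    have := conv_smul (k := k) (0 : k) f (0 : B →ₗ[k] ConvDG k C A)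
    rwa [zero_smul, zero_smul] at this
  refine gr_induction k (p := fun G => swapFun (F * G) = conv (swapFun F) (swapFun G)) ?_ ?_ ?_ G
  · intro n G hG
    exact swapFun_mul_of_mem F hG
  · rw [mul_zero, swapFun_zero, h0']
  · intro G G' h h'
    rw [mul_add, swapFun_add, swapFun_add, conv_add, h, h']

theorem swapFun_del_of_mem {m : ℤ} {F : ConvDG k C (ConvDG k B A)}
    (hF : F ∈ gr k (ConvDG k C (ConvDG k B A)) m) :
    swapFun (del k (ConvDG k C (ConvDG k B A)) F) = homDel (swapFun F) := by
  refine swap_ext fun i c hc j b hb => ?_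
  have hdc := Cx.dif_mem i c hc
  have hdb := Cx.dif_mem j b hb
  have e1 : ((del k (ConvDG k C (ConvDG k B A)) F).val c).val b =
      del k A ((F.val c).val b) - koszul k (i + m) • (F.val c).val (del k B b) -
        koszul k m • (F.val (del k C c)).val b := by
    rw [ConvDG.val_del, homDel_apply, hat_of_mem hF]
    simp only [LinearMap.sub_apply, LinearMap.comp_apply, map_sub, LinearMap.smul_apply, map_smul,
      ConvDG.val_del, homDel_apply, hat_of_mem (hF i c hc)]
  have e2 : (homDel (swapFun F) b).val c =
      del k A ((swapFun F b).val c) - koszul k (j + m) • (swapFun F b).val (del k C c) -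
        koszul k m • (swapFun F (del k B b)).val c := by
    rw [homDel_apply, hat_of_mem (swapFun_mem hF)]
    simp only [LinearMap.sub_apply, LinearMap.comp_apply, map_sub, LinearMap.smul_apply, map_smul,
      ConvDG.val_del, homDel_apply, hat_of_mem (swapFun_mem hF j b hb)]
  rw [swapFun_of_mem _ hc hb, e1, e2, swapFun_of_mem _ hc hb, swapFun_of_mem _ hdc hb,
    swapFun_of_mem _ hc hdb, sub_mul, mul_sub, one_mul, mul_one, koszul_sub, koszul_sub,
    koszul_add, koszul_add]
  simp only [smul_sub, map_smul, smul_smul]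
  unfold koszul
  by_cases h1 : Even i <;> by_cases h2 : Even j <;> by_cases h3 : Even m <;>
    simp [Int.even_mul, h1, h2, h3] <;> abel

theorem swapFun_del (F : ConvDG k C (ConvDG k B A)) :
    swapFun (del k (ConvDG k C (ConvDG k B A)) F) = homDel (swapFun F) := by
  refine gr_induction k (p := fun F => swapFun (del k (ConvDG k C (ConvDG k B A)) F) =
    homDel (swapFun F)) (fun m F hF => swapFun_del_of_mem hF) ?_ ?_ F
  · rw [map_zero, swapFun_zero, map_zero]
  · intro F G hF hG
    rw [map_add, swapFun_add, swapFun_add, map_add, hF, hG]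

variable (k C B A) in
/-- The interchange `Hom(C, Hom(B, A)) → Hom(B, Hom(C, A))`,
`F ↦ (b ↦ c ↦ (-1) ^ (|b| |c|) F(c)(b))`. -/
def swap : DGHom k (ConvDG k C (ConvDG k B A)) (ConvDG k B (ConvDG k C A)) where
  toAlgHom := AlgHom.ofLinearMap
    { toFun := fun F => ConvDG.mk (swapFun F) (swapFun_mem_iSup F)
      map_add' := fun F G => ConvDG.val_injective (swapFun_add F G)
      map_smul' := fun c F => ConvDG.val_injective (swapFun_smul c F) }
    (ConvDG.val_injective swapFun_one)
    (fun F G => ConvDG.val_injective (swapFun_mul F G))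
  map_mem _ _ hF := swapFun_mem hF
  map_del F := ConvDG.val_injective (swapFun_del F)

theorem swap_val (F : ConvDG k C (ConvDG k B A)) :
    ((swap k C B A).toAlgHom F).val = swapFun F := rfl

theorem swap_swap (F : ConvDG k C (ConvDG k B A)) :
    (swap k B C A).toAlgHom ((swap k C B A).toAlgHom F) = F := by
  apply ConvDG.val_injective
  refine swap_ext fun i b hb j c hc => ?_
  rw [swap_val, swapFun_of_mem _ hb hc, swap_val, swapFun_of_mem _ hc hb, smul_smul, mul_comm j i,
    koszul_mul_self, one_smul]

end Swap

section MaurerCartan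

variable {k : Type*} [Field k]

/-- The image of a Maurer–Cartan element. -/
def MC.map {A B : Type*} [Ring A] [Algebra k A] [DGA k A] [Ring B] [Algebra k B] [DGA k B]
    (f : DGHom k A B) (t : MC k A) : MC k B where
  val := f.toAlgHom t.val
  mem := f.map_mem _ _ t.mem
  eq := by
    have h : f.toAlgHom (del k A t.val) = del k B (f.toAlgHom t.val) := f.map_del t.val
    rw [← h, ← map_mul, ← map_add, t.eq, map_zero]

end MaurerCartan

section Hochschild

variable (k : Type*) [Field k] (A : Type*) [Ring A] [Algebra k A] [DGA k A]

/-- The Hochschild cochain algebra `CH^*(A, A)`: linear maps `f` from words `[a₁ | ⋯ | aₙ]` in `A`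
to `A`, with the cup product `(f ∪ g)[a₁ | ⋯ | aₙ] = ∑ ± f[a₁ | ⋯ | aᵢ] g[aᵢ₊₁ | ⋯ | aₙ]` and
the differential
`(D f)[a₁ | ⋯ | aₙ] = d (f[a₁ | ⋯ | aₙ]) - (-1) ^ |f| f (b [a₁ | ⋯ | aₙ])
  ± a₁ f[a₂ | ⋯ | aₙ] ± f[a₁ | ⋯ | aₙ₋₁] aₙ`, `b` being the differential of the bar construction; the
signs are given by the Koszul rule. Here `f` has homological degree `i` if it sends words of degree `j` to `A_{i + j}`;
this is cohomological degree `-i`. -/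
abbrev Hoch : Type _ := Twist (barMC (NDGHom.id (k := k) A))

/-- The Hochschild cohomology algebra `HH^*(A, A)` with the cup product. The part `HH^n(A, A)` is
`Homology.part k (Hoch k A) (-n)`. -/
abbrev HH : Type _ := Homology k (Hoch k A)

end Hochschild

section KoszulDuality

variable {k : Type*} [Field k] {R : Type*} [Ring R] [Algebra k R] [DGA k R]

variable (k R) in
/-- A differential graded algebra is connected if its homology is the ground field in degree `0`
and vanishes either in all negative or in all positive degrees. -/
structure IsConnected : Prop where
  zero : ∀ x ∈ gr k R 0, del k R x = 0 → ∃ (c : k) (y : R), x = algebraMap k R c + del k R y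
  bounded : (∀ n < 0, ∀ x ∈ gr k R n, del k R x = 0 → ∃ y, x = del k R y) ∨
    (∀ n > 0, ∀ x ∈ gr k R n, del k R x = 0 → ∃ y, x = del k R y)

variable (ε : DGHom k R k)

/-- The bar construction `B(R) = B(k, R, k)`, normalized: words in the augmentation ideal. -/
abbrev BarAug : Type _ := Bar k (AugIdeal ε)

/-- The Koszul dual `R^! = Hom(B(R), k)`. -/
abbrev KoszulDual : Type _ := ConvDG k (BarAug ε) k

/-- `Hom(B(R), R)` with the twisted differential: the normalized Hochschild cochains of `R`,
that is, `Hom_{R ⊗ R^op}(B(R, R, R), R)` for the normalized two-sided bar construction. -/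
abbrev HochNorm : Type _ := Twist (barMC (augIncl ε))

/-- Restriction of Hochschild cochains to words in the augmentation ideal. -/
def restrict : DGHom k (Hoch k R) (HochNorm ε) :=
  (precomp R (Bar.map (augIncl ε))).twist _ _ (by
    apply ConvDG.val_injective
    rw [precomp_val, barMC_val, barMC_val]
    refine Bar.ext' ?_ fun v w _ => ?_
    · show Bar.proj _ (Bar.mapL _ Bar.nil) = _
      rw [Bar.mapL_nil, Bar.proj_nil, Bar.proj_nil]
    · show Bar.proj _ (Bar.mapL _ (Bar.cons v w)) = _
      have h : Bar.counit (Bar.mapL (augIncl ε) w) = Bar.counit w :=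
        LinearMap.congr_fun (Bar.map (augIncl ε)).counit_comp w
      rw [Bar.mapL_cons, Bar.proj_cons, Bar.proj_cons, h]
      rfl)

/-- `Hom(B(R), Ω(B(R)))` with the differential twisted by the universal twisting cochain
`B(R) → Ω(B(R))`: the complex of comodule maps from `B(R)` to the cofree
`B(R) ⊗ B(R)^op`-comodule `Ω(B(R), B(R), B(R))`. The product is the composition (Yoneda) product
in convolution form. -/
abbrev CoHoch : Type _ := Twist (Cobar.univ k (BarAug ε))

/-- The homomorphism induced by the counit `Ω(B(R)) → R`, `[r] ↦ r`. -/
def cobarCounit : DGHom k (CoHoch ε) (HochNorm ε) :=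
  (postcomp (BarAug ε) (Cobar.liftDG (barMC (augIncl ε)))).twist _ _ (by
    apply ConvDG.val_injective
    rw [postcomp_val]
    ext x
    exact Cobar.lift_ι _ x)

/-- The twisting cochain `B(R) → Hom(B(R^!), k)`, `x ↦ ([φ] ↦ ± φ(x))`. -/
def evalMC : MC k (ConvDG k (BarAug ε) (ConvDG k (Bar k (KoszulDual ε)) k)) :=
  MC.map (swap k (Bar k (KoszulDual ε)) (BarAug ε) k)
    (barMC (NDGHom.id (k := k) (KoszulDual ε)))

theorem swap_map_val {C B A : Type*} [AddCommGroup C] [Module k C] [Coalgebra k C] [DGCoalg k C]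
    [AddCommGroup B] [Module k B] [Coalgebra k B] [DGCoalg k B] [Ring A] [Algebra k A] [DGA k A]
    (t : MC k (ConvDG k C (ConvDG k B A))) :
    (swap k B C A).toAlgHom (MC.map (swap k C B A) t).val = t.val := swap_swap t.val

/-- Linear duality. It is induced by the homomorphism
`Ω(B(R)) → Hom(B(R^!), k)` which evaluates a word `[φ₁ | ⋯ | φₙ]` in `R^!` on a word of length `n`
in `B(R)`, and by the interchange `Hom(B(R), Hom(B(R^!), k)) ≅ Hom(B(R^!), Hom(B(R), k))`. -/
def dualize : DGHom k (CoHoch ε) (Hoch k (KoszulDual ε)) :=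
  ((swap k (BarAug ε) (Bar k (KoszulDual ε)) k).comp
    (postcomp (BarAug ε) (Cobar.liftDG (evalMC ε)))).twist _ _ (by
    have h1 : (postcomp (BarAug ε) (Cobar.liftDG (evalMC ε))).toAlgHom
        (Cobar.univ k (BarAug ε)).val = (evalMC ε).val := by
      apply ConvDG.val_injective
      rw [postcomp_val]
      ext x : 1
      exact Cobar.lift_ι _ x
    show (swap k (BarAug ε) (Bar k (KoszulDual ε)) k).toAlgHom
      ((postcomp (BarAug ε) (Cobar.liftDG (evalMC ε))).toAlgHom
        (Cobar.univ k (BarAug ε)).val) = _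
    rw [h1]
    exact swap_map_val _)

end KoszulDuality

end DG

end

/-! All complexes in play are convolution algebras Hom(C, A), where C is a bar construction and the
differential is twisted by a twisting cochain t. Filter linear maps out of C by the length of the
words on which they vanish. Every element of C has bounded word length, and a map can be prescribed
separately on the words of each length, so this filtration is Hausdorff and complete and equations
can be solved by successive approximation (`exists_of_lenGE_approx`). To leading order, t enters
only through its value at the empty word, which is a Maurer–Cartan element of A. Hence a
homomorphism of coefficients that is a quasi-isomorphism for the differentials twisted by these
values induces a quasi-isomorphism of twisted convolution algebras (`postcomp_twist_isQuasiIso`).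
The proof contracts the mapping cone of the coefficients and corrects length by length.

For ρ there is an explicit homotopy: precomposition with the operator that doubles the first unit
letter of a word. Its commutator with the twisted differential is the identity minus the letterwise
projection onto the augmentation ideal (`twHom_unitDup`). The argument works for coefficients in any
algebra B that receives a unital homomorphism, and it is used a second time for R^! with
coefficients in k.

For α, change of coefficients reduces the claim to the map Ω(B(R)) → R, where Ω(B(R)) carries the
differential twisted by the generator of the empty word. This twist cancels the trivial splittings
in the full coproduct. The operator that deletes a leading empty word and joins a leading one-letter
word to its successor is a homotopy from the identity to terms with fewer letters or terms in k ⊕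
ker ε (`cobarHtpy_step`). Induction on the number of letters leaves k ⊕ ker ε = R. Neither ρ nor α
needs connectedness or finiteness.

For δ, change of coefficients and the bijective interchange reduce the claim to Ω(B(R)) →
Hom(B(R^!), k). By the normalization argument the target may be tested on words in the augmentation
ideal W of R^!, where the twist of the target vanishes. Connectedness provides a subalgebra S of ker
ε with all degrees at least 1, or all at most -1, onto which ker ε retracts linearly
(`exists_bounded_deformation`). Every class of the twisted Ω(B(R)) is represented in k ⊕ S, so it
suffices that the cone is acyclic on the reduced words over S. Filter products by their number of
factors. To leading order the p-th step compares the p-th tensor power of the reduced homology of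
B(S) with the dual of the p-th tensor power of its dual. Finite-dimensionality of the homology of
R^! gives finite dual bases and contractions onto them (`exists_hodgeDuality`), and peeling off one
tensor factor at a time proves the comparison (`WordEvaluation.exists_approx`). On the side of
functionals the approximations converge by completeness. On the side of Ω they stop: a product of p
reduced words over S has degree at least p up to a global sign, so in a fixed degree only finitely
many filtration steps are nonzero.

The ring isomorphism is then δ after the inverse of α after ρ, on homology. -/

open scoped TensorProduct

noncomputable section

namespace DG

/-! ### Homogeneous components -/

section GradedProjections

variable {k : Type*} [Field k] {V W : Type*} [AddCommGroup V] [Module k V] [AddCommGroup W]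
  [Module k W] [GrMod k V] [GrMod k W]

variable (k V) in
/-- Projection onto the part of degree `n`. -/
def pr (n : ℤ) : V →ₗ[k] V := wt k V (Pi.single n 1)

theorem pr_of_mem {n : ℤ} {v : V} (hv : v ∈ gr k V n) : pr k V n v = v := by
  rw [pr, wt_of_mem _ hv, Pi.single_eq_same, one_smul]

theorem pr_of_mem_ne {m n : ℤ} (h : m ≠ n) {v : V} (hv : v ∈ gr k V m) : pr k V n v = 0 := by
  rw [pr, wt_of_mem _ hv, Pi.single_eq_of_ne h, zero_smul]

theorem pr_mem (n : ℤ) (v : V) : pr k V n v ∈ gr k V n := by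
  refine gr_induction k (p := fun v => pr k V n v ∈ gr k V n) ?_ (by simp) ?_ v
  · intro m v hv
    by_cases h : m = n
    · subst h; rwa [pr_of_mem hv]
    · rw [pr_of_mem_ne h hv]; exact zero_mem _
  · intro v w hv hw
    rw [map_add]; exact add_mem hv hw

theorem eq_sum_pr (v : V) : ∃ s : Finset ℤ, v = ∑ n ∈ s, pr k V n v := by
  classical
  -- A support may be enlarged freely; in this form the supports of two summands can be united.
  suffices h : ∃ s : Finset ℤ, ∀ t, s ⊆ t → v = ∑ n ∈ t, pr k V n v by
    obtain ⟨s, hs⟩ := h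
    exact ⟨s, hs s subset_rfl⟩
  refine gr_induction k (p := fun v => ∃ s : Finset ℤ, ∀ t, s ⊆ t → v = ∑ n ∈ t, pr k V n v)
    ?_ ⟨∅, by simp⟩ ?_ v
  · intro m v hv
    refine ⟨{m}, fun t ht => ?_⟩
    rw [Finset.sum_eq_single m, pr_of_mem hv]
    · intro n _ hn
      exact pr_of_mem_ne (Ne.symm hn) hv
    · intro h
      exact absurd (ht (Finset.mem_singleton_self m)) h
  · rintro v w ⟨s, hs⟩ ⟨t, ht⟩
    refine ⟨s ∪ t, fun u hu => ?_⟩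
    simp only [map_add, Finset.sum_add_distrib]
    rw [← hs u (Finset.union_subset_left hu), ← ht u (Finset.union_subset_right hu)]

theorem mem_of_pr_mem {p : Submodule k V} {v : V} (h : ∀ n, pr k V n v ∈ p) : v ∈ p := by
  obtain ⟨s, hs⟩ := eq_sum_pr (k := k) v
  rw [hs]
  exact sum_mem fun n _ => h n

theorem map_pr {m : ℤ} {f : V →ₗ[k] W} (hf : f ∈ homGr k V W m) (n : ℤ) (v : V) :
    f (pr k V n v) = pr k W (n + m) (f v) := by
  refine gr_induction k (p := fun v => f (pr k V n v) = pr k W (n + m) (f v)) ?_ (by simp) ?_ v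
  · intro i v hv
    by_cases h : i = n
    · subst h; rw [pr_of_mem hv, pr_of_mem (hf i v hv)]
    · rw [pr_of_mem_ne h hv, pr_of_mem_ne (by omega) (hf i v hv), map_zero]
  · intro v w hv hw
    simp only [map_add, hv, hw]

theorem gr_of_eq {m n : ℤ} {v : V} (hv : v ∈ gr k V m) (h : m = n) : v ∈ gr k V n := h ▸ hv

end GradedProjections

/-! ### Criteria for quasi-isomorphisms -/

section QuasiIsos

variable {k : Type*} [Field k] {X Y Z : Type*} [AddCommGroup X] [Module k X] [Cx k X]
  [AddCommGroup Y] [Module k Y] [Cx k Y] [AddCommGroup Z] [Module k Z] [Cx k Z]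

theorem del_mem_homGr : del k X ∈ homGr k X X (-1) := fun i v hv => Cx.dif_mem i v hv

theorem del_mem {n : ℤ} {x : X} (hx : x ∈ gr k X n) : del k X x ∈ gr k X (n - 1) :=
  Cx.dif_mem n x hx

theorem del_del (x : X) : del k X (del k X x) = 0 := Cx.dif_dif x

theorem del_pr (n : ℤ) (x : X) : del k X (pr k X n x) = pr k X (n - 1) (del k X x) :=
  map_pr del_mem_homGr n x

theorem IsChainMap.map_pr {f : X →ₗ[k] Y} (hf : IsChainMap k f) (n : ℤ) (x : X) :
    f (pr k X n x) = pr k Y n (f x) := by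
  have h : f ∈ homGr k X Y 0 := fun i v hv => by simpa using hf.map_mem i v hv
  simpa using DG.map_pr h n x

/-- Quasi-isomorphisms can be recognized on homogeneous elements. -/
theorem IsQuasiIso.of_homogeneous {f : X →ₗ[k] Y} (hf : IsChainMap k f)
    (inj : ∀ n, ∀ x ∈ gr k X n, del k X x = 0 → ∀ y ∈ gr k Y (n + 1), f x = del k Y y →
      ∃ u, x = del k X u)
    (surj : ∀ n, ∀ y ∈ gr k Y n, del k Y y = 0 → ∃ x, del k X x = 0 ∧ ∃ u, y = f x + del k Y u) :
    IsQuasiIso k f where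
  toIsChainMap := hf
  inj := by
    rintro x hx ⟨y, hy⟩
    have : x ∈ LinearMap.range (del k X) := mem_of_pr_mem (k := k) fun n => by
      obtain ⟨u, hu⟩ := inj n (pr k X n x) (pr_mem n x) (by rw [del_pr, hx, map_zero])
        (pr k Y (n + 1) y) (pr_mem _ _) (by rw [hf.map_pr, hy, del_pr, add_sub_cancel_right])
      exact ⟨u, hu.symm⟩
    obtain ⟨u, hu⟩ := this
    exact ⟨u, hu.symm⟩
  surj := by
    intro y hy
    have : y ∈ (LinearMap.ker (del k X)).map f ⊔ LinearMap.range (del k Y) :=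
      mem_of_pr_mem (k := k) fun n => by
        obtain ⟨x, hx, u, hu⟩ := surj n (pr k Y n y) (pr_mem n y) (by rw [del_pr, hy, map_zero])
        rw [hu]
        exact Submodule.add_mem_sup ⟨x, hx, rfl⟩ ⟨u, rfl⟩
    obtain ⟨_, ⟨x, hx, rfl⟩, _, ⟨u, rfl⟩, h⟩ := Submodule.mem_sup.1 this
    exact ⟨x, hx, u, h.symm⟩

/-- A chain map with a linear section that is a homotopy inverse is a quasi-isomorphism. -/
theorem IsQuasiIso.of_homotopy {f : X →ₗ[k] Y} (hf : IsChainMap k f) (g : Y →ₗ[k] X)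
    (H : X →ₗ[k] X) (hfg : ∀ y, f (g y) = y)
    (hH : ∀ x, del k X (H x) + H (del k X x) = x - g (f x)) : IsQuasiIso k f := by
  -- The section `g` is not assumed to be a chain map; the homotopy forces it. Evaluating the
  -- identity at g y gives dHgy + Hdgy = 0, hence dHdgy = 0, and evaluating it at d g y gives dHdgy
  -- = dgy - gdy.
  have hg : ∀ y, g (del k Y y) = del k X (g y) := fun y => by
    have h1 := hH (g y)
    rw [hfg, sub_self] at h1
    have h2 := hH (del k X (g y))
    rw [del_del, map_zero, add_zero, hf.map_del, hfg] at h2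
    have h3 := congrArg (del k X) h1
    rw [map_add, del_del, zero_add, map_zero] at h3
    rw [h3, eq_comm, sub_eq_zero] at h2
    exact h2.symm
  refine { toIsChainMap := hf, inj := ?_, surj := ?_ }
  · rintro x hx ⟨y, hy⟩
    refine ⟨H x + g y, ?_⟩
    have h1 := hH x
    rw [hx, map_zero, add_zero, hy, hg] at h1
    rw [map_add, h1]
    abel
  · intro y hy
    exact ⟨g y, by rw [← hg, hy, map_zero], 0, by rw [hfg, map_zero, add_zero]⟩

theorem IsQuasiIso.comp {f : X →ₗ[k] Y} {g : Y →ₗ[k] Z} (hg : IsQuasiIso k g)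
    (hf : IsQuasiIso k f) : IsQuasiIso k (g ∘ₗ f) where
  map_mem n x hx := hg.map_mem n _ (hf.map_mem n x hx)
  map_del x := by rw [LinearMap.comp_apply, hf.map_del, hg.map_del, LinearMap.comp_apply]
  inj x hx h := by
    obtain ⟨u, hu⟩ := hg.inj (f x) (by rw [← hf.map_del, hx, map_zero]) h
    exact hf.inj x hx ⟨u, hu⟩
  surj z hz := by
    obtain ⟨y, hy, u, rfl⟩ := hg.surj z hz
    obtain ⟨x, hx, v, rfl⟩ := hf.surj y hy
    refine ⟨x, hx, g v + u, ?_⟩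
    rw [LinearMap.comp_apply, map_add, map_add, ← hg.map_del]
    abel

/-- One case of two-out-of-three. It lets a map be tested after composition with a known comparison,
here the restriction of functionals to words in an augmentation ideal. -/
theorem IsQuasiIso.of_comp_left {f : X →ₗ[k] Y} {g : Y →ₗ[k] Z} (hg : IsQuasiIso k g)
    (hf : IsChainMap k f) (h : IsQuasiIso k (g ∘ₗ f)) : IsQuasiIso k f where
  toIsChainMap := hf
  inj := by
    rintro x hx ⟨y, hy⟩
    exact h.inj x hx ⟨g y, by rw [LinearMap.comp_apply, hy, hg.map_del]⟩
  surj y hy := by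
    obtain ⟨x, hx, u, hu⟩ := h.surj (g y) (by rw [← hg.map_del, hy, map_zero])
    obtain ⟨v, hv⟩ := hg.inj (y - f x) (by rw [map_sub, hy, ← hf.map_del, hx]; simp)
      ⟨u, by rw [map_sub, hu, LinearMap.comp_apply]; abel⟩
    exact ⟨x, hx, v, by rw [← hv]; abel⟩

/-- A bijective chain map is a quasi-isomorphism. -/
theorem IsQuasiIso.of_inverse {f : X →ₗ[k] Y} (hf : IsChainMap k f) (g : Y →ₗ[k] X)
    (hgf : ∀ x, g (f x) = x) (hfg : ∀ y, f (g y) = y) : IsQuasiIso k f :=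
  IsQuasiIso.of_homotopy hf g 0 hfg fun x => by simp [hgf]

end QuasiIsos

/-! ### Splittings and contractions over a field -/

section Contractions

variable {k : Type*} [Field k]

/-- The corestriction to the range splits because all modules over a field are projective, and the
splitting extends to F because the range has a complement. All contractions of abstract complexes
below go back to this choice. -/
theorem exists_generalized_inverse {E F : Type*} [AddCommGroup E] [Module k E] [AddCommGroup F]
    [Module k F] (f : E →ₗ[k] F) : ∃ g : F →ₗ[k] E, ∀ x, f (g (f x)) = f x := by
  obtain ⟨g, hg⟩ := f.rangeRestrict.exists_rightInverse_of_surjective f.range_rangeRestrict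
  obtain ⟨g', hg'⟩ := LinearMap.exists_extend g
  refine ⟨g', fun x => ?_⟩
  have h1 : g' (f x) = g (f.rangeRestrict x) := LinearMap.congr_fun hg' (f.rangeRestrict x)
  have h2 := LinearMap.congr_fun hg (f.rangeRestrict x)
  rw [h1]
  exact congrArg Subtype.val h2

variable {V : Type*} [AddCommGroup V] [Module k V] [Cx k V]

/-- A generalized inverse of the differential of a relative complex. -/
theorem exists_graded_inverse (L M : Submodule k V) (hL : ∀ n, ∀ x ∈ L, pr k V n x ∈ L)
    (hM : ∀ n, ∀ x ∈ M, pr k V n x ∈ M) :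
    ∃ σ ∈ homGr k V V 1, (∀ x, σ x ∈ M) ∧ (∀ x ∈ L, σ x = 0) ∧
      ∀ x ∈ M, del k V x - del k V (σ (del k V x)) ∈ L := by
  -- In each degree the map from M to V/L induced by the differential is inverted. Its generalized
  -- inverse takes values in M and is defined on V/L, which gives the conditions on the range and on
  -- L.
  let f : ∀ n, ↥(M ⊓ gr k V (n + 1)) →ₗ[k] V ⧸ L := fun n =>
    L.mkQ ∘ₗ del k V ∘ₗ (M ⊓ gr k V (n + 1)).subtype
  choose g hg using fun n => exists_generalized_inverse (f n)
  let σ : V →ₗ[k] V := grLift k V fun n =>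
    (M ⊓ gr k V (n + 1)).subtype ∘ₗ g n ∘ₗ L.mkQ ∘ₗ (gr k V n).subtype
  have hσ : ∀ {n : ℤ} {v : V} (hv : v ∈ gr k V n), σ v = (g n (L.mkQ v) : V) := fun hv => by
    simp only [σ, grLift_of_mem _ hv, LinearMap.comp_apply, Submodule.subtype_apply]
  refine ⟨σ, fun n v hv => ?_, fun x => ?_, fun x hx => ?_, fun x hx => ?_⟩
  · rw [hσ hv]; exact (g n (L.mkQ v)).2.2
  · refine gr_induction k (p := fun x => σ x ∈ M) ?_ (by simp) ?_ x
    · intro n v hv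
      rw [hσ hv]; exact (g n (L.mkQ v)).2.1
    · intro v w hv hw
      rw [map_add]; exact add_mem hv hw
  · have : x ∈ LinearMap.ker σ := mem_of_pr_mem (k := k) fun n => by
      rw [LinearMap.mem_ker, hσ (pr_mem n x)]
      have : L.mkQ (pr k V n x) = 0 := by simpa using hL n x hx
      rw [this, map_zero]; rfl
    exact this
  · have : x ∈ L.comap (del k V - del k V ∘ₗ σ ∘ₗ del k V) := mem_of_pr_mem (k := k) fun n => by
      have h1 : pr k V n x ∈ M ⊓ gr k V (n - 1 + 1) := ⟨hM n x hx, by simpa using pr_mem n x⟩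
      have h2 := hg (n - 1) ⟨_, h1⟩
      have h3 : del k V (pr k V n x) ∈ gr k V (n - 1) := del_mem (pr_mem n x)
      rw [Submodule.mem_comap, LinearMap.sub_apply, LinearMap.comp_apply, LinearMap.comp_apply,
        hσ h3, ← Submodule.Quotient.eq]
      exact h2.symm
    exact this

/-- A relatively acyclic pair of graded subcomplexes has a relative contraction. -/
theorem exists_rel_contraction (L M : Submodule k V) (hL : ∀ n, ∀ x ∈ L, pr k V n x ∈ L)
    (hM : ∀ n, ∀ x ∈ M, pr k V n x ∈ M) (hdL : ∀ x ∈ L, del k V x ∈ L)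
    (hac : ∀ x ∈ M, del k V x ∈ L → ∃ u ∈ M, x - del k V u ∈ L) :
    ∃ h ∈ homGr k V V 1, (∀ x, h x ∈ M) ∧ (∀ x ∈ L, h x = 0) ∧
      ∀ x ∈ M, x - del k V (h x) - h (del k V x) ∈ L := by
  obtain ⟨σ, hσ, hσM, hσL, hdσ⟩ := exists_graded_inverse L M hL hM
  refine ⟨σ - σ ∘ₗ σ ∘ₗ del k V, ?_, fun x => ?_, fun x hx => ?_, fun x hx => ?_⟩
  · refine sub_mem hσ fun n v hv => ?_
    have := hσ _ _ (hσ _ _ (del_mem hv))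
    exact gr_of_eq this (by ring)
  · exact sub_mem (hσM _) (hσM _)
  · simp [hσL x hx, hσL _ (hdL x hx)]
  -- With h = σ - σσd one has x - dhx - hdx = x' - dσx' for x' = x - σdx. This x' is a relative
  -- cycle, so x' = du modulo L for some u in M. Since σ vanishes on L, σx' = σdu, and dσdu = du
  -- modulo L.
  · have hx' : x - σ (del k V x) ∈ M := sub_mem hx (hσM _)
    have hd : del k V (x - σ (del k V x)) ∈ L := by rw [map_sub]; exact hdσ x hx
    obtain ⟨u, hu, hl⟩ := hac _ hx' hd
    have h1 : σ (x - σ (del k V x)) = σ (del k V u) := by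
      have := hσL _ hl
      rwa [map_sub, sub_eq_zero] at this
    have h2 := hdσ u hu
    have h3 := add_mem hl h2
    rw [← h1] at h3
    convert h3 using 1
    simp only [LinearMap.sub_apply, LinearMap.comp_apply, map_sub, del_del, map_zero]
    abel

/-- An acyclic complex has a contraction. -/
theorem exists_contraction (hac : ∀ x : V, del k V x = 0 → ∃ u, x = del k V u) :
    ∃ s ∈ homGr k V V 1, ∀ x, del k V (s x) + s (del k V x) = x := by
  obtain ⟨s, hs, -, -, h⟩ := exists_rel_contraction (⊥ : Submodule k V) ⊤ (by simp) (by simp)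
    (by simp) (fun x _ hx => by
      obtain ⟨u, hu⟩ := hac x (by simpa using hx)
      exact ⟨u, trivial, by simp [← hu]⟩)
  refine ⟨s, hs, fun x => ?_⟩
  have := h x trivial
  rw [Submodule.mem_bot, sub_sub, sub_eq_zero] at this
  exact this.symm

end Contractions

/-! ### Mapping cones -/

section Cone

variable {k : Type*} [Field k] {X Y : Type*} [AddCommGroup X] [Module k X] [Cx k X]
  [AddCommGroup Y] [Module k Y] [Cx k Y]

/-- The mapping cone of a chain map. -/
def Cone {f : X →ₗ[k] Y} (_hf : IsChainMap k f) : Type _ := Y × X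

variable {f : X →ₗ[k] Y} (hf : IsChainMap k f)

instance : AddCommGroup (Cone hf) := inferInstanceAs (AddCommGroup (Y × X))

instance : Module k (Cone hf) := inferInstanceAs (Module k (Y × X))

/-- The first component. -/
def Cone.fst : Cone hf →ₗ[k] Y := LinearMap.fst k Y X

/-- The second component. -/
def Cone.snd : Cone hf →ₗ[k] X := LinearMap.snd k Y X

/-- The inclusion of the first component. -/
def Cone.inl : Y →ₗ[k] Cone hf := LinearMap.inl k Y X

/-- The inclusion of the second component. -/
def Cone.inr : X →ₗ[k] Cone hf := LinearMap.inr k Y X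

theorem Cone.ext {p q : Cone hf} (h1 : Cone.fst hf p = Cone.fst hf q)
    (h2 : Cone.snd hf p = Cone.snd hf q) : p = q := Prod.ext h1 h2

@[simp] theorem Cone.fst_inl (y : Y) : Cone.fst hf (Cone.inl hf y) = y := rfl
@[simp] theorem Cone.snd_inl (y : Y) : Cone.snd hf (Cone.inl hf y) = 0 := rfl
@[simp] theorem Cone.fst_inr (x : X) : Cone.fst hf (Cone.inr hf x) = 0 := rfl
@[simp] theorem Cone.snd_inr (x : X) : Cone.snd hf (Cone.inr hf x) = x := rfl

theorem Cone.eq_add (p : Cone hf) : p = Cone.inl hf (Cone.fst hf p) + Cone.inr hf (Cone.snd hf p) :=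
  Cone.ext hf (by simp) (by simp)

instance : GrMod k (Cone hf) where
  part n := (gr k Y n).comap (Cone.fst hf) ⊓ (gr k X (n - 1)).comap (Cone.snd hf)
  internal := by
    refine isInternal_of_separating (T := Unit) (W := Cone hf) _
      (fun n _ => Cone.inl hf ∘ₗ pr k Y n ∘ₗ Cone.fst hf +
        Cone.inr hf ∘ₗ pr k X (n - 1) ∘ₗ Cone.snd hf) ?_ ?_ ?_
    · rintro m n hmn p ⟨h1, h2⟩ _
      simp only [LinearMap.add_apply, LinearMap.comp_apply]
      rw [pr_of_mem_ne hmn h1, pr_of_mem_ne (by omega) h2, map_zero, map_zero, add_zero]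
    · rintro n p ⟨h1, h2⟩ h
      have := h ()
      simp only [LinearMap.add_apply, LinearMap.comp_apply] at this
      rw [pr_of_mem h1, pr_of_mem h2] at this
      rw [Cone.eq_add hf p, this]
    · rw [eq_top_iff]
      intro p _
      rw [Cone.eq_add hf p]
      refine add_mem ?_ ?_
      · refine Submodule.mem_comap.1 (mem_of_pr_mem (k := k) (p := Submodule.comap (Cone.inl hf) _)
          fun n => Submodule.mem_iSup_of_mem n ⟨?_, ?_⟩)
        · exact pr_mem n _
        · exact Submodule.zero_mem _
      · refine Submodule.mem_comap.1 (mem_of_pr_mem (k := k) (p := Submodule.comap (Cone.inr hf) _)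
          fun n => Submodule.mem_iSup_of_mem (n + 1) ⟨?_, ?_⟩)
        · exact Submodule.zero_mem _
        · show pr k X n _ ∈ gr k X (n + 1 - 1)
          rw [add_sub_cancel_right]
          exact pr_mem n _

theorem Cone.mem_gr {n : ℤ} {p : Cone hf} :
    p ∈ gr k (Cone hf) n ↔ Cone.fst hf p ∈ gr k Y n ∧ Cone.snd hf p ∈ gr k X (n - 1) := Iff.rfl

instance : Cx k (Cone hf) where
  dif := Cone.inl hf ∘ₗ (del k Y ∘ₗ Cone.fst hf + f ∘ₗ Cone.snd hf) -
    Cone.inr hf ∘ₗ del k X ∘ₗ Cone.snd hf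
  dif_mem n p hp := by
    obtain ⟨h1, h2⟩ := (Cone.mem_gr hf).1 hp
    refine (Cone.mem_gr hf).2 ⟨?_, ?_⟩
    · simpa using add_mem (del_mem h1) (hf.map_mem _ _ h2)
    · simpa using del_mem h2
  dif_dif p := by
    refine Cone.ext hf ?_ ?_ <;> simp [del_del, hf.map_del]

theorem Cone.fst_del (p : Cone hf) :
    Cone.fst hf (del k (Cone hf) p) = del k Y (Cone.fst hf p) + f (Cone.snd hf p) := by
  simp [del, Cx.dif]

theorem Cone.snd_del (p : Cone hf) :
    Cone.snd hf (del k (Cone hf) p) = - del k X (Cone.snd hf p) := by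
  simp [del, Cx.dif]

theorem Cone.fst_sgn (p : Cone hf) : Cone.fst hf (sgn k (Cone hf) p) = sgn k Y (Cone.fst hf p) := by
  refine gr_induction k (p := fun p => Cone.fst hf (sgn k (Cone hf) p) = sgn k Y (Cone.fst hf p))
    ?_ (by simp) ?_ p
  · intro n p hp
    rw [sgn_of_mem hp, map_smul, sgn_of_mem ((Cone.mem_gr hf).1 hp).1]
  · intro v w hv hw
    simp only [map_add, hv, hw]

theorem Cone.snd_sgn (p : Cone hf) :
    Cone.snd hf (sgn k (Cone hf) p) = - sgn k X (Cone.snd hf p) := by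
  refine gr_induction k (p := fun p => Cone.snd hf (sgn k (Cone hf) p) = - sgn k X (Cone.snd hf p))
    ?_ (by simp) ?_ p
  · intro n p hp
    rw [sgn_of_mem hp, map_smul, sgn_of_mem ((Cone.mem_gr hf).1 hp).2, koszul_sub]
    simp
  · intro v w hv hw
    simp only [map_add, hv, hw]
    abel

/-- The cone of a quasi-isomorphism is contractible. -/
theorem IsQuasiIso.exists_cone_contraction (h : IsQuasiIso k f) :
    ∃ s ∈ homGr k (Cone h.toIsChainMap) (Cone h.toIsChainMap) 1,
      ∀ p, del k (Cone h.toIsChainMap) (s p) + s (del k (Cone h.toIsChainMap) p) = p := by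
  have hc := h.toIsChainMap
  refine exists_contraction (V := Cone hc) fun p hp => ?_
  have h1 := congrArg (Cone.fst hc) hp
  have h2 := congrArg (Cone.snd hc) hp
  rw [Cone.fst_del, map_zero] at h1
  rw [Cone.snd_del, map_zero, neg_eq_zero] at h2
  -- For a cycle (y, a) of the cone, a is a cycle with f a = -dy, so a = du by injectivity. Then y +
  -- f u is a cycle, hence equal to f x + dw with x a cycle, and (w, x - u) has boundary (y, a).
  obtain ⟨u, hu⟩ := h.inj _ h2 ⟨- Cone.fst hc p, by rw [map_neg, eq_neg_iff_add_eq_zero, add_comm, h1]⟩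
  have h3 : del k Y (Cone.fst hc p + f u) = 0 := by
    rw [map_add, ← h.map_del, ← hu, h1]
  obtain ⟨x, hx, w, hw⟩ := h.surj _ h3
  refine ⟨Cone.inl hc w + Cone.inr hc (x - u), Cone.ext hc ?_ ?_⟩
  · rw [Cone.fst_del]
    simp only [map_add, Cone.fst_inl, Cone.fst_inr, Cone.snd_inl, Cone.snd_inr, map_sub]
    rw [eq_sub_of_add_eq hw]
    simp only [map_zero]
    abel
  · rw [Cone.snd_del]
    simp only [map_add, Cone.snd_inl, Cone.snd_inr, map_sub, map_zero, hx, ← hu]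
    abel

end Cone

/-! ### Induction on words -/

section BarBasics

variable {k : Type*} [Field k] {V : Type*} [AddCommGroup V] [Module k V]

theorem Bar.induct {p : Bar k V → Prop} (nil : p Bar.nil) (cons : ∀ v w, p w → p (Bar.cons v w))
    (add : ∀ v w, p v → p w → p (v + w)) (smul : ∀ (c : k) w, p w → p (c • w)) (w : Bar k V) :
    p w := by
  let S : Submodule k (Bar k V) :=
    { carrier := {w | p w}
      add_mem' := fun {a b} ha hb => add a b ha hb
      zero_mem' := by
        have h := smul 0 Bar.nil nil
        rw [zero_smul] at h
        exact h
      smul_mem' := fun c w hw => smul c w hw }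
  have hS : S.mkQ = 0 := Bar.ext' (by simpa using (show Bar.nil ∈ S from nil)) fun v w hw => by
    rw [LinearMap.zero_apply, Submodule.mkQ_apply, Submodule.Quotient.mk_eq_zero] at hw ⊢
    exact cons v w hw
  have h := LinearMap.congr_fun hS w
  rw [LinearMap.zero_apply, Submodule.mkQ_apply, Submodule.Quotient.mk_eq_zero] at h
  exact h

end BarBasics

/-! ### Twisted differentials and convolution with the canonical cochain -/

section TwistedHom

variable {k : Type*} [Field k] {C : Type*} [AddCommGroup C] [Module k C] [Coalgebra k C]
  [DGCoalg k C] {A : Type*} [Ring A] [Algebra k A] [DGA k A]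

theorem neg_conv (f g : C →ₗ[k] A) : conv (-f) g = -conv f g := 
  neg_mul (α := ConvAlg k C A) f g

theorem conv_neg (f g : C →ₗ[k] A) : conv f (-g) = -conv f g := 
  mul_neg (α := ConvAlg k C A) f g

/-- The differential on linear maps, twisted by `t`. -/
def twHom (t f : C →ₗ[k] A) : C →ₗ[k] A := homDel f + conv t f - conv (hat f) t

theorem val_twistDel (t : MC k (ConvDG k C A)) (f : ConvDG k C A) :
    (twistDel t f).val = twHom t.val.val f.val := by
  rw [twistDel_apply, map_sub, map_add, ConvDG.val_mul, ConvDG.val_mul, ConvDG.val_sgn,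
    ConvDG.val_del, twHom]

theorem val_del_twist (t : MC k (ConvDG k C A)) (f : ConvDG k C A) :
    ConvDG.val (del k (Twist t) f : ConvDG k C A) = twHom t.val.val f.val := val_twistDel t f

variable {V : Type*} [AddCommGroup V] [Module k V] [NDGA k V]

/-- The cochain `Bar.proj i` sees only one-letter words, so of all splittings only the one after the
first letter contributes. The operator `tw (j + 1)` is the Koszul sign of moving g past a letter of
suspended degree j + 1. -/
theorem conv_proj_cons (i : NDGHom k V A) (g : Bar k V →ₗ[k] A) {j : ℤ} {r : V} (hr : r ∈ gr k V j)
    (w : Bar k V) :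
    conv (Bar.proj i) g (Bar.cons r w) = i.toLinearMap r * tw (j + 1) g w := by
  have h : LinearMap.mul' k A ∘ₗ km (Bar.proj i) g ∘ₗ (Bar.cons r).rTensor (Bar k V) =
      LinearMap.mulLeft k (i.toLinearMap r) ∘ₗ tw (j + 1) g ∘ₗ
        (TensorProduct.lid k (Bar k V)).toLinearMap ∘ₗ (Bar.counit).rTensor (Bar k V) := by
    refine gr_ext₂ fun m n x hx y hy => ?_
    simp only [LinearMap.comp_apply, LinearMap.rTensor_tmul, km_tmul (Bar.cons_mem hr hx),
      LinearMap.mul'_apply, Bar.proj_cons, LinearEquiv.coe_coe, TensorProduct.lid_tmul,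
      LinearMap.mulLeft_apply, map_smul, smul_mul_assoc]
    by_cases hm : m = 0
    · subst hm; simp
    · have : Bar.counit x = 0 := DGCoalg.counit_eq_zero m hm x hx
      simp [this]
  have h1 := LinearMap.congr_fun h (Bar.comul w)
  have h2 : (Bar.counit).rTensor (Bar k V) (Bar.comul w) = 1 ⊗ₜ w :=
    Coalgebra.rTensor_counit_comul (R := k) (A := Bar k V) w
  simp only [LinearMap.comp_apply, h2, LinearEquiv.coe_coe, TensorProduct.lid_tmul, one_smul,
    LinearMap.mulLeft_apply] at h1
  rw [conv, LinearMap.comp_apply, LinearMap.comp_apply, Bar.comul_def, Bar.comul_cons, map_add,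
    map_add, h1, km_tmul Bar.nil_mem, Bar.proj_nil]
  simp

theorem conv_proj_nil (i : NDGHom k V A) (g : Bar k V →ₗ[k] A) :
    conv (Bar.proj i) g Bar.nil = 0 := by
  rw [conv, LinearMap.comp_apply, LinearMap.comp_apply, Bar.comul_def, Bar.comul_nil,
    km_tmul Bar.nil_mem, Bar.proj_nil]
  simp

/-- On this side it is the last letter that is split off, so there is no closed formula in terms of
the first letter but only a recursion. The first letter moves into f, and the sign is that of its
suspended degree. -/
theorem conv_cons_proj (i : NDGHom k V A) (f : Bar k V →ₗ[k] A) (r : V) (w : Bar k V) :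
    conv f (Bar.proj i) (Bar.cons r w) = Bar.counit w • (f Bar.nil * i.toLinearMap r) -
      conv (f ∘ₗ Bar.cons (sgn k V r)) (Bar.proj i) w := by
  rw [conv_apply_of_mem (Bar.proj_mem i) (by decide), conv_apply_of_mem (Bar.proj_mem i) (by decide),
    Bar.comul_def, Bar.comul_cons, map_add, map_add, map_add, sub_eq_add_neg]
  congr 1
  · simp [Bar.sgn_nil, Bar.proj_cons]
  · generalize Bar.comul w = t
    induction t with
    | zero => simp
    | add s t hs ht => simp only [map_add, hs, ht, neg_add]
    | tmul x y => simp [Bar.sgn_cons]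

theorem conv_nil_proj (i : NDGHom k V A) (f : Bar k V →ₗ[k] A) :
    conv f (Bar.proj i) Bar.nil = 0 := by
  rw [conv_apply_of_mem (Bar.proj_mem i) (by decide), Bar.comul_def, Bar.comul_nil]
  simp [Bar.proj_nil]

end TwistedHom

/-! ### The normalization homotopy -/

section Normalization

variable {k : Type*} [Field k] {A : Type*} [Ring A] [Algebra k A] [DGA k A] (ε : DGHom k A k)

/-- The augmentation as a linear functional. -/
def augL : A →ₗ[k] k := ε.toAlgHom.toLinearMap

/-- The projection `r ↦ r - ε(r)` onto the augmentation ideal. -/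
def augBar : A →ₗ[k] A := LinearMap.id - (Algebra.linearMap k A) ∘ₗ augL ε

theorem augBar_apply (r : A) : augBar ε r = r - augL ε r • (1 : A) := by
  simp [augBar, Algebra.algebraMap_eq_smul_one]

theorem augL_one : augL ε 1 = 1 := map_one ε.toAlgHom

theorem augL_mul (r s : A) : augL ε (r * s) = augL ε r * augL ε s := map_mul ε.toAlgHom r s

theorem augL_of_mem {n : ℤ} (hn : n ≠ 0) {r : A} (hr : r ∈ gr k A n) : augL ε r = 0 :=
  (ground_mem k hn).1 (ε.map_mem n r hr)

theorem augL_sgn (r : A) : augL ε (sgn k A r) = augL ε r := by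
  refine gr_induction k (p := fun r => augL ε (sgn k A r) = augL ε r) ?_ (by simp) ?_ r
  · intro n v hv
    rw [sgn_of_mem hv, map_smul]
    by_cases h : n = 0
    · subst h; simp
    · rw [augL_of_mem ε h hv, smul_zero]
  · intro v w hv hw
    simp only [map_add, hv, hw]

theorem augL_del (r : A) : augL ε (del k A r) = 0 := ε.map_del r

theorem augL_augBar (r : A) : augL ε (augBar ε r) = 0 := by
  rw [augBar_apply, map_sub, map_smul, augL_one, smul_eq_mul, mul_one, sub_self]

theorem augBar_of_zero {r : A} (hr : augL ε r = 0) : augBar ε r = r := by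
  rw [augBar_apply, hr, zero_smul, sub_zero]

theorem augBar_one : augBar ε 1 = 0 := by rw [augBar_apply, augL_one, one_smul, sub_self]

theorem augBar_mem {n : ℤ} {r : A} (hr : r ∈ gr k A n) : augBar ε r ∈ gr k A n := by
  rw [augBar_apply]
  by_cases h : n = 0
  · subst h
    exact sub_mem hr (Submodule.smul_mem _ _ DGA.one_mem)
  · rw [augL_of_mem ε h hr, zero_smul, sub_zero]; exact hr

theorem sgn_augBar (r : A) : sgn k A (augBar ε r) = augBar ε (sgn k A r) := by
  rw [augBar_apply, augBar_apply, map_sub, map_smul, DGA.sgn_one, augL_sgn]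

theorem eq_add_augBar (r : A) : r = augL ε r • (1 : A) + augBar ε r := by
  rw [augBar_apply]; abel

/-- The algebra is k·1 ⊕ ker ε. In the computations with `unitDup` the first letter can thus be
taken to be either the unit or an element of the augmentation ideal. -/
theorem linear_aug_ext {X : Type*} [AddCommGroup X] [Module k X] {f g : A →ₗ[k] X}
    (h1 : f 1 = g 1) (h0 : ∀ r, augL ε r = 0 → f r = g r) : f = g := by
  ext r
  rw [eq_add_augBar ε r, map_add, map_add, map_smul, map_smul, h1, h0 _ (augL_augBar ε r)]

/-- The homotopy that doubles the first unit of a word. -/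
def unitDup : Bar k A →ₗ[k] Bar k A :=
  Bar.rec' 0 (-(LinearMap.lsmul k (Bar k A →ₗ[k] Bar k A)).flip (Bar.cons 1 ∘ₗ Bar.cons 1) ∘ₗ augL ε)
    (-(Bar.cons ∘ₗ sgn k A ∘ₗ augBar ε))

theorem unitDup_nil : unitDup ε Bar.nil = 0 := by simp [unitDup]

theorem unitDup_cons (r : A) (w : Bar k A) : unitDup ε (Bar.cons r w) =
    -(augL ε r • Bar.cons 1 (Bar.cons 1 w)) - Bar.cons (sgn k A (augBar ε r)) (unitDup ε w) := by
  simp [unitDup]; abel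

theorem unitDup_cons_one (w : Bar k A) :
    unitDup ε (Bar.cons 1 w) = - Bar.cons 1 (Bar.cons 1 w) := by
  simp [unitDup_cons, augL_one, augBar_one]

theorem unitDup_cons_bar {r : A} (hr : augL ε r = 0) (w : Bar k A) :
    unitDup ε (Bar.cons r w) = - Bar.cons (sgn k A r) (unitDup ε w) := by
  simp [unitDup_cons, hr, augBar_of_zero]

/-- Letterwise projection onto the augmentation ideal. -/
def wordsNorm : Bar k A →ₗ[k] Bar k A := Bar.rec' Bar.nil 0 (Bar.cons ∘ₗ augBar ε)

theorem wordsNorm_nil : wordsNorm ε Bar.nil = Bar.nil := by simp [wordsNorm]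

theorem wordsNorm_cons (r : A) (w : Bar k A) :
    wordsNorm ε (Bar.cons r w) = Bar.cons (augBar ε r) (wordsNorm ε w) := by simp [wordsNorm]

/-- The part of `1 - wordsNorm` where the first unit is not the last letter. -/
def unitInner : Bar k A →ₗ[k] Bar k A :=
  Bar.rec' 0 ((LinearMap.lsmul k (Bar k A →ₗ[k] Bar k A)).flip
    (Bar.cons 1 - (LinearMap.lsmul k (Bar k A)).flip (Bar.cons 1 Bar.nil) ∘ₗ Bar.counit) ∘ₗ augL ε)
    (Bar.cons ∘ₗ augBar ε)

theorem unitInner_nil : unitInner ε Bar.nil = 0 := by simp [unitInner]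

theorem unitInner_cons (r : A) (w : Bar k A) : unitInner ε (Bar.cons r w) =
    augL ε r • (Bar.cons 1 w - Bar.counit w • Bar.cons 1 Bar.nil) +
      Bar.cons (augBar ε r) (unitInner ε w) := by
  simp [unitInner]

/-- The part of `1 - wordsNorm` where the first unit is the last letter. -/
def unitLast : Bar k A →ₗ[k] Bar k A :=
  Bar.rec' 0 ((LinearMap.lsmul k (Bar k A →ₗ[k] Bar k A)).flip
    ((LinearMap.lsmul k (Bar k A)).flip (Bar.cons 1 Bar.nil) ∘ₗ Bar.counit) ∘ₗ augL ε)
    (Bar.cons ∘ₗ augBar ε)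

theorem unitLast_nil : unitLast ε Bar.nil = 0 := by simp [unitLast]

theorem unitLast_cons (r : A) (w : Bar k A) : unitLast ε (Bar.cons r w) =
    augL ε r • Bar.counit w • Bar.cons 1 Bar.nil + Bar.cons (augBar ε r) (unitLast ε w) := by
  simp [unitLast]

theorem unitInner_add_unitLast (w : Bar k A) :
    unitInner ε w + unitLast ε w = w - wordsNorm ε w := by
  have : unitInner ε + unitLast ε = LinearMap.id - wordsNorm ε := by
    refine Bar.ext' (by simp [unitInner_nil, unitLast_nil, wordsNorm_nil]) fun r w hw => ?_
    simp only [LinearMap.add_apply, LinearMap.sub_apply, LinearMap.id_apply] at hw ⊢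
    rw [unitInner_cons, unitLast_cons, wordsNorm_cons]
    have h1 : Bar.cons r w = augL ε r • Bar.cons 1 w + Bar.cons (augBar ε r) w := by
      conv_lhs => rw [eq_add_augBar ε r]
      simp
    have h2 : Bar.cons (augBar ε r) (unitInner ε w) + Bar.cons (augBar ε r) (unitLast ε w) =
        Bar.cons (augBar ε r) w - Bar.cons (augBar ε r) (wordsNorm ε w) := by
      rw [← map_add, hw, map_sub]
    rw [h1, add_sub_assoc, ← h2, smul_sub]
    abel
  exact LinearMap.congr_fun this w

/-- Correction term in the comparison of `unitDup` with the differential. -/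
def unitFirst : Bar k A →ₗ[k] Bar k A :=
  Bar.rec' 0 ((LinearMap.lsmul k (Bar k A →ₗ[k] Bar k A)).flip
    (Bar.cons 1 - unitDup ε) ∘ₗ augL ε) 0

theorem unitFirst_nil : unitFirst ε Bar.nil = 0 := by simp [unitFirst]

theorem unitFirst_cons (r : A) (w : Bar k A) : unitFirst ε (Bar.cons r w) =
    augL ε r • (Bar.cons 1 w - unitDup ε w) := by
  simp [unitFirst]

theorem ndga_mul (x y : A) : NDGA.mul (k := k) x y = x * y := rfl

/-- The defect comes from a unit directly behind r. Before merging, this unit is the one to be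
doubled; the product r·1 lies in the augmentation ideal, so after merging the next unit of the word
is doubled instead. -/
theorem unitDup_merge {r : A} (hr : augL ε r = 0) (w : Bar k A) :
    unitDup ε (Bar.merge r w) =
      Bar.merge (sgn k A r) (unitDup ε w) + Bar.cons r (unitFirst ε w) := by
  have : unitDup ε ∘ₗ Bar.merge r = Bar.merge (sgn k A r) ∘ₗ unitDup ε +
      Bar.cons r ∘ₗ unitFirst ε := by
    refine Bar.ext' (by simp [unitDup_nil, unitFirst_nil]) fun s w _ => ?_
    simp only [LinearMap.comp_apply, LinearMap.add_apply, Bar.merge_cons, unitFirst_cons,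
      unitDup_cons, map_sub, map_neg, map_smul, sgn_sgn, ndga_mul, augL_mul, augL_sgn, hr,
      zero_mul, zero_smul, mul_one]
    have h : augBar ε (sgn k A r * s) = sgn k A r * s :=
      augBar_of_zero ε (by rw [augL_mul, augL_sgn, hr, zero_mul])
    rw [h, DGA.sgn_mul, sgn_sgn, augBar_apply]
    simp only [map_sub, map_smul, DGA.sgn_one, mul_sub, mul_smul_comm, mul_one,
      LinearMap.sub_apply, LinearMap.smul_apply, smul_sub]
    abel
  exact LinearMap.congr_fun this w

theorem merge_one (w : Bar k A) : Bar.merge 1 w = w - Bar.counit w • Bar.nil := by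
  have : Bar.merge (1 : A) = LinearMap.id -
      (LinearMap.lsmul k (Bar k A)).flip Bar.nil ∘ₗ Bar.counit := by
    refine Bar.ext' (by simp [Bar.counit_nil]) fun s w _ => ?_
    simp [Bar.counit_cons, ndga_mul]
  have h := LinearMap.congr_fun this w
  simpa using h

/-- A doubled unit merges with itself and with its neighbours, and these terms cancel except at the
two ends of the word. At the front `unitFirst` remains, and a unit in last position has no right
neighbour, so `unitInner` appears in place of 1 - `wordsNorm`. Both defects are made up for by the
outer terms of the twisted differential, where the first or last letter acts on the coefficients. -/
theorem unitDup_dif (w : Bar k A) :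
    unitDup ε (Bar.dif w) + Bar.dif (unitDup ε w) + unitFirst ε w = unitInner ε w := by
  have : unitDup ε ∘ₗ Bar.dif + Bar.dif ∘ₗ unitDup ε + unitFirst ε = unitInner ε := by
    refine Bar.ext' (by simp [unitDup_nil, unitFirst_nil, unitInner_nil, Bar.dif_nil])
      fun r w hw => ?_
    simp only [LinearMap.add_apply, LinearMap.comp_apply] at hw ⊢
    revert r
    have key : ((unitDup ε ∘ₗ Bar.dif + Bar.dif ∘ₗ unitDup ε + unitFirst ε) ∘ₗ
        (Bar.cons : A →ₗ[k] Bar k A →ₗ[k] Bar k A).flip w) =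
        unitInner ε ∘ₗ (Bar.cons : A →ₗ[k] Bar k A →ₗ[k] Bar k A).flip w := by
      refine linear_aug_ext ε ?_ fun r hr => ?_
      · simp only [LinearMap.comp_apply, LinearMap.add_apply, LinearMap.flip_apply]
        simp only [Bar.dif_cons, unitDup_cons_one, map_neg, map_sub, merge_one, DGA.del_one,
          DGA.sgn_one, map_zero, LinearMap.zero_apply, unitFirst_cons, unitInner_cons, augL_one,
          augBar_one, map_smul, unitDup_nil, Bar.counit_cons]
        simp
        abel
      · simp only [LinearMap.comp_apply, LinearMap.add_apply, LinearMap.flip_apply]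
        have h1 : augL ε (del k A r) = 0 := augL_del ε r
        have h2 : augL ε (sgn k A r) = 0 := by rw [augL_sgn, hr]
        rw [Bar.dif_cons, map_sub, map_sub, unitDup_merge ε hr, unitDup_cons_bar ε h1,
          unitDup_cons_bar ε h2, unitDup_cons_bar ε hr, map_neg, Bar.dif_cons, sgn_sgn, sgn_del,
          unitFirst_cons, unitInner_cons, hr, augBar_of_zero ε hr, ← hw]
        simp only [map_add, zero_smul, map_neg, LinearMap.neg_apply]
        rw [show del k A (sgn k A r) = - sgn k A (del k A r) by rw [sgn_del, neg_neg]]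
        simp only [map_neg, LinearMap.neg_apply]
        abel
    intro r
    exact LinearMap.congr_fun key r
  exact LinearMap.congr_fun this w

theorem sgn_unitDup (w : Bar k A) :
    sgn k (Bar k A) (unitDup ε w) = - unitDup ε (sgn k (Bar k A) w) := by
  have : sgn k (Bar k A) ∘ₗ unitDup ε = -(unitDup ε ∘ₗ sgn k (Bar k A)) := by
    refine Bar.ext' (by simp [unitDup_nil, Bar.sgn_nil]) fun r w hw => ?_
    simp only [LinearMap.comp_apply, LinearMap.neg_apply] at hw ⊢
    rw [Bar.sgn_cons, map_neg, unitDup_cons, unitDup_cons, map_sub, map_neg, map_smul,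
      Bar.sgn_cons, Bar.sgn_cons, Bar.sgn_cons, DGA.sgn_one, augL_sgn, hw, sgn_augBar, sgn_augBar]
    simp [sub_eq_add_neg]
  exact LinearMap.congr_fun this w

theorem hat_unitDup : hat (unitDup ε) = - unitDup ε := by
  ext w
  simp only [hat, LinearMap.comp_apply, sgn_unitDup, sgn_sgn, LinearMap.neg_apply]

theorem unitDup_mem : unitDup ε ∈ homGr k (Bar k A) (Bar k A) 1 := by
  intro n w hw
  refine Bar.induction_gr (p := fun n w => unitDup ε w ∈ gr k (Bar k A) (n + 1)) ?_ ?_ ?_ ?_ ?_ hw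
  · rw [unitDup_nil]; exact zero_mem _
  · intro j r hr n w hw h
    rw [unitDup_cons]
    refine sub_mem (neg_mem ?_) ?_
    · by_cases hj : j = 0
      · subst hj
        have h1 := Bar.cons_mem (DGA.one_mem (k := k) (A := A))
          (Bar.cons_mem (DGA.one_mem (k := k) (A := A)) hw)
        exact Submodule.smul_mem _ _ (gr_of_eq h1 (by ring))
      · rw [augL_of_mem ε hj hr, zero_smul]; exact zero_mem _
    · rw [sgn_of_mem (augBar_mem ε hr), map_smul, LinearMap.smul_apply]
      exact Submodule.smul_mem _ _ (gr_of_eq (Bar.cons_mem (augBar_mem ε hr) h) (by ring))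
  · intro n; rw [map_zero]; exact zero_mem _
  · intro n x y hx hy
    rw [map_add]; exact add_mem hx hy
  · intro n c x hx
    rw [map_smul]; exact Submodule.smul_mem _ _ hx

section Coefficients

variable {B : Type*} [Ring B] [Algebra k B] [DGA k B] (i : NDGHom k A B)

/-- The left action cancels the front defect `unitFirst`: doubling a unit in first position and
letting one copy act gives the identity, since i is unital. A first letter in the augmentation ideal
only passes through. -/
theorem conv_proj_unitDup (hi : i.toLinearMap 1 = 1) (f : Bar k A →ₗ[k] B) (w : Bar k A) :
    conv (Bar.proj i) (hat f ∘ₗ unitDup ε) w - conv (Bar.proj i) (hat f) (unitDup ε w) =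
      f (unitFirst ε w) := by
  have : conv (Bar.proj i) (hat f ∘ₗ unitDup ε) - conv (Bar.proj i) (hat f) ∘ₗ unitDup ε =
      f ∘ₗ unitFirst ε := by
    refine Bar.ext_hom (by simp [conv_proj_nil, unitDup_nil, unitFirst_nil]) fun j r hr w _ => ?_
    have h1 : tw (j + 1) (hat f ∘ₗ unitDup ε) =
        -(koszul k j • tw (j + 1) (hat f) ∘ₗ unitDup ε) := by
      rw [tw_comp, tw_of_mem (unitDup_mem ε), mul_one, koszul_add]
      ext; simp
    simp only [LinearMap.sub_apply, LinearMap.comp_apply, conv_proj_cons i _ hr, unitDup_cons,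
      map_sub, map_neg, map_smul, conv_proj_cons i _ (DGA.one_mem (k := k) (A := A)),
      sgn_of_mem (augBar_mem ε hr), LinearMap.smul_apply, conv_proj_cons i _ (augBar_mem ε hr), h1,
      hi, unitFirst_cons, one_mul, LinearMap.neg_apply, mul_neg, mul_smul_comm]
    have h2 : tw (0 + 1) (hat f) = f := by simp [tw]
    rw [h2]
    by_cases hj : j = 0
    · subst hj
      rw [h2]
      have h3 : i.toLinearMap r = augL ε r • 1 + i.toLinearMap (augBar ε r) := by
        conv_lhs => rw [eq_add_augBar ε r]
        rw [map_add, map_smul, hi]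
      rw [h3, add_mul]
      simp only [koszul_zero, one_smul, smul_mul_assoc, one_mul, smul_sub]
      abel
    · rw [augL_of_mem ε hj hr, augBar_of_zero ε (augL_of_mem ε hj hr)]
      simp
  exact LinearMap.congr_fun this w

theorem counit_unitDup (w : Bar k A) : Bar.counit (unitDup ε w) = 0 := by
  have : Bar.counit ∘ₗ unitDup ε = 0 := by
    refine Bar.ext' (by simp [unitDup_nil]) fun r w _ => ?_
    simp [unitDup_cons, Bar.counit_cons]
  exact LinearMap.congr_fun this w

/-- The right action supplies the missing contribution of a unit in last position. The induction
runs over all f at once, because removing the first letter replaces f by its composite with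
`Bar.cons`. -/
theorem conv_unitDup_proj (hi : i.toLinearMap 1 = 1) (w : Bar k A) : ∀ f : Bar k A →ₗ[k] B,
    conv (f ∘ₗ unitDup ε) (Bar.proj i) w + conv f (Bar.proj i) (unitDup ε w) =
      f (unitLast ε w) := by
  refine Bar.induct (p := fun w => ∀ f : Bar k A →ₗ[k] B,
    conv (f ∘ₗ unitDup ε) (Bar.proj i) w + conv f (Bar.proj i) (unitDup ε w) =
      f (unitLast ε w)) ?_ ?_ ?_ ?_ w
  · intro f
    simp [conv_nil_proj, unitDup_nil, unitLast_nil]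
  · intro r w hw f
    have key : ((conv (f ∘ₗ unitDup ε) (Bar.proj i) + conv f (Bar.proj i) ∘ₗ unitDup ε) ∘ₗ
        (Bar.cons : A →ₗ[k] Bar k A →ₗ[k] Bar k A).flip w) =
        (f ∘ₗ unitLast ε) ∘ₗ (Bar.cons : A →ₗ[k] Bar k A →ₗ[k] Bar k A).flip w := by
      refine linear_aug_ext ε ?_ fun r hr => ?_
      · simp only [LinearMap.comp_apply, LinearMap.add_apply, LinearMap.flip_apply,
          unitDup_cons_one, map_neg, conv_cons_proj, unitDup_nil, map_zero, smul_zero,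
          DGA.sgn_one, unitLast_cons, augL_one, augBar_one, Bar.counit_cons, hi, one_smul,
          zero_smul, LinearMap.zero_apply, add_zero, mul_one, map_smul]
        have h1 : (f ∘ₗ unitDup ε) ∘ₗ Bar.cons 1 = -((f ∘ₗ Bar.cons 1) ∘ₗ Bar.cons 1) := by
          ext x; simp [unitDup_cons_one]
        rw [h1, neg_conv, LinearMap.neg_apply]
        abel
      · have h2 : augL ε (sgn k A r) = 0 := by rw [augL_sgn, hr]
        simp only [LinearMap.comp_apply, LinearMap.add_apply, LinearMap.flip_apply,
          unitDup_cons_bar ε hr, map_neg, conv_cons_proj, unitDup_nil, map_zero, zero_mul,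
          smul_zero, unitLast_cons, hr, augBar_of_zero ε hr, counit_unitDup, zero_smul, sgn_sgn,
          zero_add, zero_sub, neg_neg]
        have h1 : (f ∘ₗ unitDup ε) ∘ₗ Bar.cons (sgn k A r) =
            -((f ∘ₗ Bar.cons r) ∘ₗ unitDup ε) := by
          ext x; simp [unitDup_cons_bar ε h2]
        rw [h1, neg_conv, LinearMap.neg_apply, neg_neg, hw]
        rfl
    exact LinearMap.congr_fun key r
  · intro v w hv hw f
    simp only [map_add, ← hv, ← hw]
    abel
  · intro c w hw f
    simp only [map_smul, ← hw, smul_add]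

/-- The homotopy is f ↦ f∘`unitDup` up to sign. The internal differential of B contributes nothing,
the bar differential contributes `unitInner` minus `unitFirst`, and the left and right actions
contribute `unitFirst` and `unitLast`; the sum is 1 - `wordsNorm`. -/
theorem twHom_unitDup (hi : i.toLinearMap 1 = 1) (f : Bar k A →ₗ[k] B) :
    twHom (Bar.proj i) (hat f ∘ₗ unitDup ε) + hat (twHom (Bar.proj i) f) ∘ₗ unitDup ε =
      f - f ∘ₗ wordsNorm ε := by
  have hτ : hat (Bar.proj i) = - Bar.proj i := by
    rw [hat_of_mem (Bar.proj_mem i), koszul_neg, koszul_one]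
    ext x
    simp
  have hd : hat (Bar.dif : Bar k A →ₗ[k] Bar k A) = -Bar.dif := hat_del
  ext w
  have h1 := conv_proj_unitDup ε i hi f w
  have h2 := conv_unitDup_proj ε i hi w f
  have h3 := congrArg f (unitDup_dif ε w)
  have h4 := congrArg f (unitInner_add_unitLast ε w)
  rw [map_add, map_sub] at h4
  rw [map_add, map_add] at h3
  have h5 : f (unitDup ε (Bar.dif w)) + f (Bar.dif (unitDup ε w)) = f (unitInner ε w) - f (unitFirst ε w) := by
    rw [← h3]; abel
  simp only [twHom, homDel_apply, hat_add, hat_sub, hat_comp, hat_conv, hat_hat, hτ, hat_unitDup,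
    hat_del, LinearMap.comp_neg, LinearMap.neg_comp, neg_conv, conv_neg, hd, LinearMap.add_apply,
    LinearMap.sub_apply, LinearMap.comp_apply, LinearMap.neg_apply, Bar.del_def]
  rw [← h4, ← h2, eq_add_of_sub_eq h5.symm, ← h1]
  abel

end Coefficients

end Normalization

/-! ### Twisted homotopies and precomposition -/

section Precomposition

variable {k : Type*} [Field k]

theorem DGHom.isChainMap {A B : Type*} [Ring A] [Algebra k A] [DGA k A] [Ring B] [Algebra k B]
    [DGA k B] (f : DGHom k A B) : IsChainMap k f.toAlgHom.toLinearMap :=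
  ⟨f.map_mem, f.map_del⟩

theorem DGHom.twist_isQuasiIso_of_homotopy {A B : Type*} [Ring A] [Algebra k A] [DGA k A] [Ring B]
    [Algebra k B] [DGA k B] (f : DGHom k A B) (t : MC k A) (s : MC k B)
    (h : f.toAlgHom t.val = s.val) (g : B →ₗ[k] A) (H : A →ₗ[k] A)
    (hfg : ∀ y, f.toAlgHom (g y) = y)
    (hH : ∀ x, twistDel t (H x) + H (twistDel t x) = x - g (f.toAlgHom x)) :
    IsQuasiIso k (f.twist t s h).toAlgHom.toLinearMap :=
  IsQuasiIso.of_homotopy (X := Twist t) (Y := Twist s) (f.twist t s h).isChainMap g H hfg hH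

variable {C D : Type*} [AddCommGroup C] [Module k C] [Coalgebra k C] [DGCoalg k C]
  [AddCommGroup D] [Module k D] [Coalgebra k D] [DGCoalg k D]
  {A : Type*} [Ring A] [Algebra k A] [DGA k A]

theorem comp_mem_homGr {V W X : Type*} [AddCommGroup V] [Module k V] [AddCommGroup W] [Module k W]
    [AddCommGroup X] [Module k X] [GrMod k V] [GrMod k W] [GrMod k X] {m n : ℤ} {f : W →ₗ[k] X}
    {g : V →ₗ[k] W} (hf : f ∈ homGr k W X m) (hg : g ∈ homGr k V W n) :
    f ∘ₗ g ∈ homGr k V X (m + n) := fun i v hv =>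
  gr_of_eq (hf _ _ (hg i v hv)) (by ring)

variable (A) in
/-- Precomposition with a homogeneous linear map. -/
def ConvDG.compRight {m : ℤ} (κ : C →ₗ[k] D) (hκ : κ ∈ homGr k C D m) :
    ConvDG k D A →ₗ[k] ConvDG k C A where
  toFun f := ConvDG.mk (f.val ∘ₗ κ) (by
    refine Submodule.iSup_induction (motive := fun f : D →ₗ[k] A => f ∘ₗ κ ∈
      ⨆ n, homGr k C A n) _ f.val_mem ?_ ?_ ?_
    · intro n f hf
      exact Submodule.mem_iSup_of_mem (n + m) (comp_mem_homGr hf hκ)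
    · rw [LinearMap.zero_comp]; exact zero_mem _
    · intro f g hf hg
      rw [LinearMap.add_comp]; exact add_mem hf hg)
  map_add' _ _ := ConvDG.val_injective rfl
  map_smul' _ _ := ConvDG.val_injective rfl

theorem ConvDG.compRight_val {m : ℤ} (κ : C →ₗ[k] D) (hκ : κ ∈ homGr k C D m)
    (f : ConvDG k D A) : (ConvDG.compRight A κ hκ f).val = f.val ∘ₗ κ := rfl

end Precomposition

/-! ### Restriction to words in the augmentation ideal -/

section NormalizedCochains

variable {k : Type*} [Field k] {A : Type*} [Ring A] [Algebra k A] [DGA k A] (ε : DGHom k A k)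

/-- The letterwise projection of words onto words in the augmentation ideal. -/
def wordsAug : Bar k A →ₗ[k] BarAug ε :=
  Bar.rec' Bar.nil 0 (Bar.cons ∘ₗ (augBar ε).codRestrict (augIdeal ε) (augL_augBar ε))

theorem wordsAug_nil : wordsAug ε Bar.nil = Bar.nil := by simp [wordsAug]

theorem wordsAug_cons (r : A) (w : Bar k A) : wordsAug ε (Bar.cons r w) =
    Bar.cons ((augBar ε).codRestrict (augIdeal ε) (augL_augBar ε) r) (wordsAug ε w) := by
  simp [wordsAug]

theorem wordsAug_mem : wordsAug ε ∈ homGr k (Bar k A) (BarAug ε) 0 := by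
  intro n w hw
  rw [add_zero]
  refine Bar.induction_gr (p := fun n w => wordsAug ε w ∈ gr k (BarAug ε) n) ?_ ?_ ?_ ?_ ?_ hw
  · rw [wordsAug_nil]; exact Bar.nil_mem
  · intro j r hr n w hw h
    rw [wordsAug_cons]
    exact Bar.cons_mem (show _ ∈ (gr k A j).comap (augIdeal ε).subtype from augBar_mem ε hr) h
  · intro n; rw [map_zero]; exact zero_mem _
  · intro n x y hx hy
    rw [map_add]; exact add_mem hx hy
  · intro n c x hx
    rw [map_smul]; exact Submodule.smul_mem _ _ hx

theorem mapL_wordsAug (w : Bar k A) : Bar.mapL (augIncl ε) (wordsAug ε w) = wordsNorm ε w := by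
  have : Bar.mapL (augIncl ε) ∘ₗ wordsAug ε = wordsNorm ε := by
    refine Bar.ext' ?_ fun r w h => ?_
    · rw [LinearMap.comp_apply, wordsAug_nil, Bar.mapL_nil, wordsNorm_nil]
    · rw [LinearMap.comp_apply] at h
      rw [LinearMap.comp_apply, wordsAug_cons, Bar.mapL_cons, wordsNorm_cons, h]
      rfl
  exact LinearMap.congr_fun this w

theorem wordsAug_mapL (w : BarAug ε) : wordsAug ε (Bar.mapL (augIncl ε) w) = w := by
  have : wordsAug ε ∘ₗ Bar.mapL (augIncl ε) = LinearMap.id := by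
    refine Bar.ext' ?_ fun r w h => ?_
    · rw [LinearMap.comp_apply, Bar.mapL_nil, wordsAug_nil, LinearMap.id_apply]
    · rw [LinearMap.comp_apply, LinearMap.id_apply] at h
      rw [LinearMap.comp_apply, Bar.mapL_cons, wordsAug_cons, h, LinearMap.id_apply]
      congr 2
      exact Subtype.ext (augBar_of_zero ε r.2)
  exact LinearMap.congr_fun this w

variable {B : Type*} [Ring B] [Algebra k B] [DGA k B]

/-- Cochains on words in an augmented algebra may be restricted to words in the augmentation
ideal. -/
theorem precomp_augIncl_isQuasiIso (i : NDGHom k A B) (hi : i.toLinearMap 1 = 1)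
    (t : MC k (ConvDG k (BarAug ε) B))
    (h : (precomp B (Bar.map (augIncl ε))).toAlgHom (barMC i).val = t.val) :
    IsQuasiIso k ((precomp B (Bar.map (augIncl ε))).twist _ t h).toAlgHom.toLinearMap := by
  -- The section extends a cochain along the letterwise projection `wordsAug`. It need not commute
  -- with the differentials a priori, because the projection is not multiplicative; the homotopy
  -- takes care of that.
  refine DGHom.twist_isQuasiIso_of_homotopy _ _ _ _
    (ConvDG.compRight B (wordsAug ε) (wordsAug_mem ε))
    (ConvDG.compRight B (unitDup ε) (unitDup_mem ε) ∘ₗ sgn k _) ?_ ?_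
  · intro f
    apply ConvDG.val_injective
    rw [precomp_val, ConvDG.compRight_val]
    ext w
    exact congrArg f.val (wordsAug_mapL ε w)
  · intro f
    apply ConvDG.val_injective
    have h1 := twHom_unitDup ε i hi f.val
    rw [map_add, map_sub, val_twistDel, LinearMap.comp_apply, LinearMap.comp_apply,
      ConvDG.compRight_val, ConvDG.compRight_val, ConvDG.val_sgn, ConvDG.val_sgn, val_twistDel,
      barMC_val, h1, ConvDG.compRight_val, precomp_val]
    congr 1
    ext w
    exact congrArg f.val (mapL_wordsAug ε w).symm

/-- The case of coefficients in the algebra itself. The general form is used again for R^! with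
coefficients in k. -/
theorem restrict_isQuasiIso : IsQuasiIso k (restrict ε).toAlgHom.toLinearMap :=
  precomp_augIncl_isQuasiIso ε (NDGHom.id (k := k) A) rfl _ _

end NormalizedCochains

/-! ### The filtration of the bar construction by word length -/

section WordLength

variable {k : Type*} [Field k] {V : Type*} [AddCommGroup V] [Module k V]

variable (k V) in
/-- The span of the words of length less than `n`. -/
def Bar.lenLT : ℕ → Submodule k (Bar k V)
  | 0 => ⊥
  | n + 1 => Submodule.span k {Bar.nil} ⊔ Submodule.map₂ Bar.cons ⊤ (Bar.lenLT n)

theorem Bar.nil_mem_lenLT (n : ℕ) : Bar.nil ∈ Bar.lenLT k V (n + 1) :=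
  Submodule.mem_sup_left (Submodule.mem_span_singleton_self _)

theorem Bar.cons_mem_lenLT {n : ℕ} (v : V) {w : Bar k V} (hw : w ∈ Bar.lenLT k V n) :
    Bar.cons v w ∈ Bar.lenLT k V (n + 1) :=
  Submodule.mem_sup_right (Submodule.apply_mem_map₂ _ trivial hw)

theorem Bar.lenLT_succ_le {n : ℕ} {S : Submodule k (Bar k V)} (hn : Bar.nil ∈ S)
    (hc : ∀ v, ∀ w ∈ Bar.lenLT k V n, Bar.cons v w ∈ S) : Bar.lenLT k V (n + 1) ≤ S :=
  sup_le ((Submodule.span_singleton_le_iff_mem _ _).2 hn)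
    (Submodule.map₂_le.2 fun v _ w hw => hc v w hw)

theorem Bar.lenLT_le_succ (n : ℕ) : Bar.lenLT k V n ≤ Bar.lenLT k V (n + 1) := by
  induction n with
  | zero => exact bot_le
  | succ n ih =>
    exact Bar.lenLT_succ_le (Bar.nil_mem_lenLT _) fun v w hw => Bar.cons_mem_lenLT v (ih hw)

theorem Bar.lenLT_mono {m n : ℕ} (h : m ≤ n) : Bar.lenLT k V m ≤ Bar.lenLT k V n :=
  monotone_nat_of_le_succ Bar.lenLT_le_succ h

theorem Bar.exists_mem_lenLT (w : Bar k V) : ∃ n, w ∈ Bar.lenLT k V n := by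
  refine Bar.induct (p := fun w => ∃ n, w ∈ Bar.lenLT k V n) ⟨1, Bar.nil_mem_lenLT 0⟩ ?_ ?_ ?_ w
  · rintro v w ⟨n, hw⟩
    exact ⟨n + 1, Bar.cons_mem_lenLT v hw⟩
  · rintro v w ⟨m, hv⟩ ⟨n, hw⟩
    exact ⟨max m n, add_mem (Bar.lenLT_mono (le_max_left m n) hv)
      (Bar.lenLT_mono (le_max_right m n) hw)⟩
  · rintro c w ⟨n, hw⟩
    exact ⟨n, Submodule.smul_mem _ c hw⟩

theorem Bar.comul_mem_right {n : ℕ} : Bar.lenLT k V n ≤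
    (Submodule.map₂ (TensorProduct.mk k (Bar k V) (Bar k V)) ⊤ (Bar.lenLT k V n)).comap
      Bar.comul := by
  induction n with
  | zero => exact bot_le
  | succ n ih =>
    refine Bar.lenLT_succ_le ?_ fun v w hw => ?_
    · rw [Submodule.mem_comap, Bar.comul_nil]
      exact Submodule.apply_mem_map₂ _ trivial (Bar.nil_mem_lenLT n)
    · rw [Submodule.mem_comap, Bar.comul_cons]
      refine add_mem (Submodule.apply_mem_map₂ _ trivial (Bar.cons_mem_lenLT v hw)) ?_
      have h : Submodule.map₂ (TensorProduct.mk k (Bar k V) (Bar k V)) ⊤ (Bar.lenLT k V n) ≤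
          (Submodule.map₂ (TensorProduct.mk k (Bar k V) (Bar k V)) ⊤ (Bar.lenLT k V (n + 1))).comap
            ((Bar.cons v).rTensor (Bar k V)) :=
        Submodule.map₂_le.2 fun x _ y hy => Submodule.apply_mem_map₂
          (TensorProduct.mk k (Bar k V) (Bar k V)) (m := Bar.cons v x) trivial
          (Bar.lenLT_le_succ n hy)
      exact h (ih hw)

/-- A nonempty left factor uses up at least one letter. This is why convolution with a cochain that
vanishes on the empty word raises the length filtration. -/
theorem Bar.comul_mem_nil_left {n : ℕ} : Bar.lenLT k V (n + 1) ≤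
    (Submodule.map₂ (TensorProduct.mk k (Bar k V) (Bar k V)) (Submodule.span k {Bar.nil}) ⊤ ⊔
      Submodule.map₂ (TensorProduct.mk k (Bar k V) (Bar k V)) ⊤ (Bar.lenLT k V n)).comap
      Bar.comul := by
  refine Bar.lenLT_succ_le ?_ fun v w hw => ?_
  · rw [Submodule.mem_comap, Bar.comul_nil]
    exact Submodule.mem_sup_left (Submodule.apply_mem_map₂ _
      (Submodule.mem_span_singleton_self _) trivial)
  · rw [Submodule.mem_comap, Bar.comul_cons]
    refine add_mem (Submodule.mem_sup_left (Submodule.apply_mem_map₂ _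
      (Submodule.mem_span_singleton_self _) trivial)) (Submodule.mem_sup_right ?_)
    have h : Submodule.map₂ (TensorProduct.mk k (Bar k V) (Bar k V)) ⊤ (Bar.lenLT k V n) ≤
        (Submodule.map₂ (TensorProduct.mk k (Bar k V) (Bar k V)) ⊤ (Bar.lenLT k V n)).comap
          ((Bar.cons v).rTensor (Bar k V)) :=
      Submodule.map₂_le.2 fun x _ y hy => Submodule.apply_mem_map₂
        (TensorProduct.mk k (Bar k V) (Bar k V)) (m := Bar.cons v x) trivial hy
    exact h (Bar.comul_mem_right hw)

theorem Bar.comul_mem_nil_right {n : ℕ} : Bar.lenLT k V (n + 1) ≤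
    (Submodule.map₂ (TensorProduct.mk k (Bar k V) (Bar k V)) ⊤ (Submodule.span k {Bar.nil}) ⊔
      Submodule.map₂ (TensorProduct.mk k (Bar k V) (Bar k V)) (Bar.lenLT k V n) ⊤).comap
      Bar.comul := by
  induction n with
  | zero =>
    refine Bar.lenLT_succ_le ?_ fun v w hw => ?_
    · rw [Submodule.mem_comap, Bar.comul_nil]
      exact Submodule.mem_sup_left (Submodule.apply_mem_map₂ _ trivial
        (Submodule.mem_span_singleton_self _))
    · rw [(Submodule.mem_bot k).1 hw, map_zero]
      exact zero_mem _
  | succ n ih =>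
    refine Bar.lenLT_succ_le ?_ fun v w hw => ?_
    · rw [Submodule.mem_comap, Bar.comul_nil]
      exact Submodule.mem_sup_left (Submodule.apply_mem_map₂ _ trivial
        (Submodule.mem_span_singleton_self _))
    · rw [Submodule.mem_comap, Bar.comul_cons]
      refine add_mem (Submodule.mem_sup_right (Submodule.apply_mem_map₂ _
        (Bar.nil_mem_lenLT n) trivial)) ?_
      have h := ih hw
      rw [Submodule.mem_comap] at h
      generalize Bar.comul w = t at h
      rw [← Submodule.mem_comap]
      refine SetLike.le_def.1 (sup_le ?_ ?_) h
      · exact Submodule.map₂_le.2 fun x _ y hy => Submodule.mem_sup_left (Submodule.apply_mem_map₂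
          (TensorProduct.mk k (Bar k V) (Bar k V)) (m := Bar.cons v x) trivial hy)
      · exact Submodule.map₂_le.2 fun x hx y _ => Submodule.mem_sup_right (Submodule.apply_mem_map₂
          (TensorProduct.mk k (Bar k V) (Bar k V)) (m := Bar.cons v x) (Bar.cons_mem_lenLT v hx)
          trivial)

theorem Bar.wt_cons [GrMod k V] (c : ℤ → k) {i : ℤ} {v : V} (hv : v ∈ gr k V i) (w : Bar k V) :
    wt k (Bar k V) c (Bar.cons v w) = Bar.cons v (wt k (Bar k V) (fun n => c (i + 1 + n)) w) := by
  have : wt k (Bar k V) c ∘ₗ Bar.cons v =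
      Bar.cons v ∘ₗ wt k (Bar k V) (fun n => c (i + 1 + n)) := gr_ext fun n w hw => by
    rw [LinearMap.comp_apply, LinearMap.comp_apply, wt_of_mem _ (Bar.cons_mem hv hw),
      wt_of_mem _ hw, map_smul]
  exact LinearMap.congr_fun this w

/-- Homogeneous components of short words are combinations of short words. Removing a homogeneous
letter shifts the weight function, so the induction is over all weights. -/
theorem Bar.wt_mem_lenLT [GrMod k V] {n : ℕ} {w : Bar k V} (hw : w ∈ Bar.lenLT k V n)
    (c : ℤ → k) : wt k (Bar k V) c w ∈ Bar.lenLT k V n := by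
  induction n generalizing w c with
  | zero =>
    rw [(Submodule.mem_bot k).1 hw, map_zero]
    exact zero_mem _
  | succ n ih =>
    have h : Bar.lenLT k V (n + 1) ≤ (Bar.lenLT k V (n + 1)).comap (wt k (Bar k V) c) := by
      refine Bar.lenLT_succ_le ?_ fun v w hw => ?_
      · rw [Submodule.mem_comap, wt_of_mem _ Bar.nil_mem]
        exact Submodule.smul_mem _ _ (Bar.nil_mem_lenLT n)
      · refine gr_induction k (p := fun v => Bar.cons v w ∈ _) (fun i v hv => ?_) ?_ ?_ v
        · rw [Submodule.mem_comap, Bar.wt_cons c hv]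
          exact Bar.cons_mem_lenLT v (ih hw _)
        · rw [map_zero, LinearMap.zero_apply]; exact zero_mem _
        · intro a b ha hb
          rw [map_add, LinearMap.add_apply]; exact add_mem ha hb
    exact h hw

theorem Bar.merge_mem_lenLT [NDGA k V] {n : ℕ} (v : V) {w : Bar k V} (hw : w ∈ Bar.lenLT k V n) :
    Bar.merge v w ∈ Bar.lenLT k V n := by
  cases n with
  | zero =>
    rw [(Submodule.mem_bot k).1 hw, map_zero]
    exact zero_mem _
  | succ n =>
    have h : Bar.lenLT k V (n + 1) ≤ (Bar.lenLT k V (n + 1)).comap (Bar.merge v) := by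
      refine Bar.lenLT_succ_le ?_ fun v w hw => ?_
      · rw [Submodule.mem_comap, Bar.merge_nil]; exact zero_mem _
      · rw [Submodule.mem_comap, Bar.merge_cons]; exact Bar.cons_mem_lenLT _ hw
    exact h hw

theorem Bar.dif_mem_lenLT [NDGA k V] {n : ℕ} {w : Bar k V} (hw : w ∈ Bar.lenLT k V n) :
    Bar.dif w ∈ Bar.lenLT k V n := by
  induction n generalizing w with
  | zero =>
    rw [(Submodule.mem_bot k).1 hw, map_zero]
    exact zero_mem _
  | succ n ih =>
    have h : Bar.lenLT k V (n + 1) ≤ (Bar.lenLT k V (n + 1)).comap Bar.dif := by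
      refine Bar.lenLT_succ_le ?_ fun v w hw => ?_
      · rw [Submodule.mem_comap, Bar.dif_nil]; exact zero_mem _
      · rw [Submodule.mem_comap, Bar.dif_cons]
        exact sub_mem (sub_mem (Bar.lenLT_le_succ n (Bar.merge_mem_lenLT v hw))
          (Bar.cons_mem_lenLT _ hw)) (Bar.cons_mem_lenLT _ (ih hw))
    exact h hw

end WordLength

/-! ### The complete filtration on maps out of the bar construction -/

section LengthFiltration

variable {k : Type*} [Field k] {V : Type*} [AddCommGroup V] [Module k V]
  {Q : Type*} [AddCommGroup Q] [Module k Q]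

variable (k V Q) in
/-- The maps that vanish on words of length less than `n`. -/
def lenGE (n : ℕ) : Submodule k (Bar k V →ₗ[k] Q) where
  carrier := {f | ∀ w ∈ Bar.lenLT k V n, f w = 0}
  add_mem' hf hg w hw := by rw [LinearMap.add_apply, hf w hw, hg w hw, add_zero]
  zero_mem' _ _ := rfl
  smul_mem' c f hf w hw := by rw [LinearMap.smul_apply, hf w hw, smul_zero]

theorem mem_lenGE_zero (f : Bar k V →ₗ[k] Q) : f ∈ lenGE k V Q 0 := fun w hw => by
  rw [(Submodule.mem_bot k).1 hw, map_zero]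

theorem mem_lenGE_one {f : Bar k V →ₗ[k] Q} (hf : f Bar.nil = 0) : f ∈ lenGE k V Q 1 := by
  have h : Bar.lenLT k V 1 ≤ LinearMap.ker f := Bar.lenLT_succ_le hf fun v w hw => by
    rw [(Submodule.mem_bot k).1 hw, map_zero]
    exact zero_mem _
  exact fun w hw => h hw

theorem mem_lenGE_succ {n : ℕ} {f : Bar k V →ₗ[k] Q} (h0 : f Bar.nil = 0)
    (hf : ∀ v, f ∘ₗ Bar.cons v ∈ lenGE k V Q n) : f ∈ lenGE k V Q (n + 1) := by
  have h : Bar.lenLT k V (n + 1) ≤ LinearMap.ker f := Bar.lenLT_succ_le h0 fun v w hw => hf v w hw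
  exact fun w hw => h hw

theorem lenGE_anti {m n : ℕ} (h : m ≤ n) : lenGE k V Q n ≤ lenGE k V Q m :=
  fun _ hf w hw => hf w (Bar.lenLT_mono h hw)

theorem eq_zero_of_mem_lenGE {f : Bar k V →ₗ[k] Q} (hf : ∀ n, f ∈ lenGE k V Q n) : f = 0 := by
  ext w
  obtain ⟨n, hn⟩ := Bar.exists_mem_lenLT w
  exact hf n w hn

theorem comp_mem_lenGE {P : Type*} [AddCommGroup P] [Module k P] {n : ℕ} {f : Bar k V →ₗ[k] Q}
    (hf : f ∈ lenGE k V Q n) (g : Q →ₗ[k] P) : g ∘ₗ f ∈ lenGE k V P n := fun w hw => by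
  rw [LinearMap.comp_apply, hf w hw, map_zero]

theorem hat_mem_lenGE [GrMod k V] [GrMod k Q] {n : ℕ} {f : Bar k V →ₗ[k] Q}
    (hf : f ∈ lenGE k V Q n) : hat f ∈ lenGE k V Q n := fun w hw => by
  rw [hat, LinearMap.comp_apply, LinearMap.comp_apply, sgn, sgn,
    hf _ (Bar.wt_mem_lenLT hw _), map_zero]

/-- The map that agrees with `u n` on words of length `n`. -/
def lenDiag (u : ℕ → Bar k V →ₗ[k] Q) : Bar k V →ₗ[k] Q :=
  -- Removing a letter replaces the family u by its shift, so the recursion cannot be done for a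
  -- single u. It produces, for each word, the functional that takes a family to the value at this
  -- word.
  (LinearMap.applyₗ u) ∘ₗ Bar.rec' (X := (ℕ → Bar k V →ₗ[k] Q) →ₗ[k] Q)
    (LinearMap.applyₗ Bar.nil ∘ₗ LinearMap.proj 0) 0
    (LinearMap.mk₂ k (fun v φ => φ ∘ₗ LinearMap.pi fun n =>
        LinearMap.lcomp k Q (Bar.cons v) ∘ₗ LinearMap.proj (n + 1))
      (fun v v' φ => by
        ext u
        rw [LinearMap.add_apply]
        simp only [LinearMap.comp_apply]
        rw [← map_add]
        congr 1
        ext n w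
        simp)
      (fun c v φ => by
        ext u
        rw [LinearMap.smul_apply]
        simp only [LinearMap.comp_apply]
        rw [← map_smul]
        congr 1
        ext n w
        simp)
      (fun v φ φ' => by ext; simp)
      (fun c v φ => by ext; simp))

theorem lenDiag_nil (u : ℕ → Bar k V →ₗ[k] Q) : lenDiag u Bar.nil = u 0 Bar.nil := by
  simp [lenDiag]

theorem lenDiag_cons (u : ℕ → Bar k V →ₗ[k] Q) (v : V) (w : Bar k V) :
    lenDiag u (Bar.cons v w) = lenDiag (fun n => u (n + 1) ∘ₗ Bar.cons v) w := by
  simp only [lenDiag, LinearMap.comp_apply, Bar.rec'_cons]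
  simp only [LinearMap.zero_apply, zero_add, LinearMap.mk₂_apply, LinearMap.applyₗ_apply_apply,
    LinearMap.comp_apply]
  rfl

theorem lenDiag_mem [GrMod k V] [GrMod k Q] {m : ℤ} {u : ℕ → Bar k V →ₗ[k] Q}
    (hu : ∀ n, u n ∈ homGr k (Bar k V) Q m) : lenDiag u ∈ homGr k (Bar k V) Q m := by
  intro n w hw
  refine Bar.induction_gr (p := fun n w => ∀ (m : ℤ) (u : ℕ → Bar k V →ₗ[k] Q),
    (∀ n, u n ∈ homGr k (Bar k V) Q m) → lenDiag u w ∈ gr k Q (n + m)) ?_ ?_ ?_ ?_ ?_ hw m u hu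
  · intro m u hu
    rw [lenDiag_nil]
    exact hu 0 _ _ Bar.nil_mem
  · intro i v hv n w hw h m u hu
    rw [lenDiag_cons]
    refine gr_of_eq (h (i + 1 + m) _ fun n j x hx => ?_) (by ring)
    exact gr_of_eq (hu _ _ _ (Bar.cons_mem hv hx)) (by ring)
  · intro n m u _
    rw [map_zero]; exact zero_mem _
  · intro n x y hx hy m u hu
    rw [map_add]; exact add_mem (hx m u hu) (hy m u hu)
  · intro n c x hx m u hu
    rw [map_smul]; exact Submodule.smul_mem _ _ (hx m u hu)

/-- The hypothesis says that the sequence is Cauchy: from index i on it does not change on words of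
length at most i. Its limit on words of length n is therefore already attained by u n. -/
theorem lenDiag_sub_mem (n : ℕ) (u : ℕ → Bar k V →ₗ[k] Q)
    (hu : ∀ i j, i ≤ j → u j - u i ∈ lenGE k V Q (i + 1)) :
    lenDiag u - u n ∈ lenGE k V Q (n + 1) := by
  suffices h : ∀ n (u : ℕ → Bar k V →ₗ[k] Q), (∀ i j, i ≤ j → u j - u i ∈ lenGE k V Q (i + 1)) →
      ∀ m, n ≤ m → lenDiag u - u m ∈ lenGE k V Q (n + 1) from h n u hu n le_rfl
  clear hu n u
  intro n
  induction n with
  | zero =>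
    intro u hu m hm
    refine mem_lenGE_one ?_
    have h := hu 0 m hm _ (Bar.nil_mem_lenLT 0)
    rw [LinearMap.sub_apply] at h
    rw [LinearMap.sub_apply, lenDiag_nil, sub_eq_zero.1 h, sub_self]
  | succ n ih =>
    intro u hu m hm
    obtain ⟨m, rfl⟩ : ∃ m', m = m' + 1 := ⟨m - 1, by omega⟩
    refine mem_lenGE_succ ?_ fun v => ?_
    · have h := hu 0 (m + 1) (by omega) _ (Bar.nil_mem_lenLT 0)
      rw [LinearMap.sub_apply] at h
      rw [LinearMap.sub_apply, lenDiag_nil, sub_eq_zero.1 h, sub_self]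
    · have h : (lenDiag u - u (m + 1)) ∘ₗ Bar.cons v =
          lenDiag (fun n => u (n + 1) ∘ₗ Bar.cons v) - u (m + 1) ∘ₗ Bar.cons v := by
        ext w
        simp [lenDiag_cons]
      rw [h]
      refine ih (fun n => u (n + 1) ∘ₗ Bar.cons v) (fun i j hij w hw => ?_) m (by omega)
      exact hu (i + 1) (j + 1) (by omega) _ (Bar.cons_mem_lenLT v hw)

/-- Successive approximation along the filtration by word length. -/
theorem exists_of_lenGE_approx [GrMod k V] [GrMod k Q] {P : Type*} [AddCommGroup P] [Module k P]
    {m : ℤ} (D : (Bar k V →ₗ[k] Q) →ₗ[k] (Bar k V →ₗ[k] P))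
    (hD : ∀ n, ∀ f ∈ lenGE k V Q n, D f ∈ lenGE k V P n)
    (good : (Bar k V →ₗ[k] P) → Prop) (p : ℕ)
    (step : ∀ n ≥ p, ∀ z ∈ lenGE k V P n, good z → ∃ u ∈ lenGE k V Q n,
      u ∈ homGr k (Bar k V) Q m ∧ z - D u ∈ lenGE k V P (n + 1) ∧ good (z - D u))
    {z : Bar k V →ₗ[k] P} (hz : z ∈ lenGE k V P p) (hg : good z) :
    ∃ u ∈ lenGE k V Q p, u ∈ homGr k (Bar k V) Q m ∧ z = D u := by
  classical
  -- The remainder is pushed up one filtration step at a time. The predicate `good` carries what the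
  -- next step needs to know about the remainder, in the applications homogeneity and closedness.
  have step' : ∀ (n : ℕ) (z : {z // z ∈ lenGE k V P (p + n) ∧ good z}),
      ∃ u ∈ lenGE k V Q (p + n), u ∈ homGr k (Bar k V) Q m ∧
        (z : Bar k V →ₗ[k] P) - D u ∈ lenGE k V P (p + (n + 1)) ∧ good (z - D u) := fun n z =>
    step (p + n) (by omega) z z.2.1 z.2.2
  choose U hU hUm hUD hUg using step'
  let Z : ∀ n, {z // z ∈ lenGE k V P (p + n) ∧ good z} := fun n =>
    Nat.rec ⟨z, hz, hg⟩ (fun n z => ⟨z - D (U n z), hUD n z, hUg n z⟩) n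
  have hZ : ∀ n, ((Z (n + 1)).1 : Bar k V →ₗ[k] P) = (Z n).1 - D (U n (Z n)) := fun n => rfl
  -- Partial sums of the corrections. The i-th correction has filtration p + i, so the sums
  -- stabilize on words of bounded length and `lenDiag S` is their limit.
  let S : ℕ → Bar k V →ₗ[k] Q := fun n => ∑ i ∈ Finset.range (n + 1), U i (Z i)
  have hS : ∀ n, S (n + 1) = S n + U (n + 1) (Z (n + 1)) := fun n => Finset.sum_range_succ _ _
  have hzS : ∀ n, z - D (S n) = (Z (n + 1)).1 := by
    intro n
    induction n with
    | zero => rw [hZ]; simp [S, Z]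
    | succ n ih => rw [hZ (n + 1), ← ih, hS, map_add]; abel
  have hSd : ∀ i d, S (i + d) - S i ∈ lenGE k V Q (i + 1) := by
    intro i d
    induction d with
    | zero => simp
    | succ d ih =>
      rw [← add_assoc, hS, add_sub_right_comm]
      exact add_mem ih (lenGE_anti (by omega) (hU _ _))
  have hd : ∀ n, lenDiag S - S n ∈ lenGE k V Q (n + 1) := fun n =>
    lenDiag_sub_mem n S fun i j hij => by
      obtain ⟨d, rfl⟩ := Nat.exists_eq_add_of_le hij
      exact hSd i d
  refine ⟨lenDiag S, ?_, lenDiag_mem fun n => sum_mem fun i _ => hUm _ _, ?_⟩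
  · have h : lenDiag S = (lenDiag S - S p) + S p := by abel
    rw [h]
    exact add_mem (lenGE_anti (by omega) (hd p))
      (sum_mem fun i _ => lenGE_anti (by omega) (hU _ _))
  · rw [← sub_eq_zero]
    -- Both the n-th remainder and the image under D of the tail of the series have filtration at
    -- least n, for every n.
    refine eq_zero_of_mem_lenGE fun n => ?_
    have h : z - D (lenDiag S) = (Z (n + 1)).1 - D (lenDiag S - S n) := by
      rw [map_sub, ← hzS]; abel
    rw [h]
    exact sub_mem (lenGE_anti (by omega) (Z (n + 1)).2.1) (hD _ _ (lenGE_anti (by omega) (hd n)))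

end LengthFiltration

/-! ### The leading part of a twisted differential -/

section ConvolutionFiltration

variable {k : Type*} [Field k]

section Constant

variable {C : Type*} [AddCommGroup C] [Module k C] [Coalgebra k C]
  [DGCoalg k C] {A : Type*} [Ring A] [Algebra k A] [DGA k A]

variable (k C) in
/-- The map `x ↦ ε(x) a`. -/
def convConst (a : A) : C →ₗ[k] A := (LinearMap.lsmul k A).flip a ∘ₗ Coalgebra.counit

theorem convConst_apply (a : A) (x : C) :
    convConst k C a x = Coalgebra.counit (R := k) x • a := rfl

theorem convConst_conv (a : A) (f : C →ₗ[k] A) :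
    conv (convConst k C a) f = LinearMap.mulLeft k a ∘ₗ f := by
  have h1 : convConst k C a = LinearMap.mulLeft k a ∘ₗ convOne := by
    ext x
    simp [convConst_apply, convOne, Algebra.algebraMap_eq_smul_one]
  have h2 : LinearMap.mul' k A ∘ₗ km (LinearMap.mulLeft k a ∘ₗ convOne) f =
      LinearMap.mulLeft k a ∘ₗ LinearMap.mul' k A ∘ₗ km (convOne : C →ₗ[k] A) f :=
    gr_ext₂ fun i j x hx y hy => by simp [km_tmul hx, mul_assoc]
  conv_rhs => rw [← convOne_conv f]
  rw [h1, conv, conv, ← LinearMap.comp_assoc, h2]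
  rfl

theorem conv_convConst {n : ℤ} (hn : ¬ Even n) {a : A} (ha : a ∈ gr k A n) (f : C →ₗ[k] A)
    (x : C) : conv f (convConst k C a) x = f (sgn k C x) * a := by
  have hm : convConst k C a ∈ homGr k C A n := by
    intro i x hx
    rw [convConst_apply]
    by_cases hi : i = 0
    · subst hi
      rw [zero_add]
      exact Submodule.smul_mem _ _ ha
    · rw [DGCoalg.counit_eq_zero i hi x hx, zero_smul]; exact zero_mem _
  rw [conv_apply_of_mem hm hn]
  have h1 : LinearMap.mul' k A ∘ₗ TensorProduct.map f (convConst k C a) ∘ₗ (sgn k C).rTensor C =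
      LinearMap.mulRight k a ∘ₗ f ∘ₗ sgn k C ∘ₗ (TensorProduct.rid k C).toLinearMap ∘ₗ
        (Coalgebra.counit (R := k)).lTensor C :=
    TensorProduct.ext' fun y z => by simp [convConst_apply]
  have h2 := LinearMap.congr_fun h1 (Coalgebra.comul (R := k) x)
  simp only [LinearMap.comp_apply] at h2
  rw [h2, Coalgebra.lTensor_counit_comul]
  simp

end Constant

variable {V : Type*} [AddCommGroup V] [Module k V] [NDGA k V]
  {A : Type*} [Ring A] [Algebra k A] [DGA k A]

theorem conv_nil (f g : Bar k V →ₗ[k] A) : conv f g Bar.nil = f Bar.nil * g Bar.nil := by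
  rw [conv, LinearMap.comp_apply, LinearMap.comp_apply, Bar.comul_def, Bar.comul_nil,
    km_tmul Bar.nil_mem]
  simp [tw]

/-- A splitting with empty left factor is killed by t, and in every other splitting the right factor
is shorter than the whole word. -/
theorem conv_mem_lenGE_left {n : ℕ} {t f : Bar k V →ₗ[k] A} (ht : t Bar.nil = 0)
    (hf : f ∈ lenGE k V A n) : conv t f ∈ lenGE k V A (n + 1) := by
  intro w hw
  have h := Bar.comul_mem_nil_left hw
  rw [conv, LinearMap.comp_apply, LinearMap.comp_apply, Bar.comul_def, ← LinearMap.comp_apply]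
  rw [Submodule.mem_comap] at h
  generalize Bar.comul w = s at h
  rw [← LinearMap.mem_ker]
  refine SetLike.le_def.1 (sup_le ?_ ?_) h
  · refine Submodule.map₂_le.2 fun x hx y _ => ?_
    obtain ⟨c, rfl⟩ := Submodule.mem_span_singleton.1 hx
    rw [LinearMap.mem_ker, LinearMap.comp_apply, TensorProduct.mk_apply,
      km_tmul (Submodule.smul_mem _ c Bar.nil_mem), map_smul, ht]
    simp
  · refine Submodule.map₂_le.2 fun x _ y hy => ?_
    rw [LinearMap.mem_ker, LinearMap.comp_apply, TensorProduct.mk_apply, km, LinearMap.add_apply,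
      TensorProduct.map_tmul, TensorProduct.map_tmul, hf y hy, hat_mem_lenGE hf y hy]
    simp

theorem conv_mem_lenGE_right {n : ℕ} {t f : Bar k V →ₗ[k] A} (ht : t Bar.nil = 0)
    (hf : f ∈ lenGE k V A n) : conv f t ∈ lenGE k V A (n + 1) := by
  intro w hw
  have h := Bar.comul_mem_nil_right hw
  rw [conv, LinearMap.comp_apply, LinearMap.comp_apply, Bar.comul_def, ← LinearMap.comp_apply]
  rw [Submodule.mem_comap] at h
  generalize Bar.comul w = s at h
  rw [← LinearMap.mem_ker]
  refine SetLike.le_def.1 (sup_le ?_ ?_) h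
  · refine Submodule.map₂_le.2 fun x _ y hy => ?_
    obtain ⟨c, rfl⟩ := Submodule.mem_span_singleton.1 hy
    have h2 : hat t (Bar.nil : Bar k V) = 0 := by
      rw [hat, LinearMap.comp_apply, LinearMap.comp_apply, Bar.sgn_nil, ht, map_zero]
    rw [LinearMap.mem_ker, LinearMap.comp_apply, TensorProduct.mk_apply, km, LinearMap.add_apply,
      TensorProduct.map_tmul, TensorProduct.map_tmul, map_smul, map_smul, ht, h2]
    simp
  · refine Submodule.map₂_le.2 fun x hx y _ => ?_
    have h1 : f (ev k (Bar k V) x) = 0 := hf _ (Bar.wt_mem_lenLT hx _)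
    have h2 : f (od k (Bar k V) x) = 0 := hf _ (Bar.wt_mem_lenLT hx _)
    rw [LinearMap.mem_ker, LinearMap.comp_apply, TensorProduct.mk_apply, km, LinearMap.add_apply,
      TensorProduct.map_tmul, TensorProduct.map_tmul, LinearMap.comp_apply, LinearMap.comp_apply,
      h1, h2]
    simp

/-- The value of a twisting cochain at the empty word. -/
def MC.atNil (t : MC k (ConvDG k (Bar k V) A)) : MC k A where
  val := t.val.val Bar.nil
  mem := gr_of_eq (ConvDG.mem_gr.1 t.mem 0 _ Bar.nil_mem) (by ring)
  eq := by
    have h := t.val_apply Bar.nil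
    rw [Bar.del_def, Bar.dif_nil, map_zero, add_zero, conv_nil] at h
    exact h

theorem twHom_add (t f g : Bar k V →ₗ[k] A) : twHom t (f + g) = twHom t f + twHom t g := by
  simp only [twHom, map_add, hat_add, conv_add, add_conv]
  abel

theorem twHom_smul (t f : Bar k V →ₗ[k] A) (c : k) : twHom t (c • f) = c • twHom t f := by
  simp only [twHom, map_smul, hat_smul, conv_smul, smul_conv, smul_sub, smul_add]

theorem twHom_mem (t : MC k (ConvDG k (Bar k V) A)) {n : ℤ} {f : Bar k V →ₗ[k] A}
    (hf : f ∈ homGr k (Bar k V) A n) : twHom t.val.val f ∈ homGr k (Bar k V) A (n - 1) := by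
  have h := twistDel_mem t n (ConvDG.mk f (mem_convTot hf)) hf
  rw [ConvDG.mem_gr, val_twistDel] at h
  exact h

theorem twHom_twHom (t : MC k (ConvDG k (Bar k V) A)) {n : ℤ} {f : Bar k V →ₗ[k] A}
    (hf : f ∈ homGr k (Bar k V) A n) : twHom t.val.val (twHom t.val.val f) = 0 := by
  have h := congrArg ConvDG.val (twistDel_twistDel t (ConvDG.mk f (mem_convTot hf)))
  rw [val_twistDel, val_twistDel, map_zero] at h
  exact h

theorem twHom_eq_zero (t : MC k (ConvDG k (Bar k V) A)) (x : ConvDG k (Bar k V) A)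
    (hx : twistDel t x = 0) : twHom t.val.val x.val = 0 := by
  rw [← val_twistDel, hx, map_zero]

/-- The twisting cochain is split into the constant cochain with its value at the empty word and a
rest that vanishes there. The constant part only changes the differential of the coefficients; the
rest raises the filtration. -/
theorem twHom_eq (t : MC k (ConvDG k (Bar k V) A)) (f : Bar k V →ₗ[k] A) :
    twHom t.val.val f = twistDel t.atNil ∘ₗ f - hat f ∘ₗ Bar.dif +
      (conv (t.val.val - convConst k _ t.atNil.val) f -
        conv (hat f) (t.val.val - convConst k _ t.atNil.val)) := by
  have h1 : conv (t.val.val - convConst k _ t.atNil.val) f =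
      conv t.val.val f - conv (convConst k _ t.atNil.val) f := by
    rw [sub_eq_add_neg, add_conv, neg_conv, ← sub_eq_add_neg]
  have h2 : conv (hat f) (t.val.val - convConst k _ t.atNil.val) =
      conv (hat f) t.val.val - conv (hat f) (convConst k _ t.atNil.val) := by
    rw [sub_eq_add_neg, conv_add, conv_neg, ← sub_eq_add_neg]
  rw [h1, h2]
  ext w
  have h3 : (hat f) (sgn k (Bar k V) w) = sgn k A (f w) := by
    rw [hat, LinearMap.comp_apply, LinearMap.comp_apply, sgn_sgn]
  simp only [twHom, homDel_apply, LinearMap.add_apply, LinearMap.sub_apply, LinearMap.comp_apply,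
    convConst_conv, conv_convConst (by decide) t.atNil.mem, twistDel_apply, h3,
    LinearMap.mulLeft_apply, Bar.del_def]
  abel

theorem comp_dif_mem_lenGE {Q : Type*} [AddCommGroup Q] [Module k Q] {n : ℕ} {f : Bar k V →ₗ[k] Q}
    (hf : f ∈ lenGE k V Q n) : f ∘ₗ Bar.dif ∈ lenGE k V Q n :=
  fun _ hw => hf _ (Bar.dif_mem_lenLT hw)

/-- The leading part of the twisted differential with respect to word length. -/
theorem twHom_sub_mem_lenGE (t : MC k (ConvDG k (Bar k V) A)) {n : ℕ} {f : Bar k V →ₗ[k] A}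
    (hf : f ∈ lenGE k V A n) :
    twHom t.val.val f - (twistDel t.atNil ∘ₗ f - hat f ∘ₗ Bar.dif) ∈ lenGE k V A (n + 1) := by
  have h0 : (t.val.val - convConst k (Bar k V) t.atNil.val) Bar.nil = 0 := by
    rw [LinearMap.sub_apply, convConst_apply, Bar.counit_def, Bar.counit_nil, one_smul]
    exact sub_self _
  rw [twHom_eq, add_sub_cancel_left]
  exact sub_mem (conv_mem_lenGE_left h0 hf) (conv_mem_lenGE_right h0 (hat_mem_lenGE hf))

end ConvolutionFiltration

/-! ### The cone of a change of coefficients -/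

section ChangeOfCoefficients

variable {k : Type*} [Field k] {V : Type*} [AddCommGroup V] [Module k V] [NDGA k V]
  {A : Type*} [Ring A] [Algebra k A] [DGA k A] {B : Type*} [Ring B] [Algebra k B] [DGA k B]
  (g : DGHom k A B) (t : MC k (ConvDG k (Bar k V) A)) (s : MC k (ConvDG k (Bar k V) B))

theorem atNil_postcomp
    (h : (postcomp (Bar k V) g).toAlgHom t.val = s.val) : g.toAlgHom t.atNil.val = s.atNil.val := by
  show _ = s.val.val Bar.nil
  rw [← h, postcomp_val]
  rfl

theorem postcomp_twHom
    (h : (postcomp (Bar k V) g).toAlgHom t.val = s.val) (f : Bar k V →ₗ[k] A) :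
    g.toAlgHom.toLinearMap ∘ₗ twHom t.val.val f =
      twHom s.val.val (g.toAlgHom.toLinearMap ∘ₗ f) := by
  have h1 : g.toAlgHom.toLinearMap ∘ₗ homDel f = homDel (g.toAlgHom.toLinearMap ∘ₗ f) := by
    have h : ∀ x, g.toAlgHom.toLinearMap (del k A x) = del k B (g.toAlgHom.toLinearMap x) :=
      g.map_del
    ext x
    simp only [homDel_apply, hat_postcomp, LinearMap.sub_apply, LinearMap.comp_apply, h, map_sub]
  rw [← h, postcomp_val, twHom, twHom, LinearMap.comp_sub, LinearMap.comp_add, postcomp_conv,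
    postcomp_conv, h1, hat_postcomp]

variable (h : (postcomp (Bar k V) g).toAlgHom t.val = s.val)
  (hf : IsChainMap k (g.twist t.atNil s.atNil (atNil_postcomp g t s h)).toAlgHom.toLinearMap)

/-- The first component of the cone, untwisted. -/
def twFst : Cone hf →ₗ[k] B := Cone.fst hf

/-- The second component of the cone, untwisted. -/
def twSnd : Cone hf →ₗ[k] A := Cone.snd hf

/-- The inclusion of the first component of the cone, untwisted. -/
def twInl : B →ₗ[k] Cone hf := Cone.inl hf

/-- The inclusion of the second component of the cone, untwisted. -/
def twInr : A →ₗ[k] Cone hf := Cone.inr hf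

theorem twCone_ext {f f' : Bar k V →ₗ[k] Cone hf}
    (h1 : twFst g t s h hf ∘ₗ f = twFst g t s h hf ∘ₗ f')
    (h2 : twSnd g t s h hf ∘ₗ f = twSnd g t s h hf ∘ₗ f') : f = f' :=
  LinearMap.ext fun w => Cone.ext hf (LinearMap.congr_fun h1 w) (LinearMap.congr_fun h2 w)

theorem twFst_comp_mk (a : Bar k V →ₗ[k] B) (b : Bar k V →ₗ[k] A) :
    twFst g t s h hf ∘ₗ (twInl g t s h hf ∘ₗ a + twInr g t s h hf ∘ₗ b) = a :=
  LinearMap.ext fun w => add_zero (a w)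

theorem twSnd_comp_mk (a : Bar k V →ₗ[k] B) (b : Bar k V →ₗ[k] A) :
    twSnd g t s h hf ∘ₗ (twInl g t s h hf ∘ₗ a + twInr g t s h hf ∘ₗ b) = b :=
  LinearMap.ext fun w => zero_add (b w)

theorem twFst_hat (f : Bar k V →ₗ[k] Cone hf) :
    twFst g t s h hf ∘ₗ hat f = hat (twFst g t s h hf ∘ₗ f) :=
  LinearMap.ext fun _ => Cone.fst_sgn hf _

theorem twSnd_hat (f : Bar k V →ₗ[k] Cone hf) :
    twSnd g t s h hf ∘ₗ hat f = -hat (twSnd g t s h hf ∘ₗ f) :=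
  LinearMap.ext fun _ => Cone.snd_sgn hf _

theorem twFst_del (f : Bar k V →ₗ[k] Cone hf) :
    twFst g t s h hf ∘ₗ del k (Cone hf) ∘ₗ f = twistDel s.atNil ∘ₗ twFst g t s h hf ∘ₗ f +
      g.toAlgHom.toLinearMap ∘ₗ twSnd g t s h hf ∘ₗ f :=
  LinearMap.ext fun _ => Cone.fst_del hf _

theorem twSnd_del (f : Bar k V →ₗ[k] Cone hf) :
    twSnd g t s h hf ∘ₗ del k (Cone hf) ∘ₗ f = -(twistDel t.atNil ∘ₗ twSnd g t s h hf ∘ₗ f) :=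
  LinearMap.ext fun _ => Cone.snd_del hf _

theorem mem_homGr_cone {m : ℤ} {f : Bar k V →ₗ[k] Cone hf} :
    f ∈ homGr k (Bar k V) (Cone hf) m ↔ twFst g t s h hf ∘ₗ f ∈ homGr k (Bar k V) B m ∧
      twSnd g t s h hf ∘ₗ f ∈ homGr k (Bar k V) A (m - 1) := by
  constructor
  · intro hm
    exact ⟨fun i v hv => ((Cone.mem_gr hf).1 (hm i v hv)).1,
      fun i v hv => gr_of_eq ((Cone.mem_gr hf).1 (hm i v hv)).2 (by ring)⟩
  · rintro ⟨h1, h2⟩ i v hv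
    exact (Cone.mem_gr hf).2 ⟨h1 i v hv, gr_of_eq (V := Twist t.atNil) (h2 i v hv) (by ring)⟩

theorem mem_lenGE_cone {n : ℕ} {f : Bar k V →ₗ[k] Cone hf}
    (h1 : twFst g t s h hf ∘ₗ f ∈ lenGE k V B n) (h2 : twSnd g t s h hf ∘ₗ f ∈ lenGE k V A n) :
    f ∈ lenGE k V (Cone hf) n := fun w hw => Cone.ext hf (h1 w hw) (h2 w hw)

/-- The twisted differential on maps to the cone. -/
def coneTw : (Bar k V →ₗ[k] Cone hf) →ₗ[k] (Bar k V →ₗ[k] Cone hf) where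
  toFun z := twInl g t s h hf ∘ₗ (twHom s.val.val (twFst g t s h hf ∘ₗ z) +
      g.toAlgHom.toLinearMap ∘ₗ twSnd g t s h hf ∘ₗ z) +
    twInr g t s h hf ∘ₗ (-twHom t.val.val (twSnd g t s h hf ∘ₗ z))
  map_add' z z' := by
    simp only [LinearMap.comp_add, twHom_add, neg_add]
    abel
  map_smul' c z := by
    have h1 : ∀ x : Bar k V →ₗ[k] A, -(c • x) = c • -x := fun x => (smul_neg c x).symm
    simp only [LinearMap.comp_smul, twHom_smul, ← smul_add, h1, RingHom.id_apply]

theorem twFst_coneTw (z : Bar k V →ₗ[k] Cone hf) : twFst g t s h hf ∘ₗ coneTw g t s h hf z =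
    twHom s.val.val (twFst g t s h hf ∘ₗ z) + g.toAlgHom.toLinearMap ∘ₗ twSnd g t s h hf ∘ₗ z :=
  twFst_comp_mk g t s h hf _ _

theorem twSnd_coneTw (z : Bar k V →ₗ[k] Cone hf) : twSnd g t s h hf ∘ₗ coneTw g t s h hf z =
    -twHom t.val.val (twSnd g t s h hf ∘ₗ z) :=
  twSnd_comp_mk g t s h hf _ _

theorem twHom_neg (t f : Bar k V →ₗ[k] A) : twHom t (-f) = -twHom t f := by
  have h := twHom_add t f (-f)
  have h0 := twHom_smul t f 0
  rw [zero_smul, zero_smul] at h0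
  rw [add_neg_cancel, h0] at h
  exact (neg_eq_of_add_eq_zero_right h.symm).symm

theorem coneTw_coneTw {m : ℤ} {z : Bar k V →ₗ[k] Cone hf}
    (hz : z ∈ homGr k (Bar k V) (Cone hf) m) :
    coneTw g t s h hf (coneTw g t s h hf z) = 0 := by
  obtain ⟨h1, h2⟩ := (mem_homGr_cone g t s h hf).1 hz
  refine twCone_ext g t s h hf ?_ ?_
  · rw [twFst_coneTw, twFst_coneTw, twSnd_coneTw, twHom_add, twHom_twHom s h1, LinearMap.comp_neg,
      postcomp_twHom g t s h, zero_add, add_neg_cancel, LinearMap.comp_zero]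
  · rw [twSnd_coneTw, twSnd_coneTw, twHom_neg, twHom_twHom t h2, neg_zero, neg_zero,
      LinearMap.comp_zero]

theorem coneTw_mem {m : ℤ} {z : Bar k V →ₗ[k] Cone hf}
    (hz : z ∈ homGr k (Bar k V) (Cone hf) m) :
    coneTw g t s h hf z ∈ homGr k (Bar k V) (Cone hf) (m - 1) := by
  obtain ⟨h1, h2⟩ := (mem_homGr_cone g t s h hf).1 hz
  refine (mem_homGr_cone g t s h hf).2 ⟨?_, ?_⟩
  · rw [twFst_coneTw]
    exact add_mem (twHom_mem s h1) (postcomp_mem g h2)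
  · rw [twSnd_coneTw]
    exact neg_mem (twHom_mem t h2)

/-- To leading order nothing remains of the twisting but its values at the empty word, and these are
built into the differential of the cone of coefficients. A contraction of that cone can thus be used
on maps into it. -/
theorem coneTw_sub_mem {n : ℕ} {z : Bar k V →ₗ[k] Cone hf} (hz : z ∈ lenGE k V (Cone hf) n) :
    coneTw g t s h hf z - homDel z ∈ lenGE k V (Cone hf) (n + 1) := by
  have h1 := twHom_sub_mem_lenGE s (comp_mem_lenGE hz (twFst g t s h hf))
  have h2 := neg_mem (twHom_sub_mem_lenGE t (comp_mem_lenGE hz (twSnd g t s h hf)))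
  refine mem_lenGE_cone g t s h hf ?_ ?_
  · convert h1 using 1
    rw [LinearMap.comp_sub, twFst_coneTw, homDel_apply, LinearMap.comp_sub, twFst_del,
      ← twFst_hat, LinearMap.comp_assoc, Bar.del_def]
    abel
  · convert h2 using 1
    rw [LinearMap.comp_sub, twSnd_coneTw, homDel_apply, LinearMap.comp_sub, twSnd_del,
      ← neg_eq_iff_eq_neg.2 (twSnd_hat g t s h hf z), LinearMap.neg_comp,
      LinearMap.comp_assoc, Bar.del_def]
    abel

theorem homDel_mem_lenGE {Q : Type*} [AddCommGroup Q] [Module k Q] [Cx k Q] {n : ℕ}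
    {f : Bar k V →ₗ[k] Q} (hf : f ∈ lenGE k V Q n) : homDel f ∈ lenGE k V Q n :=
  sub_mem (comp_mem_lenGE hf _) (comp_dif_mem_lenGE (hat_mem_lenGE hf))

theorem coneTw_mem_lenGE {n : ℕ} {z : Bar k V →ₗ[k] Cone hf} (hz : z ∈ lenGE k V (Cone hf) n) :
    coneTw g t s h hf z ∈ lenGE k V (Cone hf) n := by
  have h1 := add_mem (lenGE_anti n.le_succ (coneTw_sub_mem g t s h hf hz)) (homDel_mem_lenGE hz)
  rwa [sub_add_cancel] at h1

end ChangeOfCoefficients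

/-! ### Invariance under change of coefficients -/

section ChangeOfCoefficientsTheorem

variable {k : Type*} [Field k] {V : Type*} [AddCommGroup V] [Module k V] [NDGA k V]
  {A : Type*} [Ring A] [Algebra k A] [DGA k A] {B : Type*} [Ring B] [Algebra k B] [DGA k B]
  (g : DGHom k A B) (t : MC k (ConvDG k (Bar k V) A)) (s : MC k (ConvDG k (Bar k V) B))

/-- A contraction of the values contracts the Hom complex; the operator σ is odd, so the term with
the differential of the source cancels. -/
theorem homDel_comp_contraction {Q : Type*} [AddCommGroup Q] [Module k Q] [Cx k Q]
    {σ : Q →ₗ[k] Q} (hσ : σ ∈ homGr k Q Q 1)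
    (h : ∀ q, del k Q (σ q) + σ (del k Q q) = q) (f : Bar k V →ₗ[k] Q) :
    homDel (σ ∘ₗ f) = f - σ ∘ₗ homDel f := by
  have h1 : hat σ = -σ := by
    rw [hat_of_mem hσ, koszul_one]
    ext; simp
  rw [homDel_apply, hat_comp, h1, homDel_apply, LinearMap.comp_sub]
  ext w
  have h2 := h (f w)
  simp only [LinearMap.sub_apply, LinearMap.comp_apply, LinearMap.neg_apply]
  rw [eq_sub_of_add_eq h2]
  abel

theorem eq_postcomp_add_twistDel (y : ConvDG k (Bar k V) B) (v : ConvDG k (Bar k V) A)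
    (w : ConvDG k (Bar k V) B)
    (hy : y.val = g.toAlgHom.toLinearMap ∘ₗ v.val + twHom s.val.val w.val) :
    y = (postcomp (Bar k V) g).toAlgHom v + twistDel s w :=
  ConvDG.val_injective (by rw [map_add, postcomp_val, val_twistDel, hy])

/-- A homomorphism of coefficients that is a quasi-isomorphism for the differentials twisted by
the values of the twisting cochains at the empty word induces a quasi-isomorphism of twisted
convolution algebras. -/
theorem postcomp_twist_isQuasiIso
    (h : (postcomp (Bar k V) g).toAlgHom t.val = s.val)
    (hq : IsQuasiIso k (g.twist t.atNil s.atNil (atNil_postcomp g t s h)).toAlgHom.toLinearMap) :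
    IsQuasiIso k ((postcomp (Bar k V) g).twist t s h).toAlgHom.toLinearMap := by
  obtain ⟨σ, hσ, hσd⟩ := hq.exists_cone_contraction
  let hf := hq.toIsChainMap
  have key : ∀ (m : ℤ) (z : Bar k V →ₗ[k] Cone hf), z ∈ homGr k (Bar k V) (Cone hf) m →
      coneTw g t s h hf z = 0 →
      ∃ u ∈ homGr k (Bar k V) (Cone hf) (m + 1), z = coneTw g t s h hf u := by
    intro m z hz hDz
    suffices hs : ∃ u ∈ lenGE k V (Cone hf) 0, u ∈ homGr k (Bar k V) (Cone hf) (m + 1) ∧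
        z = coneTw g t s h hf u from ⟨hs.choose, hs.choose_spec.2⟩
    refine exists_of_lenGE_approx (m := m + 1) (coneTw g t s h hf)
      (fun n f hn => coneTw_mem_lenGE g t s h hf hn)
      (fun z => z ∈ homGr k (Bar k V) (Cone hf) m ∧ coneTw g t s h hf z = 0) 0 ?_
      (mem_lenGE_zero z) ⟨hz, hDz⟩
    · rintro n - z hzn ⟨hz, hDz⟩
      -- As z is closed for the twisted differential, `homDel z` has higher filtration than z. By
      -- the contraction, σ∘z is then a primitive of z up to longer words.
      have hun := comp_mem_lenGE hzn σ
      have hu : σ ∘ₗ z ∈ homGr k (Bar k V) (Cone hf) (m + 1) := by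
        rw [add_comm]; exact comp_mem_homGr hσ hz
      refine ⟨σ ∘ₗ z, hun, hu, ?_, ?_, ?_⟩
      · have h1 := coneTw_sub_mem g t s h hf hun
        have h2 := comp_mem_lenGE (coneTw_sub_mem g t s h hf hzn) σ
        rw [homDel_comp_contraction hσ hσd] at h1
        rw [hDz, zero_sub, LinearMap.comp_neg] at h2
        have h3 := neg_mem (add_mem h1 h2)
        convert h3 using 1
        abel
      · refine sub_mem hz ?_
        have := coneTw_mem g t s h hf hu
        rwa [add_sub_cancel_right] at this
      · rw [map_sub, hDz, coneTw_coneTw g t s h hf hu, sub_zero]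
  have hval : ∀ (x : ConvDG k (Bar k V) A), (((postcomp (Bar k V) g).twist t s h).toAlgHom x :
      ConvDG k (Bar k V) B).val = g.toAlgHom.toLinearMap ∘ₗ x.val := fun x => rfl
  refine IsQuasiIso.of_homogeneous (X := Twist t) (Y := Twist s) (DGHom.isChainMap _) ?_ ?_
  · intro n x hx hdx y hy hxy
    have hx' : ConvDG.val (x : ConvDG k (Bar k V) A) ∈ homGr k (Bar k V) A n := hx
    have hy' : ConvDG.val (y : ConvDG k (Bar k V) B) ∈ homGr k (Bar k V) B (n + 1) := hy
    have e1 : twHom t.val.val (ConvDG.val (x : ConvDG k (Bar k V) A)) = 0 := twHom_eq_zero t x hdx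
    have e2 : g.toAlgHom.toLinearMap ∘ₗ ConvDG.val (x : ConvDG k (Bar k V) A) =
        twHom s.val.val (ConvDG.val (y : ConvDG k (Bar k V) B)) := 
      (congrArg (ConvDG.val (k := k) (C := Bar k V) (A := B)) hxy).trans (val_del_twist s y)
    -- The pair (-y, x) is closed in the cone because g x is the boundary of y. The second component
    -- of a primitive has boundary -x, which explains the sign of the witness.
    obtain ⟨u, hu, hzu⟩ := key (n + 1)
      (twInl g t s h hf ∘ₗ (-ConvDG.val (y : ConvDG k (Bar k V) B)) +
        twInr g t s h hf ∘ₗ ConvDG.val (x : ConvDG k (Bar k V) A))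
      ((mem_homGr_cone g t s h hf).2 (by
        rw [twFst_comp_mk, twSnd_comp_mk, add_sub_cancel_right]
        exact ⟨neg_mem hy', hx'⟩))
      (twCone_ext g t s h hf (by
        rw [twFst_coneTw, twFst_comp_mk, twSnd_comp_mk, e2, twHom_neg, neg_add_cancel,
          LinearMap.comp_zero]) (by
        rw [twSnd_coneTw, twSnd_comp_mk, e1, neg_zero, LinearMap.comp_zero]))
    obtain ⟨h1, h2⟩ := (mem_homGr_cone g t s h hf).1 hu
    have h3 := congrArg (fun z => twSnd g t s h hf ∘ₗ z) hzu
    simp only [twSnd_comp_mk, twSnd_coneTw] at h3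
    refine ⟨(ConvDG.mk (-(twSnd g t s h hf ∘ₗ u)) (mem_convTot (neg_mem h2)) :
      ConvDG k (Bar k V) A), ConvDG.val_injective ?_⟩
    rw [val_del_twist, ConvDG.val_mk, twHom_neg]
    exact h3
  · intro n y hy hdy
    have hy' : ConvDG.val (y : ConvDG k (Bar k V) B) ∈ homGr k (Bar k V) B n := hy
    have e1 : twHom s.val.val (ConvDG.val (y : ConvDG k (Bar k V) B)) = 0 := twHom_eq_zero s y hdy
    -- For the closed pair (y, 0), a primitive (b, a) consists of a cycle a and an element b with y
    -- = g a + db.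
    obtain ⟨u, hu, hzu⟩ := key n
      (twInl g t s h hf ∘ₗ (ConvDG.val (y : ConvDG k (Bar k V) B)) +
        twInr g t s h hf ∘ₗ (0 : Bar k V →ₗ[k] A))
      ((mem_homGr_cone g t s h hf).2 (by
        rw [twFst_comp_mk, twSnd_comp_mk]
        exact ⟨hy', zero_mem _⟩))
      (twCone_ext g t s h hf (by
        rw [twFst_coneTw, twFst_comp_mk, twSnd_comp_mk, e1, zero_add, LinearMap.comp_zero,
          LinearMap.comp_zero]) (by
        rw [twSnd_coneTw, twSnd_comp_mk, ← neg_zero, twHom_neg]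
        have h0 := twHom_smul t.val.val (0 : Bar k V →ₗ[k] A) 0
        rw [zero_smul, zero_smul] at h0
        rw [h0, neg_zero, neg_zero, LinearMap.comp_zero]))
    obtain ⟨h1, h2⟩ := (mem_homGr_cone g t s h hf).1 hu
    have h3 := congrArg (fun z => twFst g t s h hf ∘ₗ z) hzu
    have h4 := congrArg (fun z => twSnd g t s h hf ∘ₗ z) hzu
    simp only [twFst_comp_mk, twFst_coneTw] at h3
    simp only [twSnd_comp_mk, twSnd_coneTw] at h4
    refine ⟨(ConvDG.mk (twSnd g t s h hf ∘ₗ u) (mem_convTot h2) : ConvDG k (Bar k V) A), ?_,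
      (ConvDG.mk (twFst g t s h hf ∘ₗ u) (mem_convTot h1) : ConvDG k (Bar k V) B), ?_⟩
    · refine ConvDG.val_injective ?_
      rw [val_del_twist, ConvDG.val_mk]
      exact neg_eq_zero.1 h4.symm
    · refine eq_postcomp_add_twistDel g s y _ _ (h3.trans ?_)
      rw [ConvDG.val_mk, ConvDG.val_mk, add_comm]

end ChangeOfCoefficientsTheorem

/-! ### The twisted cobar construction of a bar construction -/

section CobarTwist

variable {k : Type*} [Field k] {V : Type*} [AddCommGroup V] [Module k V] [NDGA k V]

variable (k V) in
/-- The cobar construction of a bar construction, with the differential twisted by the generator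
of the empty word. -/
def cobarTw : Cobar k (Bar k V) →ₗ[k] Cobar k (Bar k V) :=
  twistDel (Cobar.univ k (Bar k V)).atNil

theorem cobarTw_apply (w : Cobar k (Bar k V)) : cobarTw k V w =
    Cobar.dif w + Cobar.ι Bar.nil * w - sgn k _ w * Cobar.ι Bar.nil := rfl

theorem cobarTw_cobarTw (w : Cobar k (Bar k V)) : cobarTw k V (cobarTw k V w) = 0 :=
  twistDel_twistDel _ w

theorem cobarTw_one : cobarTw k V 1 = 0 := by
  rw [cobarTw_apply, Cobar.dif_one, Cobar.sgn_one]
  simp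

/-- The leading part of the twisted differential on generators. -/
def cobarTwι : Bar k V →ₗ[k] Cobar k (Bar k V) :=
  Cobar.difι + LinearMap.mulLeft k (Cobar.ι Bar.nil) ∘ₗ Cobar.ι +
    LinearMap.mulRight k (Cobar.ι Bar.nil) ∘ₗ Cobar.ι ∘ₗ sgn k (Bar k V)

theorem cobarTwι_apply (c : Bar k V) : cobarTwι c = -Cobar.ι (Bar.dif c) -
    Cobar.ιι ((sgn k (Bar k V)).rTensor _ (Bar.comul c)) + Cobar.ι Bar.nil * Cobar.ι c +
      Cobar.ι (sgn k _ c) * Cobar.ι Bar.nil := rfl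

theorem cobarTw_cons (c : Bar k V) (w : Cobar k (Bar k V)) :
    cobarTw k V (Cobar.ι c * w) = cobarTwι c * w - Cobar.ι (sgn k _ c) * cobarTw k V w := by
  have h : cobarTwι c = Cobar.difι c + Cobar.ι Bar.nil * Cobar.ι c +
    Cobar.ι (sgn k _ c) * Cobar.ι Bar.nil := rfl
  rw [cobarTw_apply, cobarTw_apply, Cobar.dif_cons, Cobar.sgn_mul, Cobar.sgn_ι, h]
  noncomm_ring

/-- The coproduct contributes -1 times the square of the empty word, and the two terms of the twist
contribute +1 each. -/
theorem cobarTwι_nil :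
    cobarTwι (Bar.nil : Bar k V) = Cobar.ι Bar.nil * Cobar.ι Bar.nil := by
  rw [cobarTwι_apply, Bar.dif_nil, Bar.comul_nil, Bar.sgn_nil, map_zero]
  simp [Cobar.ιι, Bar.sgn_nil]

/-- The two terms of the twist cancel the splittings with an empty factor, so the quadratic part is
the reduced coproduct. The formula runs over all splittings of x with r prepended on the left and
subtracts the one with empty right factor. -/
theorem cobarTwι_cons (r : V) (x : Bar k V) : cobarTwι (Bar.cons r x) =
    -Cobar.ι (Bar.dif (Bar.cons r x)) +
      Cobar.ιι ((Bar.cons (sgn k V r) ∘ₗ sgn k (Bar k V)).rTensor _ (Bar.comul x)) -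
      Cobar.ι (Bar.cons (sgn k V r) (sgn k _ x)) * Cobar.ι Bar.nil := by
  have h1 : (sgn k (Bar k V)).rTensor (Bar k V) ((Bar.cons r).rTensor _ (Bar.comul x)) =
      -((Bar.cons (sgn k V r) ∘ₗ sgn k (Bar k V)).rTensor _ (Bar.comul x)) := by
    rw [← LinearMap.comp_apply, ← LinearMap.rTensor_comp, ← LinearMap.neg_apply,
      ← LinearMap.rTensor_neg]
    congr 2
    ext y
    simp [Bar.sgn_cons]
  rw [cobarTwι_apply, Bar.comul_cons, map_add, map_add, h1, LinearMap.rTensor_tmul, Bar.sgn_nil,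
    Bar.sgn_cons, map_neg, map_neg, neg_mul]
  have h2 : Cobar.ιι ((Bar.nil : Bar k V) ⊗ₜ[k] Bar.cons r x) =
    Cobar.ι Bar.nil * Cobar.ι (Bar.cons r x) := rfl
  rw [h2]
  abel

end CobarTwist

/-! ### The collapsing homotopy on the twisted cobar construction -/

section Collapse

variable {k : Type*} [Field k] {V : Type*} [AddCommGroup V] [Module k V]

/-- The part of length one. -/
def Bar.first : Bar k V →ₗ[k] V := Bar.rec' 0 ((LinearMap.lsmul k V).flip.compl₂ Bar.counit) 0

@[simp] theorem Bar.first_nil : Bar.first (Bar.nil : Bar k V) = 0 := by simp [Bar.first]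

@[simp] theorem Bar.first_cons (r : V) (x : Bar k V) :
    Bar.first (Bar.cons r x) = Bar.counit x • r := by
  simp [Bar.first]

/-- The action of a bilinear operation on the first generator. -/
def Cobar.onFirst {C : Type*} [AddCommGroup C] [Module k C] (m : V →ₗ[k] C →ₗ[k] C) :
    V →ₗ[k] Cobar k C →ₗ[k] Cobar k C :=
  (Cobar.rec' (X := V →ₗ[k] Cobar k C) 0
    (LinearMap.mk₂ k (fun c w => LinearMap.mulRight k w ∘ₗ Cobar.ι ∘ₗ m.flip c)
      (fun c c' w => by ext; simp [add_mul]) (fun a c w => by ext; simp)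
      (fun c w w' => by ext; simp [mul_add]) (fun a c w => by ext; simp)) 0).flip

@[simp] theorem Cobar.onFirst_one {C : Type*} [AddCommGroup C] [Module k C]
    (m : V →ₗ[k] C →ₗ[k] C) (r : V) : Cobar.onFirst m r (1 : Cobar k C) = 0 := by
  simp [Cobar.onFirst]

@[simp] theorem Cobar.onFirst_cons {C : Type*} [AddCommGroup C] [Module k C]
    (m : V →ₗ[k] C →ₗ[k] C) (r : V) (c : C) (w : Cobar k C) :
    Cobar.onFirst m r (Cobar.ι c * w) = Cobar.ι (m r c) * w := by
  simp [Cobar.onFirst]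

theorem Cobar.onFirst_mul {C : Type*} [AddCommGroup C] [Module k C]
    (m : V →ₗ[k] C →ₗ[k] C) (r : V) (t : C ⊗[k] C) (w : Cobar k C) :
    Cobar.onFirst m r (Cobar.ιι t * w) = Cobar.ιι ((m r).rTensor C t) * w := by
  induction t with
  | zero => simp
  | add s t hs ht => simp only [map_add, add_mul, hs, ht]
  | tmul x y =>
    have h : ∀ x y : C, Cobar.ιι (x ⊗ₜ[k] y) = Cobar.ι x * Cobar.ι y := fun _ _ => rfl
    rw [LinearMap.rTensor_tmul, h, h, mul_assoc, Cobar.onFirst_cons, mul_assoc]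

variable [NDGA k V]

variable (k V) in
/-- Removes a leading empty word, and joins a leading one-letter word to the next word. -/
def cobarHtpy : Cobar k (Bar k V) →ₗ[k] Cobar k (Bar k V) :=
  Cobar.rec' 0 (((LinearMap.lsmul k (Cobar k (Bar k V))) ∘ₗ Bar.counit) +
    Cobar.onFirst Bar.cons ∘ₗ sgn k V ∘ₗ Bar.first) 0

@[simp] theorem cobarHtpy_one : cobarHtpy k V 1 = 0 := by simp [cobarHtpy]

theorem cobarHtpy_cons (c : Bar k V) (w : Cobar k (Bar k V)) :
    cobarHtpy k V (Cobar.ι c * w) =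
      Bar.counit c • w + Cobar.onFirst Bar.cons (sgn k V (Bar.first c)) w := by
  simp [cobarHtpy]

theorem Bar.counit_dif (w : Bar k V) : Bar.counit (Bar.dif w) = 0 := DGCoalg.counit_dif w

theorem Bar.first_dif (r : V) (x : Bar k V) : Bar.first (Bar.dif (Bar.cons r x)) =
    Bar.first (Bar.merge r x) - Bar.counit x • del k V r := by
  rw [Bar.dif_cons, map_sub, map_sub, Bar.first_cons, Bar.first_cons, Bar.counit_dif, zero_smul,
    sub_zero]

variable (k) in
/-- The coefficient of the empty product. -/
def Cobar.unitCoeff (C : Type*) [AddCommGroup C] [Module k C] : Cobar k C →ₗ[k] k :=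
  Cobar.rec' 1 0 0

/-- Prepending r to the first word commutes with the differential except for three effects: the
differential of r, the product of r with the old first letter, and the new splitting that separates
r. The last one would give [r] times w; on w = 1 there is no first word to extend, and the term with
`Cobar.unitCoeff` makes up for this. -/
theorem onFirst_cons_cobarTw (r : V) (w : Cobar k (Bar k V)) :
    Cobar.onFirst Bar.cons r (cobarTw k V w) + cobarTw k V (Cobar.onFirst Bar.cons (sgn k V r) w) +
        Cobar.onFirst Bar.cons (sgn k V (del k V r)) w =
      Cobar.ι (Bar.cons r Bar.nil) * w -
        Cobar.unitCoeff k _ w • Cobar.ι (Bar.cons r Bar.nil) -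
        Cobar.onFirst Bar.merge (sgn k V r) w := by
  have key : Cobar.onFirst Bar.cons r ∘ₗ cobarTw k V +
      cobarTw k V ∘ₗ Cobar.onFirst Bar.cons (sgn k V r) +
        Cobar.onFirst Bar.cons (sgn k V (del k V r)) =
      LinearMap.mulLeft k (Cobar.ι (Bar.cons r Bar.nil)) -
        (LinearMap.lsmul k _).flip (Cobar.ι (Bar.cons r Bar.nil)) ∘ₗ Cobar.unitCoeff k _ -
        Cobar.onFirst Bar.merge (sgn k V r) := by
    refine Cobar.ext' ?_ fun c w _ => ?_
    · simp [Cobar.unitCoeff, cobarTw_one]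
    · have h : del k V (sgn k V r) = -sgn k V (del k V r) := by rw [sgn_del, neg_neg]
      have h1 : Cobar.onFirst Bar.cons r (cobarTwι c * w) =
          -(Cobar.ι (Bar.cons r (Bar.dif c)) * w) -
            Cobar.ιι ((Bar.cons r ∘ₗ sgn k (Bar k V)).rTensor _ (Bar.comul c)) * w +
            Cobar.ι (Bar.cons r Bar.nil) * Cobar.ι c * w +
            Cobar.ι (Bar.cons r (sgn k _ c)) * Cobar.ι Bar.nil * w := by
        rw [cobarTwι_apply, add_mul, add_mul, sub_mul, neg_mul, map_add, map_add, map_sub, map_neg,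
          Cobar.onFirst_cons, Cobar.onFirst_mul, mul_assoc, Cobar.onFirst_cons, mul_assoc,
          Cobar.onFirst_cons, LinearMap.rTensor_comp_apply, mul_assoc, mul_assoc]
      simp only [LinearMap.add_apply, LinearMap.sub_apply, LinearMap.comp_apply,
        LinearMap.mulLeft_apply, Cobar.onFirst_cons, cobarTw_cons,
        cobarTwι_cons, map_sub, h1, sgn_sgn, Bar.dif_cons, h, map_neg, LinearMap.neg_apply,
        Bar.sgn_cons, Cobar.unitCoeff, Cobar.rec'_cons, LinearMap.zero_apply, map_zero, add_zero]
      noncomm_ring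
  exact LinearMap.congr_fun key w

/-- The differential turns a leading empty word into two of them, and the homotopy removes one. No
error term occurs. -/
theorem cobarHtpy_nil_mul (w : Cobar k (Bar k V)) :
    cobarTw k V (cobarHtpy k V (Cobar.ι Bar.nil * w)) +
      cobarHtpy k V (cobarTw k V (Cobar.ι Bar.nil * w)) = Cobar.ι Bar.nil * w := by
  rw [cobarTw_cons, cobarTwι_nil, Bar.sgn_nil, map_sub, mul_assoc, cobarHtpy_cons, cobarHtpy_cons,
    cobarHtpy_cons]
  simp [Bar.counit_nil]

/-- The splitting that separates the first letter is undone by joining it to the next word; this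
produces the identity. What is left over lies in V or contains a product of two letters, formed
either across two words or within the first one. -/
theorem cobarHtpy_cons_mul (r : V) (x : Bar k V) (w : Cobar k (Bar k V)) :
    cobarTw k V (cobarHtpy k V (Cobar.ι (Bar.cons r x) * w)) +
      cobarHtpy k V (cobarTw k V (Cobar.ι (Bar.cons r x) * w)) = Cobar.ι (Bar.cons r x) * w -
        Bar.counit x • (Cobar.unitCoeff k _ w • Cobar.ι (Bar.cons r Bar.nil) +
          Cobar.onFirst Bar.merge (sgn k V r) w) -
        Cobar.onFirst Bar.cons (sgn k V (Bar.first (Bar.merge r x))) w := by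
  have h1 : cobarHtpy k V (Cobar.ιι ((Bar.cons (sgn k V r) ∘ₗ sgn k (Bar k V)).rTensor _
      (Bar.comul x)) * w) = Cobar.ι (Bar.cons r x) * w := by
    have h2 : (Bar.counit).rTensor (Bar k V) (Bar.comul x) = 1 ⊗ₜ x :=
      Coalgebra.rTensor_counit_comul (R := k) (A := Bar k V) x
    have h3 : ∀ t : Bar k V ⊗[k] Bar k V,
        cobarHtpy k V (Cobar.ιι ((Bar.cons (sgn k V r) ∘ₗ sgn k (Bar k V)).rTensor _ t) * w) =
          Cobar.ι (Bar.cons r (TensorProduct.lid k _ ((Bar.counit).rTensor (Bar k V) t))) * w := by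
      intro t
      induction t with
      | zero => simp
      | add s t hs ht => simp only [map_add, add_mul, hs, ht]
      | tmul y z =>
        have h : ∀ x y : Bar k V, Cobar.ιι (x ⊗ₜ[k] y) = Cobar.ι x * Cobar.ι y := fun _ _ => rfl
        have hs : Bar.counit (sgn k _ y) = Bar.counit y := counit_sgn y
        rw [LinearMap.rTensor_tmul, h, mul_assoc, cobarHtpy_cons]
        simp [Bar.counit_cons, hs]
    rw [h3, h2]
    simp
  have h4 := onFirst_cons_cobarTw r w
  have hs : Bar.counit (sgn k _ x) = Bar.counit x := counit_sgn x
  have h5 := congrArg (fun y => Bar.counit x • y) h4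
  simp only [smul_add, smul_sub] at h5
  rw [cobarTw_cons, cobarTwι_cons, sub_mul, add_mul, neg_mul, map_sub, map_sub, map_add, map_neg, h1,
    cobarHtpy_cons, cobarHtpy_cons, mul_assoc, cobarHtpy_cons, Bar.first_dif, Bar.sgn_cons, map_neg,
    neg_mul, map_neg, cobarHtpy_cons, Bar.counit_dif, Bar.counit_cons, Bar.counit_cons,
    Bar.first_cons, Bar.first_cons, hs]
  simp only [zero_smul, zero_add, map_smul, LinearMap.smul_apply, sgn_sgn, map_sub,
    LinearMap.sub_apply, Cobar.onFirst_cons, smul_add, sub_neg_eq_add]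
  rw [← sub_eq_zero] at h5 ⊢
  rw [← h5]
  abel

end Collapse

theorem apply_mem_of_mem_span {k M N : Type*} [Field k] [AddCommGroup M] [Module k M]
    [AddCommGroup N] [Module k N] {s : Set M} {T : Submodule k N} (f : M →ₗ[k] N)
    (h : ∀ x ∈ s, f x ∈ T) {x : M} (hx : x ∈ Submodule.span k s) : f x ∈ T :=
  (Submodule.span_le (p := T.comap f)).2 h hx

/-! ### Spanning sets and the number of letters -/

section Spanning

variable {k : Type*} [Field k] {V : Type*} [AddCommGroup V] [Module k V]

variable (k) in
/-- The word with the given letters. -/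
def Bar.word (l : List V) : Bar k V := l.foldr (fun v w => Bar.cons v w) Bar.nil

variable (k) in
/-- The product of words. -/
def Cobar.prodWords (L : List (List V)) : Cobar k (Bar k V) :=
  (L.map fun l => Cobar.ι (Bar.word k l)).prod

@[simp] theorem Bar.word_nil : Bar.word k ([] : List V) = Bar.nil := rfl

@[simp] theorem Bar.word_cons (v : V) (l : List V) :
    Bar.word k (v :: l) = Bar.cons v (Bar.word k l) := rfl

@[simp] theorem Cobar.prodWords_nil : Cobar.prodWords k ([] : List (List V)) = 1 := rfl

@[simp] theorem Cobar.prodWords_cons (l : List V) (L : List (List V)) :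
    Cobar.prodWords k (l :: L) = Cobar.ι (Bar.word k l) * Cobar.prodWords k L := by
  simp [Cobar.prodWords]

theorem Bar.span_word : Submodule.span k (Set.range (Bar.word k (V := V))) = ⊤ := by
  rw [eq_top_iff]
  intro w _
  refine Bar.induct (p := fun w => w ∈ Submodule.span k (Set.range (Bar.word k (V := V))))
    (Submodule.subset_span ⟨[], rfl⟩) (fun v w hw => ?_) (fun _ _ => add_mem)
    (fun c _ => Submodule.smul_mem _ c) w
  refine apply_mem_of_mem_span (Bar.cons v) ?_ hw
  rintro _ ⟨l, rfl⟩
  exact Submodule.subset_span ⟨v :: l, rfl⟩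

theorem Cobar.induct {C : Type*} [AddCommGroup C] [Module k C] {S : Submodule k (Cobar k C)}
    (one : 1 ∈ S) (cons : ∀ c, ∀ w ∈ S, Cobar.ι c * w ∈ S) (w : Cobar k C) : w ∈ S := by
  have hS : S.mkQ = 0 := Cobar.ext' (by simpa using one) fun v w hw => by
    rw [LinearMap.zero_apply, Submodule.mkQ_apply, Submodule.Quotient.mk_eq_zero] at hw ⊢
    exact cons v w hw
  have h := LinearMap.congr_fun hS w
  rw [LinearMap.zero_apply, Submodule.mkQ_apply, Submodule.Quotient.mk_eq_zero] at h
  exact h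

theorem Cobar.span_prodWords :
    Submodule.span k (Set.range (Cobar.prodWords k (V := V))) = ⊤ := by
  rw [eq_top_iff]
  intro w _
  refine Cobar.induct (Submodule.subset_span (Set.mem_range.2 ⟨[], rfl⟩)) (fun c w hw => ?_) w
  have hc : c ∈ Submodule.span k (Set.range (Bar.word k (V := V))) := by
    rw [Bar.span_word]; trivial
  refine apply_mem_of_mem_span (LinearMap.mulLeft k (Cobar.ι c)) ?_ hw
  rintro _ ⟨L, rfl⟩
  refine apply_mem_of_mem_span (LinearMap.mulRight k (Cobar.prodWords k L) ∘ₗ Cobar.ι) ?_ hc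
  rintro _ ⟨l, rfl⟩
  exact Submodule.subset_span ⟨l :: L, by simp⟩

variable (k V) in
/-- The span of the products of words with less than `n` letters in total. -/
def Cobar.lettersLT (n : ℕ) : Submodule k (Cobar k (Bar k V)) :=
  Submodule.span k (Cobar.prodWords k '' {L | (L.map List.length).sum < n})

theorem Cobar.prodWords_mem {n : ℕ} {L : List (List V)} (hL : (L.map List.length).sum < n) :
    Cobar.prodWords k L ∈ Cobar.lettersLT k V n := Submodule.subset_span ⟨L, hL, rfl⟩

theorem Cobar.lettersLT_mono {m n : ℕ} (h : m ≤ n) :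
    Cobar.lettersLT k V m ≤ Cobar.lettersLT k V n :=
  Submodule.span_mono (Set.image_mono fun _ hL => lt_of_lt_of_le hL h)

theorem Cobar.exists_mem_lettersLT (w : Cobar k (Bar k V)) : ∃ n, w ∈ Cobar.lettersLT k V n := by
  have hw : w ∈ Submodule.span k (Set.range (Cobar.prodWords k (V := V))) := by
    rw [Cobar.span_prodWords]; trivial
  refine Submodule.span_induction (p := fun w _ => ∃ n, w ∈ Cobar.lettersLT k V n) ?_
    ⟨0, zero_mem _⟩ ?_ ?_ hw
  · rintro _ ⟨L, rfl⟩
    exact ⟨_, Cobar.prodWords_mem (Nat.lt_succ_self _)⟩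
  · rintro v w _ _ ⟨m, hv⟩ ⟨n, hw⟩
    exact ⟨max m n, add_mem (Cobar.lettersLT_mono (le_max_left m n) hv)
      (Cobar.lettersLT_mono (le_max_right m n) hw)⟩
  · rintro c w _ ⟨n, hw⟩
    exact ⟨n, Submodule.smul_mem _ c hw⟩

end Spanning

/-! ### Reduction of the twisted cobar construction to k ⊕ V -/

section CobarOfBar

variable {k : Type*} [Field k] {V : Type*} [AddCommGroup V] [Module k V] [NDGA k V]

variable (k V) in
/-- The inclusion of `k ⊕ V` in the cobar construction of the bar construction. -/
def cobarIncl : k × V →ₗ[k] Cobar k (Bar k V) :=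
  (LinearMap.toSpanSingleton k _ 1).coprod (Cobar.ι ∘ₗ Bar.cons.flip Bar.nil)

theorem cobarIncl_apply (p : k × V) :
    cobarIncl k V p = p.1 • 1 + Cobar.ι (Bar.cons p.2 Bar.nil) := by
  simp [cobarIncl]

theorem cobarTw_cobarIncl (p : k × V) : cobarTw k V (cobarIncl k V p) =
    cobarIncl k V (0, del k V p.2) := by
  have h := cobarTw_cons (Bar.cons p.2 Bar.nil) (1 : Cobar k (Bar k V))
  rw [mul_one, cobarTw_one, mul_zero, mul_one, sub_zero] at h
  have h1 : Cobar.ιι ((Bar.cons (sgn k V p.2) (Bar.nil : Bar k V)) ⊗ₜ[k] (Bar.nil : Bar k V)) =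
    Cobar.ι (Bar.cons (sgn k V p.2) Bar.nil) * Cobar.ι Bar.nil := rfl
  rw [cobarIncl_apply, map_add, map_smul, cobarTw_one, h, cobarTwι_cons, cobarIncl_apply,
    Bar.comul_nil, LinearMap.rTensor_tmul, LinearMap.comp_apply, Bar.sgn_nil, h1, Bar.dif_cons]
  simp [Bar.dif_nil]

theorem cobarHtpy_cobarIncl (p : k × V) : cobarHtpy k V (cobarIncl k V p) = 0 := by
  have h := cobarHtpy_cons (Bar.cons p.2 Bar.nil) (1 : Cobar k (Bar k V))
  rw [mul_one] at h
  rw [cobarIncl_apply, map_add, map_smul, cobarHtpy_one, h]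
  simp [Bar.counit_cons]

/-- The error terms of the homotopy are read off on products of words. Each product of two letters
lowers the total number of letters by one, and the remaining errors are multiples of 1 or of a
single one-letter word. -/
theorem cobarHtpy_step {n : ℕ} {z : Cobar k (Bar k V)} (hz : z ∈ Cobar.lettersLT k V (n + 1)) :
    z - (cobarTw k V (cobarHtpy k V z) + cobarHtpy k V (cobarTw k V z)) ∈
      LinearMap.range (cobarIncl k V) ⊔ Cobar.lettersLT k V n := by
  refine apply_mem_of_mem_span (LinearMap.id - (cobarTw k V ∘ₗ cobarHtpy k V +
    cobarHtpy k V ∘ₗ cobarTw k V)) ?_ hz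
  rintro _ ⟨L, hL, rfl⟩
  show Cobar.prodWords k L - (cobarTw k V (cobarHtpy k V (Cobar.prodWords k L)) +
    cobarHtpy k V (cobarTw k V (Cobar.prodWords k L))) ∈ _
  have hl : (L.map List.length).sum < n + 1 := hL
  match L, hl with
  | [], _ =>
    rw [Cobar.prodWords_nil, cobarHtpy_one, cobarTw_one, map_zero, map_zero]
    exact Submodule.mem_sup_left ⟨(1, 0), by simp [cobarIncl_apply]⟩
  | [] :: L, _ =>
    rw [Cobar.prodWords_cons, Bar.word_nil, cobarHtpy_nil_mul, sub_self]
    exact zero_mem _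
  | (r :: x) :: L, hl =>
    have hab : ∀ a b c : Cobar k (Bar k V), a - (a - b - c) = b + c := fun a b c => by abel
    rw [Cobar.prodWords_cons, Bar.word_cons, cobarHtpy_cons_mul, hab]
    refine add_mem (Submodule.smul_mem _ _ (add_mem ?_ ?_)) ?_
    · exact Submodule.mem_sup_left (Submodule.smul_mem _ _ ⟨(0, r), by simp [cobarIncl_apply]⟩)
    · refine Submodule.mem_sup_right ?_
      match L, hl with
      | [], _ => rw [Cobar.prodWords_nil, Cobar.onFirst_one]; exact zero_mem _
      | [] :: L, _ =>
        rw [Cobar.prodWords_cons, Cobar.onFirst_cons, Bar.word_nil, Bar.merge_nil, map_zero,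
          zero_mul]
        exact zero_mem _
      | (s :: t) :: L, hl =>
        rw [Cobar.prodWords_cons, Cobar.onFirst_cons, Bar.word_cons, Bar.merge_cons,
          ← Bar.word_cons, ← Cobar.prodWords_cons]
        refine Cobar.prodWords_mem ?_
        simp only [List.map_cons, List.sum_cons, List.length_cons] at hl ⊢
        omega
    · refine Submodule.mem_sup_right ?_
      match x, L, hl with
      | [], L, _ => rw [Bar.word_nil, Bar.merge_nil, map_zero, map_zero, map_zero]; exact zero_mem _
      | s :: t, [], _ => rw [Cobar.prodWords_nil, Cobar.onFirst_one]; exact zero_mem _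
      | s :: t, l :: L, hl =>
        rw [Cobar.prodWords_cons, Cobar.onFirst_cons, ← Bar.word_cons, ← Cobar.prodWords_cons]
        refine Cobar.prodWords_mem ?_
        simp only [List.map_cons, List.sum_cons, List.length_cons] at hl ⊢
        omega

/-- Every relative cycle of the twisted cobar construction modulo `k ⊕ V` is homologous to an
element of `k ⊕ V`. -/
theorem exists_eq_cobarIncl_add (z : Cobar k (Bar k V))
    (hz : cobarTw k V z ∈ LinearMap.range (cobarIncl k V)) :
    ∃ (p : k × V) (u : Cobar k (Bar k V)), z = cobarIncl k V p + cobarTw k V u := by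
  obtain ⟨n, hn⟩ := Cobar.exists_mem_lettersLT z
  induction n generalizing z with
  | zero =>
    have h0 : z ∈ (⊥ : Submodule k (Cobar k (Bar k V))) := by
      simpa [Cobar.lettersLT] using hn
    refine ⟨0, 0, ?_⟩
    rw [(Submodule.mem_bot k).1 h0, map_zero, map_zero, add_zero]
  | succ n ih =>
    obtain ⟨q, hq⟩ := hz
    have h := cobarHtpy_step hn
    -- The homotopy vanishes on k ⊕ V, so for a relative cycle z the element z - d(hz) itself lies
    -- in k ⊕ V up to terms with fewer letters.
    rw [← hq, cobarHtpy_cobarIncl, add_zero] at h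
    obtain ⟨_, ⟨p, rfl⟩, z', hz', h⟩ := Submodule.mem_sup.1 h
    have hd : z' = z - cobarTw k V (cobarHtpy k V z) - cobarIncl k V p := by
      rw [← h]; abel
    obtain ⟨p', u, hu⟩ := ih z' (by
      rw [hd, map_sub, map_sub, cobarTw_cobarTw, ← hq, cobarTw_cobarIncl, sub_zero, ← map_sub]
      exact ⟨_, rfl⟩) hz'
    refine ⟨p + p', cobarHtpy k V z + u, ?_⟩
    rw [map_add, map_add, eq_sub_of_add_eq' hu.symm, hd]
    abel

end CobarOfBar

/-! ### The counit from the cobar construction to R -/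

section Augmented

variable {k : Type*} [Field k] {R : Type*} [Ring R] [Algebra k R] [DGA k R] (ε : DGHom k R k)

/-- The counit of the twisted cobar construction of the bar construction. -/
theorem cobar_counit_isQuasiIso (s : MC k R)
    (h : (Cobar.liftDG (barMC (augIncl ε))).toAlgHom (Cobar.univ k (BarAug ε)).atNil.val = s.val) :
    IsQuasiIso k ((Cobar.liftDG (barMC (augIncl ε))).twist
      (Cobar.univ k (BarAug ε)).atNil s h).toAlgHom.toLinearMap := by
  have hp : ∀ p : k × AugIdeal ε, (Cobar.liftDG (barMC (augIncl ε))).toAlgHom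
      (cobarIncl k _ p) = p.1 • 1 + (p.2 : R) := by
    intro p
    show Cobar.lift (Bar.proj (augIncl ε)) _ = _
    rw [cobarIncl_apply, map_add, map_smul, map_one, Cobar.lift_ι, Bar.proj_cons, Bar.counit_nil,
      one_smul]
    rfl
  -- The canonical cochain vanishes on the empty word, so at this stage the differential of R is not
  -- twisted.
  have hs : s.val = 0 := by
    rw [← h]
    show Cobar.lift (Bar.proj (augIncl ε)) (Cobar.ι Bar.nil) = 0
    rw [Cobar.lift_ι, Bar.proj_nil]
  have hd : ∀ x : R, twistDel s x = del k R x := fun x => by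
    rw [twistDel_apply, hs, zero_mul, mul_zero, add_zero, sub_zero]
  have hR : ∀ x : R, ∃ p : k × AugIdeal ε, x = p.1 • 1 + (p.2 : R) := fun x =>
    ⟨(augL ε x, ⟨augBar ε x, augL_augBar ε x⟩), eq_add_augBar ε x⟩
  have hdp : ∀ p : k × AugIdeal ε, del k R (p.1 • 1 + (p.2 : R)) = (del k (AugIdeal ε) p.2 : R) := by
    intro p
    rw [map_add, map_smul, DGA.del_one, smul_zero, zero_add]
    rfl
  have hmap : ∀ z, (Cobar.liftDG (barMC (augIncl ε))).toAlgHom (cobarTw k _ z) =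
      del k R ((Cobar.liftDG (barMC (augIncl ε))).toAlgHom z) := fun z =>
    (DGHom.map_twistDel _ _ s h z).trans (hd _)
  refine ⟨DGHom.isChainMap _, ?_, ?_⟩
  · intro z hz hw
    have hz' : cobarTw k (AugIdeal ε) z = 0 := hz
    obtain ⟨(w : R), hw⟩ := hw
    have hw' : (Cobar.liftDG (barMC (augIncl ε))).toAlgHom z = del k R w := hw.trans (hd w)
    obtain ⟨p, u, rfl⟩ := exists_eq_cobarIncl_add z (by rw [hz']; exact zero_mem _)
    -- The primitive w of the image of z, corrected by the image of u, is lifted along R = k ⊕ ker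
    -- ε. Its lift q bounds p, and q + u bounds z.
    obtain ⟨q, hq⟩ := hR (w - (Cobar.liftDG (barMC (augIncl ε))).toAlgHom u)
    have e : p.1 • (1 : R) + (p.2 : R) = (del k (AugIdeal ε) q.2 : R) := by
      rw [← hdp, ← hq, map_sub, ← hw', map_add, hp, hmap, add_sub_cancel_right]
    have e1 : p.1 = 0 := by
      have := congrArg (augL ε) e
      rw [map_add, map_smul, augL_one, show augL ε (p.2 : R) = 0 from p.2.2,
        show augL ε (del k (AugIdeal ε) q.2 : R) = 0 from (del k (AugIdeal ε) q.2).2] at this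
      simpa using this
    have e2 : p.2 = del k (AugIdeal ε) q.2 := by
      rw [e1, zero_smul, zero_add] at e
      exact Subtype.ext e
    refine ⟨cobarIncl k _ q + u, ?_⟩
    show _ = cobarTw k (AugIdeal ε) _
    rw [map_add, cobarTw_cobarIncl, ← e2, ← e1]
  · intro y hy
    have hy' : del k R y = 0 := (hd y).symm.trans hy
    obtain ⟨p, rfl⟩ := hR y
    rw [hdp] at hy'
    refine ⟨cobarIncl k _ p, ?_, 0, ?_⟩
    · show cobarTw k (AugIdeal ε) _ = 0
      rw [cobarTw_cobarIncl, show del k (AugIdeal ε) p.2 = 0 from Subtype.ext hy']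
      exact map_zero _
    · rw [map_zero, add_zero]
      exact (hp p).symm

/-- Change of coefficients leaves only the statement about the counit with the twist at the empty
word. Neither connectedness nor finiteness enters. -/
theorem cobarCounit_isQuasiIso : IsQuasiIso k (cobarCounit ε).toAlgHom.toLinearMap :=
  postcomp_twist_isQuasiIso _ _ _ _ (cobar_counit_isQuasiIso ε _ _)

end Augmented

/-! ### Homogeneous subalgebras -/

section SubNDGAs

variable {k : Type*} [Field k] {V : Type*} [AddCommGroup V] [Module k V]

variable (k V) in
/-- A homogeneous subspace. -/
structure GrSub [GrMod k V] where
  carrier : Submodule k V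
  pr_mem : ∀ n, ∀ x ∈ carrier, pr k V n x ∈ carrier

instance [GrMod k V] (S : GrSub k V) : GrMod k S.carrier where
  part n := (gr k V n).comap S.carrier.subtype
  internal := by
    refine isInternal_of_separating (T := Unit) (W := V) _
      (fun n _ => pr k V n ∘ₗ S.carrier.subtype) ?_ ?_ ?_
    · intro m n hmn v hv _
      exact pr_of_mem_ne hmn hv
    · intro n v hv h
      have h1 := h ()
      rw [LinearMap.comp_apply, pr_of_mem (show S.carrier.subtype v ∈ gr k V n from hv)] at h1
      exact Subtype.ext h1
    · rw [eq_top_iff]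
      rintro v -
      obtain ⟨s, hs⟩ := eq_sum_pr (k := k) (v : V)
      have : v = ∑ n ∈ s, (⟨pr k V n v, S.pr_mem n v v.2⟩ : S.carrier) := by
        apply Subtype.ext
        rw [AddSubmonoidClass.coe_finsetSum]
        exact hs
      rw [this]
      exact sum_mem fun n _ => Submodule.mem_iSup_of_mem n
        (show pr k V n v ∈ gr k V n from pr_mem n _)

theorem GrSub.mem_gr [GrMod k V] (S : GrSub k V) {n : ℤ} {v : S.carrier} :
    v ∈ gr k S.carrier n ↔ (v : V) ∈ gr k V n := Iff.rfl

variable (k V) in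
/-- A homogeneous subspace that is closed under the differential and the product. -/
structure SubNDGA [NDGA k V] extends GrSub k V where
  del_mem : ∀ x ∈ carrier, del k V x ∈ carrier
  mul_mem : ∀ x ∈ carrier, ∀ y ∈ carrier, NDGA.mul (k := k) x y ∈ carrier

instance [NDGA k V] (S : SubNDGA k V) : NDGA k S.carrier where
  dif := (del k V).restrict S.del_mem
  dif_mem n v hv := Cx.dif_mem n v.1 hv
  dif_dif v := Subtype.ext (Cx.dif_dif v.1)
  mul := LinearMap.mk₂ k (fun x y => ⟨NDGA.mul (k := k) x.1 y.1, S.mul_mem _ x.2 _ y.2⟩)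
    (fun x x' y => Subtype.ext (by simp)) (fun c x y => Subtype.ext (by simp))
    (fun x y y' => Subtype.ext (by simp)) (fun c x y => Subtype.ext (by simp))
  mul_mem m n x hx y hy := NDGA.mul_mem m n x.1 hx y.1 hy
  mul_assoc x y z := Subtype.ext (NDGA.mul_assoc x.1 y.1 z.1)
  leibniz m x hx y := Subtype.ext (NDGA.leibniz m x.1 hx y.1)

/-- The inclusion of a subobject. -/
def SubNDGA.incl [NDGA k V] (S : SubNDGA k V) : NDGHom k S.carrier V where
  toLinearMap := S.carrier.subtype
  map_mem _ _ h := h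
  map_del _ := rfl
  map_mul _ _ := rfl

end SubNDGAs

/-! ### Letterwise maps and homotopies on words -/

section LetterwiseMaps

variable {k : Type*} [Field k] {V W : Type*} [AddCommGroup V] [Module k V] [AddCommGroup W]
  [Module k W]

/-- Apply a linear map to all letters. -/
def Bar.letters (q : V →ₗ[k] W) : Bar k V →ₗ[k] Bar k W := Bar.rec' Bar.nil 0 (Bar.cons ∘ₗ q)

@[simp] theorem Bar.letters_nil (q : V →ₗ[k] W) : Bar.letters q Bar.nil = Bar.nil := by
  simp [Bar.letters]

@[simp] theorem Bar.letters_cons (q : V →ₗ[k] W) (v : V) (w : Bar k V) :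
    Bar.letters q (Bar.cons v w) = Bar.cons (q v) (Bar.letters q w) := by
  simp [Bar.letters]

theorem Bar.letters_mem [GrMod k V] [GrMod k W] {q : V →ₗ[k] W} (hq : q ∈ homGr k V W 0) :
    Bar.letters q ∈ homGr k (Bar k V) (Bar k W) 0 := by
  intro n w hw
  rw [add_zero]
  refine Bar.induction_gr (p := fun n w => Bar.letters q w ∈ gr k (Bar k W) n) ?_ ?_ ?_ ?_ ?_ hw
  · rw [Bar.letters_nil]; exact Bar.nil_mem
  · intro j r hr n w hw h
    rw [Bar.letters_cons]
    exact Bar.cons_mem (gr_of_eq (hq j r hr) (add_zero j)) h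
  · intro n; rw [map_zero]; exact zero_mem _
  · intro n x y hx hy
    rw [map_add]; exact add_mem hx hy
  · intro n c x hx
    rw [map_smul]; exact Submodule.smul_mem _ _ hx

theorem Bar.letters_mem_lenLT {n : ℕ} (q : V →ₗ[k] W) {w : Bar k V} (hw : w ∈ Bar.lenLT k V n) :
    Bar.letters q w ∈ Bar.lenLT k W n := by
  induction n generalizing w with
  | zero => rw [(Submodule.mem_bot k).1 hw, map_zero]; exact zero_mem _
  | succ n ih =>
    refine (Bar.lenLT_succ_le (S := (Bar.lenLT k W (n + 1)).comap (Bar.letters q)) ?_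
      fun v w hw => ?_) hw
    · rw [Submodule.mem_comap, Bar.letters_nil]; exact Bar.nil_mem_lenLT n
    · rw [Submodule.mem_comap, Bar.letters_cons]; exact Bar.cons_mem_lenLT _ (ih hw)

/-- The homotopy on words induced by a homotopy `h` on letters from the identity to `r`. -/
def Bar.lettersHtpy [GrMod k V] (h r : V →ₗ[k] V) : Bar k V →ₗ[k] Bar k V :=
  Bar.rec' 0 (-(Bar.cons ∘ₗ h)) (-(Bar.cons ∘ₗ sgn k V ∘ₗ r))

@[simp] theorem Bar.lettersHtpy_nil [GrMod k V] (h r : V →ₗ[k] V) :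
    Bar.lettersHtpy h r Bar.nil = 0 := by simp [Bar.lettersHtpy]

@[simp] theorem Bar.lettersHtpy_cons [GrMod k V] (h r : V →ₗ[k] V) (v : V) (w : Bar k V) :
    Bar.lettersHtpy h r (Bar.cons v w) =
      -Bar.cons (h v) w - Bar.cons (sgn k V (r v)) (Bar.lettersHtpy h r w) := by
  simp [Bar.lettersHtpy, sub_eq_add_neg]

theorem Bar.lettersHtpy_mem_lenLT [GrMod k V] {n : ℕ} (h r : V →ₗ[k] V) {w : Bar k V}
    (hw : w ∈ Bar.lenLT k V n) : Bar.lettersHtpy h r w ∈ Bar.lenLT k V n := by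
  induction n generalizing w with
  | zero => rw [(Submodule.mem_bot k).1 hw, map_zero]; exact zero_mem _
  | succ n ih =>
    refine (Bar.lenLT_succ_le (S := (Bar.lenLT k V (n + 1)).comap (Bar.lettersHtpy h r)) ?_
      fun v w hw => ?_) hw
    · rw [Submodule.mem_comap, Bar.lettersHtpy_nil]; exact zero_mem _
    · rw [Submodule.mem_comap, Bar.lettersHtpy_cons]
      exact sub_mem (neg_mem (Bar.cons_mem_lenLT _ hw)) (Bar.cons_mem_lenLT _ (ih hw))

theorem Bar.lettersHtpy_mem [GrMod k V] {h r : V →ₗ[k] V} (hh : h ∈ homGr k V V 1)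
    (hr : r ∈ homGr k V V 0) : Bar.lettersHtpy h r ∈ homGr k (Bar k V) (Bar k V) 1 := by
  intro n w hw
  refine Bar.induction_gr (p := fun n w => Bar.lettersHtpy h r w ∈ gr k (Bar k V) (n + 1))
    ?_ ?_ ?_ ?_ ?_ hw
  · rw [Bar.lettersHtpy_nil]; exact zero_mem _
  · intro j v hv n w hw ih
    rw [Bar.lettersHtpy_cons]
    refine sub_mem (neg_mem (gr_of_eq (Bar.cons_mem (hh j v hv) hw) (by ring))) ?_
    have h1 := hr j v hv
    rw [add_zero] at h1
    rw [sgn_of_mem h1, map_smul, LinearMap.smul_apply]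
    exact Submodule.smul_mem _ _ (gr_of_eq (Bar.cons_mem h1 ih) (by ring))
  · intro n; rw [map_zero]; exact zero_mem _
  · intro n x y hx hy
    rw [map_add]; exact add_mem hx hy
  · intro n c x hx
    rw [map_smul]; exact Submodule.smul_mem _ _ hx

variable [NDGA k V] {h r : V →ₗ[k] V}

/-- Up to shorter words, `lettersHtpy` is a homotopy from the identity to `letters r`. -/
theorem Bar.lettersHtpy_spec (hh : h ∈ homGr k V V 1)
    (hr : ∀ v, r v = v - del k V (h v) - h (del k V v)) {n : ℕ} {w : Bar k V}
    (hw : w ∈ Bar.lenLT k V (n + 1)) :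
    Bar.dif (Bar.lettersHtpy h r w) + Bar.lettersHtpy h r (Bar.dif w) - (w - Bar.letters r w) ∈
      Bar.lenLT k V n := by
  have hsh : ∀ v, sgn k V (h v) = -h (sgn k V v) := by
    intro v
    have h1 := LinearMap.congr_fun (hat_of_mem hh) (sgn k V v)
    simp only [hat, LinearMap.comp_apply, sgn_sgn, koszul_one,
      neg_smul, one_smul] at h1
    exact h1
  have hsr : ∀ v, sgn k V (r v) = r (sgn k V v) := by
    intro v
    rw [hr, hr, map_sub, map_sub, sgn_del, hsh, map_neg, hsh, sgn_del, map_neg, neg_neg, neg_neg]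
  have hdr : ∀ v, del k V (r v) = r (del k V v) := by
    intro v
    rw [hr, hr, map_sub, map_sub, del_del, del_del, map_zero]
    abel
  induction n generalizing w with
  | zero =>
    refine (Bar.lenLT_succ_le (S := (Bar.lenLT k V 0).comap (Bar.dif ∘ₗ Bar.lettersHtpy h r +
      Bar.lettersHtpy h r ∘ₗ Bar.dif - (LinearMap.id - Bar.letters r))) ?_ fun v w hw => ?_) hw
    · simp [Bar.dif_nil]
    · rw [(Submodule.mem_bot k).1 hw, map_zero]; exact zero_mem _
  | succ n ih =>
    refine (Bar.lenLT_succ_le (S := (Bar.lenLT k V (n + 1)).comap (Bar.dif ∘ₗ Bar.lettersHtpy h r +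
      Bar.lettersHtpy h r ∘ₗ Bar.dif - (LinearMap.id - Bar.letters r))) ?_ fun v w hw => ?_) hw
    · simp [Bar.dif_nil]
    · have h1 := Bar.cons_mem_lenLT (r v) (ih hw)
      have h2 := Bar.merge_mem_lenLT (h v) hw
      have h3 := Bar.merge_mem_lenLT (sgn k V (r v)) (Bar.lettersHtpy_mem_lenLT h r hw)
      have h4 := Bar.lettersHtpy_mem_lenLT h r (Bar.merge_mem_lenLT v hw)
      have h5 := sub_mem (add_mem h1 h4) (add_mem h2 h3)
      rw [Submodule.mem_comap]
      convert h5 using 1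
      have h6 : Bar.cons (r v) w = Bar.cons v w - Bar.cons (del k V (h v)) w -
        Bar.cons (h (del k V v)) w := by rw [hr v]; simp
      have h7 : del k V (r (sgn k V v)) = -r (sgn k V (del k V v)) := by
        rw [hdr, sgn_del, map_neg, neg_neg]
      simp only [LinearMap.sub_apply, LinearMap.add_apply, LinearMap.comp_apply,
        LinearMap.id_apply, Bar.lettersHtpy_cons, Bar.letters_cons, Bar.dif_cons, map_sub, map_add,
        map_neg, hsh, h6, h7, hsr, sgn_sgn, LinearMap.neg_apply]
      abel

end LetterwiseMaps

/-! ### Functionals with values in the ground field -/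

section Functionals

variable {k : Type*} [Field k] {C : Type*} [AddCommGroup C] [Module k C]

theorem sgn_ground (x : k) : sgn k k x = x :=
  (sgn_of_mem (n := 0) (by show x ∈ (if (0 : ℤ) = 0 then ⊤ else ⊥ : Submodule k k); simp)).trans
    (by simp)

theorem hat_ground [GrMod k C] (f : C →ₗ[k] k) : hat f = f ∘ₗ sgn k C :=
  LinearMap.ext fun x => sgn_ground (f (sgn k C x))

theorem homDel_ground [Cx k C] (f : C →ₗ[k] k) (x : C) :
    homDel f x = f (del k C (sgn k C x)) := by
  have h : del k k (f x) = 0 := rfl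
  rw [homDel_apply, LinearMap.sub_apply, LinearMap.comp_apply, h, hat_ground,
    LinearMap.comp_apply, LinearMap.comp_apply, sgn_del, map_neg, zero_sub, neg_neg]

theorem homDel_ground_eq_zero [Cx k C] {f : C →ₗ[k] k} :
    homDel f = 0 ↔ ∀ x, f (del k C x) = 0 := by
  constructor
  · intro h x
    have := LinearMap.congr_fun h (sgn k C x)
    rwa [homDel_ground, sgn_sgn] at this
  · intro h
    ext x
    rw [homDel_ground, h]
    rfl

theorem mem_homGr_ground [GrMod k C] {m : ℤ} {f : C →ₗ[k] k} :
    f ∈ homGr k C k m ↔ ∀ n, n + m ≠ 0 → ∀ x ∈ gr k C n, f x = 0 := by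
  constructor
  · intro h n hn x hx
    exact (ground_mem k hn).1 (h n x hx)
  · intro h n x hx
    by_cases hn : n + m = 0
    · rw [hn]
      show f x ∈ (if (0 : ℤ) = 0 then ⊤ else ⊥ : Submodule k k)
      simp
    · exact (ground_mem k hn).2 (h n hn x hx)

end Functionals

/-! ### Contraction onto a projection -/

section Homotopies

variable {k : Type*} [Field k] {V W : Type*} [AddCommGroup V] [Module k V] [AddCommGroup W]
  [Module k W]

theorem map_sgn_of_mem [GrMod k V] [GrMod k W] {n : ℤ} {f : V →ₗ[k] W} (hf : f ∈ homGr k V W n)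
    (x : V) : sgn k W (f x) = koszul k n • f (sgn k V x) := by
  have h := LinearMap.congr_fun (hat_of_mem hf) (sgn k V x)
  simpa only [hat, LinearMap.comp_apply, sgn_sgn, LinearMap.smul_apply] using h

theorem map_sgn_of_mem_one [GrMod k V] {f : V →ₗ[k] V} (hf : f ∈ homGr k V V 1)
    (x : V) : sgn k V (f x) = -f (sgn k V x) := by
  rw [map_sgn_of_mem hf, koszul_one, neg_smul, one_smul]

theorem map_sgn_of_mem_zero [GrMod k V] [GrMod k W] {f : V →ₗ[k] W} (hf : f ∈ homGr k V W 0)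
    (x : V) : sgn k W (f x) = f (sgn k V x) := by
  rw [map_sgn_of_mem hf, koszul_zero, one_smul]

/-- A complex contracts to the image of a projection that sees its homology. -/
theorem exists_contraction_to_projection [Cx k V] {r : V →ₗ[k] V} (hr : r ∈ homGr k V V 0)
    (hdr : ∀ x, del k V (r x) = 0) (hrd : ∀ x, r (del k V x) = 0) (hrr : ∀ x, r (r x) = r x)
    (hac : ∀ n, ∀ x ∈ gr k V n, del k V x = 0 → r x = 0 → ∃ u, x = del k V u) :
    ∃ h ∈ homGr k V V 1, (∀ x, x - r x = del k V (h x) + h (del k V x)) ∧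
      (∀ x, r (h x) = 0) ∧ ∀ x, h (r x) = 0 := by
  have hker : ∀ n, ∀ x ∈ LinearMap.ker r, pr k V n x ∈ LinearMap.ker r := fun n x hx => by
    rw [LinearMap.mem_ker] at hx ⊢
    rw [map_pr hr n x, hx, map_zero]
  obtain ⟨h, hh, hM, -, hc⟩ := exists_rel_contraction (⊥ : Submodule k V) (LinearMap.ker r)
    (by simp) hker (by simp) (fun x hx hdx => by
      have hx' : x ∈ LinearMap.range (del k V) := mem_of_pr_mem (k := k) fun n => by
        obtain ⟨u, hu⟩ := hac n _ (pr_mem n x)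
          (by rw [del_pr, (Submodule.mem_bot k).1 hdx, map_zero]) (hker n x hx)
        exact ⟨u, hu.symm⟩
      obtain ⟨u, hu⟩ := hx'
      -- The primitive has to be moved into the kernel of r; its boundary does not change because r
      -- takes values in cycles.
      refine ⟨u - r u, ?_, ?_⟩
      · rw [LinearMap.mem_ker, map_sub, hrr, sub_self]
      · rw [map_sub, hdr, sub_zero, hu, sub_self]; exact zero_mem _)
  have hr1 : LinearMap.id - r ∈ homGr k V V 0 :=
    sub_mem (fun i v hv => by rw [add_zero]; exact hv) hr
  -- The relative contraction is only valid on the kernel of r. Precomposing with the projection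
  -- onto this kernel makes it valid everywhere and makes it vanish on the image of r.
  refine ⟨h ∘ₗ (LinearMap.id - r), by simpa using comp_mem_homGr hh hr1, fun x => ?_,
    fun x => hM _, fun x => ?_⟩
  · have h1 := hc (x - r x) (by rw [LinearMap.mem_ker, map_sub, hrr, sub_self])
    have h2 : del k V (x - r x) = del k V x := by rw [map_sub, hdr, sub_zero]
    rw [Submodule.mem_bot, h2, sub_sub, sub_eq_zero] at h1
    simpa only [LinearMap.comp_apply, LinearMap.sub_apply, LinearMap.id_apply, hrd, sub_zero]
      using h1
  · simp only [LinearMap.comp_apply, LinearMap.sub_apply, LinearMap.id_apply, hrr, sub_self,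
      map_zero]

end Homotopies

/-! ### Functionals on words in a deformation retract -/

section RestrictionOfFunctionals

variable {k : Type*} [Field k] {V : Type*} [AddCommGroup V] [Module k V] [NDGA k V]
  {S : SubNDGA k V}

/-- A linear deformation of `V` into a subobject. -/
structure SubNDGA.Deformation (S : SubNDGA k V) where
  htpy : V →ₗ[k] V
  htpy_mem : htpy ∈ homGr k V V 1
  htpy_eq_zero : ∀ x ∈ S.carrier, htpy x = 0
  proj : V →ₗ[k] S.carrier
  proj_eq : ∀ x, (proj x : V) = x - del k V (htpy x) - htpy (del k V x)

variable (D : S.Deformation)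

theorem SubNDGA.Deformation.proj_mem : D.proj ∈ homGr k V S.carrier 0 := by
  intro n x hx
  rw [S.mem_gr, D.proj_eq, add_zero]
  refine sub_mem (sub_mem hx ?_) ?_
  · simpa using DG.del_mem (D.htpy_mem n x hx)
  · simpa using D.htpy_mem _ _ (DG.del_mem hx)

theorem SubNDGA.Deformation.proj_incl (x : S.carrier) : D.proj (x : V) = x := by
  apply Subtype.ext
  rw [D.proj_eq, D.htpy_eq_zero _ x.2, D.htpy_eq_zero _ (S.del_mem _ x.2), map_zero, sub_zero,
    sub_zero]

theorem SubNDGA.mapL_mem (S : SubNDGA k V) :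
    Bar.mapL S.incl ∈ homGr k (Bar k S.carrier) (Bar k V) 0 := fun n x hx => by
  rw [add_zero]; exact (Bar.map S.incl).map_mem n x hx

theorem SubNDGA.mapL_dif (S : SubNDGA k V) (x : Bar k S.carrier) :
    Bar.mapL S.incl (Bar.dif x) = Bar.dif (Bar.mapL S.incl x) := (Bar.map S.incl).map_del x

theorem SubNDGA.Deformation.letters_mapL (x : Bar k S.carrier) :
    Bar.letters D.proj (Bar.mapL S.incl x) = x := by
  have : Bar.letters D.proj ∘ₗ Bar.mapL S.incl = LinearMap.id :=
    Bar.ext' (by simp [Bar.mapL_nil]) fun v w hw => by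
      have h1 : D.proj (S.incl.toLinearMap v) = v := D.proj_incl v
      rw [LinearMap.comp_apply, LinearMap.id_apply] at hw
      rw [LinearMap.comp_apply, Bar.mapL_cons, Bar.letters_cons, hw, h1, LinearMap.id_apply]
  exact LinearMap.congr_fun this x

theorem SubNDGA.Deformation.mapL_letters (x : Bar k V) :
    Bar.mapL S.incl (Bar.letters D.proj x) =
      Bar.letters (S.carrier.subtype ∘ₗ D.proj) x := by
  have : Bar.mapL S.incl ∘ₗ Bar.letters D.proj = Bar.letters (S.carrier.subtype ∘ₗ D.proj) :=
    Bar.ext' (by simp [Bar.mapL_nil]) fun v w hw => by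
      rw [LinearMap.comp_apply] at hw
      rw [LinearMap.comp_apply, Bar.letters_cons, Bar.mapL_cons, hw, Bar.letters_cons]
      rfl
  exact LinearMap.congr_fun this x

theorem SubNDGA.Deformation.lettersHtpy_mapL (x : Bar k S.carrier) :
    Bar.lettersHtpy D.htpy (S.carrier.subtype ∘ₗ D.proj) (Bar.mapL S.incl x) = 0 := by
  have : Bar.lettersHtpy D.htpy (S.carrier.subtype ∘ₗ D.proj) ∘ₗ Bar.mapL S.incl = 0 :=
    Bar.ext' (by simp [Bar.mapL_nil]) fun v w hw => by
      have h1 : D.htpy (S.incl.toLinearMap v) = 0 := D.htpy_eq_zero _ v.2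
      rw [LinearMap.comp_apply, LinearMap.zero_apply] at hw
      rw [LinearMap.comp_apply, Bar.mapL_cons, Bar.lettersHtpy_cons, hw, h1]
      simp
  exact LinearMap.congr_fun this x

theorem SubNDGA.Deformation.subtype_proj_mem :
    S.carrier.subtype ∘ₗ D.proj ∈ homGr k V V 0 := fun n x hx => D.proj_mem n x hx

/-- Compose z with the letterwise homotopy H from the identity to the projection onto words in S. As
z kills boundaries and words in S, the homotopy formula leaves z = z∘H∘d on words of length at most
n, the error being a value of z on shorter words, where z vanishes. The sign operator in the witness
turns this composite into a value of `homDel`. -/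
theorem SubNDGA.Deformation.exists_homDel_approx (D : S.Deformation) {m : ℤ} {n : ℕ}
    {z : Bar k V →ₗ[k] k} (hz : z ∈ lenGE k V k n) (hzm : z ∈ homGr k (Bar k V) k m)
    (hdz : homDel z = 0) (hz0 : ∀ x, z (Bar.mapL S.incl x) = 0) :
    ∃ u ∈ lenGE k V k n, u ∈ homGr k (Bar k V) k (m + 1) ∧ (∀ x, u (Bar.mapL S.incl x) = 0) ∧
      z - homDel u ∈ lenGE k V k (n + 1) ∧ ∀ x, homDel u (Bar.mapL S.incl x) = 0 := by
  set r : V →ₗ[k] V := S.carrier.subtype ∘ₗ D.proj with hr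
  have hHmem := Bar.lettersHtpy_mem D.htpy_mem D.subtype_proj_mem
  have hdz' := homDel_ground_eq_zero.1 hdz
  have hDu : ∀ w, homDel (hat z ∘ₗ Bar.lettersHtpy D.htpy r) w =
      z (Bar.lettersHtpy D.htpy r (Bar.dif w)) := fun w => by
    rw [homDel_ground, hat_ground, LinearMap.comp_apply,
      LinearMap.comp_apply, map_sgn_of_mem_one hHmem, sgn_del, sgn_sgn, map_neg, map_neg, map_neg,
      neg_neg]
    rfl
  refine ⟨hat z ∘ₗ Bar.lettersHtpy D.htpy r,
    fun w hw => hat_mem_lenGE hz _ (Bar.lettersHtpy_mem_lenLT _ _ hw), ?_, fun x => ?_,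
    fun w hw => ?_, fun x => ?_⟩
  · rw [hat_of_mem hzm]
    exact comp_mem_homGr (Submodule.smul_mem _ _ hzm) hHmem
  · rw [LinearMap.comp_apply, D.lettersHtpy_mapL, map_zero]
  · have h1 := hz _ (Bar.lettersHtpy_spec (r := r) D.htpy_mem D.proj_eq hw)
    have h2 : z (Bar.dif (Bar.lettersHtpy D.htpy r w)) = 0 := hdz' _
    have h3 : z (Bar.letters r w) = 0 := by rw [hr, ← D.mapL_letters]; exact hz0 _
    rw [map_sub, map_sub, map_add] at h1
    change z (Bar.dif (Bar.lettersHtpy D.htpy r w)) + z (Bar.lettersHtpy D.htpy r (Bar.dif w)) -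
      (z w - z (Bar.letters r w)) = 0 at h1
    rw [h2, h3, zero_add, sub_zero, sub_eq_zero] at h1
    rw [LinearMap.sub_apply, hDu, h1, sub_self]
  · rw [hDu, ← S.mapL_dif, D.lettersHtpy_mapL, map_zero]

/-- Subtract the extension by `proj` of the restriction. -/
def SubNDGA.Deformation.relPart : (Bar k V →ₗ[k] k) →ₗ[k] (Bar k V →ₗ[k] k) where
  toFun u := u - u ∘ₗ Bar.letters (S.carrier.subtype ∘ₗ D.proj)
  map_add' u v := by rw [LinearMap.add_comp]; abel
  map_smul' c u := by rw [LinearMap.smul_comp, RingHom.id_apply, smul_sub]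

theorem SubNDGA.Deformation.relPart_apply (u : Bar k V →ₗ[k] k) (w : Bar k V) :
    D.relPart u w = u w - u (Bar.mapL S.incl (Bar.letters D.proj w)) := by
  rw [D.mapL_letters]; rfl

theorem SubNDGA.Deformation.relPart_mapL (u : Bar k V →ₗ[k] k) (x : Bar k S.carrier) :
    D.relPart u (Bar.mapL S.incl x) = 0 := by
  rw [D.relPart_apply, D.letters_mapL, sub_self]

theorem SubNDGA.Deformation.relPart_eq {u : Bar k V →ₗ[k] k}
    (hu : ∀ x, u (Bar.mapL S.incl x) = 0) : D.relPart u = u := by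
  ext w
  rw [D.relPart_apply, hu, sub_zero]

theorem SubNDGA.Deformation.relPart_mem {m : ℤ} {u : Bar k V →ₗ[k] k}
    (hu : u ∈ homGr k (Bar k V) k m) : D.relPart u ∈ homGr k (Bar k V) k m := by
  have := comp_mem_homGr hu (Bar.letters_mem D.subtype_proj_mem)
  rw [add_zero] at this
  exact sub_mem hu this

theorem SubNDGA.Deformation.relPart_mem_lenGE {n : ℕ} {u : Bar k V →ₗ[k] k}
    (hu : u ∈ lenGE k V k n) : D.relPart u ∈ lenGE k V k n :=
  sub_mem hu fun _ hw => hu _ (Bar.letters_mem_lenLT _ hw)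

/-- A closed functional that vanishes on the words in the subobject is the boundary of such a
functional. -/
theorem SubNDGA.Deformation.exists_eq_homDel (D : S.Deformation) {m : ℤ} {f : Bar k V →ₗ[k] k}
    (hf : f ∈ homGr k (Bar k V) k m) (hdf : homDel f = 0)
    (h0 : ∀ x, f (Bar.mapL S.incl x) = 0) :
    ∃ u ∈ homGr k (Bar k V) k (m + 1), f = homDel u ∧ ∀ x, u (Bar.mapL S.incl x) = 0 := by
  have hD : ∀ n, ∀ g ∈ lenGE k V k n, homDel (D.relPart g) ∈ lenGE k V k n := fun n g hg =>
    homDel_mem_lenGE (V := V) (Q := k) (D.relPart_mem_lenGE hg)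
  -- The approximation is run for the operator `homDel` after `relPart`. The limit of the
  -- corrections can then be replaced by its `relPart`, which vanishes on the words in S.
  obtain ⟨u, -, hu, hfu⟩ := exists_of_lenGE_approx (k := k) (V := V) (Q := k) (P := k)
    (m := m + 1) ((homDel (V := Bar k V) (W := k)) ∘ₗ D.relPart) hD
    (fun z => z ∈ homGr k (Bar k V) k m ∧ homDel z = 0 ∧ ∀ x, z (Bar.mapL S.incl x) = 0) 0
    (fun n _ z hz hgood => by
      obtain ⟨u, hu, hum, hu0, hzu, hdu⟩ :=
        D.exists_homDel_approx hz hgood.1 hgood.2.1 hgood.2.2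
      have hDL : homDel (D.relPart u) = homDel u := congrArg homDel (D.relPart_eq hu0)
      rw [← hDL] at hzu
      have hum' := homDel_mem hum
      rw [add_sub_cancel_right] at hum'
      have h1 : homDel (z - homDel u) = 0 := by
        rw [map_sub, hgood.2.1, homDel_homDel, sub_zero]
      have h2 : ∀ x, (z - homDel u) (Bar.mapL S.incl x) = 0 := fun x => by
        rw [LinearMap.sub_apply, hgood.2.2, hdu, sub_zero]
      have h3 := sub_mem hgood.1 hum'
      rw [← hDL] at h1 h2 h3
      exact ⟨u, hu, hum, hzu, h3, h1, h2⟩)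
    (z := f) (mem_lenGE_zero f) ⟨hf, hdf, h0⟩
  exact ⟨D.relPart u, D.relPart_mem hu, hfu, D.relPart_mapL u⟩

/-- Closed functionals extend to closed functionals. -/
theorem SubNDGA.Deformation.exists_extension (D : S.Deformation) {m : ℤ} {f : Bar k S.carrier →ₗ[k] k}
    (hf : f ∈ homGr k (Bar k S.carrier) k m) (hdf : homDel f = 0) :
    ∃ g ∈ homGr k (Bar k V) k m, homDel g = 0 ∧ ∀ x, g (Bar.mapL S.incl x) = f x := by
  have hg : f ∘ₗ Bar.letters D.proj ∈ homGr k (Bar k V) k m := by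
    simpa using comp_mem_homGr hf (Bar.letters_mem D.proj_mem)
  have hres : ∀ x, (f ∘ₗ Bar.letters D.proj) (Bar.mapL S.incl x) = f x := fun x => by
    rw [LinearMap.comp_apply, D.letters_mapL]
  -- Extending f along the letterwise projection does not give a closed functional, since the
  -- projection is not multiplicative. The boundary of the extension is closed and vanishes on words
  -- in S; subtracting a primitive that also vanishes there corrects the extension without changing
  -- its restriction.
  obtain ⟨u, hu, hgu, hu0⟩ := D.exists_eq_homDel (homDel_mem hg) (homDel_homDel _) (fun x => by
    rw [homDel_ground, map_sgn_of_mem_zero S.mapL_mem]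
    show (f ∘ₗ Bar.letters D.proj) (Bar.dif _) = 0
    rw [← S.mapL_dif, hres]
    exact homDel_ground_eq_zero.1 hdf _)
  rw [sub_add_cancel] at hu
  refine ⟨_, sub_mem hg hu, by rw [map_sub, ← hgu, sub_self], fun x => ?_⟩
  rw [LinearMap.sub_apply, hres, hu0, sub_zero]

end RestrictionOfFunctionals

/-! ### Truncation to strictly positive or strictly negative degrees -/

section StrictlyBounded

variable {k : Type*} [Field k] {V : Type*} [AddCommGroup V] [Module k V] [NDGA k V]

/-- The homogeneous subspace with given parts. -/
def GrSub.ofParts (P : ℤ → Submodule k V) : GrSub k V where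
  carrier := ⨅ n, (P n).comap (pr k V n)
  pr_mem n x hx := by
    rw [Submodule.mem_iInf] at hx ⊢
    intro m
    rw [Submodule.mem_comap]
    by_cases h : n = m
    · subst h
      rw [pr_of_mem (DG.pr_mem n x)]
      exact hx n
    · rw [pr_of_mem_ne h (DG.pr_mem n x)]
      exact zero_mem _

theorem GrSub.mem_ofParts {P : ℤ → Submodule k V} {x : V} :
    x ∈ (GrSub.ofParts P).carrier ↔ ∀ n, pr k V n x ∈ P n := by
  simp [GrSub.ofParts]

theorem GrSub.mem_ofParts_of_mem {P : ℤ → Submodule k V} {n : ℤ} {x : V} (hx : x ∈ gr k V n) :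
    x ∈ (GrSub.ofParts P).carrier ↔ x ∈ P n := by
  rw [GrSub.mem_ofParts]
  constructor
  · intro h
    have := h n
    rwa [pr_of_mem hx] at this
  · intro h m
    by_cases hm : n = m
    · subst hm; rwa [pr_of_mem hx]
    · rw [pr_of_mem_ne hm hx]; exact zero_mem _

theorem GrSub.induction (S : GrSub k V) {T : Submodule k V}
    (h : ∀ n, ∀ x ∈ gr k V n, x ∈ S.carrier → x ∈ T) {x : V} (hx : x ∈ S.carrier) : x ∈ T :=
  mem_of_pr_mem (k := k) fun n => h n _ (DG.pr_mem n x) (S.pr_mem n x hx)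

/-- A subobject is given by homogeneous parts that are stable under the operations. -/
def SubNDGA.ofParts (P : ℤ → Submodule k V)
    (hd : ∀ n, ∀ x ∈ gr k V n, x ∈ P n → del k V x ∈ P (n - 1))
    (hm : ∀ m n, ∀ x ∈ gr k V m, x ∈ P m → ∀ y ∈ gr k V n, y ∈ P n →
      NDGA.mul (k := k) x y ∈ P (m + n)) : SubNDGA k V where
  toGrSub := GrSub.ofParts P
  del_mem _ hx := (GrSub.ofParts P).induction
    (T := Submodule.comap (del k V) (GrSub.ofParts P).carrier)
    (fun n _ hx h => (GrSub.mem_ofParts_of_mem (DG.del_mem hx)).2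
      (hd n _ hx ((GrSub.mem_ofParts_of_mem hx).1 h))) hx
  mul_mem _ hx y hy := (GrSub.ofParts P).induction
    (T := Submodule.comap ((NDGA.mul (k := k)).flip y) (GrSub.ofParts P).carrier)
    (fun m x hx h => (GrSub.ofParts P).induction (T := Submodule.comap (NDGA.mul (k := k) x)
      (GrSub.ofParts P).carrier)
      (fun n y hy h' => (GrSub.mem_ofParts_of_mem (NDGA.mul_mem m n x hx y hy)).2
        (hm m n x hx ((GrSub.mem_ofParts_of_mem hx).1 h) y hy
          ((GrSub.mem_ofParts_of_mem hy).1 h'))) hy) hx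

theorem SubNDGA.mem_ofParts_of_mem {P : ℤ → Submodule k V} {hd hm} {n : ℤ} {x : V}
    (hx : x ∈ gr k V n) : x ∈ (SubNDGA.ofParts P hd hm).carrier ↔ x ∈ P n :=
  GrSub.mem_ofParts_of_mem hx

/-- The hypothesis is that the relative homology of V modulo S vanishes, so there is a contraction
relative to S. It is only linear; compatibility with products is not available and is replaced by
the length filtration. -/
theorem SubNDGA.exists_deformation (S : SubNDGA k V)
    (h : ∀ n, ∀ x ∈ gr k V n, del k V x ∈ S.carrier → ∃ u, x - del k V u ∈ S.carrier) :
    Nonempty S.Deformation := by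
  obtain ⟨h, hh, -, h0, hr⟩ := exists_rel_contraction S.carrier ⊤ S.pr_mem (by simp) S.del_mem
    (fun x _ hx => by
      have : x ∈ S.carrier ⊔ LinearMap.range (del k V) := mem_of_pr_mem (k := k) fun n => by
        obtain ⟨u, hu⟩ := h n _ (DG.pr_mem n x) (by rw [del_pr]; exact S.pr_mem _ _ hx)
        rw [← sub_add_cancel (pr k V n x) (del k V u)]
        exact Submodule.add_mem_sup hu ⟨u, rfl⟩
      obtain ⟨s, hs, _, ⟨u, rfl⟩, rfl⟩ := Submodule.mem_sup.1 this
      exact ⟨u, trivial, by rwa [add_sub_cancel_right]⟩)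
  exact ⟨⟨h, hh, h0, LinearMap.codRestrict S.carrier (LinearMap.id - del k V ∘ₗ h - h ∘ₗ del k V)
    fun x => hr x trivial, fun x => rfl⟩⟩

/-- If the homology is bounded on one side, there is a deformation into a strictly bounded
subobject. -/
theorem exists_bounded_deformation
    (hV : (∀ n ≤ 0, ∀ x ∈ gr k V n, del k V x = 0 → ∃ y, x = del k V y) ∨
      (∀ n ≥ 0, ∀ x ∈ gr k V n, del k V x = 0 → ∃ y, x = del k V y)) :
    ∃ (S : SubNDGA k V) (η : ℤ), (η = 1 ∨ η = -1) ∧ Nonempty S.Deformation ∧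
      ∀ n, ∀ x ∈ gr k S.carrier n, x ≠ 0 → 1 ≤ η * n := by
  rcases hV with hV | hV
  -- All of V in degrees at least 2, the cycles in degree 1, nothing below. Products of elements of
  -- positive degree land in degree at least 2, so this is a subalgebra, and what is discarded
  -- carries no homology.
  · let P : ℤ → Submodule k V := fun n => if 2 ≤ n then ⊤ else if n = 1 then LinearMap.ker (del k V)
      else ⊥
    have P2 : ∀ n, 2 ≤ n → P n = ⊤ := fun n hn => if_pos hn
    have P1 : P 1 = LinearMap.ker (del k V) := by simp [P]
    have P0 : ∀ n ≤ 0, P n = ⊥ := fun n hn => by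
      simp only [P]; rw [if_neg (by omega), if_neg (by omega)]
    have hpos : ∀ n x, x ∈ P n → x ≠ 0 → 1 ≤ n := fun n x hx h0 => by
      by_contra hn
      rw [P0 n (by omega)] at hx
      exact h0 ((Submodule.mem_bot k).1 hx)
    have hd : ∀ n, ∀ x ∈ gr k V n, x ∈ P n → del k V x ∈ P (n - 1) := by
      intro n x _ hx
      rcases lt_trichotomy n 2 with h | h | h
      · by_cases h1 : n = 1
        · subst h1
          rw [P1] at hx
          rw [LinearMap.mem_ker.1 hx]; exact zero_mem _
        · rw [P0 n (by omega)] at hx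
          rw [(Submodule.mem_bot k).1 hx, map_zero]; exact zero_mem _
      · subst h
        show _ ∈ P 1
        rw [P1]; exact LinearMap.mem_ker.2 (del_del x)
      · rw [P2 _ (by omega)]; trivial
    have hm : ∀ m n, ∀ x ∈ gr k V m, x ∈ P m → ∀ y ∈ gr k V n, y ∈ P n →
        NDGA.mul (k := k) x y ∈ P (m + n) := by
      intro m n x _ hx y _ hy
      by_cases hx0 : x = 0
      · rw [hx0, map_zero]; exact zero_mem _
      by_cases hy0 : y = 0
      · rw [hy0, map_zero]; exact zero_mem _
      have := hpos m x hx hx0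
      have := hpos n y hy hy0
      rw [P2 _ (by omega)]; trivial
    refine ⟨SubNDGA.ofParts P hd hm, 1, Or.inl rfl, SubNDGA.exists_deformation _ ?_, ?_⟩
    · intro n x hx hdx
      have hdx' : del k V x ∈ P (n - 1) := (SubNDGA.mem_ofParts_of_mem (del_mem hx)).1 hdx
      by_cases h2 : 2 ≤ n
      · refine ⟨0, ?_⟩
        rw [map_zero, sub_zero]
        exact (SubNDGA.mem_ofParts_of_mem hx).2 (by rw [P2 n h2]; trivial)
      · rw [P0 _ (by omega), Submodule.mem_bot] at hdx'
        by_cases h1 : n = 1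
        · subst h1
          refine ⟨0, ?_⟩
          rw [map_zero, sub_zero]
          exact (SubNDGA.mem_ofParts_of_mem hx).2 (by rw [P1]; exact hdx')
        · obtain ⟨y, hy⟩ := hV n (by omega) x hx hdx'
          exact ⟨y, by rw [← hy, sub_self]; exact zero_mem _⟩
    · intro n x hx h0
      rw [one_mul]
      exact hpos n x ((SubNDGA.mem_ofParts_of_mem (P := P) (hd := hd) (hm := hm) hx).1 x.2) fun h => h0 (Subtype.ext h)
  -- In the negative case degree -1 has to lose the boundaries of elements of degree 0, which are
  -- discarded; hence a complement of these boundaries is kept there. Products of elements of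
  -- negative degree land in degree at most -2, where everything is kept.
  · obtain ⟨Q, hQ⟩ := Submodule.exists_isCompl ((gr k V 0).map (del k V))
    let P : ℤ → Submodule k V := fun n => if n ≤ -2 then ⊤ else if n = -1 then Q else ⊥
    have P2 : ∀ n ≤ -2, P n = ⊤ := fun n hn => if_pos hn
    have P1 : P (-1) = Q := by simp [P]
    have P0 : ∀ n ≥ 0, P n = ⊥ := fun n hn => by
      simp only [P]; rw [if_neg (by omega), if_neg (by omega)]
    have hneg : ∀ n x, x ∈ P n → x ≠ 0 → n ≤ -1 := fun n x hx h0 => by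
      by_contra hn
      rw [P0 n (by omega)] at hx
      exact h0 ((Submodule.mem_bot k).1 hx)
    have hd : ∀ n, ∀ x ∈ gr k V n, x ∈ P n → del k V x ∈ P (n - 1) := by
      intro n x _ hx
      by_cases hx0 : x = 0
      · rw [hx0, map_zero]; exact zero_mem _
      have := hneg n x hx hx0
      rw [P2 _ (by omega)]; trivial
    have hm : ∀ m n, ∀ x ∈ gr k V m, x ∈ P m → ∀ y ∈ gr k V n, y ∈ P n →
        NDGA.mul (k := k) x y ∈ P (m + n) := by
      intro m n x _ hx y _ hy
      by_cases hx0 : x = 0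
      · rw [hx0, map_zero]; exact zero_mem _
      by_cases hy0 : y = 0
      · rw [hy0, map_zero]; exact zero_mem _
      have := hneg m x hx hx0
      have := hneg n y hy hy0
      rw [P2 _ (by omega)]; trivial
    refine ⟨SubNDGA.ofParts P hd hm, -1, Or.inr rfl, SubNDGA.exists_deformation _ ?_, ?_⟩
    · intro n x hx hdx
      have hdx' : del k V x ∈ P (n - 1) := (SubNDGA.mem_ofParts_of_mem (del_mem hx)).1 hdx
      by_cases h2 : n ≤ -2
      · refine ⟨0, ?_⟩
        rw [map_zero, sub_zero]
        exact (SubNDGA.mem_ofParts_of_mem hx).2 (by rw [P2 n h2]; trivial)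
      by_cases h1 : n = -1
      · subst h1
        have hx' : x ∈ (gr k V 0).map (del k V) ⊔ Q := by rw [hQ.sup_eq_top]; trivial
        obtain ⟨_, ⟨u, hu, rfl⟩, q, hq, rfl⟩ := Submodule.mem_sup.1 hx'
        refine ⟨u, ?_⟩
        rw [add_sub_cancel_left]
        refine (SubNDGA.mem_ofParts_of_mem (n := -1) ?_).2 (by rw [P1]; exact hq)
        have := sub_mem hx (del_mem hu)
        rwa [add_sub_cancel_left] at this
      · have hd0 : del k V x = 0 := by
          by_cases h0 : n = 0
          · subst h0
            change del k V x ∈ P (-1) at hdx'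
            rw [P1] at hdx'
            exact (Submodule.disjoint_def.1 hQ.disjoint) _ ⟨x, hx, rfl⟩ hdx'
          · rwa [P0 _ (by omega), Submodule.mem_bot] at hdx'
        obtain ⟨y, hy⟩ := hV n (by omega) x hx hd0
        exact ⟨y, by rw [← hy, sub_self]; exact zero_mem _⟩
    · intro n x hx h0
      have := hneg n x ((SubNDGA.mem_ofParts_of_mem (P := P) (hd := hd) (hm := hm) hx).1 x.2) fun h => h0 (Subtype.ext h)
      omega

/-- The homology of the augmentation ideal of a connected algebra is bounded on one side. -/
theorem IsConnected.augIdeal_bounded {R : Type*} [Ring R] [Algebra k R] [DGA k R]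
    (hR : IsConnected k R) (ε : DGHom k R k) :
    (∀ n ≤ 0, ∀ x ∈ gr k (AugIdeal ε) n, del k (AugIdeal ε) x = 0 → ∃ y, x = del k _ y) ∨
      (∀ n ≥ 0, ∀ x ∈ gr k (AugIdeal ε) n, del k (AugIdeal ε) x = 0 → ∃ y, x = del k _ y) := by
  have key : ∀ (x : AugIdeal ε) (y : R), (x : R) = del k R y → ∃ y, x = del k (AugIdeal ε) y :=
    fun x y h => ⟨⟨augBar ε y, augL_augBar ε y⟩, Subtype.ext (by
      show (x : R) = del k R (augBar ε y)
      rw [augBar_apply, map_sub, map_smul, DGA.del_one, smul_zero, sub_zero, h])⟩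
  have h0 : ∀ x ∈ gr k (AugIdeal ε) 0, del k (AugIdeal ε) x = 0 →
      ∃ y, x = del k (AugIdeal ε) y := by
    intro x hx hdx
    obtain ⟨c, y, h⟩ := hR.zero x hx (congrArg Subtype.val hdx)
    -- A cycle of degree 0 is a scalar plus a boundary. The augmentation vanishes on the cycle and
    -- on boundaries, so it forces the scalar to be zero.
    have h1 := congrArg (augL ε) h
    rw [Algebra.algebraMap_eq_smul_one, map_add, map_smul, augL_one, augL_del, add_zero,
      show augL ε (x : R) = 0 from x.2] at h1
    have hc : c = 0 := by simpa using h1.symm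
    rw [hc, map_zero, zero_add] at h
    exact key x y h
  refine hR.bounded.imp (fun h n hn x hx hdx => ?_) (fun h n hn x hx hdx => ?_)
  · rcases hn.lt_or_eq with hn | rfl
    · obtain ⟨y, hy⟩ := h n hn x hx (congrArg Subtype.val hdx)
      exact key x y hy
    · exact h0 x hx hdx
  · rcases hn.lt_or_eq with hn | rfl
    · obtain ⟨y, hy⟩ := h n hn x hx (congrArg Subtype.val hdx)
      exact key x y hy
    · exact h0 x hx hdx

end StrictlyBounded

/-! ### Representatives of the homology of a bar construction -/

section HarmonicProjection

variable {k : Type*} [Field k]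

/-- A basis of homogeneous elements. -/
theorem exists_homogeneous_basis.{w} (H : Type w) [AddCommGroup H] [Module k H] [GrMod k H] :
    ∃ (ι : Type w) (b : Module.Basis ι k H) (n : ι → ℤ), (∀ i, b i ∈ gr k H (n i)) ∧
      ∀ i, b.coord i ∈ homGr k H k (-n i) := by
  classical
  have hI : DirectSum.IsInternal (gr k H) := GrMod.internal
  obtain ⟨v⟩ : Nonempty (∀ n, Module.Basis (Module.Basis.ofVectorSpaceIndex k (gr k H n)) k
    (gr k H n)) := ⟨fun n => Module.Basis.ofVectorSpace k (gr k H n)⟩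
  refine ⟨Σ n, Module.Basis.ofVectorSpaceIndex k (gr k H n), hI.collectedBasis v, fun i => i.1,
    fun i => hI.collectedBasis_mem v i, fun i => ?_⟩
  rw [mem_homGr_ground]
  intro n hn x hx
  have h : n ≠ i.1 := fun h => hn (by rw [h, add_neg_cancel])
  exact hI.collectedBasis_repr_of_mem_ne v h hx

variable {S : Type*} [AddCommGroup S] [Module k S]

variable (k S) in
/-- Projection onto the span of the empty word. -/
def Bar.unitPart : Bar k S →ₗ[k] Bar k S := Bar.counit.smulRight Bar.nil

theorem Bar.unitPart_apply (x : Bar k S) : Bar.unitPart k S x = Bar.counit x • Bar.nil := rfl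

variable [NDGA k S]

theorem Bar.counit_of_mem {n : ℤ} (hn : n ≠ 0) {x : Bar k S} (hx : x ∈ gr k (Bar k S) n) :
    Bar.counit x = 0 := DGCoalg.counit_eq_zero (k := k) n hn x hx

theorem Bar.unitPart_mem : Bar.unitPart k S ∈ homGr k (Bar k S) (Bar k S) 0 := by
  intro n x hx
  rw [Bar.unitPart_apply, add_zero]
  by_cases hn : n = 0
  · subst hn
    exact Submodule.smul_mem _ _ Bar.nil_mem
  · rw [Bar.counit_of_mem hn hx, zero_smul]
    exact zero_mem _

/-- A projection onto representatives of the homology of the bar construction. -/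
theorem Bar.exists_projection : ∃ r ∈ homGr k (Bar k S) (Bar k S) 0,
    (∀ x, Bar.dif (r x) = 0) ∧ (∀ x, r (Bar.dif x) = 0) ∧ (∀ x, r (r x) = r x) ∧
    (∀ x, Bar.dif x = 0 → r x = 0 → ∃ u, x = Bar.dif u) ∧ r Bar.nil = Bar.nil ∧
    ∀ x, Bar.counit (r x) = Bar.counit x := by
  obtain ⟨τ, hτ, -, -, hd⟩ := exists_graded_inverse (k := k) (V := Bar k S) ⊥ ⊤ (by simp) (by simp)
  have hid : LinearMap.id - Bar.unitPart k S ∈ homGr k (Bar k S) (Bar k S) 0 :=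
    sub_mem (fun i v hv => by rw [add_zero]; exact hv) Bar.unitPart_mem
  -- A generalized inverse of the differential, cut down on both sides to the reduced part. The
  -- empty word is then untouched by the projection r and the counit is preserved.
  let σ : Bar k S →ₗ[k] Bar k S :=
    (LinearMap.id - Bar.unitPart k S) ∘ₗ τ ∘ₗ (LinearMap.id - Bar.unitPart k S)
  have hσ : ∀ x, σ x = τ (x - Bar.unitPart k S x) - Bar.unitPart k S (τ (x - Bar.unitPart k S x)) :=
    fun _ => rfl
  have hσm : σ ∈ homGr k (Bar k S) (Bar k S) 1 := by
    have := comp_mem_homGr hid (comp_mem_homGr hτ hid)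
    exact this
  have hcσ : ∀ x, Bar.counit (σ x) = 0 := fun x => by
    rw [hσ, map_sub, Bar.unitPart_apply (τ _), map_smul, Bar.counit_nil, smul_eq_mul, mul_one,
      sub_self]
  have hud : ∀ x, Bar.unitPart k S (Bar.dif x) = 0 := fun x => by
    rw [Bar.unitPart_apply, Bar.counit_dif, zero_smul]
  have hdu : ∀ x, Bar.dif (Bar.unitPart k S x) = 0 := fun x => by
    rw [Bar.unitPart_apply, map_smul, Bar.dif_nil, smul_zero]
  have hdσd : ∀ x, Bar.dif (σ (Bar.dif x)) = Bar.dif x := fun x => by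
    have h := hd x trivial
    rw [Submodule.mem_bot, sub_eq_zero] at h
    rw [hσ, hud, sub_zero, map_sub, hdu, sub_zero]
    exact h.symm
  -- As dσd = d, the right factor 1 - σd takes values in cycles and fixes cycles, while the left
  -- factor 1 - dσ kills boundaries and changes a cycle only by a boundary.
  let r : Bar k S →ₗ[k] Bar k S :=
    (LinearMap.id - Bar.dif ∘ₗ σ) ∘ₗ (LinearMap.id - σ ∘ₗ Bar.dif)
  have hr : ∀ x, r x = x - σ (Bar.dif x) - Bar.dif (σ (x - σ (Bar.dif x))) := fun _ => rfl
  have hdr : ∀ x, Bar.dif (r x) = 0 := fun x => by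
    rw [hr, map_sub, map_sub, hdσd, Bar.dif_dif, sub_self, sub_self]
  have hrd : ∀ x, r (Bar.dif x) = 0 := fun x => by
    rw [hr, Bar.dif_dif, map_zero, sub_zero, hdσd, sub_self]
  have hrz : ∀ x, Bar.dif x = 0 → r x = x - Bar.dif (σ x) := fun x hx => by
    rw [hr, hx, map_zero, sub_zero]
  refine ⟨r, ?_, hdr, hrd, fun x => ?_, fun x hx h => ⟨σ x, ?_⟩, ?_, fun x => ?_⟩
  · have h1 : ∀ {n : ℤ} {x : Bar k S}, x ∈ gr k (Bar k S) n → σ (Bar.dif x) ∈ gr k (Bar k S) n :=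
      fun hx => by simpa using hσm _ _ (Bar.dif_mem hx)
    have h2 : ∀ {n : ℤ} {x : Bar k S}, x ∈ gr k (Bar k S) n → Bar.dif (σ x) ∈ gr k (Bar k S) n :=
      fun hx => by simpa using Bar.dif_mem (hσm _ _ hx)
    intro n x hx
    rw [add_zero, hr]
    exact sub_mem (sub_mem hx (h1 hx)) (h2 (sub_mem hx (h1 hx)))
  · have h1 : r (r x) = r x - Bar.dif (σ (r x)) := hrz _ (hdr x)
    have h2 : Bar.dif (σ (r x)) = 0 := by
      rw [hr, map_sub, map_sub, hdσd, sub_self]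
    rw [h1, h2, sub_zero]
  · rw [hrz x hx, sub_eq_zero] at h
    exact h
  · have h1 : σ Bar.nil = 0 := by
      rw [hσ, Bar.unitPart_apply, Bar.counit_nil, one_smul, sub_self, map_zero, map_zero, sub_zero]
    rw [hrz _ Bar.dif_nil, h1, map_zero, sub_zero]
  · rw [hr, map_sub, map_sub, hcσ, Bar.counit_dif, sub_zero, sub_zero]

end HarmonicProjection

/-! ### The augmented algebra of functionals on a bar construction -/

section DualAugmentation

variable {k : Type*} [Field k] {V : Type*} [AddCommGroup V] [Module k V] [NDGA k V]

variable (k V) in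
/-- The augmentation of the dual of a bar construction. -/
def dualAug : DGHom k (ConvDG k (Bar k V) k) k where
  toAlgHom := AlgHom.ofLinearMap (LinearMap.applyₗ Bar.nil ∘ₗ ConvDG.val)
    (by
      show (convOne : Bar k V →ₗ[k] k) Bar.nil = 1
      simp [convOne, Bar.counit_def, Bar.counit_nil])
    (fun f g => conv_nil f.val g.val)
  map_mem n f hf := by
    have := hf 0 Bar.nil Bar.nil_mem
    rwa [zero_add] at this
  map_del f := by
    show homDel f.val Bar.nil = 0
    rw [homDel_ground, Bar.sgn_nil, Bar.del_def, Bar.dif_nil, map_zero]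

/-- The element of the augmentation ideal given by a homogeneous functional. -/
def dualAug.mk {m : ℤ} (f : Bar k V →ₗ[k] k) (hf : f ∈ homGr k (Bar k V) k m)
    (h0 : f Bar.nil = 0) : AugIdeal (dualAug k V) :=
  ⟨ConvDG.mk f (mem_convTot hf), h0⟩

variable (k V) in
/-- Evaluation of functionals. -/
def dualEval : Bar k V →ₗ[k] AugIdeal (dualAug k V) →ₗ[k] k :=
  (ConvDG.val ∘ₗ (augIdeal (dualAug k V)).subtype).flip

theorem dualEval_del (c : Bar k V) (φ : AugIdeal (dualAug k V)) :
    dualEval k V c (del k _ φ) = dualEval k V (Bar.dif (sgn k _ c)) φ :=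
  homDel_ground _ c

theorem dualEval_mem {m : ℤ} {φ : AugIdeal (dualAug k V)} :
    φ ∈ gr k (AugIdeal (dualAug k V)) m ↔ ∀ n, n + m ≠ 0 → ∀ c ∈ gr k (Bar k V) n,
      dualEval k V c φ = 0 := mem_homGr_ground

end DualAugmentation

/-! ### Dual families of cycles and closed functionals -/

section HodgeDuality

variable (k : Type*) [Field k]

/-- A pairing between a bar construction and an algebra, with dual finite families of cycles that
represent the reduced homology of both, and contractions to them. -/
structure HodgeDuality (S W ι : Type*) [Fintype ι] [AddCommGroup S] [Module k S] [NDGA k S]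
    [AddCommGroup W] [Module k W] [NDGA k W] where
  pairing : Bar k S →ₗ[k] W →ₗ[k] k
  pairing_of_mem : ∀ m n, m + n ≠ 0 → ∀ c ∈ gr k (Bar k S) m, ∀ φ ∈ gr k W n, pairing c φ = 0
  degree : ι → ℤ
  cyc : ι → Bar k S
  cyc_mem : ∀ i, cyc i ∈ gr k (Bar k S) (degree i)
  dif_cyc : ∀ i, Bar.dif (cyc i) = 0
  counit_cyc : ∀ i, Bar.counit (cyc i) = 0
  coc : ι → W
  coc_mem : ∀ i, coc i ∈ gr k W (-degree i)
  del_coc : ∀ i, del k W (coc i) = 0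
  pairing_cyc_coc : ∀ x : ι → k, ∀ j, ∑ i, x i • pairing (cyc i) (coc j) = x j
  pairing_dif_coc : ∀ i c, pairing (Bar.dif c) (coc i) = 0
  pairing_cyc_del : ∀ i φ, pairing (cyc i) (del k W φ) = 0
  barHtpy : Bar k S →ₗ[k] Bar k S
  barHtpy_mem : barHtpy ∈ homGr k (Bar k S) (Bar k S) 1
  counit_barHtpy : ∀ c, Bar.counit (barHtpy c) = 0
  barHtpy_spec : ∀ c, Bar.counit c = 0 → Bar.dif (barHtpy c) + barHtpy (Bar.dif c) =
    c - ∑ i, pairing c (coc i) • cyc i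
  algHtpy : W →ₗ[k] W
  algHtpy_mem : algHtpy ∈ homGr k W W 1
  pairing_algHtpy : ∀ i φ, pairing (cyc i) (algHtpy φ) = 0
  algHtpy_spec : ∀ φ, del k W (algHtpy φ) + algHtpy (del k W φ) =
    φ - ∑ i, pairing (cyc i) φ • coc i

variable {k} {V : Type*} [AddCommGroup V] [Module k V] [NDGA k V] {S : SubNDGA k V}
  (D : S.Deformation)

/-- The homology of the dual is finite-dimensional, so every dual family of cycles and closed
functionals is finite. -/
theorem finite_of_dual_families (hfin : FiniteDimensional k (Homology k (ConvDG k (Bar k V) k)))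
    {ι : Type*} (c : ι → Bar k V) (hc : ∀ i, Bar.dif (c i) = 0) (n : ι → ℤ)
    (g : ι → Bar k V →ₗ[k] k) (hg : ∀ i, g i ∈ homGr k (Bar k V) k (n i))
    (hdg : ∀ i, homDel (g i) = 0) (hgc : ∀ i, g i (c i) = 1) (hgc' : ∀ i j, i ≠ j → g i (c j) = 0) :
    Finite ι := by
  let z : ι → cycles k (ConvDG k (Bar k V) k) := fun i =>
    ⟨ConvDG.mk (g i) (mem_convTot (hg i)), ConvDG.val_injective (hdg i)⟩
  have hli : LinearIndependent k fun i => Homology.mk k (ConvDG k (Bar k V) k) (z i) := by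
    rw [linearIndependent_iff']
    intro s a h j hj
    have h1 : Homology.mk k (ConvDG k (Bar k V) k) (∑ i ∈ s, a i • z i) = 0 := by
      rw [map_sum, ← h]
      exact Finset.sum_congr rfl fun i _ => map_smul _ _ _
    obtain ⟨y, hy⟩ := Ideal.Quotient.eq_zero_iff_mem.1 h1
    -- A linear relation between the homology classes is a boundary, and a boundary vanishes on the
    -- cycle c j; by duality the value there is the j-th coefficient.
    have h2 := LinearMap.congr_fun (congrArg ConvDG.val hy) (c j)
    rw [ConvDG.val_del, homDel_ground, ← neg_neg (del k (Bar k V) (sgn k _ (c j))), ← sgn_del,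
      Bar.del_def, hc, map_zero, neg_zero, map_zero] at h2
    have h3 : ConvDG.val ((∑ i ∈ s, a i • z i : cycles k (ConvDG k (Bar k V) k)) :
        ConvDG k (Bar k V) k) (c j) = ∑ i ∈ s, a i • g i (c j) := by
      rw [AddSubmonoidClass.coe_finsetSum, map_sum, LinearMap.sum_apply]
      rfl
    rw [h3, Finset.sum_eq_single j (fun i _ hij => by rw [hgc' i j hij, smul_zero])
      (fun h => absurd hj h), hgc, smul_eq_mul, mul_one] at h2
    exact h2.symm
  exact hli.finite

end HodgeDuality

/-! ### Homogeneous bases of the reduced homology -/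

section HarmonicBasis

universe u v

variable {k : Type u} [Field k] {S : Type v} [AddCommGroup S] [Module k S] [NDGA k S]

/-- A homogeneous basis of the image of a projection onto the reduced homology, with the
coordinates of the projection. -/
theorem Bar.exists_harmonic_basis {r : Bar k S →ₗ[k] Bar k S}
    (hr : r ∈ homGr k (Bar k S) (Bar k S) 0) (hdr : ∀ x, Bar.dif (r x) = 0)
    (hrd : ∀ x, r (Bar.dif x) = 0) (hrr : ∀ x, r (r x) = r x) (hrn : r Bar.nil = Bar.nil)
    (hrc : ∀ x, Bar.counit (r x) = Bar.counit x) :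
    ∃ (ι : Type (max u v)) (c : ι → Bar k S) (n : ι → ℤ) (l : ι → Bar k S →ₗ[k] k),
      (∀ i, c i ∈ gr k (Bar k S) (n i)) ∧ (∀ i, Bar.dif (c i) = 0) ∧
      (∀ i, Bar.counit (c i) = 0) ∧ (∀ i, r (c i) = c i) ∧
      (∀ i, l i ∈ homGr k (Bar k S) k (-n i)) ∧ (∀ i x, l i (Bar.dif x) = 0) ∧
      (∀ i, l i Bar.nil = 0) ∧ (∀ i, l i (c i) = 1) ∧ (∀ i j, i ≠ j → l i (c j) = 0) ∧
      ∀ [Fintype ι] (x), r x = Bar.counit x • Bar.nil + ∑ i, l i x • c i := by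
  -- Removing the empty word leaves a projection onto representatives of the reduced homology. It is
  -- again idempotent because r fixes the empty word and preserves the counit.
  have hrm : r - Bar.unitPart k S ∈ homGr k (Bar k S) (Bar k S) 0 := sub_mem hr Bar.unitPart_mem
  have hr1 : ∀ x, (r - Bar.unitPart k S) x = r x - Bar.counit x • Bar.nil := fun _ => rfl
  have hrr1 : ∀ x, (r - Bar.unitPart k S) ((r - Bar.unitPart k S) x) = (r - Bar.unitPart k S) x := by
    intro x
    rw [hr1, hr1, map_sub, map_sub, map_smul, map_smul, hrr, hrn, hrc, Bar.counit_nil, smul_eq_mul,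
      mul_one, sub_self, zero_smul, sub_zero]
  generalize r - Bar.unitPart k S = r1 at hrm hr1 hrr1
  obtain ⟨H, hHr⟩ : ∃ H : GrSub k (Bar k S), ∀ x, x ∈ H.carrier ↔ ∃ y, r1 y = x :=
    ⟨{ carrier := LinearMap.range r1
       pr_mem := by
        rintro n _ ⟨x, rfl⟩
        have := map_pr hrm n x
        rw [add_zero] at this
        exact ⟨_, this⟩ }, fun _ => Iff.rfl⟩
  have hH : ∀ x : H.carrier, r1 x = x := by
    rintro ⟨x, hx⟩
    obtain ⟨y, rfl⟩ := (hHr x).1 hx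
    exact hrr1 y
  have hcH : ∀ x : H.carrier, Bar.counit (x : Bar k S) = 0 := by
    intro x
    rw [← hH, hr1, map_sub, hrc, map_smul, Bar.counit_nil, smul_eq_mul, mul_one, sub_self]
  have hrH : ∀ x : H.carrier, r x = x := by
    intro x
    have := hr1 x
    rw [hH, hcH, zero_smul, sub_zero] at this
    exact this.symm
  obtain ⟨ι, b, n, hb, hbc⟩ := exists_homogeneous_basis (k := k) H.carrier
  let q : Bar k S →ₗ[k] H.carrier := r1.codRestrict H.carrier fun x => (hHr _).2 ⟨x, rfl⟩
  have hq : ∀ x : H.carrier, q x = x := fun x => Subtype.ext (hH x)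
  have hqm : q ∈ homGr k (Bar k S) H.carrier 0 := fun n x hx => hrm n x hx
  have hq0 : ∀ x, r1 x = 0 → q x = 0 := fun x hx => Subtype.ext hx
  refine ⟨ι, fun i => b i, n, fun i => b.coord i ∘ₗ q, hb, fun i => ?_, fun i => hcH _,
    fun i => hrH _, fun i => ?_, fun i x => ?_, fun i => ?_, fun i => ?_, fun i j hij => ?_, ?_⟩
  · have := hdr (b i)
    rwa [hrH] at this
  · simpa using comp_mem_homGr (hbc i) hqm
  · rw [LinearMap.comp_apply, hq0 _ (by rw [hr1, hrd, Bar.counit_dif, zero_smul, sub_zero]),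
      map_zero]
  · rw [LinearMap.comp_apply, hq0 _ (by rw [hr1, hrn, Bar.counit_nil, one_smul, sub_self]),
      map_zero]
  · rw [LinearMap.comp_apply, hq, Module.Basis.coord_apply, Module.Basis.repr_self,
      Finsupp.single_eq_same]
  · rw [LinearMap.comp_apply, hq, Module.Basis.coord_apply, Module.Basis.repr_self,
      Finsupp.single_eq_of_ne hij]
  · intro _ x
    have h1 := congrArg (Submodule.subtype H.carrier) (b.sum_repr (q x))
    rw [map_sum] at h1
    have h2 : r1 x = ∑ i, (b.coord i ∘ₗ q) x • (b i : Bar k S) := by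
      refine Eq.trans ?_ (h1.symm.trans ?_)
      · rfl
      · exact Finset.sum_congr rfl fun i _ => map_smul _ _ _
    rw [← h2, hr1, add_sub_cancel]

end HarmonicBasis

/-! ### Finite dual bases and contractions -/

section Existence

variable {k : Type*} [Field k] {V : Type*} [AddCommGroup V] [Module k V] [NDGA k V]
  {S : SubNDGA k V}

/-- A closed functional that vanishes on representatives of the homology of the subobject is the
boundary of a functional. -/
theorem SubNDGA.Deformation.exists_eq_homDel_of_htpy (D : S.Deformation)
    {r h : Bar k S.carrier →ₗ[k] Bar k S.carrier}
    (hh : h ∈ homGr k (Bar k S.carrier) (Bar k S.carrier) 1)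
    (hspec : ∀ x, x - r x = Bar.dif (h x) + h (Bar.dif x)) (hn : h Bar.nil = 0)
    {m : ℤ} {f : Bar k V →ₗ[k] k} (hf : f ∈ homGr k (Bar k V) k m) (hdf : homDel f = 0)
    (hfr : ∀ x, f (Bar.mapL S.incl (r x)) = 0) :
    ∃ u ∈ homGr k (Bar k V) k (m + 1), f = homDel u ∧ u Bar.nil = 0 := by
  have hm := Bar.letters_mem D.proj_mem
  have hsm : sgn k (Bar k S.carrier) ∈ homGr k (Bar k S.carrier) (Bar k S.carrier) 0 := by
    intro n x hx
    rw [add_zero, sgn_of_mem hx]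
    exact Submodule.smul_mem _ _ hx
  -- On words in S the homotopy h gives the primitive -f∘h, up to signs, and u extends it along the
  -- letterwise projection. The difference f - `homDel u` is closed and vanishes on words in S, so
  -- it has a primitive v.
  set u : Bar k V →ₗ[k] k :=
    -(f ∘ₗ Bar.mapL S.incl ∘ₗ h ∘ₗ sgn k _ ∘ₗ Bar.letters D.proj) with hu
  have hum : u ∈ homGr k (Bar k V) k (m + 1) := by
    have := comp_mem_homGr hf (comp_mem_homGr S.mapL_mem (comp_mem_homGr hh
      (comp_mem_homGr hsm hm)))
    simp only [zero_add, add_zero] at this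
    exact neg_mem this
  have hures : ∀ x, u (Bar.mapL S.incl x) = -f (Bar.mapL S.incl (h (sgn k _ x))) := fun x => by
    simp only [hu, LinearMap.neg_apply, LinearMap.comp_apply, D.letters_mapL]
  have hum' := homDel_mem hum
  rw [add_sub_cancel_right] at hum'
  obtain ⟨v, hv, hfv, hv0⟩ := D.exists_eq_homDel (sub_mem hf hum')
    (by rw [map_sub, hdf, homDel_homDel, sub_zero]) (fun x => by
      have h1 : homDel u (Bar.mapL S.incl x) = f (Bar.mapL S.incl (h (Bar.dif x))) := by
        rw [homDel_ground, map_sgn_of_mem_zero S.mapL_mem, Bar.del_def, ← S.mapL_dif, hures,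
          ← Bar.del_def, sgn_del, sgn_sgn, map_neg, map_neg, map_neg, neg_neg]
      have h2 : f (Bar.mapL S.incl (Bar.dif (h x))) = 0 := by
        rw [S.mapL_dif]
        exact homDel_ground_eq_zero.1 hdf _
      have h3 := congrArg (f ∘ₗ Bar.mapL S.incl) (hspec x)
      simp only [LinearMap.comp_apply, map_sub, map_add, hfr, h2, sub_zero, zero_add] at h3
      rw [LinearMap.sub_apply, h1, h3, sub_self])
  refine ⟨u + v, add_mem hum hv, ?_, ?_⟩
  · rw [map_add, ← hfv, add_sub_cancel]
  · have h1 := hures Bar.nil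
    have h2 := hv0 Bar.nil
    rw [Bar.mapL_nil] at h1 h2
    rw [LinearMap.add_apply, h1, h2, Bar.sgn_nil, hn, map_zero, map_zero, neg_zero, add_zero]

/-- The coordinate functionals of a homogeneous basis of harmonic cycles of B(S) kill boundaries, so
they extend to closed functionals on B(V). The extended family is dual to cycles, hence independent
in the homology of the dual, and therefore finite. A closed functional on B(V) that vanishes on the
chosen cycles is a boundary; this makes the kernel of the projection to the chosen functionals
acyclic and gives the contraction on the algebra side. -/
theorem exists_hodgeDuality (D : S.Deformation)
    (hfin : FiniteDimensional k (Homology k (ConvDG k (Bar k V) k))) :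
    ∃ (r : ℕ) (H : HodgeDuality k S.carrier (AugIdeal (dualAug k V)) (Fin r)),
      H.pairing = dualEval k V ∘ₗ Bar.mapL S.incl := by
  obtain ⟨r, hr, hdr, hrd, hrr, hac, hrn, hrc⟩ := Bar.exists_projection (k := k) (S := S.carrier)
  obtain ⟨ι, c, n, l, hc, hdc, hcc, hrci, hl, hld, hln, hl1, hl0, hrl⟩ :=
    Bar.exists_harmonic_basis hr hdr hrd hrr hrn hrc
  obtain ⟨h, hh, hspec, hrh, hhr⟩ := exists_contraction_to_projection hr hdr hrd hrr
    (fun _ x _ => hac x)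
  have hhn : h Bar.nil = 0 := by rw [← hrn, hhr]
  choose g hg hdg hgl using fun i => D.exists_extension (hl i) (by
    rw [homDel_ground_eq_zero]; exact hld i)
  have hdgc : ∀ i, ∀ x, g i (Bar.dif x) = 0 := fun i => homDel_ground_eq_zero.1 (hdg i)
  have hι : Finite ι := finite_of_dual_families hfin (fun i => Bar.mapL S.incl (c i))
    (fun i => by rw [← S.mapL_dif, hdc, map_zero]) (fun i => -n i) g hg hdg
    (fun i => by rw [hgl, hl1]) (fun i j hij => by rw [hgl, hl0 i j hij])
  obtain ⟨N, ⟨e⟩⟩ := Finite.exists_equiv_fin ι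
  have : Fintype ι := Fintype.ofFinite ι
  have hgn : ∀ i, g i Bar.nil = 0 := fun i => by
    have := hgl i Bar.nil
    rwa [Bar.mapL_nil, hln] at this
  let φ : Fin N → AugIdeal (dualAug k V) := fun i =>
    dualAug.mk (g (e.symm i)) (hg _) (hgn _)
  have hφ : ∀ i x, dualEval k V (Bar.mapL S.incl x) (φ i) = l (e.symm i) x := fun i x => hgl _ x
  have hφm : ∀ i, φ i ∈ gr k (AugIdeal (dualAug k V)) (-n (e.symm i)) := fun i => hg _
  have hdφ : ∀ i, del k (AugIdeal (dualAug k V)) (φ i) = 0 := fun i =>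
    Subtype.ext (ConvDG.val_injective (hdg (e.symm i)))
  have hsum : ∀ x, r x = Bar.counit x • Bar.nil + ∑ i, l (e.symm i) x • c (e.symm i) := fun x => by
    rw [hrl x, e.symm.sum_comp fun i => l i x • c i]
  let ev : Fin N → AugIdeal (dualAug k V) →ₗ[k] k := fun i =>
    dualEval k V (Bar.mapL S.incl (c (e.symm i)))
  have hev : ∀ i ψ, ev i (del k (AugIdeal (dualAug k V)) ψ) = 0 := fun i ψ => by
    simp only [ev]
    rw [dualEval_del, map_sgn_of_mem_zero S.mapL_mem, ← S.mapL_dif, ← Bar.del_def, ← neg_neg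
      (del k (Bar k S.carrier) (sgn k _ _)), ← sgn_del, Bar.del_def, hdc, map_zero, neg_zero,
      map_zero, map_zero, LinearMap.zero_apply]
  have hevφ : ∀ (x : Fin N → k) j, ∑ i, x i • ev i (φ j) = x j := fun x j => by
    simp only [ev, hφ]
    rw [Finset.sum_eq_single j, hl1, smul_eq_mul, mul_one]
    · intro i _ hij
      rw [hl0 _ _ fun h => hij (e.symm.injective h.symm), smul_zero]
    · intro h; exact absurd (Finset.mem_univ _) h
  have hevφ' : ∀ (x : Fin N → k) i, ∑ j, x j • ev i (φ j) = x i := fun x i => by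
    simp only [ev, hφ]
    rw [Finset.sum_eq_single i, hl1, smul_eq_mul, mul_one]
    · intro j _ hij
      rw [hl0 _ _ fun h => hij (e.symm.injective h), smul_zero]
    · intro h; exact absurd (Finset.mem_univ _) h
  -- The projection onto the span of the chosen functionals along their values on the chosen cycles.
  -- Finiteness of the family is what makes this sum available.
  let ρ : AugIdeal (dualAug k V) →ₗ[k] AugIdeal (dualAug k V) :=
    ∑ i, (ev i).smulRight (φ i)
  have hρ : ∀ ψ, ρ ψ = ∑ i, ev i ψ • φ i := fun ψ => by
    simp only [ρ, LinearMap.sum_apply, LinearMap.smulRight_apply]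
  have hevρ : ∀ i ψ, ev i (ρ ψ) = ev i ψ := fun i ψ => by
    rw [hρ, map_sum]
    simp only [map_smul]
    exact hevφ' (fun j => ev j ψ) i
  have hρm : ρ ∈ homGr k _ (AugIdeal (dualAug k V)) 0 := by
    intro m ψ hψ
    rw [hρ, add_zero]
    refine sum_mem fun i _ => ?_
    by_cases h0 : n (e.symm i) + m = 0
    · rw [eq_neg_of_add_eq_zero_right h0]
      exact Submodule.smul_mem _ _ (hφm i)
    · have h1 : ev i ψ = 0 := dualEval_mem.1 hψ _ h0 _ ((Bar.map S.incl).map_mem _ _ (hc _))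
      rw [h1, zero_smul]
      exact zero_mem _
  obtain ⟨h', hh', hspec', hρh', -⟩ := exists_contraction_to_projection hρm
    (fun ψ => by
      rw [hρ, map_sum]
      exact Finset.sum_eq_zero fun i _ => by rw [map_smul, hdφ, smul_zero])
    (fun ψ => by
      rw [hρ]
      exact Finset.sum_eq_zero fun i _ => by rw [hev, zero_smul])
    (fun ψ => by rw [hρ (ρ ψ), hρ ψ]; exact Finset.sum_congr rfl fun i _ => by rw [← hρ, hevρ])
    (fun m ψ hψ hdψ hρψ => by
      have hev0 : ∀ i, ev i ψ = 0 := fun i => by rw [← hevρ, hρψ, map_zero]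
      obtain ⟨u, hu, hψu, hun⟩ := D.exists_eq_homDel_of_htpy hh hspec hhn (f := ψ.1.val) hψ
        (congrArg (fun x : AugIdeal (dualAug k V) => x.1.val) hdψ) (fun x => by
          have hψn : ψ.1.val Bar.nil = 0 := ψ.2
          rw [hsum, map_add, map_smul, map_sum, Bar.mapL_nil, map_add, map_smul, hψn, smul_zero,
            zero_add, map_sum]
          refine Finset.sum_eq_zero fun i _ => ?_
          rw [map_smul, map_smul]
          exact (congrArg _ (hev0 i)).trans (smul_zero _))
      exact ⟨dualAug.mk u hu hun, Subtype.ext (ConvDG.val_injective hψu)⟩)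
  refine ⟨N, {
    pairing := dualEval k V ∘ₗ Bar.mapL S.incl
    pairing_of_mem := fun m n hmn c hc φ hφ =>
      dualEval_mem.1 hφ m hmn _ ((Bar.map S.incl).map_mem _ _ hc)
    degree := fun i => n (e.symm i)
    cyc := fun i => c (e.symm i)
    cyc_mem := fun i => hc _
    dif_cyc := fun i => hdc _
    counit_cyc := fun i => hcc _
    coc := φ
    coc_mem := hφm
    del_coc := hdφ
    pairing_cyc_coc := hevφ
    pairing_dif_coc := fun i c => (hφ i _).trans (hld _ _)
    pairing_cyc_del := hev
    barHtpy := h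
    barHtpy_mem := hh
    counit_barHtpy := fun c => by rw [← hrc, hrh, map_zero]
    barHtpy_spec := fun c hc => ?_
    algHtpy := h'
    algHtpy_mem := hh'
    pairing_algHtpy := fun i ψ => by
      have := hevρ i (h' ψ)
      rw [hρh', map_zero] at this
      exact this.symm
    algHtpy_spec := fun ψ => by
      rw [← hspec', hρ]
      rfl }, rfl⟩
  have h1 := hspec c
  rw [hsum, hc, zero_smul, zero_add] at h1
  rw [← Bar.del_def, ← h1]
  congr 1
  exact Finset.sum_congr rfl fun i _ => by rw [← hφ]; rfl

end Existence

/-! ### Products of reduced words -/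

section ReducedCobar

variable {k : Type*} [Field k] {S : Type*} [AddCommGroup S] [Module k S]

variable (k S) in
/-- The span of the products of at least `p` words without constant term. -/
def Cobar.redGE (p : ℕ) : Submodule k (Cobar k (Bar k S)) :=
  Submodule.span k {w | ∃ L : List (Bar k S), p ≤ L.length ∧ (∀ c ∈ L, Bar.counit c = 0) ∧
    w = (L.map Cobar.ι).prod}

theorem Cobar.redGE_anti {p q : ℕ} (h : p ≤ q) : Cobar.redGE k S q ≤ Cobar.redGE k S p :=
  Submodule.span_mono fun _ ⟨L, h1, h2⟩ => ⟨L, h.trans h1, h2⟩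

theorem Cobar.one_mem_redGE : (1 : Cobar k (Bar k S)) ∈ Cobar.redGE k S 0 :=
  Submodule.subset_span ⟨[], le_rfl, by simp, by simp⟩

theorem Cobar.ι_mem_redGE {c : Bar k S} (hc : Bar.counit c = 0) :
    Cobar.ι c ∈ Cobar.redGE k S 1 :=
  Submodule.subset_span ⟨[c], le_rfl, by simpa using hc, by simp⟩

theorem Cobar.mul_mem_redGE {p q : ℕ} {x y : Cobar k (Bar k S)} (hx : x ∈ Cobar.redGE k S p)
    (hy : y ∈ Cobar.redGE k S q) : x * y ∈ Cobar.redGE k S (p + q) := by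
  refine apply_mem_of_mem_span (LinearMap.mulRight k y) ?_ hx
  rintro _ ⟨L, h1, h2, rfl⟩
  refine apply_mem_of_mem_span (LinearMap.mulLeft k _) ?_ hy
  rintro _ ⟨L', h1', h2', rfl⟩
  refine Submodule.subset_span ⟨L ++ L', ?_, ?_, ?_⟩
  · rw [List.length_append]; omega
  · intro c hc
    rcases List.mem_append.1 hc with h | h
    exacts [h2 c h, h2' c h]
  · rw [List.map_append, List.prod_append]; rfl

theorem Cobar.cons_mem_redGE {p : ℕ} {c : Bar k S} (hc : Bar.counit c = 0)
    {w : Cobar k (Bar k S)} (hw : w ∈ Cobar.redGE k S p) :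
    Cobar.ι c * w ∈ Cobar.redGE k S (p + 1) :=
  add_comm 1 p ▸ Cobar.mul_mem_redGE (Cobar.ι_mem_redGE hc) hw

theorem Cobar.redGE_succ_le {p : ℕ} {T : Submodule k (Cobar k (Bar k S))}
    (h : ∀ c, Bar.counit c = 0 → ∀ w ∈ Cobar.redGE k S p, Cobar.ι c * w ∈ T) :
    Cobar.redGE k S (p + 1) ≤ T := by
  refine Submodule.span_le.2 ?_
  rintro _ ⟨_ | ⟨c, L⟩, h1, h2, rfl⟩
  · simp at h1
  · rw [List.map_cons, List.prod_cons]
    refine h c (h2 c (by simp)) _ (Submodule.subset_span ⟨L, ?_, fun c hc => h2 c (by simp [hc]),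
      rfl⟩)
    simpa using h1

theorem Cobar.redGE_zero_le {T : Submodule k (Cobar k (Bar k S))} (h1 : 1 ∈ T)
    (h : Cobar.redGE k S 1 ≤ T) : Cobar.redGE k S 0 ≤ T := by
  refine Submodule.span_le.2 ?_
  rintro _ ⟨_ | ⟨c, L⟩, hp, h2, rfl⟩
  · exact h1
  · exact h (Submodule.subset_span ⟨c :: L, by simp, h2, rfl⟩)

/-- Induction on the number of factors. -/
theorem Cobar.redGE_induct {p : ℕ} {T : ℕ → Submodule k (Cobar k (Bar k S))}
    (hT : ∀ m n, m ≤ n → T n ≤ T m) (h1 : 1 ∈ T 0)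
    (h : ∀ n c, Bar.counit c = 0 → ∀ w ∈ Cobar.redGE k S n, w ∈ T n → Cobar.ι c * w ∈ T (n + 1)) :
    Cobar.redGE k S p ≤ T p := by
  have key : ∀ L : List (Bar k S), (∀ c ∈ L, Bar.counit c = 0) →
      (L.map Cobar.ι).prod ∈ T L.length := by
    intro L
    induction L with
    | nil => intro _; exact h1
    | cons c L ih =>
      intro hL
      have hL' : ∀ c ∈ L, Bar.counit c = 0 := fun c hc => hL c (by simp [hc])
      exact h _ c (hL c (by simp)) _ (Submodule.subset_span ⟨L, le_rfl, hL', rfl⟩) (ih hL')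
  refine Submodule.span_le.2 ?_
  rintro _ ⟨L, hp, h2, rfl⟩
  exact hT _ _ hp (key L h2)

end ReducedCobar

/-! ### The twisted differential and degrees on reduced words -/

section ReducedCobarDifferential

variable {k : Type*} [Field k] {S : Type*} [AddCommGroup S] [Module k S] [NDGA k S]

/-- The right factor is split into its constant term and its reduced part; the left factor begins
with r and so is reduced already. -/
theorem Cobar.ιι_reduced_mem (r : S) (t : Bar k S ⊗[k] Bar k S) :
    Cobar.ιι ((Bar.cons r ∘ₗ sgn k (Bar k S)).rTensor _ t) -
      Cobar.ι (Bar.cons r (sgn k _ (TensorProduct.rid k _ (Bar.counit.lTensor _ t)))) *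
        Cobar.ι Bar.nil ∈ Cobar.redGE k S 2 := by
  induction t with
  | zero => simp
  | add s t hs ht =>
    have := add_mem hs ht
    convert this using 1
    simp only [map_add, add_mul]
    abel
  | tmul a b =>
    have h1 : Cobar.ι (Bar.cons r (sgn k _ a)) * Cobar.ι (b - Bar.counit b • Bar.nil) ∈
        Cobar.redGE k S (1 + 1) :=
      Cobar.mul_mem_redGE (Cobar.ι_mem_redGE (Bar.counit_cons _ _)) (Cobar.ι_mem_redGE
        (by rw [map_sub, map_smul, Bar.counit_nil, smul_eq_mul, mul_one, sub_self]))
    convert h1 using 1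
    simp [Cobar.ιι, mul_sub]

/-- The quadratic part of the twisted differential is the reduced coproduct. Therefore, modulo
products with one more factor, the twisted differential is the internal differential of the factors.
-/
theorem cobarTwι_add_mem {c : Bar k S} (hc : Bar.counit c = 0) :
    cobarTwι c + Cobar.ι (Bar.dif c) ∈ Cobar.redGE k S 2 := by
  -- The condition of vanishing counit is not stable under induction on words; subtracting the
  -- constant term makes the claim linear in an arbitrary c.
  have key : ∀ c : Bar k S, cobarTwι (c - Bar.unitPart k S c) + Cobar.ι (Bar.dif c) ∈
      Cobar.redGE k S 2 := by
    refine Bar.induct ?_ (fun r x _ => ?_) (fun v w hv hw => ?_) (fun a w hw => ?_)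
    · rw [Bar.unitPart_apply, Bar.counit_nil, one_smul, sub_self, Bar.dif_nil, map_zero, map_zero,
        add_zero]
      exact zero_mem _
    · have h := Cobar.ιι_reduced_mem (sgn k S r) (Bar.comul x)
      have h1 : Bar.counit.lTensor _ (Bar.comul x) = x ⊗ₜ[k] (1 : k) :=
        Coalgebra.lTensor_counit_comul (R := k) x
      rw [h1, TensorProduct.rid_tmul, one_smul] at h
      rw [Bar.unitPart_apply, Bar.counit_cons, zero_smul, sub_zero, cobarTwι_cons]
      convert h using 1
      abel
    · have := add_mem hv hw
      convert this using 1
      simp only [map_add, map_sub]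
      abel
    · have := Submodule.smul_mem _ a hw
      convert this using 1
      simp only [map_smul, map_sub, smul_add, smul_sub]
  have := key c
  rwa [Bar.unitPart_apply, hc, zero_smul, sub_zero] at this

theorem cobarTw_cons_mem {p : ℕ} {c : Bar k S} (hc : Bar.counit c = 0) {w : Cobar k (Bar k S)}
    (hw : w ∈ Cobar.redGE k S p) :
    cobarTw k S (Cobar.ι c * w) + Cobar.ι (Bar.dif c) * w + Cobar.ι (sgn k _ c) * cobarTw k S w ∈
      Cobar.redGE k S (p + 2) := by
  have := Cobar.mul_mem_redGE (cobarTwι_add_mem hc) hw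
  rw [add_comm 2 p] at this
  convert this using 1
  rw [cobarTw_cons, add_mul]
  abel

variable {η : ℤ}

/-- A nonempty word as a generator of the cobar construction has degree n - 1. One letter of degree
i gives exactly i, and a further letter of degree j changes it by j + 1. If all degrees are positive
this grows; if they are at most -1 it never increases. In both cases its sign is η and its absolute
value is at least 1. -/
theorem Bar.degree_bound (hη : η = 1 ∨ η = -1) (hS : ∀ n, ∀ x ∈ gr k S n, x ≠ 0 → 1 ≤ η * n)
    {n : ℤ} {c : Bar k S} (hc : c ∈ gr k (Bar k S) n) :
    1 ≤ η * (n - 1) ∨ c = Bar.unitPart k S c := by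
  refine Bar.induction_gr (p := fun n c => 1 ≤ η * (n - 1) ∨ c = Bar.unitPart k S c)
    ?_ ?_ ?_ ?_ ?_ hc
  · right
    rw [Bar.unitPart_apply, Bar.counit_nil, one_smul]
  · intro i v hv n w hw h
    by_cases hv0 : v = 0
    · right
      rw [hv0, map_zero, LinearMap.zero_apply, map_zero]
    have h1 := hS i v hv hv0
    rcases h with h | h
    · left
      rcases hη with rfl | rfl <;> omega
    · by_cases h0 : n = 0
      · left
        rwa [h0, show i + 1 + 0 - 1 = i by ring]
      · right
        have hw0 : w = 0 := by
          rw [h, Bar.unitPart_apply, Bar.counit_of_mem h0 hw, zero_smul]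
        rw [hw0, map_zero, map_zero]
  · intro n
    right; rw [map_zero]
  · rintro n x y (hx | hx) (hy | hy)
    · exact Or.inl hx
    · exact Or.inl hx
    · exact Or.inl hy
    · right; rw [map_add, ← hx, ← hy]
  · rintro n a x (hx | hx)
    · exact Or.inl hx
    · right; rw [map_smul, ← hx]

theorem pr_mul_of_mem {A : Type*} [Ring A] [Algebra k A] [DGA k A] {i : ℤ} {x : A}
    (hx : x ∈ gr k A i) (m : ℤ) (y : A) : pr k A m (x * y) = x * pr k A (m - i) y := by
  have h : LinearMap.mulLeft k x ∈ homGr k A A i := fun n y hy => by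
    rw [add_comm]
    exact DGA.mul_mem i n x hx y hy
  have := map_pr h (m - i) y
  rw [sub_add_cancel] at this
  exact this.symm

/-- Products of many words have large degree, up to the sign `η`. -/
theorem Cobar.pr_eq_zero_of_redGE (hη : η = 1 ∨ η = -1)
    (hS : ∀ n, ∀ x ∈ gr k S n, x ≠ 0 → 1 ≤ η * n) {p : ℕ} {x : Cobar k (Bar k S)}
    (hx : x ∈ Cobar.redGE k S p) {m : ℤ} (hm : η * m < p) : pr k _ m x = 0 := by
  let T : ℕ → Submodule k (Cobar k (Bar k S)) := fun p =>
    ⨅ m : {m : ℤ // η * m < p}, LinearMap.ker (pr k (Cobar k (Bar k S)) m)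
  have hT : ∀ {p x}, x ∈ T p ↔ ∀ m : ℤ, η * m < p → pr k (Cobar k (Bar k S)) m x = 0 := by
    intro p x
    simp [T, Submodule.mem_iInf]
  have key : Cobar.redGE k S p ≤ T p := by
    refine Cobar.redGE_induct (fun m n h x hx => ?_) ?_ ?_
    · rw [hT] at hx ⊢
      intro i hi
      exact hx i (by omega)
    · rw [hT]
      intro m hm
      refine pr_of_mem_ne (m := 0) ?_ Cobar.one_mem
      rintro rfl
      simp at hm
    · intro n c hc w _ hw
      rw [hT] at hw ⊢
      intro m hm
      -- The factor c need not be homogeneous. Its homogeneous components, without their constant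
      -- terms, obey `Bar.degree_bound`, and each contributes at least 1 to the degree up to η.
      have h1 : ∀ c : Bar k S, pr k _ m (Cobar.ι (c - Bar.unitPart k S c) * w) = 0 := by
        refine gr_induction k ?_ (by simp) ?_
        · intro i c hc
          have hc' : c - Bar.unitPart k S c ∈ gr k (Bar k S) i :=
            sub_mem hc (by simpa using Bar.unitPart_mem i c hc)
          rcases Bar.degree_bound hη hS hc with h | h
          · rw [pr_mul_of_mem (Cobar.ι_mem hc'), hw, mul_zero]
            have : η * (m - (i - 1)) = η * m - η * (i - 1) := by ring
            push_cast at hm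
            omega
          · rw [← h, sub_self, map_zero, zero_mul, map_zero]
        · intro x y hx hy
          have : x + y - Bar.unitPart k S (x + y) =
            (x - Bar.unitPart k S x) + (y - Bar.unitPart k S y) := by rw [map_add]; abel
          rw [this, map_add, add_mul, map_add, hx, hy, add_zero]
      have := h1 c
      rwa [Bar.unitPart_apply, hc, zero_smul, sub_zero] at this
  exact hT.1 (key hx) m hm

end ReducedCobarDifferential

/-! ### Powers of the sign operator -/

section SignPower

variable {k : Type*} [Field k]

variable (k) in
/-- The `i`-th power of `sgn`. -/
def sgnPow (V : Type*) [AddCommGroup V] [Module k V] [GrMod k V] (i : ℤ) : V →ₗ[k] V :=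
  if Even i then LinearMap.id else sgn k V

variable {V : Type*} [AddCommGroup V] [Module k V]

theorem tw_ground [GrMod k V] (i : ℤ) (f : V →ₗ[k] k) : tw i f = f ∘ₗ sgnPow k V i := by
  unfold tw sgnPow
  split_ifs
  · rfl
  · exact hat_ground f

theorem sgnPow_sgnPow [GrMod k V] (i : ℤ) (x : V) : sgnPow k V i (sgnPow k V i x) = x := by
  unfold sgnPow
  split_ifs
  · rfl
  · exact sgn_sgn x

theorem sgnPow_sgn [GrMod k V] (i : ℤ) (x : V) :
    sgnPow k V i (sgn k V x) = sgn k V (sgnPow k V i x) := by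
  unfold sgnPow
  split_ifs <;> rfl

theorem sgnPow_mem [GrMod k V] (i : ℤ) {n : ℤ} {x : V} (hx : x ∈ gr k V n) :
    sgnPow k V i x ∈ gr k V n := by
  unfold sgnPow
  split_ifs
  · exact hx
  · rw [sgn_of_mem hx]
    exact Submodule.smul_mem _ _ hx

theorem sgnPow_del [Cx k V] (i : ℤ) (x : V) :
    sgnPow k V i (del k V x) = koszul k i • del k V (sgnPow k V i x) := by
  unfold sgnPow koszul
  split_ifs
  · rw [one_smul]; rfl
  · rw [sgn_del]
    module

theorem Bar.sgnPow_mem_lenLT [GrMod k V] {n : ℕ} (i : ℤ) {w : Bar k V} (hw : w ∈ Bar.lenLT k V n) :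
    sgnPow k _ i w ∈ Bar.lenLT k V n := by
  unfold sgnPow
  split_ifs
  · exact hw
  · exact Bar.wt_mem_lenLT hw _

theorem comp_mem_lenGE_of_lenLT {m n : ℕ} {f : Bar k V →ₗ[k] k} (hf : f ∈ lenGE k V k n)
    {T : Bar k V →ₗ[k] Bar k V} (hT : ∀ w ∈ Bar.lenLT k V m, T w ∈ Bar.lenLT k V n) :
    f ∘ₗ T ∈ lenGE k V k m := fun w hw => hf _ (hT w hw)

theorem homDel_comp_ground [Cx k V] {C : Type*} [AddCommGroup C] [Module k C] [Cx k C]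
    (f : V →ₗ[k] k) (T : C →ₗ[k] V) (x : C) :
    homDel (f ∘ₗ T) x = f (T (del k C (sgn k C x))) := homDel_ground _ _

end SignPower

/-! ### Operators on the first factor and on the first letter -/

section HodgeOperators

variable {k : Type*} [Field k] {S W ι : Type*} [Fintype ι] [AddCommGroup S] [Module k S] [NDGA k S]
  [AddCommGroup W] [Module k W] [NDGA k W] (H : HodgeDuality k S W ι)

namespace HodgeDuality

/-- The contraction of the first factor. -/
def cobarHtpy : Cobar k (Bar k S) →ₗ[k] Cobar k (Bar k S) :=
  Cobar.rec' 0 (-(LinearMap.mul k (Cobar k (Bar k S)) ∘ₗ Cobar.ι ∘ₗ H.barHtpy)) 0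

/-- Evaluation of a closed functional on the first factor. -/
def coeff (i : ι) : Cobar k (Bar k S) →ₗ[k] Cobar k (Bar k S) :=
  Cobar.rec' 0 (LinearMap.lsmul k (Cobar k (Bar k S)) ∘ₗ H.pairing.flip (H.coc i)) 0

/-- Multiplication by a cycle. -/
def mulCyc (i : ι) : Cobar k (Bar k S) →ₗ[k] Cobar k (Bar k S) :=
  LinearMap.mulLeft k (Cobar.ι (H.cyc i))

/-- The projection of the first factor to the chosen cycles. -/
def harm : Cobar k (Bar k S) →ₗ[k] Cobar k (Bar k S) := ∑ i, H.mulCyc i ∘ₗ H.coeff i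

/-- Insertion of a cocycle as first letter. -/
def insert (i : ι) : Bar k W →ₗ[k] Bar k W :=
  Bar.cons (H.coc i) ∘ₗ sgnPow k (Bar k W) (H.degree i + 1)

/-- Evaluation of the first letter on a cycle. -/
def extract (i : ι) : Bar k W →ₗ[k] Bar k W :=
  Bar.rec' 0 ((LinearMap.lsmul k (Bar k W)).compl₁₂ (H.pairing (H.cyc i))
    (sgnPow k (Bar k W) (H.degree i + 1))) 0

/-- The contraction of the first letter. -/
def wordHtpy : Bar k W →ₗ[k] Bar k W := Bar.rec' 0 (-(Bar.cons ∘ₗ H.algHtpy)) 0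

theorem cobarHtpy_one : H.cobarHtpy 1 = 0 := by simp [cobarHtpy]

theorem cobarHtpy_cons (c : Bar k S) (w : Cobar k (Bar k S)) :
    H.cobarHtpy (Cobar.ι c * w) = -(Cobar.ι (H.barHtpy c) * w) := by
  simp [cobarHtpy]

theorem coeff_one (i : ι) : H.coeff i 1 = 0 := by simp [coeff]

theorem coeff_cons (i : ι) (c : Bar k S) (w : Cobar k (Bar k S)) :
    H.coeff i (Cobar.ι c * w) = H.pairing c (H.coc i) • w := by
  simp [coeff]

theorem mulCyc_apply (i : ι) (w : Cobar k (Bar k S)) :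
    H.mulCyc i w = Cobar.ι (H.cyc i) * w := rfl

theorem harm_apply (x : Cobar k (Bar k S)) : H.harm x = ∑ i, H.mulCyc i (H.coeff i x) := by
  simp [harm]

theorem insert_apply (i : ι) (u : Bar k W) :
    H.insert i u = Bar.cons (H.coc i) (sgnPow k (Bar k W) (H.degree i + 1) u) := rfl

theorem extract_nil (i : ι) : H.extract i Bar.nil = 0 := by simp [extract]

theorem extract_cons (i : ι) (φ : W) (u : Bar k W) : H.extract i (Bar.cons φ u) =
    H.pairing (H.cyc i) φ • sgnPow k (Bar k W) (H.degree i + 1) u := by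
  simp [extract]

theorem wordHtpy_nil : H.wordHtpy Bar.nil = 0 := by simp [wordHtpy]

theorem wordHtpy_cons (φ : W) (u : Bar k W) :
    H.wordHtpy (Bar.cons φ u) = -Bar.cons (H.algHtpy φ) u := by
  simp [wordHtpy]

theorem pairing_sgn_coc (c : Bar k S) (i : ι) :
    H.pairing (sgn k _ c) (H.coc i) = koszul k (H.degree i) * H.pairing c (H.coc i) := by
  refine gr_induction k (p := fun c => H.pairing (sgn k _ c) (H.coc i) =
    koszul k (H.degree i) * H.pairing c (H.coc i)) (fun n c hc => ?_) (by simp) ?_ c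
  · rw [sgn_of_mem hc, map_smul, LinearMap.smul_apply, smul_eq_mul]
    by_cases h : n = H.degree i
    · rw [h]
    · rw [H.pairing_of_mem n (-H.degree i) (by omega) c hc _ (H.coc_mem i), mul_zero, mul_zero]
  · intro x y hx hy
    simp only [map_add, LinearMap.add_apply, mul_add, hx, hy]

/-- Testing `pairing_cyc_coc` on standard vectors turns it into the Kronecker delta, so that it
applies to sums in any module. -/
theorem sum_pairing_smul {X : Type*} [AddCommGroup X] [Module k X] (v : ι → X) (j : ι) :
    ∑ i, H.pairing (H.cyc i) (H.coc j) • v i = v j := by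
  classical
  have h : ∀ i, H.pairing (H.cyc i) (H.coc j) = if i = j then 1 else 0 := fun i => by
    have := H.pairing_cyc_coc (Pi.single i 1) j
    rw [Finset.sum_eq_single i (fun b _ hb => by rw [Pi.single_eq_of_ne hb, zero_smul])
      (fun h => absurd (Finset.mem_univ i) h), Pi.single_eq_same, one_smul] at this
    rw [this, Pi.single_apply]
    simp only [eq_comm]
  simp [h]

theorem sgn_barHtpy (c : Bar k S) : sgn k _ (H.barHtpy c) = -H.barHtpy (sgn k _ c) := by
  rw [map_sgn_of_mem_one H.barHtpy_mem]

theorem sgn_algHtpy (φ : W) : sgn k _ (H.algHtpy φ) = -H.algHtpy (sgn k _ φ) := by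
  rw [map_sgn_of_mem_one H.algHtpy_mem]

/-! ### The operators and the filtrations -/

variable {H}

theorem cobarHtpy_mem_redGE {p : ℕ} {x : Cobar k (Bar k S)} (hx : x ∈ Cobar.redGE k S (p + 1)) :
    H.cobarHtpy x ∈ Cobar.redGE k S (p + 1) := by
  refine Cobar.redGE_succ_le (T := (Cobar.redGE k S (p + 1)).comap H.cobarHtpy) ?_ hx
  intro c _ w hw
  rw [Submodule.mem_comap, cobarHtpy_cons]
  exact neg_mem (Cobar.cons_mem_redGE (H.counit_barHtpy c) hw)

theorem coeff_mem_redGE {p : ℕ} {x : Cobar k (Bar k S)} (hx : x ∈ Cobar.redGE k S (p + 1))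
    (i : ι) : H.coeff i x ∈ Cobar.redGE k S p := by
  refine Cobar.redGE_succ_le (T := (Cobar.redGE k S p).comap (H.coeff i)) ?_ hx
  intro c _ w hw
  rw [Submodule.mem_comap, coeff_cons]
  exact Submodule.smul_mem _ _ hw

theorem mulCyc_mem_redGE {p : ℕ} {x : Cobar k (Bar k S)} (hx : x ∈ Cobar.redGE k S p)
    (i : ι) : H.mulCyc i x ∈ Cobar.redGE k S (p + 1) :=
  Cobar.cons_mem_redGE (H.counit_cyc i) hx

/-- To leading order the differential acts factor by factor. Contracting the first factor replaces
it by its harmonic part, and the terms in which the differential hits the other factors cancel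
because `barHtpy` is odd. -/
theorem cobarHtpy_spec {p : ℕ} {x : Cobar k (Bar k S)} (hx : x ∈ Cobar.redGE k S (p + 1)) :
    cobarTw k S (H.cobarHtpy x) + H.cobarHtpy (cobarTw k S x) - (x - H.harm x) ∈
      Cobar.redGE k S (p + 2) := by
  refine Cobar.redGE_succ_le (T := (Cobar.redGE k S (p + 2)).comap
    (cobarTw k S ∘ₗ H.cobarHtpy + H.cobarHtpy ∘ₗ cobarTw k S - (LinearMap.id - H.harm))) ?_ hx
  intro c hc w hw
  have h1 := cobarTw_cons_mem (H.counit_barHtpy c) hw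
  have h2 := cobarHtpy_mem_redGE (H := H) (p := p + 1) (cobarTw_cons_mem hc hw)
  have h3 : H.harm (Cobar.ι c * w) = Cobar.ι (∑ i, H.pairing c (H.coc i) • H.cyc i) * w := by
    simp only [harm_apply, coeff_cons, map_smul, mulCyc_apply, map_sum, Finset.sum_mul,
      smul_mul_assoc]
  have h4 : Cobar.ι c * w - H.harm (Cobar.ι c * w) =
      Cobar.ι (Bar.dif (H.barHtpy c)) * w + Cobar.ι (H.barHtpy (Bar.dif c)) * w := by
    rw [h3, ← sub_mul, ← map_sub, ← H.barHtpy_spec c hc, map_add, add_mul]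
  have := sub_mem h2 h1
  rw [Submodule.mem_comap]
  convert this using 1
  simp only [LinearMap.sub_apply, LinearMap.add_apply, LinearMap.comp_apply, LinearMap.id_apply,
    map_add, cobarHtpy_cons, map_neg, h4, sgn_barHtpy, neg_mul]
  abel

/-- The functional `coc i` kills boundaries, so the differential of the first factor drops out; the
sign is that of moving the differential past a generator of degree `degree i` - 1. -/
theorem coeff_cobarTw {p : ℕ} {x : Cobar k (Bar k S)} (hx : x ∈ Cobar.redGE k S (p + 1)) (i : ι) :
    H.coeff i (cobarTw k S x) - koszul k (H.degree i + 1) • cobarTw k S (H.coeff i x) ∈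
      Cobar.redGE k S (p + 1) := by
  refine Cobar.redGE_succ_le (T := (Cobar.redGE k S (p + 1)).comap
    (H.coeff i ∘ₗ cobarTw k S - koszul k (H.degree i + 1) • cobarTw k S ∘ₗ H.coeff i)) ?_ hx
  intro c hc w hw
  have h1 := coeff_mem_redGE (H := H) (p := p + 1) (cobarTw_cons_mem hc hw) i
  rw [Submodule.mem_comap]
  convert h1 using 1
  simp only [LinearMap.sub_apply, LinearMap.comp_apply, LinearMap.smul_apply,
    map_add, coeff_cons, map_smul, H.pairing_dif_coc, pairing_sgn_coc, koszul_add,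
    koszul_one]
  module

theorem cobarTw_mulCyc {p : ℕ} {y : Cobar k (Bar k S)} (hy : y ∈ Cobar.redGE k S p) (i : ι) :
    cobarTw k S (H.mulCyc i y) - koszul k (H.degree i + 1) • H.mulCyc i (cobarTw k S y) ∈
      Cobar.redGE k S (p + 2) := by
  have h1 := cobarTw_cons_mem (H.counit_cyc i) hy
  convert h1 using 1
  rw [H.dif_cyc, sgn_of_mem (H.cyc_mem i), map_smul, map_zero, koszul_add, koszul_one,
    mulCyc_apply, mulCyc_apply, smul_mul_assoc, zero_mul]
  module

theorem coeff_harm (x : Cobar k (Bar k S)) (j : ι) : H.coeff j (H.harm x) = H.coeff j x := by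
  rw [harm_apply, map_sum]
  simp only [mulCyc_apply, coeff_cons]
  exact H.sum_pairing_smul _ j

theorem insert_mem_lenLT {n : ℕ} {u : Bar k W} (hu : u ∈ Bar.lenLT k W n) (i : ι) :
    H.insert i u ∈ Bar.lenLT k W (n + 1) :=
  Bar.cons_mem_lenLT _ (Bar.sgnPow_mem_lenLT _ hu)

theorem extract_mem_lenLT {n : ℕ} {u : Bar k W} (hu : u ∈ Bar.lenLT k W (n + 1)) (i : ι) :
    H.extract i u ∈ Bar.lenLT k W n := by
  refine Bar.lenLT_succ_le (S := (Bar.lenLT k W n).comap (H.extract i)) ?_ ?_ hu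
  · rw [Submodule.mem_comap, extract_nil]; exact zero_mem _
  · intro φ w hw
    rw [Submodule.mem_comap, extract_cons]
    exact Submodule.smul_mem _ _ (Bar.sgnPow_mem_lenLT _ hw)

theorem wordHtpy_mem_lenLT {n : ℕ} {u : Bar k W} (hu : u ∈ Bar.lenLT k W n) :
    H.wordHtpy u ∈ Bar.lenLT k W n := by
  cases n with
  | zero =>
    rw [(Submodule.mem_bot k).1 hu, map_zero]
    exact zero_mem _
  | succ n =>
    refine Bar.lenLT_succ_le (S := (Bar.lenLT k W (n + 1)).comap H.wordHtpy) ?_ ?_ hu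
    · rw [Submodule.mem_comap, wordHtpy_nil]; exact zero_mem _
    · intro φ w hw
      rw [Submodule.mem_comap, wordHtpy_cons]
      exact neg_mem (Bar.cons_mem_lenLT _ hw)

/-- Since `coc i` is closed, the only error is its product with the next letter, and this has one
letter less. -/
theorem dif_sgn_insert {n : ℕ} {u : Bar k W} (hu : u ∈ Bar.lenLT k W n) (i : ι) :
    Bar.dif (sgn k _ (H.insert i u)) -
      koszul k (H.degree i + 1) • H.insert i (Bar.dif (sgn k _ u)) ∈ Bar.lenLT k W n := by
  have h1 := Submodule.smul_mem _ (koszul k (H.degree i + 1)) (Bar.merge_mem_lenLT (H.coc i)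
    (Bar.wt_mem_lenLT (Bar.sgnPow_mem_lenLT (H.degree i + 1) hu) (koszul k)))
  have h2 : sgnPow k _ (H.degree i + 1) (Bar.dif (sgn k _ u)) = koszul k (H.degree i + 1) •
      Bar.dif (sgn k _ (sgnPow k _ (H.degree i + 1) u)) := by
    rw [← sgnPow_sgn]
    exact sgnPow_del _ _
  convert h1 using 1
  rw [insert_apply, insert_apply, h2, Bar.sgn_cons, sgn_of_mem (H.coc_mem i), map_neg,
    map_smul, LinearMap.smul_apply, map_smul, Bar.dif_cons, H.del_coc, sgn_of_mem (H.coc_mem i),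
    map_zero, LinearMap.zero_apply, map_smul, map_smul, LinearMap.smul_apply, koszul_add,
    koszul_one, koszul_neg, smul_smul (koszul k (H.degree i) * -1)]
  simp only [smul_sub, smul_smul, koszul_mul_self, mul_neg, mul_one, neg_mul, neg_neg, sub_zero,
    one_smul, neg_smul, neg_sub, sgn]
  abel

/-- The counterpart of `cobarHtpy_spec` on words: `algHtpy` contracts the first letter onto the span
of the `coc i`, and products with the next letter are shorter. The empty word is not contracted and
stays as an error; this is why the bound on the error must allow at least words of length 0. -/
theorem wordHtpy_spec {n : ℕ} {u : Bar k W} (hu : u ∈ Bar.lenLT k W (n + 2)) :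
    H.wordHtpy (Bar.dif u) + Bar.dif (H.wordHtpy u) - u + ∑ i, H.insert i (H.extract i u) ∈
      Bar.lenLT k W (n + 1) := by
  suffices h : Bar.lenLT k W (n + 2) ≤ (Bar.lenLT k W (n + 1)).comap (H.wordHtpy ∘ₗ Bar.dif +
      Bar.dif ∘ₗ H.wordHtpy - LinearMap.id + ∑ i, H.insert i ∘ₗ H.extract i) by
    have := h hu
    rw [Submodule.mem_comap] at this
    simpa only [LinearMap.add_apply, LinearMap.sub_apply, LinearMap.sum_apply,
      LinearMap.comp_apply, LinearMap.id_apply] using this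
  refine Bar.lenLT_succ_le ?_ ?_
  · rw [Submodule.mem_comap]
    have h := neg_mem (Bar.nil_mem_lenLT (k := k) (V := W) n)
    convert h using 1
    simp [Bar.dif_nil, wordHtpy_nil, extract_nil]
  · intro φ w hw
    have h1 := wordHtpy_mem_lenLT (H := H) (Bar.merge_mem_lenLT φ hw)
    have h2 := Bar.merge_mem_lenLT (H.algHtpy φ) hw
    have h3 := sub_mem h1 h2
    rw [Submodule.mem_comap]
    convert h3 using 1
    have h4 : ∑ i, H.insert i (H.extract i (Bar.cons φ w)) =
        Bar.cons (φ - del k W (H.algHtpy φ) - H.algHtpy (del k W φ)) w := by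
      rw [sub_sub, H.algHtpy_spec, sub_sub_cancel, map_sum, LinearMap.sum_apply]
      refine Finset.sum_congr rfl fun i _ => ?_
      rw [extract_cons, map_smul, insert_apply, sgnPow_sgnPow, map_smul, LinearMap.smul_apply]
    simp only [LinearMap.add_apply, LinearMap.sub_apply, LinearMap.comp_apply, LinearMap.id_apply,
      LinearMap.sum_apply, h4, Bar.dif_cons, wordHtpy_cons, map_sub, map_neg, sgn_algHtpy,
      LinearMap.neg_apply]
    abel

/-- The cycle `cyc i` pairs to zero with boundaries. The error is what is extracted from a merged
word: one letter is lost in the product and one in the evaluation, so the filtration drops by two.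
-/
theorem extract_dif_sgn {n : ℕ} {u : Bar k W} (hu : u ∈ Bar.lenLT k W (n + 2)) (i : ι) :
    H.extract i (Bar.dif (sgn k _ u)) -
      koszul k (H.degree i + 1) • Bar.dif (sgn k _ (H.extract i u)) ∈ Bar.lenLT k W n := by
  refine Bar.lenLT_succ_le (S := (Bar.lenLT k W n).comap (H.extract i ∘ₗ Bar.dif ∘ₗ sgn k _ -
    koszul k (H.degree i + 1) • Bar.dif ∘ₗ sgn k _ ∘ₗ H.extract i)) ?_ ?_ hu
  · rw [Submodule.mem_comap]
    simp [Bar.dif_nil, extract_nil, Bar.sgn_nil]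
  · intro φ w hw
    have h1 := neg_mem (extract_mem_lenLT (H := H) (Bar.merge_mem_lenLT (sgn k W φ)
      (Bar.wt_mem_lenLT hw (koszul k))) i)
    have h2 : sgnPow k _ (H.degree i + 1) (Bar.dif (sgn k _ w)) = koszul k (H.degree i + 1) •
        Bar.dif (sgn k _ (sgnPow k _ (H.degree i + 1) w)) := by
      rw [← sgnPow_sgn]
      exact sgnPow_del _ _
    rw [Submodule.mem_comap]
    convert h1 using 1
    simp only [LinearMap.sub_apply, LinearMap.comp_apply, LinearMap.smul_apply, Bar.sgn_cons,
      map_neg, Bar.dif_cons, map_sub, extract_cons, H.pairing_cyc_del, sgn_sgn, h2, map_smul]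
    simp only [sgn]
    module

end HodgeDuality

end HodgeOperators

/-! ### Degrees of the operators -/

section HodgeOperatorDegrees

variable {k : Type*} [Field k] {S W ι : Type*} [Fintype ι] [AddCommGroup S] [Module k S] [NDGA k S]
  [AddCommGroup W] [Module k W] [NDGA k W] (H : HodgeDuality k S W ι)

namespace HodgeDuality

theorem cobarHtpy_mem : H.cobarHtpy ∈ homGr k (Cobar k (Bar k S)) (Cobar k (Bar k S)) 1 := by
  intro n x hx
  refine Cobar.induction_gr (p := fun n x => H.cobarHtpy x ∈ gr k _ (n + 1)) ?_ ?_ ?_ ?_ ?_ hx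
  · rw [cobarHtpy_one]; exact zero_mem _
  · intro i c hc n w hw _
    rw [cobarHtpy_cons]
    exact neg_mem (gr_of_eq (Cobar.mul_mem (Cobar.ι_mem (H.barHtpy_mem _ _ hc)) hw) (by ring))
  · intro n; rw [map_zero]; exact zero_mem _
  · intro n v w hv hw; rw [map_add]; exact add_mem hv hw
  · intro n c w hw; rw [map_smul]; exact Submodule.smul_mem _ _ hw

theorem coeff_mem (i : ι) :
    H.coeff i ∈ homGr k (Cobar k (Bar k S)) (Cobar k (Bar k S)) (1 - H.degree i) := by
  intro n x hx
  refine Cobar.induction_gr (p := fun n x => H.coeff i x ∈ gr k _ (n + (1 - H.degree i)))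
    ?_ ?_ ?_ ?_ ?_ hx
  · rw [coeff_one]; exact zero_mem _
  · intro j c hc n w hw _
    rw [coeff_cons]
    by_cases h : j = H.degree i
    · exact Submodule.smul_mem _ _ (gr_of_eq hw (by rw [h]; ring))
    · rw [H.pairing_of_mem j (-H.degree i) (by omega) c hc _ (H.coc_mem i), zero_smul]
      exact zero_mem _
  · intro n; rw [map_zero]; exact zero_mem _
  · intro n v w hv hw; rw [map_add]; exact add_mem hv hw
  · intro n c w hw; rw [map_smul]; exact Submodule.smul_mem _ _ hw

theorem mulCyc_mem (i : ι) :
    H.mulCyc i ∈ homGr k (Cobar k (Bar k S)) (Cobar k (Bar k S)) (H.degree i - 1) :=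
  fun _ _ hx => gr_of_eq (Cobar.mul_mem (Cobar.ι_mem (H.cyc_mem i)) hx) (by ring)

theorem insert_mem (i : ι) : H.insert i ∈ homGr k (Bar k W) (Bar k W) (1 - H.degree i) :=
  fun _ _ hu => gr_of_eq (Bar.cons_mem (H.coc_mem i) (sgnPow_mem _ hu)) (by ring)

theorem extract_mem (i : ι) : H.extract i ∈ homGr k (Bar k W) (Bar k W) (H.degree i - 1) := by
  intro n x hx
  refine Bar.induction_gr (p := fun n x => H.extract i x ∈ gr k _ (n + (H.degree i - 1)))
    ?_ ?_ ?_ ?_ ?_ hx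
  · rw [extract_nil]; exact zero_mem _
  · intro j φ hφ n w hw _
    rw [extract_cons]
    by_cases h : j = -H.degree i
    · exact Submodule.smul_mem _ _ (gr_of_eq (sgnPow_mem _ hw) (by rw [h]; ring))
    · rw [H.pairing_of_mem (H.degree i) j (by omega) _ (H.cyc_mem i) φ hφ, zero_smul]
      exact zero_mem _
  · intro n; rw [map_zero]; exact zero_mem _
  · intro n v w hv hw; rw [map_add]; exact add_mem hv hw
  · intro n c w hw; rw [map_smul]; exact Submodule.smul_mem _ _ hw

theorem wordHtpy_mem : H.wordHtpy ∈ homGr k (Bar k W) (Bar k W) 1 := by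
  intro n x hx
  refine Bar.induction_gr (p := fun n x => H.wordHtpy x ∈ gr k _ (n + 1)) ?_ ?_ ?_ ?_ ?_ hx
  · rw [wordHtpy_nil]; exact zero_mem _
  · intro i φ hφ n w hw _
    rw [wordHtpy_cons]
    exact neg_mem (gr_of_eq (Bar.cons_mem (H.algHtpy_mem _ _ hφ) hw) (by ring))
  · intro n; rw [map_zero]; exact zero_mem _
  · intro n v w hv hw; rw [map_add]; exact add_mem hv hw
  · intro n c w hw; rw [map_smul]; exact Submodule.smul_mem _ _ hw

end HodgeDuality

end HodgeOperatorDegrees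

/-! ### Letterwise evaluation of products on words -/

section WordEvaluation

variable {k : Type*} [Field k] {S W ι : Type*} [Fintype ι] [AddCommGroup S] [Module k S] [NDGA k S]
  [AddCommGroup W] [Module k W] [NDGA k W]

/-- A chain map that evaluates products of words on words letter by letter. -/
structure WordEvaluation (β : Bar k S →ₗ[k] W →ₗ[k] k) where
  toFun : Cobar k (Bar k S) →ₗ[k] Bar k W →ₗ[k] k
  one : toFun 1 = Bar.counit
  cons_nil : ∀ c w, toFun (Cobar.ι c * w) Bar.nil = 0
  cons_cons : ∀ n, ∀ c ∈ gr k (Bar k S) n, ∀ w φ u, toFun (Cobar.ι c * w) (Bar.cons φ u) =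
    β c φ * toFun w (sgnPow k _ (n + 1) u)
  map_mem : ∀ n, ∀ x ∈ gr k (Cobar k (Bar k S)) n, toFun x ∈ homGr k (Bar k W) k n
  map_cobarTw : ∀ x, toFun (cobarTw k S x) = homDel (toFun x)

namespace WordEvaluation

/-- Each factor consumes one letter, so a product of p reduced words vanishes on words with fewer
than p letters. -/
theorem mem_lenGE {β : Bar k S →ₗ[k] W →ₗ[k] k} (Ψ : WordEvaluation β) {p : ℕ}
    {x : Cobar k (Bar k S)} (hx : x ∈ Cobar.redGE k S p) : Ψ.toFun x ∈ lenGE k W k p := by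
  refine Cobar.redGE_induct (T := fun p => (lenGE k W k p).comap Ψ.toFun)
    (fun m n h x hx => lenGE_anti h hx) (mem_lenGE_zero _) ?_ hx
  intro n c _ w _ hw
  refine mem_lenGE_succ (Ψ.cons_nil c w) fun φ => ?_
  intro u hu
  rw [LinearMap.comp_apply]
  refine gr_induction k (p := fun c => Ψ.toFun (Cobar.ι c * w) (Bar.cons φ u) = 0)
    (fun i c hc => ?_) ?_ ?_ c
  · rw [Ψ.cons_cons i c hc, hw _ (Bar.sgnPow_mem_lenLT _ hu), mul_zero]
  · rw [map_zero, zero_mul, map_zero, LinearMap.zero_apply]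
  · intro c c' h h'
    rw [map_add, add_mul, map_add, LinearMap.add_apply, h, h', add_zero]

variable {H : HodgeDuality k S W ι} (Ψ : WordEvaluation H.pairing)

/-- Together with `mulCyc` this is the adjunction that transports the peeling of a factor from
products to functionals: `insert` corresponds to `coeff`, and `extract` to `mulCyc`. In degrees
where the signs do not match, the pairing is zero. -/
theorem comp_insert (x : Cobar k (Bar k S)) (i : ι) :
    Ψ.toFun x ∘ₗ H.insert i = Ψ.toFun (H.coeff i x) := by
  suffices h : (LinearMap.lcomp k k (H.insert i)) ∘ₗ Ψ.toFun = Ψ.toFun ∘ₗ H.coeff i from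
    LinearMap.congr_fun h x
  refine Cobar.ext' ?_ fun c w _ => ?_
  · rw [LinearMap.comp_apply, LinearMap.comp_apply, H.coeff_one, map_zero, Ψ.one]
    refine LinearMap.ext fun u => ?_
    exact Bar.counit_cons _ _
  · refine LinearMap.ext fun u => ?_
    rw [LinearMap.comp_apply, LinearMap.comp_apply, H.coeff_cons, map_smul]
    show Ψ.toFun (Cobar.ι c * w) (H.insert i u) = _
    rw [H.insert_apply, LinearMap.smul_apply, smul_eq_mul]
    refine gr_induction k (p := fun c => Ψ.toFun (Cobar.ι c * w) (Bar.cons (H.coc i)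
      (sgnPow k _ (H.degree i + 1) u)) = H.pairing c (H.coc i) * Ψ.toFun w u)
      (fun n c hc => ?_) ?_ ?_ c
    · rw [Ψ.cons_cons n c hc]
      by_cases h : n = H.degree i
      · rw [h, sgnPow_sgnPow]
      · rw [H.pairing_of_mem n (-H.degree i) (by omega) c hc _ (H.coc_mem i), zero_mul, zero_mul]
    · simp
    · intro c c' h h'
      rw [map_add, add_mul, map_add, LinearMap.add_apply, h, h', map_add, LinearMap.add_apply,
        add_mul]

theorem mulCyc (x : Cobar k (Bar k S)) (i : ι) :
    Ψ.toFun (H.mulCyc i x) = Ψ.toFun x ∘ₗ H.extract i := by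
  refine Bar.ext' ?_ fun φ u _ => ?_
  · rw [H.mulCyc_apply, Ψ.cons_nil, LinearMap.comp_apply, H.extract_nil, map_zero]
  · rw [H.mulCyc_apply, Ψ.cons_cons _ _ (H.cyc_mem i), LinearMap.comp_apply, H.extract_cons,
      map_smul, smul_eq_mul]

/-- The side condition `pairing_algHtpy` says that the homotopy on letters lands in the annihilator
of the chosen cycles, and the harmonic part evaluates the first letter on these cycles only. -/
theorem harm_sgn_wordHtpy (x : Cobar k (Bar k S)) (u : Bar k W) :
    Ψ.toFun (H.harm x) (sgn k _ (H.wordHtpy u)) = 0 := by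
  suffices h : Ψ.toFun (H.harm x) ∘ₗ sgn k _ ∘ₗ H.wordHtpy = 0 from LinearMap.congr_fun h u
  refine Bar.ext' ?_ fun φ u _ => ?_
  · simp [H.wordHtpy_nil]
  · rw [LinearMap.zero_apply, LinearMap.comp_apply, LinearMap.comp_apply, H.wordHtpy_cons, map_neg,
      Bar.sgn_cons, neg_neg, H.sgn_algHtpy, map_neg, LinearMap.neg_apply, map_neg, H.harm_apply,
      map_sum, LinearMap.sum_apply, neg_eq_zero]
    refine Finset.sum_eq_zero fun i _ => ?_
    rw [Ψ.mulCyc, LinearMap.comp_apply, H.extract_cons, H.pairing_algHtpy, zero_smul, map_zero]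

end WordEvaluation

end WordEvaluation

/-! ### Acyclicity of the cone of the evaluation -/

section WordEvaluation

variable {k : Type*} [Field k] {S W ι : Type*} [Fintype ι] [AddCommGroup S] [Module k S] [NDGA k S]
  [AddCommGroup W] [Module k W] [NDGA k W] {H : HodgeDuality k S W ι}

namespace HodgeDuality

variable (H) in
theorem homDel_comp_insert {n : ℕ} {f : Bar k W →ₗ[k] k} (hf : f ∈ lenGE k W k n) (i : ι) :
    homDel (f ∘ₗ H.insert i) - koszul k (H.degree i + 1) • homDel f ∘ₗ H.insert i ∈
      lenGE k W k n := by
  intro u hu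
  have h := hf _ (H.dif_sgn_insert hu i)
  rw [map_sub, map_smul, smul_eq_mul] at h
  have h' : f (Bar.dif (sgn k _ (H.insert i u))) =
    koszul k (H.degree i + 1) * f (H.insert i (Bar.dif (sgn k _ u))) := sub_eq_zero.1 h
  rw [LinearMap.sub_apply, homDel_comp_ground, LinearMap.smul_apply, LinearMap.comp_apply,
    homDel_ground, Bar.del_def, h', smul_eq_mul, ← mul_assoc, koszul_mul_self, one_mul,
    sub_self]

variable (H) in
theorem homDel_comp_extract {n : ℕ} {g : Bar k W →ₗ[k] k} (hg : g ∈ lenGE k W k n) (i : ι) :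
    homDel (g ∘ₗ H.extract i) - koszul k (H.degree i + 1) • homDel g ∘ₗ H.extract i ∈
      lenGE k W k (n + 2) := by
  intro u hu
  have h := hg _ (H.extract_dif_sgn hu i)
  rw [map_sub, map_smul, smul_eq_mul, sub_eq_zero] at h
  rw [LinearMap.sub_apply, homDel_comp_ground, LinearMap.smul_apply, LinearMap.comp_apply,
    homDel_ground, Bar.del_def, h, smul_eq_mul, sub_self]

variable (H) in
theorem homDel_hat_comp_wordHtpy (f : Bar k W →ₗ[k] k) :
    homDel (hat f ∘ₗ H.wordHtpy) = f ∘ₗ H.wordHtpy ∘ₗ Bar.dif := by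
  refine LinearMap.ext fun u => ?_
  rw [homDel_comp_ground, hat_ground, LinearMap.comp_apply, map_sgn_of_mem_one H.wordHtpy_mem]
  have : del k (Bar k W) (sgn k _ u) = - sgn k _ (Bar.dif u) := by
    rw [← Bar.del_def, sgn_del, neg_neg]
  rw [this]
  simp

variable (H) in
theorem hat_homDel_comp_wordHtpy (f : Bar k W →ₗ[k] k) :
    hat (homDel f) ∘ₗ H.wordHtpy = f ∘ₗ Bar.dif ∘ₗ H.wordHtpy := by
  refine LinearMap.ext fun u => ?_
  rw [LinearMap.comp_apply, hat_ground, LinearMap.comp_apply, homDel_ground, sgn_sgn]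
  rfl

variable (H) in
theorem comp_wordHtpy_spec {n : ℕ} {f : Bar k W →ₗ[k] k} (hf : f ∈ lenGE k W k (n + 1)) :
    homDel (hat f ∘ₗ H.wordHtpy) + hat (homDel f) ∘ₗ H.wordHtpy -
      (f - ∑ i, f ∘ₗ H.insert i ∘ₗ H.extract i) ∈ lenGE k W k (n + 2) := by
  intro u hu
  have h := hf _ (H.wordHtpy_spec hu)
  rw [homDel_hat_comp_wordHtpy, hat_homDel_comp_wordHtpy]
  rw [← h]
  simp only [LinearMap.add_apply, LinearMap.sub_apply, LinearMap.sum_apply, LinearMap.comp_apply,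
    map_add, map_sub, map_sum]
  abel

end HodgeDuality

variable (Ψ : WordEvaluation H.pairing)

/-- Solvability to first order, for pairs of positive filtration. -/
theorem WordEvaluation.exists_approx_succ {p : ℕ}
    (ih : ∀ (m : ℤ) (x : Cobar k (Bar k S)) (f : Bar k W →ₗ[k] k), x ∈ Cobar.redGE k S p →
      x ∈ gr k (Cobar k (Bar k S)) (m - 1) → f ∈ lenGE k W k p → f ∈ homGr k (Bar k W) k m →
      cobarTw k S x ∈ Cobar.redGE k S (p + 1) → homDel f - Ψ.toFun x ∈ lenGE k W k (p + 1) →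
      ∃ y ∈ Cobar.redGE k S p, y ∈ gr k (Cobar k (Bar k S)) m ∧ ∃ g ∈ lenGE k W k p,
        g ∈ homGr k (Bar k W) k (m + 1) ∧ x - cobarTw k S y ∈ Cobar.redGE k S (p + 1) ∧
        f - Ψ.toFun y - homDel g ∈ lenGE k W k (p + 1))
    {m : ℤ} {x : Cobar k (Bar k S)} {f : Bar k W →ₗ[k] k} (hx : x ∈ Cobar.redGE k S (p + 1))
    (hxm : x ∈ gr k (Cobar k (Bar k S)) (m - 1)) (hf : f ∈ lenGE k W k (p + 1))
    (hfm : f ∈ homGr k (Bar k W) k m) (hdx : cobarTw k S x ∈ Cobar.redGE k S (p + 2))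
    (hdf : homDel f - Ψ.toFun x ∈ lenGE k W k (p + 2)) :
    ∃ y ∈ Cobar.redGE k S (p + 1), y ∈ gr k (Cobar k (Bar k S)) m ∧ ∃ g ∈ lenGE k W k (p + 1),
      g ∈ homGr k (Bar k W) k (m + 1) ∧ x - cobarTw k S y ∈ Cobar.redGE k S (p + 2) ∧
      f - Ψ.toFun y - homDel g ∈ lenGE k W k (p + 2) := by
  -- The first factor of x is contracted: up to more factors, x is the boundary of x₁ plus the
  -- harmonic part of x.
  set x₁ := H.cobarHtpy x with hx₁
  have hx₁F : x₁ ∈ Cobar.redGE k S (p + 1) := H.cobarHtpy_mem_redGE hx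
  have hx₁m : x₁ ∈ gr k (Cobar k (Bar k S)) m := gr_of_eq (H.cobarHtpy_mem _ _ hxm) (by ring)
  obtain ⟨f', hf'⟩ : ∃ f', f' = f - Ψ.toFun x₁ := ⟨_, rfl⟩
  have hf'F : f' ∈ lenGE k W k (p + 1) := hf' ▸ sub_mem hf (Ψ.mem_lenGE hx₁F)
  have hf'm : f' ∈ homGr k (Bar k W) k m := hf' ▸ sub_mem hfm (Ψ.map_mem _ _ hx₁m)
  have hS : x - cobarTw k S x₁ - H.harm x ∈ Cobar.redGE k S (p + 2) := by
    have h := sub_mem (H.cobarHtpy_mem_redGE (p := p + 1) hdx) (H.cobarHtpy_spec hx)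
    convert h using 1
    rw [hx₁]; abel
  -- After subtracting the evaluation of x₁, the boundary of f' is to leading order the evaluation
  -- of the harmonic part alone.
  have hdf' : homDel f' - Ψ.toFun (H.harm x) ∈ lenGE k W k (p + 2) := by
    have h := add_mem hdf (Ψ.mem_lenGE hS)
    convert h using 1
    rw [hf', map_sub, map_sub, map_sub, ← Ψ.map_cobarTw]; abel
  -- The sign by which `coeff i`, `mulCyc i`, `insert i` and `extract i` commute with the
  -- differentials to leading order.
  let s : ι → k := fun i => koszul k (H.degree i + 1)
  have hss : ∀ i, s i * s i = 1 := fun i => koszul_mul_self _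
  -- The coefficient of x at the i-th cycle and the functional f' with the i-th cocycle inserted
  -- form a pair of the same kind with one factor less. Its degree is shifted by 1 - `degree i`, and
  -- the induction hypothesis solves it.
  have key : ∀ i, ∃ y ∈ Cobar.redGE k S p, y ∈ gr k (Cobar k (Bar k S)) (m + (1 - H.degree i)) ∧
      ∃ g ∈ lenGE k W k p, g ∈ homGr k (Bar k W) k (m + (1 - H.degree i) + 1) ∧
        H.coeff i x - cobarTw k S y ∈ Cobar.redGE k S (p + 1) ∧
        s i • (f' ∘ₗ H.insert i) - Ψ.toFun y - homDel g ∈ lenGE k W k (p + 1) := by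
    intro i
    refine ih _ _ _ (H.coeff_mem_redGE hx i) (gr_of_eq (H.coeff_mem i _ _ hxm) (by ring))
      (Submodule.smul_mem _ _ (comp_mem_lenGE_of_lenLT hf'F fun w hw => H.insert_mem_lenLT hw i))
      (Submodule.smul_mem _ _ ?_) ?_ ?_
    · intro j u hu
      exact gr_of_eq (hf'm _ _ (H.insert_mem i _ _ hu)) (by ring)
    · have h := Submodule.smul_mem _ (s i) (sub_mem (H.coeff_mem_redGE (p := p + 1) hdx i)
        (H.coeff_cobarTw hx i))
      convert h using 1
      rw [sub_sub_cancel, smul_smul, hss, one_smul]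
    · have h1 := Submodule.smul_mem _ (s i) (H.homDel_comp_insert hf'F i)
      have h2 := comp_mem_lenGE_of_lenLT (m := p + 1) hdf' fun w hw => H.insert_mem_lenLT hw i
      have h := add_mem h1 h2
      convert h using 1
      rw [LinearMap.sub_comp, Ψ.comp_insert, H.coeff_harm, smul_sub, smul_smul, hss, one_smul,
        map_smul]
      abel
  choose y hyF hym g hgF hgm hxy hfg using key
  -- The solutions are reassembled by multiplying y i with the i-th cycle and by evaluating the
  -- first letter of the argument of g i on this cycle. The contractions x₁ and f'∘`wordHtpy` supply
  -- the rest.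
  refine ⟨x₁ + ∑ i, s i • H.mulCyc i (y i), add_mem hx₁F (sum_mem fun i _ =>
    Submodule.smul_mem _ _ (H.mulCyc_mem_redGE (hyF i) i)), add_mem hx₁m (sum_mem fun i _ =>
    Submodule.smul_mem _ _ (gr_of_eq (H.mulCyc_mem i _ _ (hym i)) (by ring))),
    hat f' ∘ₗ H.wordHtpy + ∑ i, g i ∘ₗ H.extract i, add_mem ?_ (sum_mem fun i _ => ?_),
    add_mem ?_ (sum_mem fun i _ => ?_), ?_, ?_⟩
  · exact comp_mem_lenGE_of_lenLT (hat_mem_lenGE hf'F) fun w hw => H.wordHtpy_mem_lenLT hw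
  · exact comp_mem_lenGE_of_lenLT (hgF i) fun w hw => H.extract_mem_lenLT hw i
  · intro j u hu
    rw [hat_of_mem hf'm]
    exact Submodule.smul_mem _ _ (gr_of_eq (hf'm _ _ (H.wordHtpy_mem _ _ hu)) (by ring))
  · intro j u hu
    exact gr_of_eq (hgm i _ _ (H.extract_mem i _ _ hu)) (by ring)
  · have h1 : ∑ i, H.mulCyc i (H.coeff i x - cobarTw k S (y i)) ∈ Cobar.redGE k S (p + 2) :=
      sum_mem fun i _ => H.mulCyc_mem_redGE (hxy i) i
    have h2 : ∑ i, s i • (cobarTw k S (H.mulCyc i (y i)) - s i • H.mulCyc i (cobarTw k S (y i))) ∈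
        Cobar.redGE k S (p + 2) :=
      sum_mem fun i _ => Submodule.smul_mem _ _ (H.cobarTw_mulCyc (hyF i) i)
    have h := sub_mem (add_mem hS h1) h2
    convert h using 1
    simp only [map_add, map_sum, map_smul, map_sub, smul_sub, smul_smul, hss, one_smul,
      Finset.sum_sub_distrib, H.harm_apply]
    abel
  · have h1 : ∑ i, s i • ((s i • (f' ∘ₗ H.insert i) - Ψ.toFun (y i) - homDel (g i)) ∘ₗ
        H.extract i) ∈ lenGE k W k (p + 2) :=
      sum_mem fun i _ => Submodule.smul_mem _ _
        (comp_mem_lenGE_of_lenLT (hfg i) fun w hw => H.extract_mem_lenLT hw i)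
    have h2 : ∑ i, (homDel (g i ∘ₗ H.extract i) - s i • homDel (g i) ∘ₗ H.extract i) ∈
        lenGE k W k (p + 2) :=
      sum_mem fun i _ => H.homDel_comp_extract (hgF i) i
    have h3 := H.comp_wordHtpy_spec hf'F
    -- The leading part of `homDel f'` is the evaluation of a harmonic element, which vanishes on
    -- the image of `wordHtpy`; only the higher part survives.
    have h4 : hat (homDel f') ∘ₗ H.wordHtpy ∈ lenGE k W k (p + 2) := by
      have h5 := comp_mem_lenGE_of_lenLT (hat_mem_lenGE hdf') fun w hw => H.wordHtpy_mem_lenLT hw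
      convert h5 using 1
      refine LinearMap.ext fun u => ?_
      rw [hat_sub, LinearMap.sub_comp, LinearMap.sub_apply, hat_ground (Ψ.toFun _)]
      simp only [LinearMap.comp_apply, Ψ.harm_sgn_wordHtpy, sub_zero]
    have h := sub_mem (add_mem (sub_mem h1 h2) h4) h3
    convert h using 1
    have e1 : ∀ i, Ψ.toFun (H.mulCyc i (y i)) = Ψ.toFun (y i) ∘ₗ H.extract i := fun i =>
      Ψ.mulCyc _ _
    simp only [map_add, map_sum, map_smul, e1, smul_sub, LinearMap.sub_comp, LinearMap.smul_comp,
      smul_smul, hss, one_smul, Finset.sum_sub_distrib, LinearMap.comp_assoc]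
    rw [← sub_sub f, ← hf']
    abel

/-- Acyclicity of the associated graded of the cone of Ψ, by induction on the number of factors. In
filtration 0 both sides are the constants; each further step peels off one tensor factor by means of
the dual bases. -/
theorem WordEvaluation.exists_approx (p : ℕ) : ∀ (m : ℤ) (x : Cobar k (Bar k S))
    (f : Bar k W →ₗ[k] k), x ∈ Cobar.redGE k S p → x ∈ gr k (Cobar k (Bar k S)) (m - 1) →
    f ∈ lenGE k W k p → f ∈ homGr k (Bar k W) k m → cobarTw k S x ∈ Cobar.redGE k S (p + 1) →
    homDel f - Ψ.toFun x ∈ lenGE k W k (p + 1) →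
    ∃ y ∈ Cobar.redGE k S p, y ∈ gr k (Cobar k (Bar k S)) m ∧ ∃ g ∈ lenGE k W k p,
      g ∈ homGr k (Bar k W) k (m + 1) ∧ x - cobarTw k S y ∈ Cobar.redGE k S (p + 1) ∧
      f - Ψ.toFun y - homDel g ∈ lenGE k W k (p + 1) := by
  induction p with
  | zero =>
    intro m x f hx _ _ hfm _ hdf
    have hle : Cobar.redGE k S 0 ≤ Submodule.span k {1} ⊔ Cobar.redGE k S 1 :=
      Cobar.redGE_zero_le (Submodule.mem_sup_left (Submodule.mem_span_singleton_self _)) le_sup_right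
    obtain ⟨y, hy, r, hr, rfl⟩ := Submodule.mem_sup.1 (hle hx)
    obtain ⟨a, rfl⟩ := Submodule.mem_span_singleton.1 hy
    have hnil := Bar.nil_mem_lenLT (k := k) (V := W) 0
    -- Boundaries of functionals vanish at the empty word, and so do products with at least one
    -- reduced factor; the value of the evaluation of x there is its constant term.
    have ha : a = 0 := by
      have h1 := hdf _ hnil
      have h2 := Ψ.mem_lenGE hr _ hnil
      rw [LinearMap.sub_apply, homDel_ground, Bar.sgn_nil, Bar.del_def, Bar.dif_nil, map_zero,
        map_add, LinearMap.add_apply, h2, map_smul, Ψ.one, LinearMap.smul_apply, Bar.counit_nil] at h1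
      simpa using h1
    have hy1 : f Bar.nil • (1 : Cobar k (Bar k S)) ∈ gr k (Cobar k (Bar k S)) m := by
      by_cases hm : m = 0
      · rw [hm]; exact Submodule.smul_mem _ _ Cobar.one_mem
      · rw [mem_homGr_ground.1 hfm 0 (by omega) _ Bar.nil_mem, zero_smul]; exact zero_mem _
    -- The evaluation of 1 is the counit, so this multiple of 1 reproduces f on the empty word.
    refine ⟨f Bar.nil • 1, Submodule.smul_mem _ _ Cobar.one_mem_redGE, hy1, 0, zero_mem _,
      zero_mem _, ?_, mem_lenGE_one ?_⟩
    · rw [map_smul, cobarTw_one, smul_zero, sub_zero, ha, zero_smul, zero_add r]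
      exact hr
    · rw [map_zero, sub_zero, LinearMap.sub_apply, map_smul, Ψ.one, LinearMap.smul_apply,
        Bar.counit_nil, smul_eq_mul, mul_one, sub_self]
  | succ p ih =>
    intro m x f hx hxm hf hfm hdx hdf
    exact Ψ.exists_approx_succ ih hx hxm hf hfm hdx hdf

/-- If the degrees in `S` are positive up to sign, then the cone of the evaluation is acyclic in
the range of reduced words. -/
theorem WordEvaluation.exists_solution {η : ℤ} (hη : η = 1 ∨ η = -1)
    (hS : ∀ n, ∀ x ∈ gr k S n, x ≠ 0 → 1 ≤ η * n) {m : ℤ} {x : Cobar k (Bar k S)}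
    {f : Bar k W →ₗ[k] k} (hx : x ∈ Cobar.redGE k S 0)
    (hxm : x ∈ gr k (Cobar k (Bar k S)) (m - 1)) (hfm : f ∈ homGr k (Bar k W) k m)
    (hdx : cobarTw k S x = 0) (hdf : homDel f = Ψ.toFun x) :
    ∃ y ∈ gr k (Cobar k (Bar k S)) m, ∃ g ∈ homGr k (Bar k W) k (m + 1),
      x = cobarTw k S y ∧ f = Ψ.toFun y + homDel g := by
  -- Finitely many corrections reach any given filtration. The limit is not taken yet, because
  -- products have no infinite sums.
  have iter : ∀ p : ℕ, ∃ y ∈ gr k (Cobar k (Bar k S)) m, ∃ g ∈ homGr k (Bar k W) k (m + 1),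
      x - cobarTw k S y ∈ Cobar.redGE k S p ∧ f - Ψ.toFun y - homDel g ∈ lenGE k W k p := by
    intro p
    induction p with
    | zero =>
      refine ⟨0, zero_mem _, 0, zero_mem _, ?_, mem_lenGE_zero _⟩
      rwa [map_zero, sub_zero]
    | succ p ih =>
      obtain ⟨y, hy, g, hg, h1, h2⟩ := ih
      have hxm' : x - cobarTw k S y ∈ gr k (Cobar k (Bar k S)) (m - 1) :=
        sub_mem hxm (twistDel_mem _ _ _ hy)
      have hfm' : f - Ψ.toFun y - homDel g ∈ homGr k (Bar k W) k m :=
        sub_mem (sub_mem hfm (Ψ.map_mem _ _ hy)) (by simpa using homDel_mem hg)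
      obtain ⟨y', -, hy', g', -, hg', h3, h4⟩ := Ψ.exists_approx p m _ _ h1 hxm' h2 hfm'
        (by rw [map_sub, hdx, cobarTw_cobarTw, sub_zero]; exact zero_mem _)
        (by
          rw [map_sub, map_sub, map_sub, homDel_homDel, hdf, Ψ.map_cobarTw, sub_zero, sub_self]
          exact zero_mem _)
      refine ⟨y + y', add_mem hy hy', g + g', add_mem hg hg', ?_, ?_⟩
      · convert h3 using 1
        rw [map_add]; abel
      · convert h4 using 1
        rw [map_add, map_add]; abel
  have hη' : ∀ n : ℤ, η * n ≤ |n| := fun n => by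
    rcases hη with rfl | rfl
    · rw [one_mul]; exact le_abs_self n
    · rw [neg_one_mul]; exact neg_le_abs n
  -- For such p the filtration step p has no nonzero elements in the degrees m - 1 and m. Hence x is
  -- an exact boundary and only the functional needs further correction.
  obtain ⟨p, hp⟩ : ∃ p : ℕ, |m| + |m - 1| < p := ⟨(|m| + |m - 1| + 1).toNat, by omega⟩
  obtain ⟨y, hy, g, hg, h1, h2⟩ := iter p
  have hxm' : x - cobarTw k S y ∈ gr k (Cobar k (Bar k S)) (m - 1) :=
    sub_mem hxm (twistDel_mem _ _ _ hy)
  have hxy : x - cobarTw k S y = 0 := by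
    rw [← pr_of_mem hxm']
    exact Cobar.pr_eq_zero_of_redGE hη hS h1 (by
      have := hη' (m - 1); have := abs_nonneg m; omega)
  have hfm' : f - Ψ.toFun y - homDel g ∈ homGr k (Bar k W) k m :=
    sub_mem (sub_mem hfm (Ψ.map_mem _ _ hy)) (by simpa using homDel_mem hg)
  have hdf' : homDel (f - Ψ.toFun y - homDel g) = 0 := by
    rw [map_sub, map_sub, homDel_homDel, hdf, ← Ψ.map_cobarTw, sub_zero, ← map_sub, hxy, map_zero]
  have hD : ∀ n, ∀ u ∈ lenGE k W k n, homDel u ∈ lenGE k W k n := fun n u hu =>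
    homDel_mem_lenGE hu
  -- From filtration p on, the approximation is applied to x = 0. The product y' it returns has
  -- degree m and filtration at least p, so it is zero, and the corrections of the functional
  -- converge by completeness.
  obtain ⟨g', -, hg', h3⟩ := exists_of_lenGE_approx (k := k) (V := W) (Q := k) (P := k)
    (m := m + 1) homDel hD (fun z => z ∈ homGr k (Bar k W) k m ∧ homDel z = 0) p
    (fun n hn z hz hgood => by
      obtain ⟨y', hy'F, hy', g', hg'F, hg', -, h4⟩ := Ψ.exists_approx n m 0 z (zero_mem _)
        (zero_mem _) hz hgood.1 (by rw [map_zero]; exact zero_mem _)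
        (by rw [map_zero, sub_zero, hgood.2]; exact zero_mem _)
      have hy0 : y' = 0 := by
        rw [← pr_of_mem hy']
        exact Cobar.pr_eq_zero_of_redGE hη hS hy'F (by
          have := hη' m; have := abs_nonneg (m - 1); omega)
      rw [hy0, map_zero, sub_zero] at h4
      refine ⟨g', hg'F, hg', h4, sub_mem hgood.1 (by simpa using homDel_mem hg'), ?_⟩
      rw [map_sub, homDel_homDel, hgood.2, sub_zero]) h2 ⟨hfm', hdf'⟩
  refine ⟨y, hy, g + g', add_mem hg hg', sub_eq_zero.1 hxy, ?_⟩
  rw [map_add, ← h3]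
  abel

end WordEvaluation

/-! ### Convolution with a functional on letters -/

section FirstLetter

variable {k : Type*} [Field k] {W : Type*} [AddCommGroup W] [Module k W] [NDGA k W]

/-- Convolution with a functional that is concentrated on words of length one. -/
theorem conv_cons_of_length_one {f : Bar k W →ₗ[k] k} {l : W →ₗ[k] k} (h0 : f Bar.nil = 0)
    (hf : ∀ φ u, f (Bar.cons φ u) = Bar.counit u * l φ) (g : Bar k W →ₗ[k] k) {i : ℤ} {φ : W}
    (hφ : φ ∈ gr k W i) (u : Bar k W) :
    conv f g (Bar.cons φ u) = l φ * g (sgnPow k _ (i + 1) u) := by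
  have h : LinearMap.mul' k k ∘ₗ km f g ∘ₗ (Bar.cons φ).rTensor (Bar k W) =
      LinearMap.mulLeft k (l φ) ∘ₗ tw (i + 1) g ∘ₗ
        (TensorProduct.lid k (Bar k W)).toLinearMap ∘ₗ (Bar.counit).rTensor (Bar k W) := by
    refine gr_ext₂ fun m n x hx y hy => ?_
    simp only [LinearMap.comp_apply, LinearMap.rTensor_tmul, km_tmul (Bar.cons_mem hφ hx),
      LinearMap.mul'_apply, hf, LinearEquiv.coe_coe, TensorProduct.lid_tmul,
      LinearMap.mulLeft_apply, map_smul]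
    by_cases hm : m = 0
    · subst hm
      rw [add_zero, smul_eq_mul]
      ring
    · rw [Bar.counit_of_mem hm hx]
      simp
  have h1 := LinearMap.congr_fun h (Bar.comul u)
  have h2 : (Bar.counit).rTensor (Bar k W) (Bar.comul u) = 1 ⊗ₜ u :=
    Coalgebra.rTensor_counit_comul (R := k) (A := Bar k W) u
  simp only [LinearMap.comp_apply, h2, LinearEquiv.coe_coe, TensorProduct.lid_tmul, one_smul,
    LinearMap.mulLeft_apply] at h1
  rw [tw_ground (i + 1), LinearMap.comp_apply] at h1
  rw [conv, LinearMap.comp_apply, LinearMap.comp_apply, Bar.comul_def, Bar.comul_cons, map_add,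
    map_add, h1, km_tmul Bar.nil_mem, h0]
  simp

theorem conv_nil_of_nil {f : Bar k W →ₗ[k] k} (h0 : f Bar.nil = 0) (g : Bar k W →ₗ[k] k) :
    conv f g Bar.nil = 0 := by
  rw [conv_nil, h0, zero_mul]

end FirstLetter

/-! ### Functoriality of the cobar construction -/

section CobarFunctoriality

variable {k : Type*} [Field k] {C D : Type*} [AddCommGroup C] [Module k C] [Coalgebra k C]
  [DGCoalg k C] [AddCommGroup D] [Module k D] [Coalgebra k D] [DGCoalg k D]

/-- The functoriality of the cobar construction. -/
def Cobar.map (φ : DGCoalgHom k C D) : DGHom k (Cobar k C) (Cobar k D) :=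
  Cobar.liftDG (MC.map (precomp (Cobar k D) φ) (Cobar.univ k D))

theorem Cobar.map_ι (φ : DGCoalgHom k C D) (c : C) :
    (Cobar.map φ).toAlgHom (Cobar.ι c) = Cobar.ι (φ.toLinearMap c) := Cobar.lift_ι _ c

variable {V W : Type*} [AddCommGroup V] [Module k V] [NDGA k V] [AddCommGroup W] [Module k W]
  [NDGA k W]

theorem Cobar.map_cobarTw (j : NDGHom k V W) (x : Cobar k (Bar k V)) :
    (Cobar.map (Bar.map j)).toAlgHom (cobarTw k V x) =
      cobarTw k W ((Cobar.map (Bar.map j)).toAlgHom x) :=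
  DGHom.map_twistDel _ _ _ ((Cobar.map_ι _ _).trans (congrArg Cobar.ι (Bar.mapL_nil j))) x

theorem Cobar.map_cobarIncl (j : NDGHom k V W) (p : k × V) :
    (Cobar.map (Bar.map j)).toAlgHom (cobarIncl k V p) = cobarIncl k W (p.1, j.toLinearMap p.2) := by
  rw [cobarIncl_apply, cobarIncl_apply, map_add, map_smul, map_one, Cobar.map_ι]
  congr 2
  exact (Bar.mapL_cons j _ _).trans (by rw [Bar.mapL_nil])

end CobarFunctoriality

section CobarInclusion

variable {k : Type*} [Field k] {V : Type*} [AddCommGroup V] [Module k V] [NDGA k V]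

theorem pr_cobarIncl_mem (n : ℤ) (p : k × V) :
    pr k _ n (cobarIncl k V p) ∈ Cobar.redGE k V 0 := by
  rw [cobarIncl_apply, map_add, map_smul]
  refine add_mem (Submodule.smul_mem _ _ ?_) ?_
  · by_cases h : 0 = n
    · rw [← h, pr_of_mem Cobar.one_mem]; exact Cobar.one_mem_redGE
    · rw [pr_of_mem_ne h Cobar.one_mem]; exact zero_mem _
  · have h : Cobar.ι ∘ₗ Bar.cons.flip Bar.nil ∈ homGr k V (Cobar k (Bar k V)) 0 := fun i v hv =>
      gr_of_eq (Cobar.ι_mem (Bar.cons_mem hv Bar.nil_mem)) (by ring)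
    have h1 := map_pr h n p.2
    rw [add_zero] at h1
    have h2 : pr k _ n (Cobar.ι (Bar.cons p.2 Bar.nil)) = Cobar.ι (Bar.cons (pr k V n p.2) Bar.nil) :=
      h1.symm
    rw [h2]
    exact Cobar.redGE_anti (Nat.zero_le 1) (Cobar.ι_mem_redGE (Bar.counit_cons _ _))

end CobarInclusion

/-! ### The evaluation homomorphism for the Koszul dual -/

section ReducedEvaluation

theorem DGHom.map_twistDel_of_eq_zero {k : Type*} [Field k] {A B : Type*} [Ring A] [Algebra k A]
    [DGA k A] [Ring B] [Algebra k B] [DGA k B] (f : DGHom k A B) (t : MC k A)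
    (h : f.toAlgHom t.val = 0) (x : A) :
    f.toAlgHom (twistDel t x) = del k B (f.toAlgHom x) := by
  have h0 : (MC.map f t).val = 0 := h
  rw [f.map_twistDel t (MC.map f t) rfl x, twistDel_apply, h0, zero_mul, mul_zero, add_zero, sub_zero]

theorem dualEval_nil {k : Type*} [Field k] {V : Type*} [AddCommGroup V] [Module k V] [NDGA k V]
    (φ : AugIdeal (dualAug k V)) : dualEval k V Bar.nil φ = 0 := φ.2

theorem dualEval_eq_zero {k : Type*} [Field k] {V : Type*} [AddCommGroup V] [Module k V] [NDGA k V]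
    {n i : ℤ} (h : n + i ≠ 0) {c : Bar k V} (hc : c ∈ gr k (Bar k V) n)
    {φ : AugIdeal (dualAug k V)} (hφ : φ ∈ gr k (AugIdeal (dualAug k V)) i) :
    dualEval k V c φ = 0 := dualEval_mem.1 hφ n h c hc

variable {k : Type*} [Field k] {R : Type*} [Ring R] [Algebra k R] [DGA k R] (ε : DGHom k R k)

/-- Words in `R^!` without constant term, evaluated on products of words. -/
def reducedEval : DGHom k (Cobar k (BarAug ε))
    (ConvDG k (BarAug (dualAug k (AugIdeal ε))) k) :=
  (precomp k (Bar.map (augIncl (dualAug k (AugIdeal ε))))).comp (Cobar.liftDG (evalMC ε))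

theorem evalMC_apply {n i : ℤ} {c : BarAug ε} (hc : c ∈ gr k (BarAug ε) n)
    {u : Bar k (KoszulDual ε)} (hu : u ∈ gr k (Bar k (KoszulDual ε)) i) :
    ((evalMC ε).val.val c).val u =
      koszul k (i * n) * (Bar.proj (NDGHom.id (k := k) (KoszulDual ε)) u).val c :=
  swapFun_of_mem _ hu hc

theorem evalMC_nil (c : BarAug ε) : ((evalMC ε).val.val c).val Bar.nil = 0 := by
  refine gr_induction k (p := fun c => ((evalMC ε).val.val c).val Bar.nil = 0)
    (fun n c hc => ?_) ?_ ?_ c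
  · rw [evalMC_apply ε hc Bar.nil_mem, Bar.proj_nil]
    exact mul_zero _
  · rw [map_zero]; rfl
  · intro x y hx hy
    rw [map_add, map_add, LinearMap.add_apply, hx, hy, add_zero]

theorem evalMC_cons (c : BarAug ε) (φ : KoszulDual ε) (u : Bar k (KoszulDual ε)) :
    ((evalMC ε).val.val c).val (Bar.cons φ u) = Bar.counit u * φ.val c := by
  refine gr_induction k (p := fun c => ((evalMC ε).val.val c).val (Bar.cons φ u) =
    Bar.counit u * φ.val c) (fun n c hc => ?_) ?_ ?_ c
  · refine gr_induction k (p := fun φ => ((evalMC ε).val.val c).val (Bar.cons φ u) =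
      Bar.counit u * φ.val c) (fun i φ hφ => ?_) ?_ ?_ φ
    · refine gr_induction k (p := fun u => ((evalMC ε).val.val c).val (Bar.cons φ u) =
        Bar.counit u * φ.val c) (fun j u hu => ?_) ?_ ?_ u
      · rw [evalMC_apply ε hc (Bar.cons_mem hφ hu), Bar.proj_cons]
        show _ * (Bar.counit u * φ.val c) = _
        by_cases hj : j = 0
        · by_cases hi : n + i = 0
          · have : koszul k ((i + 1 + j) * n) = 1 := by
              rw [hj, show i = -n by omega]
              simp only [koszul]
              rw [if_pos]
              simp only [Int.even_mul, Int.even_add, even_neg]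
              by_cases hn : Even n <;> simp [hn]
            rw [this, one_mul]
          · rw [mem_homGr_ground.1 hφ n hi c hc, mul_zero, mul_zero]
        · rw [Bar.counit_of_mem hj hu, zero_mul, mul_zero]
      · simp
      · intro x y hx hy
        rw [map_add, map_add, hx, hy, map_add, add_mul]
    · simp
    · intro x y hx hy
      rw [map_add, LinearMap.add_apply, map_add, hx, hy, map_add, LinearMap.add_apply, mul_add]
  · simp
  · intro x y hx hy
    rw [map_add, map_add, LinearMap.add_apply, hx, hy, map_add, mul_add]

theorem reducedEval_ι_nil (c : BarAug ε) :
    ((reducedEval ε).toAlgHom (Cobar.ι c)).val Bar.nil = 0 := by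
  show (Cobar.lift (evalMC ε).val.val (Cobar.ι c)).val (Bar.mapL _ Bar.nil) = 0
  rw [Cobar.lift_ι, Bar.mapL_nil, evalMC_nil]

theorem reducedEval_ι_cons (c : BarAug ε) (φ : AugIdeal (dualAug k (AugIdeal ε)))
    (u : BarAug (dualAug k (AugIdeal ε))) :
    ((reducedEval ε).toAlgHom (Cobar.ι c)).val (Bar.cons φ u) =
      Bar.counit u * dualEval k _ c φ := by
  show (Cobar.lift (evalMC ε).val.val (Cobar.ι c)).val (Bar.mapL _ (Bar.cons φ u)) = _
  have h : Bar.counit (Bar.mapL (augIncl (dualAug k (AugIdeal ε))) u) = Bar.counit u :=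
    LinearMap.congr_fun (Bar.map (augIncl (dualAug k (AugIdeal ε)))).counit_comp u
  rw [Cobar.lift_ι, Bar.mapL_cons, evalMC_cons, h]
  rfl

theorem reducedEval_cons_nil (c : BarAug ε) (w : Cobar k (BarAug ε)) :
    ((reducedEval ε).toAlgHom (Cobar.ι c * w)).val Bar.nil = 0 := by
  rw [map_mul, ConvDG.val_mul, conv_nil_of_nil (reducedEval_ι_nil ε c)]

theorem reducedEval_cons_cons {n : ℤ} {c : BarAug ε} (hc : c ∈ gr k (BarAug ε) n)
    (w : Cobar k (BarAug ε)) (φ : AugIdeal (dualAug k (AugIdeal ε)))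
    (u : BarAug (dualAug k (AugIdeal ε))) :
    ((reducedEval ε).toAlgHom (Cobar.ι c * w)).val (Bar.cons φ u) =
      dualEval k _ c φ * ((reducedEval ε).toAlgHom w).val (sgnPow k _ (n + 1) u) := by
  have h : ∀ i, ∀ φ ∈ gr k (AugIdeal (dualAug k (AugIdeal ε))) i,
      ((reducedEval ε).toAlgHom (Cobar.ι c * w)).val (Bar.cons φ u) =
        dualEval k (AugIdeal ε) c φ *
          ((reducedEval ε).toAlgHom w).val (sgnPow k _ (n + 1) u) := by
    intro i φ hφ
    rw [map_mul, ConvDG.val_mul, conv_cons_of_length_one (reducedEval_ι_nil ε c)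
      (reducedEval_ι_cons ε c) _ hφ]
    by_cases hi : n + i = 0
    -- Where the pairing does not vanish, φ has degree -n, so the degrees of the suspended letter
    -- and of c, shifted by one, have the same parity.
    · have : sgnPow k (BarAug (dualAug k (AugIdeal ε))) (i + 1) = sgnPow k _ (n + 1) := by
        rw [show i = -n by omega]
        simp only [sgnPow, Int.even_add, even_neg]
      rw [this]
    · rw [dualEval_eq_zero hi hc hφ, zero_mul, zero_mul]
  have h' : ((reducedEval ε).toAlgHom (Cobar.ι c * w)).val ∘ₗ Bar.cons.flip u =
        ((reducedEval ε).toAlgHom w).val (sgnPow k _ (n + 1) u) • dualEval k (AugIdeal ε) c :=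
    gr_ext fun i φ hφ => (h i φ hφ).trans (mul_comm _ _)
  exact (LinearMap.congr_fun h' φ).trans (mul_comm _ _)

/-- Functionals in the augmentation ideal vanish on the empty word. The Maurer–Cartan element that
twists the source is therefore sent to 0, and the target carries its untwisted differential. -/
theorem reducedEval_cobarTw (x : Cobar k (BarAug ε)) :
    (reducedEval ε).toAlgHom (cobarTw k _ x) = del k _ ((reducedEval ε).toAlgHom x) := by
  refine DGHom.map_twistDel_of_eq_zero (reducedEval ε) (Cobar.univ k (BarAug ε)).atNil ?_ x
  apply ConvDG.val_injective
  refine Bar.ext' (reducedEval_ι_nil ε _) fun φ u _ => ?_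
  refine (reducedEval_ι_cons ε _ φ u).trans ?_
  rw [dualEval_nil, mul_zero, map_zero, LinearMap.zero_apply]

variable (S : SubNDGA k (AugIdeal ε))

/-- The evaluation of words in a subalgebra of the augmentation ideal. -/
def subEval : DGHom k (Cobar k (Bar k S.carrier))
    (ConvDG k (BarAug (dualAug k (AugIdeal ε))) k) :=
  (reducedEval ε).comp (Cobar.map (Bar.map S.incl))

theorem subEval_apply (x : Cobar k (Bar k S.carrier)) : (subEval ε S).toAlgHom x =
    (reducedEval ε).toAlgHom ((Cobar.map (Bar.map S.incl)).toAlgHom x) := rfl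

theorem subEval_cons (c : Bar k S.carrier) (w : Cobar k (Bar k S.carrier)) :
    (subEval ε S).toAlgHom (Cobar.ι c * w) = (reducedEval ε).toAlgHom
      (Cobar.ι (Bar.mapL S.incl c) * (Cobar.map (Bar.map S.incl)).toAlgHom w) := by
  rw [subEval_apply, map_mul, Cobar.map_ι]
  rfl

theorem subEval_cobarTw (x : Cobar k (Bar k S.carrier)) :
    (subEval ε S).toAlgHom (cobarTw k _ x) = del k _ ((subEval ε S).toAlgHom x) := by
  rw [subEval_apply, Cobar.map_cobarTw, reducedEval_cobarTw, subEval_apply]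

theorem subEval_cons_cons {n : ℤ} {c : Bar k S.carrier} (hc : c ∈ gr k (Bar k S.carrier) n)
    (w : Cobar k (Bar k S.carrier)) (φ : AugIdeal (dualAug k (AugIdeal ε)))
    (u : BarAug (dualAug k (AugIdeal ε))) :
    ((subEval ε S).toAlgHom (Cobar.ι c * w)).val (Bar.cons φ u) =
      dualEval k (AugIdeal ε) (Bar.mapL S.incl c) φ *
        ((subEval ε S).toAlgHom w).val (sgnPow k _ (n + 1) u) := by
  have hc' : Bar.mapL S.incl c ∈ gr k (BarAug ε) n := (Bar.map S.incl).map_mem n c hc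
  rw [subEval_cons, reducedEval_cons_cons ε hc', subEval_apply]

/-- The evaluation of words in a subalgebra of the augmentation ideal. -/
def wordEvaluation :
    WordEvaluation (k := k) (S := S.carrier) (W := AugIdeal (dualAug k (AugIdeal ε)))
      (dualEval k (AugIdeal ε) ∘ₗ Bar.mapL S.incl) where
  toFun := ConvDG.val ∘ₗ (subEval ε S).toAlgHom.toLinearMap
  one := congrArg ConvDG.val (map_one (subEval ε S).toAlgHom)
  cons_nil c w := (congrArg (fun f => ConvDG.val f Bar.nil) (subEval_cons ε S c w)).trans
    (reducedEval_cons_nil ε _ _)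
  cons_cons _ _ hc w φ u := subEval_cons_cons ε S hc w φ u
  map_mem := (subEval ε S).map_mem
  map_cobarTw x := congrArg ConvDG.val (subEval_cobarTw ε S x)

end ReducedEvaluation

/-! ### Acyclic cones on reduced words -/

section WordEvaluation

variable {k : Type*} [Field k] {S W ι : Type*} [Fintype ι] [AddCommGroup S] [Module k S] [NDGA k S]
  [AddCommGroup W] [Module k W] [NDGA k W]

/-- The cone of the homomorphism `F` is acyclic in the range of reduced words. -/
def ConeAcyclic {E : Type*} [Ring E] [Algebra k E] [DGA k E] (F : DGHom k (Cobar k (Bar k S)) E) :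
    Prop :=
  ∀ (m : ℤ) (x : Cobar k (Bar k S)) (f : E), x ∈ Cobar.redGE k S 0 →
    x ∈ gr k (Cobar k (Bar k S)) (m - 1) → f ∈ gr k E m → cobarTw k S x = 0 →
    del k E f = F.toAlgHom x → ∃ y g, x = cobarTw k S y ∧ f = F.toAlgHom y + del k E g

theorem WordEvaluation.coneAcyclic {H : HodgeDuality k S W ι} {β : Bar k S →ₗ[k] W →ₗ[k] k}
    (Ψ : WordEvaluation β) (hβ : H.pairing = β) {η : ℤ} (hη : η = 1 ∨ η = -1)
    (hS : ∀ n, ∀ x ∈ gr k S n, x ≠ 0 → 1 ≤ η * n)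
    (F : DGHom k (Cobar k (Bar k S)) (ConvDG k (Bar k W) k))
    (hF : Ψ.toFun = ConvDG.val ∘ₗ F.toAlgHom.toLinearMap) : ConeAcyclic F := by
  subst hβ
  intro m x f hx hxm hfm hdx hdf
  have hF' : ∀ x, Ψ.toFun x = (F.toAlgHom x).val := fun x => LinearMap.congr_fun hF x
  obtain ⟨y, -, g, hg, hy, hf⟩ := Ψ.exists_solution hη hS hx hxm (f := f.val) hfm hdx
    ((congrArg ConvDG.val hdf).trans (hF' x).symm)
  refine ⟨y, ConvDG.mk g (mem_convTot hg), hy, ConvDG.val_injective (hf.trans ?_)⟩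
  rw [map_add, hF']
  rfl

end WordEvaluation

/-! ### The reduced evaluation is a quasi-isomorphism -/

section ReducedEvaluation

variable {k : Type*} [Field k] {R : Type*} [Ring R] [Algebra k R] [DGA k R] (ε : DGHom k R k)

/-- Both hypotheses are spent here. Connectedness gives a retract S with degrees on one side of 0,
hence finiteness of the factor filtration in each degree; finite-dimensional homology of the Koszul
dual gives the dual bases. -/
theorem exists_coneAcyclic (hR : IsConnected k R)
    (hfin : FiniteDimensional k (Homology k (KoszulDual ε))) :
    ∃ S : SubNDGA k (AugIdeal ε), Nonempty S.Deformation ∧ ConeAcyclic (subEval ε S) := by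
  obtain ⟨S, η, hη, ⟨D⟩, hS⟩ := exists_bounded_deformation (hR.augIdeal_bounded ε)
  obtain ⟨r, H, hH⟩ := exists_hodgeDuality D hfin
  exact ⟨S, ⟨D⟩, (wordEvaluation ε S).coneAcyclic hH hη hS (subEval ε S) rfl⟩

theorem cobarTw_mem {V : Type*} [AddCommGroup V] [Module k V] [NDGA k V] :
    cobarTw k V ∈ homGr k (Cobar k (Bar k V)) (Cobar k (Bar k V)) (-1) :=
  fun n _ hx => gr_of_eq (twistDel_mem _ n _ hx) (by ring)

/-- The twisted differential of the given representative is the one-letter word on the differential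
of its letter, and the counit to R recovers a letter from its one-letter word. -/
theorem cobarIncl_closed {x u : Cobar k (BarAug ε)} {p : k × AugIdeal ε}
    (hx : cobarTw k _ x = 0) (h : x = cobarIncl k _ p + cobarTw k _ u) :
    del k (AugIdeal ε) p.2 = 0 := by
  rw [h, map_add, cobarTw_cobarTw, add_zero, cobarTw_cobarIncl, cobarIncl_apply, zero_smul,
    zero_add] at hx
  have h1 := congrArg (Cobar.lift (Bar.proj (augIncl ε))) hx
  rw [Cobar.lift_ι, map_zero, Bar.proj_cons, Bar.counit_nil, one_smul] at h1
  exact Subtype.ext h1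

variable {V : Type*} [AddCommGroup V] [Module k V] [NDGA k V] {S : SubNDGA k V}

/-- On a cycle the deformation formula reduces to one term, so a cycle of V and its projection to S
differ by the boundary of its image under the homotopy. In this way classes move from k ⊕ V to k ⊕
S. -/
theorem SubNDGA.Deformation.cobarIncl_eq (D : S.Deformation)
    {p : k × V} (hp : del k V p.2 = 0) :
    (Cobar.map (Bar.map S.incl)).toAlgHom (cobarIncl k S.carrier (p.1, D.proj p.2)) =
      cobarIncl k _ p - cobarTw k _ (cobarIncl k _ (0, D.htpy p.2)) ∧
    cobarTw k _ (cobarIncl k S.carrier (p.1, D.proj p.2)) = 0 := by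
  have h1 : ((D.proj p.2 : S.carrier) : V) = p.2 - del k _ (D.htpy p.2) := by
    rw [D.proj_eq, hp, map_zero, sub_zero]
  constructor
  · rw [Cobar.map_cobarIncl, cobarTw_cobarIncl, ← map_sub]
    congr 1
    refine Prod.ext (sub_zero _).symm h1
  · have h2 : del k S.carrier (D.proj p.2) = 0 := by
      apply Subtype.ext
      show del k V (D.proj p.2 : V) = 0
      rw [h1, map_sub, hp, zero_sub, neg_eq_zero]
      exact Cx.dif_dif _
    rw [cobarTw_cobarIncl, h2]
    exact map_zero _

/-- A homomorphism from the twisted cobar construction is a quasi-isomorphism if its cone is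
acyclic on words in a deformation retract. -/
theorem isQuasiIso_of_coneAcyclic (D : S.Deformation)
    (hV : ∀ (x u : Cobar k (Bar k V)) (p : k × V), cobarTw k V x = 0 →
      x = cobarIncl k V p + cobarTw k V u → del k V p.2 = 0)
    {E : Type*} [Ring E] [Algebra k E] [DGA k E]
    (F : DGHom k (Cobar k (Bar k V)) E) (hS : ConeAcyclic (F.comp (Cobar.map (Bar.map S.incl))))
    (t : MC k E) (h : F.toAlgHom (Cobar.univ k (Bar k V)).atNil.val = t.val) (ht : t.val = 0) :
    IsQuasiIso k (F.twist (Cobar.univ k (Bar k V)).atNil t h).toAlgHom.toLinearMap := by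
  have hd : ∀ y : E, twistDel t y = del k E y := by
    intro y
    rw [twistDel_apply, ht, zero_mul, mul_zero, add_zero, sub_zero]
  have hF : ∀ x, F.toAlgHom (cobarTw k V x) = del k E (F.toAlgHom x) := fun x =>
    DGHom.map_twistDel_of_eq_zero F _ (h.trans ht) x
  have hc : ∀ x, (F.comp (Cobar.map (Bar.map S.incl))).toAlgHom x =
    F.toAlgHom ((Cobar.map (Bar.map S.incl)).toAlgHom x) := fun _ => rfl
  refine IsQuasiIso.of_homogeneous (DGHom.isChainMap _) ?_ ?_
  · intro n (x : Cobar k (Bar k V)) (hxn : x ∈ gr k (Cobar k (Bar k V)) n)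
      (hx : cobarTw k V x = 0) (y : E) (hy : y ∈ gr k E (n + 1))
      (hxy' : F.toAlgHom x = twistDel t y)
    have hxy : F.toAlgHom x = del k E y := hxy'.trans (hd y)
    suffices hx : ∃ u, x = cobarTw k V u from hx
    -- The cycle x is homologous to an element of k ⊕ V, and by the deformation to one of k ⊕ S,
    -- which is a combination of 1 and one-letter words, hence reduced.
    obtain ⟨p, u, hu⟩ := exists_eq_cobarIncl_add x (by rw [hx]; exact zero_mem _)
    obtain ⟨h1, h2⟩ := D.cobarIncl_eq (hV x u p hx hu)
    set x' := cobarIncl k S.carrier (p.1, D.proj p.2)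
    set u' := u + cobarIncl k _ (0, D.htpy p.2)
    have h3 : (Cobar.map (Bar.map S.incl)).toAlgHom x' = x - cobarTw k _ u' := by
      rw [h1, hu, map_add]; abel
    have hmap : (Cobar.map (Bar.map S.incl)).toAlgHom.toLinearMap ∈
        homGr k (Cobar k (Bar k S.carrier)) (Cobar k (Bar k V)) 0 := fun i z hz => by
      rw [add_zero]
      exact (Cobar.map (Bar.map S.incl)).map_mem i z hz
    -- The representative and the correction come without a degree; `ConeAcyclic` speaks of
    -- homogeneous pairs, so the components of degree n and n + 1 are taken.
    have h4 : (Cobar.map (Bar.map S.incl)).toAlgHom (pr k _ n x') =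
        x - cobarTw k _ (pr k _ (n + 1) u') := by
      have e1 := map_pr hmap n x'
      have e2 := map_pr (cobarTw_mem (k := k) (V := V)) (n + 1) u'
      rw [add_neg_cancel_right] at e2
      rw [add_zero] at e1
      refine e1.trans ?_
      rw [e2]
      refine (congrArg (pr k _ n) h3).trans ?_
      rw [map_sub, pr_of_mem hxn]
    have h5 : cobarTw k _ (pr k _ n x') = 0 := by
      rw [map_pr cobarTw_mem, h2, map_zero]
    -- Replacing x by its representative changes its image by the boundary of F(u'), so y has to be
    -- corrected by the same element to obtain a closed pair of the cone.
    obtain ⟨z, g, hz, -⟩ := hS (n + 1) (pr k _ n x')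
      (y - F.toAlgHom (pr k _ (n + 1) u')) (pr_cobarIncl_mem _ _)
      (gr_of_eq (pr_mem _ _) (by ring)) (sub_mem hy (F.map_mem _ _ (pr_mem _ _))) h5
      (by rw [hc, h4, map_sub, map_sub, hF, hxy])
    refine ⟨(Cobar.map (Bar.map S.incl)).toAlgHom z + pr k _ (n + 1) u', ?_⟩
    rw [map_add, ← Cobar.map_cobarTw, ← hz, h4, sub_add_cancel]
  · intro n (y : E) (hy : y ∈ gr k E n) (hdy : twistDel t y = 0)
    rw [hd] at hdy
    -- Surjectivity on homology is the acyclicity of the cone at the pair (0, y).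
    obtain ⟨z, g, hz, hg⟩ := hS n 0 y (zero_mem _) (zero_mem _) hy (map_zero _)
      (by rw [hdy, map_zero])
    refine ⟨(Cobar.map (Bar.map S.incl)).toAlgHom z, ?_, g, ?_⟩
    · show cobarTw k V _ = 0
      rw [← Cobar.map_cobarTw, ← hz, map_zero]
    · show y = F.toAlgHom _ + twistDel t g
      rw [hd]
      exact hg

/-- The reduced evaluation is a quasi-isomorphism. -/
theorem reducedEval_isQuasiIso (hR : IsConnected k R)
    (hfin : FiniteDimensional k (Homology k (KoszulDual ε)))
    (t : MC k (ConvDG k (BarAug (dualAug k (AugIdeal ε))) k))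
    (h : (reducedEval ε).toAlgHom (Cobar.univ k (BarAug ε)).atNil.val = t.val) (ht : t.val = 0) :
    IsQuasiIso k ((reducedEval ε).twist (Cobar.univ k (BarAug ε)).atNil t h).toAlgHom.toLinearMap := by
  obtain ⟨S, ⟨D⟩, hS⟩ := exists_coneAcyclic ε hR hfin
  exact isQuasiIso_of_coneAcyclic D (fun _ _ _ => cobarIncl_closed ε) (reducedEval ε) hS t h ht

end ReducedEvaluation

/-! ### Linear duality -/

section Duality

variable {k : Type*} [Field k] {R : Type*} [Ring R] [Algebra k R] [DGA k R] (ε : DGHom k R k)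

/-- A homomorphism of differential graded algebras, without units. -/
def DGHom.toNDGHom {A B : Type*} [Ring A] [Algebra k A] [DGA k A] [Ring B] [Algebra k B] [DGA k B]
    (f : DGHom k A B) : NDGHom k A B where
  toLinearMap := f.toAlgHom.toLinearMap
  map_mem := f.map_mem
  map_del := f.map_del
  map_mul := map_mul f.toAlgHom

/-- A composition of twisted homomorphisms. -/
theorem DGHom.comp_twist_isQuasiIso {A B C : Type*} [Ring A] [Algebra k A] [DGA k A] [Ring B]
    [Algebra k B] [DGA k B] [Ring C] [Algebra k C] [DGA k C] (g : DGHom k B C) (f : DGHom k A B)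
    {t : MC k A} {s : MC k B} {r : MC k C} (hf : f.toAlgHom t.val = s.val)
    (hg : g.toAlgHom s.val = r.val) (h : (g.comp f).toAlgHom t.val = r.val)
    (h1 : IsQuasiIso k (f.twist t s hf).toAlgHom.toLinearMap)
    (h2 : IsQuasiIso k (g.twist s r hg).toAlgHom.toLinearMap) :
    IsQuasiIso k ((g.comp f).twist t r h).toAlgHom.toLinearMap := h2.comp h1

theorem swap_twist_isQuasiIso {C B A : Type*} [AddCommGroup C] [Module k C] [Coalgebra k C]
    [DGCoalg k C] [AddCommGroup B] [Module k B] [Coalgebra k B] [DGCoalg k B] [Ring A] [Algebra k A]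
    [DGA k A] (t : MC k (ConvDG k C (ConvDG k B A))) (s : MC k (ConvDG k B (ConvDG k C A)))
    (h : (swap k C B A).toAlgHom t.val = s.val) :
    IsQuasiIso k ((swap k C B A).twist t s h).toAlgHom.toLinearMap :=
  IsQuasiIso.of_inverse (DGHom.isChainMap _) (swap k B C A).toAlgHom.toLinearMap swap_swap swap_swap

theorem MC.ext {A : Type*} [Ring A] [Algebra k A] [DGA k A] {s t : MC k A} (h : s.val = t.val) :
    s = t := by
  cases s; cases t
  cases h
  rfl

theorem proj_dualAug_cons {V : Type*} [AddCommGroup V] [Module k V] [NDGA k V]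
    (φ : ConvDG k (Bar k V) k) (u : Bar k (ConvDG k (Bar k V) k)) :
    Bar.proj (dualAug k V).toNDGHom (Bar.cons φ u) = Bar.counit u * φ.val Bar.nil :=
  Bar.proj_cons _ _ _

/-- At the empty word of B(R) the evaluation cochain becomes the canonical cochain of the
augmentation of R^! that evaluates a functional at the empty word. The target is thus the complex of
cochains of R^! with coefficients in k, to which normalization applies. -/
theorem evalMC_nil_val : ((evalMC ε).val.val Bar.nil).val =
    Bar.proj (dualAug k (AugIdeal ε)).toNDGHom := by
  refine Bar.ext' ((evalMC_nil ε _).trans (Bar.proj_nil _).symm) fun φ u _ => ?_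
  exact (evalMC_cons ε _ φ u).trans (proj_dualAug_cons φ u).symm

section Augmented

variable {A : Type*} [Ring A] [Algebra k A] [DGA k A] (ε : DGHom k A k)

theorem precomp_barMC_augmentation :
    (precomp k (Bar.map (augIncl ε))).toAlgHom (barMC ε.toNDGHom).val = 0 := by
  apply ConvDG.val_injective
  refine Bar.ext' ?_ fun φ u _ => ?_
  · exact (congrArg _ (Bar.mapL_nil _)).trans (Bar.proj_nil _)
  · refine (congrArg _ (Bar.mapL_cons _ _ _)).trans ((Bar.proj_cons _ _ _).trans ?_)
    have h0 : ε.toNDGHom.toLinearMap ((augIncl ε).toLinearMap φ) = 0 := φ.2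
    rw [h0, smul_zero]
    rfl

/-- A homomorphism to functionals on words in an augmented algebra may be tested on words in the
augmentation ideal. -/
theorem isQuasiIso_of_precomp_augIncl {X : Type*} [Ring X] [Algebra k X] [DGA k X] {t : MC k X}
    {s : MC k (ConvDG k (Bar k A) k)} (F : DGHom k X (ConvDG k (Bar k A) k))
    (h : F.toAlgHom t.val = s.val) (hs : s = barMC ε.toNDGHom)
    (hq : ∀ (r : MC k (ConvDG k (BarAug ε) k))
      (hr : ((precomp k (Bar.map (augIncl ε))).comp F).toAlgHom t.val = r.val), r.val = 0 →
      IsQuasiIso k (((precomp k (Bar.map (augIncl ε))).comp F).twist t r hr).toAlgHom.toLinearMap) :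
    IsQuasiIso k (F.twist t s h).toAlgHom.toLinearMap := by
  subst hs
  exact IsQuasiIso.of_comp_left (precomp_augIncl_isQuasiIso ε ε.toNDGHom (map_one ε.toAlgHom)
    (MC.map (precomp k (Bar.map (augIncl ε))) (barMC ε.toNDGHom)) rfl) (DGHom.isChainMap _)
    (hq (MC.map (precomp k (Bar.map (augIncl ε))) (barMC ε.toNDGHom))
      (congrArg (precomp k (Bar.map (augIncl ε))).toAlgHom h) (precomp_barMC_augmentation ε))

end Augmented

/-- Words in R^! are replaced by words in its augmentation ideal. By normalization with coefficients
in k and two-out-of-three, the claim becomes that of the reduced evaluation, whose target is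
untwisted. -/
theorem evaluation_isQuasiIso (hR : IsConnected k R)
    (hfin : FiniteDimensional k (Homology k (KoszulDual ε)))
    (s : MC k (ConvDG k (Bar k (KoszulDual ε)) k))
    (h : (Cobar.liftDG (evalMC ε)).toAlgHom (Cobar.univ k (BarAug ε)).atNil.val = s.val) :
    IsQuasiIso k ((Cobar.liftDG (evalMC ε)).twist
      (Cobar.univ k (BarAug ε)).atNil s h).toAlgHom.toLinearMap := by
  have hs : s = barMC (dualAug k (AugIdeal ε)).toNDGHom := by
    refine MC.ext (h.symm.trans (ConvDG.val_injective ?_))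
    refine Eq.trans ?_ (evalMC_nil_val ε)
    exact congrArg ConvDG.val (Cobar.lift_ι _ _)
  exact isQuasiIso_of_precomp_augIncl (dualAug k (AugIdeal ε)) _ h hs
    fun r hr h0 => reducedEval_isQuasiIso ε hR hfin r hr h0

/-- Linear duality is a quasi-isomorphism. -/
theorem dualize_isQuasiIso (hR : IsConnected k R)
    (hfin : FiniteDimensional k (Homology k (KoszulDual ε))) :
    IsQuasiIso k (dualize ε).toAlgHom.toLinearMap := by
  have h1 : (postcomp (BarAug ε) (Cobar.liftDG (evalMC ε))).toAlgHom
      (Cobar.univ k (BarAug ε)).val = (evalMC ε).val := by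
    apply ConvDG.val_injective
    rw [postcomp_val]
    ext x : 1
    exact Cobar.lift_ι _ x
  -- The first factor is a change of coefficients along the evaluation Ω(B(R)) → Hom(B(R^!), k); the
  -- second is the interchange, which is its own inverse up to exchanging the two coalgebras.
  exact DGHom.comp_twist_isQuasiIso _ _ h1 (swap_map_val _) _
    (postcomp_twist_isQuasiIso _ _ _ h1 (evaluation_isQuasiIso ε hR hfin _ _))
    (swap_twist_isQuasiIso _ _ _)

end Duality

/-! ### From quasi-isomorphisms to isomorphisms of homology algebras -/

section HomologyIso

variable {k : Type*} [Field k] {A B : Type*} [Ring A] [Algebra k A] [DGA k A] [Ring B] [Algebra k B]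
  [DGA k B]

theorem Homology.exists_rep (a : Homology k A) : ∃ x : cycles k A, Homology.mk k A x = a :=
  Ideal.Quotient.mk_surjective a

theorem Homology.mk_eq_zero {x : cycles k A} :
    Homology.mk k A x = 0 ↔ ∃ y, (x : A) = del k A y := by
  refine Ideal.Quotient.eq_zero_iff_mem.trans ⟨?_, ?_⟩
  · rintro ⟨y, hy⟩; exact ⟨y, hy.symm⟩
  · rintro ⟨y, hy⟩; exact ⟨y, hy.symm⟩

theorem DGHom.mapHomology_mk (f : DGHom k A B) (x : cycles k A) :
    f.mapHomology (Homology.mk k A x) = Homology.mk k B (f.mapCycles x) := rfl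

variable {f : DGHom k A B}

theorem IsQuasiIso.mapHomology_bijective (hf : IsQuasiIso k f.toAlgHom.toLinearMap) :
    Function.Bijective f.mapHomology := by
  constructor
  · rw [injective_iff_map_eq_zero]
    intro a ha
    obtain ⟨x, rfl⟩ := Homology.exists_rep a
    rw [DGHom.mapHomology_mk, Homology.mk_eq_zero] at ha
    exact Homology.mk_eq_zero.2 (hf.inj x x.2 ha)
  · intro b
    obtain ⟨y, rfl⟩ := Homology.exists_rep b
    obtain ⟨x, hx, u, hu⟩ := hf.surj y y.2
    refine ⟨Homology.mk k A ⟨x, hx⟩, ?_⟩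
    rw [DGHom.mapHomology_mk, eq_comm, ← sub_eq_zero, ← map_sub, Homology.mk_eq_zero]
    exact ⟨u, sub_eq_of_eq_add' hu⟩

theorem Homology.mem_part {n : ℤ} {a : Homology k A} : a ∈ Homology.part k A n ↔
    ∃ x : cycles k A, (x : A) ∈ gr k A n ∧ Homology.mk k A x = a := Iff.rfl

theorem IsQuasiIso.mapHomology_part (hf : IsQuasiIso k f.toAlgHom.toLinearMap) (n : ℤ) :
    (Homology.part k A n).map f.mapHomology.toLinearMap = Homology.part k B n := by
  apply le_antisymm
  · rintro _ ⟨a, ha, rfl⟩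
    obtain ⟨x, hx, rfl⟩ := Homology.mem_part.1 ha
    exact Homology.mem_part.2 ⟨f.mapCycles x, f.map_mem n _ hx, rfl⟩
  · intro b hb
    obtain ⟨y, hy, rfl⟩ := Homology.mem_part.1 hb
    obtain ⟨x, hx, u, hu⟩ := hf.surj y y.2
    have hf0 : f.toAlgHom.toLinearMap ∈ homGr k A B 0 := fun i z hz => by
      rw [add_zero]; exact f.map_mem i z hz
    -- A preimage of a homogeneous class need not be homogeneous; its component of degree n still
    -- represents a preimage, because f and the differentials are homogeneous.
    have hx' : del k A (pr k A n x) = 0 := by rw [map_pr del_mem_homGr, hx, map_zero]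
    refine ⟨Homology.mk k A ⟨pr k A n x, hx'⟩, Homology.mem_part.2 ⟨_, pr_mem n x, rfl⟩, ?_⟩
    refine Eq.symm (sub_eq_zero.1 ?_)
    refine (map_sub (Homology.mk k B) _ _).symm.trans (Homology.mk_eq_zero.2 ⟨pr k B (n + 1) u, ?_⟩)
    have e1 := map_pr hf0 n x
    have e2 := map_pr (del_mem_homGr (k := k) (X := B)) (n + 1) u
    rw [add_neg_cancel_right] at e2
    rw [add_zero] at e1
    rw [e2]
    have e3 := congrArg (pr k B n) hu
    rw [pr_of_mem hy, map_add, ← e1] at e3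
    exact sub_eq_of_eq_add' e3

/-- A quasi-isomorphism induces an isomorphism of homology algebras. -/
def IsQuasiIso.homologyEquiv (hf : IsQuasiIso k f.toAlgHom.toLinearMap) :
    Homology k A ≃ₐ[k] Homology k B :=
  AlgEquiv.ofBijective f.mapHomology hf.mapHomology_bijective

end HomologyIso

end DG

end

/-! ### The main theorem -/

theorem mainTheorem8 {k : Type*} [Field k] {R : Type*} [Ring R] [Algebra k R] [DG.DGA k R]
    (ε : DG.DGHom k R k) (hconn : DG.IsConnected k R)
    (hfin : FiniteDimensional k (DG.Homology k (DG.KoszulDual ε))) :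
    DG.IsQuasiIso k (DG.restrict ε).toAlgHom.toLinearMap ∧
    DG.IsQuasiIso k (DG.cobarCounit ε).toAlgHom.toLinearMap ∧
    DG.IsQuasiIso k (DG.dualize ε).toAlgHom.toLinearMap ∧
    ∃ Φ : DG.HH k R ≃ₐ[k] DG.HH k (DG.KoszulDual ε),
      (∀ n : ℤ, (DG.Homology.part k (DG.Hoch k R) n).map Φ.toLinearMap =
        DG.Homology.part k (DG.Hoch k (DG.KoszulDual ε)) n) ∧
      ∀ (a : DG.HH k R) (z : DG.Homology k (DG.CoHoch ε)),
        (DG.restrict ε).mapHomology a = (DG.cobarCounit ε).mapHomology z →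
          Φ a = (DG.dualize ε).mapHomology z := by
  have h1 := DG.restrict_isQuasiIso ε
  have h2 := DG.cobarCounit_isQuasiIso ε
  have h3 := DG.dualize_isQuasiIso ε hconn hfin
  -- On homology Φ is δ composed with the inverse of α composed with ρ. All three maps are
  -- multiplicative and preserve degrees, and the relation ρ(a) = α(z) determines z from a.
  refine ⟨h1, h2, h3, (h1.homologyEquiv.trans h2.homologyEquiv.symm).trans h3.homologyEquiv,
    fun n => ?_, fun a z h => ?_⟩
  · refine le_antisymm ?_ fun c hc => ?_
    · rintro _ ⟨a, ha, rfl⟩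
      have e1 : (DG.restrict ε).mapHomology a ∈ DG.Homology.part k (DG.HochNorm ε) n := by
        rw [← h1.mapHomology_part]; exact ⟨a, ha, rfl⟩
      rw [← h2.mapHomology_part] at e1
      obtain ⟨z, hz, hza⟩ := e1
      rw [← h3.mapHomology_part]
      refine ⟨z, hz, congrArg h3.homologyEquiv ?_⟩
      exact h2.homologyEquiv.eq_symm_apply.2 hza
    · rw [← h3.mapHomology_part] at hc
      obtain ⟨z, hz, rfl⟩ := hc
      have e2 : (DG.cobarCounit ε).mapHomology z ∈ DG.Homology.part k (DG.HochNorm ε) n := by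
        rw [← h2.mapHomology_part]; exact ⟨z, hz, rfl⟩
      rw [← h1.mapHomology_part] at e2
      obtain ⟨a, ha, haz⟩ := e2
      refine ⟨a, ha, congrArg h3.homologyEquiv ?_⟩
      exact h2.homologyEquiv.symm_apply_eq.2 haz
  · refine congrArg h3.homologyEquiv ?_
    exact h2.homologyEquiv.symm_apply_eq.2 h
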